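/- For $L\ge\frac12$ let $\Omega_{2L}:=(0,2L)\times(0,1)\subset\mathbb R^2$, and for $\theta\in(0,\frac12]$ let $$K:=\Big\{\tfrac12\begin{pmatrix}0&\theta\\ \theta&0\end{pmatrix},\ \tfrac12\begin{pmatrix}0&-1+\theta\\ -1+\theta&0\end{pmatrix}\Big\}.$$ Write $|a|=(\mathrm{Tr}\,a^Ta)^{1/2}$ for the Euclidean norm of a matrix, $\mathrm{dist}$ for the corresponding distance, $e(u):=\frac12(\nabla u+\nabla^Tu)$, and $e_1\odot e_2:=\frac12\begin{pmatrix}0&1\\1&0\end{pmatrix}$. Let $|D^2u|(\Omega_{2L})\in[0,\infty]$ be the total variation on $\Omega_{2L}$ of the second distributional derivative of $u$, with value $\infty$ if that derivative is not a measure. For $\mu,\varepsilon>0$ and $u\in W^{1,2}_{\rm loc}(\mathbb R^2;\mathbb R^2)$ let $$J(u):=\mu\int_{\mathbb R^2\setminus\Omega_{2L}}|e(u)|^2\,d\mathcal L^2+\int_{\Omega_{2L}}\mathrm{dist}^2(e(u),K)\,d\mathcal L^2+\varepsilon|D^2u|(\Omega_{2L}),$$ $$I(u):=\mu\int_{\mathbb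 R^2\setminus\Omega_{2L}}|\nabla u|^2\,d\mathcal L^2+\int_{\Omega_{2L}}\min\big\{|e(u)-\theta e_1\odot e_2|^2,\,|e(u)+(1-\theta)e_1\odot e_2|^2\big\}\,d\mathcal L^2+\varepsilon|D^2u|(\Omega_{2L}),$$ and for scalar $v\in W^{1,2}_{\rm loc}(\mathbb R^2)$ with $\nabla v\in BV(\Omega_{2L};\mathbb R^2)$ let $E(v):=I((v,0))$. Let $$\mathcal B(\mu,\varepsilon,\theta,L):=\min\Big\{\varepsilon^{2/3}\theta^{2/3}L^{1/3}+\varepsilon L,\ \ \mu^{1/2}\varepsilon^{1/2}\theta L^{1/2}\big(\ln(3+\tfrac1{\theta^2})\big)^{1/2}+\varepsilon L,\ \ \mu^{1/2}\varepsilon^{1/2}\theta L^{1/2}\big(\ln(3+\tfrac{\varepsilon}{\mu^3\theta^2L})\big)^{1/2}+\varepsilon L\Big\}$$ (branching, laminate, two-scale branching), and let $\mathcal I(\mu,\varepsilon,\theta,L)$ be the minimum of $\mathcal B(\mu,\varepsilon,\theta,L)$ and of the five quantities - $\theta^2L$ (constant), - $\mu\theta^2\ln(3+L)$ (affine), - $\mu\theta^2\ln(3+\frac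 L\mu)+\varepsilon\theta$ (linear interpolation), - $\mu\theta^2\ln(3+\frac{\varepsilon L}{\mu\theta^2})+\mu\theta^2\ln(3+\frac{\varepsilon}{\mu^2\theta^2})+\varepsilon^{1/2}\theta^{3/2}$ (single truncated branching), - $\mu\theta^2\ln(3+\frac{\varepsilon L}{\mu\theta^2})+\mu\theta^2\ln(3+\frac\theta\mu)$ (corner laminate). **Theorem.** There is a constant $c>0$ such that for all $\mu>0$, $\varepsilon>0$, $\theta\in(0,\frac12]$ and $L\ge\frac12$ the following holds. 1. $J$ attains its minimum over $W^{1,2}_{\rm loc}(\mathbb R^2;\mathbb R^2)$, and $\min_uJ(u)\le c\,\mathcal I(\mu,\varepsilon,\theta,L)$. 2. $E$ attains its minimum over the scalar functions $v\in W^{1,2}_{\rm loc}(\mathbb R^2)$ with $\nabla v\in BV(\Omega_{2L};\mathbb R^2)$, and $\min_vE(v)\le c\,\mathcal B(\mu,\varepsilon,\theta,L)$. Moreover there is a minimizer $v$ of $E$ with $E(v)\le c\,\mathcal I(\mu,\varepsilon,\theta,L)$ and $J((v,0))\le c\,\mathcal I(\mu,\varepsilon,\theta,L)$; in particular the bound in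 1 is realized by scalar-valued fields. -/

import Mathlib

open MeasureTheory Set
open scoped ENNReal ContDiff Matrix

noncomputable section

namespace Nucleus

/-- The plane; its `volume` is two-dimensional Lebesgue measure (the product measure). -/
abbrev Plane : Type := ℝ × ℝ

/-- The coordinate directions `e₁` (index `0`) and `e₂` (index `1`). -/
def dir : Fin 2 → Plane := ![(1, 0), (0, 1)]

/-- The classical partial derivative `∂ᵢ φ`. -/
def partialDeriv (i : Fin 2) (φ : Plane → ℝ) (x : Plane) : ℝ := fderiv ℝ φ x (dir i)

/-- `φ ∈ C_c^∞(U)`. -/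
def IsTest (U : Set Plane) (φ : Plane → ℝ) : Prop :=
  ContDiff ℝ ∞ φ ∧ HasCompactSupport φ ∧ tsupport φ ⊆ U

/-- `g ∈ L²_loc(ℝ²)`. -/
def MemL2loc (g : Plane → ℝ) : Prop :=
  ∀ C : Set Plane, IsCompact C → MemLp g 2 (volume.restrict C)

/-- `g ∈ L²_loc(ℝ²)` is the weak partial derivative `∂ᵢ u` on `ℝ²`. -/
def IsWeakPartial (i : Fin 2) (u g : Plane → ℝ) : Prop :=
  MemL2loc g ∧
    ∀ φ : Plane → ℝ, IsTest univ φ → ∫ x, u x * partialDeriv i φ x = - ∫ x, g x * φ x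

/-- `u ∈ W^{1,2}_loc(ℝ²; ℝ)`. -/
def MemW12loc (u : Plane → ℝ) : Prop :=
  MemL2loc u ∧ ∀ i, ∃ g, IsWeakPartial i u g

open Classical in
/-- A representative of the weak partial derivative `∂ᵢ u` (it is unique almost everywhere);
the value `0` is used if there is no weak derivative. -/
def weakPartial (i : Fin 2) (u : Plane → ℝ) : Plane → ℝ :=
  if h : ∃ g, IsWeakPartial i u g then h.choose else 0

theorem isWeakPartial_weakPartial {u : Plane → ℝ} (hu : MemW12loc u) (i : Fin 2) :
    IsWeakPartial i u (weakPartial i u) := by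
  unfold weakPartial
  rw [dif_pos (hu.2 i)]
  exact (hu.2 i).choose_spec

theorem MemL2loc.locallyIntegrable {g : Plane → ℝ} (hg : MemL2loc g) :
    LocallyIntegrable g volume := by
  rw [locallyIntegrable_iff]
  intro C hC
  have : IsFiniteMeasure (volume.restrict C : Measure Plane) :=
    ⟨by simpa using hC.measure_lt_top⟩
  exact (hg C hC).integrable (by norm_num)

theorem IsWeakPartial.ae_eq {i : Fin 2} {u g g' : Plane → ℝ}
    (hg : IsWeakPartial i u g) (hg' : IsWeakPartial i u g') : g =ᵐ[volume] g' := by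
  refine ae_eq_of_integral_contDiff_smul_eq hg.1.locallyIntegrable hg'.1.locallyIntegrable ?_
  intro φ hφ hc
  have h1 := hg.2 φ ⟨hφ, hc, subset_univ _⟩
  have h2 := hg'.2 φ ⟨hφ, hc, subset_univ _⟩
  simp only [smul_eq_mul, mul_comm (φ _)]
  linarith

/-- Displacement fields `u : ℝ² → ℝ²`, with components `u x 0 = u₁(x)` and `u x 1 = u₂(x)`. -/
abbrev Field : Type := Plane → Fin 2 → ℝ

/-- `u ∈ W^{1,2}_loc(ℝ²; ℝ²)`. -/
def FieldMemW12loc (u : Field) : Prop := ∀ k, MemW12loc fun x => u x k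

/-- The weak gradient, `(∇u)_{kj} = ∂ⱼ u_k`. -/
def grad (u : Field) (x : Plane) : Matrix (Fin 2) (Fin 2) ℝ :=
  Matrix.of fun k j => weakPartial j (fun y => u y k) x

/-- The linearized strain `e(u) = (∇u + ∇ᵀu) / 2`. -/
def strain (u : Field) (x : Plane) : Matrix (Fin 2) (Fin 2) ℝ :=
  (1 / 2 : ℝ) • (grad u x + (grad u x)ᵀ)

/-- The Euclidean norm `|a| = (Tr aᵀa)^{1/2}` of a matrix. -/
def matNorm (a : Matrix (Fin 2) (Fin 2) ℝ) : ℝ := Real.sqrt (Matrix.trace (aᵀ * a))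

/-- The distance `dist(a, M) = inf {|a - m| : m ∈ M}`. -/
def matDist (a : Matrix (Fin 2) (Fin 2) ℝ) (M : Set (Matrix (Fin 2) (Fin 2) ℝ)) : ℝ :=
  sInf ((fun m => matNorm (a - m)) '' M)

/-- `e₁ ⊙ e₂ = (e₁ ⊗ e₂)_sym`. -/
def symE : Matrix (Fin 2) (Fin 2) ℝ := (1 / 2 : ℝ) • !![0, 1; 1, 0]

/-- The two martensitic wells. -/
def wells (θ : ℝ) : Set (Matrix (Fin 2) (Fin 2) ℝ) :=
  {(1 / 2 : ℝ) • !![0, θ; θ, 0], (1 / 2 : ℝ) • !![0, -1 + θ; -1 + θ, 0]}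

/-- The martensitic nucleus `Ω_{2L} = (0, 2L) × (0, 1)`. -/
def nucleus (L : ℝ) : Set Plane := Ioo 0 (2 * L) ×ˢ Ioo 0 1

/-- Families `φ_{ijk} ∈ C_c^∞(U)` with `∑_{ijk} φ_{ijk}² ≤ 1` everywhere. -/
def IsTestTensor (U : Set Plane) (φ : Fin 2 → Fin 2 → Fin 2 → Plane → ℝ) : Prop :=
  (∀ i j k, IsTest U (φ i j k)) ∧ ∀ x, ∑ i, ∑ j, ∑ k, φ i j k x ^ 2 ≤ 1

/-- The total variation `|D²u|(U)` of the second distributional derivative of `u` on the open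
set `U`; it is `∞` if `D²u` is not a measure of finite total variation on `U`. -/
def hessVar (u : Field) (U : Set Plane) : ℝ≥0∞ :=
  ⨆ (φ : Fin 2 → Fin 2 → Fin 2 → Plane → ℝ) (_ : IsTestTensor U φ),
    ENNReal.ofReal (∑ i, ∑ j, ∑ k,
      ∫ x in U, weakPartial j (fun y => u y k) x * partialDeriv i (φ i j k) x)

/-- The energy `J`, with values in `[0, ∞]`. -/
def energyJ (μ ε θ L : ℝ) (u : Field) : ℝ≥0∞ :=
  ENNReal.ofReal μ * (∫⁻ x in (nucleus L)ᶜ, ENNReal.ofReal (matNorm (strain u x) ^ 2))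
    + (∫⁻ x in nucleus L, ENNReal.ofReal (matDist (strain u x) (wells θ) ^ 2))
    + ENNReal.ofReal ε * hessVar u (nucleus L)

/-- The energy `I`, in which the full gradient enters in the austenite. -/
def energyI (μ ε θ L : ℝ) (u : Field) : ℝ≥0∞ :=
  ENNReal.ofReal μ * (∫⁻ x in (nucleus L)ᶜ, ENNReal.ofReal (matNorm (grad u x) ^ 2))
    + (∫⁻ x in nucleus L, ENNReal.ofReal
        (min (matNorm (strain u x - θ • symE) ^ 2) (matNorm (strain u x + (1 - θ) • symE) ^ 2)))
    + ENNReal.ofReal ε * hessVar u (nucleus L)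

/-- The field `(u, 0)` for a scalar function `u`. -/
def scalarField (u : Plane → ℝ) : Field := fun x => ![u x, 0]

/-- `u ∈ W^{1,2}_loc(ℝ²; ℝ)` with `∇u ∈ BV(Ω_{2L}; ℝ²)` (that `∇u ∈ L¹(Ω_{2L})` is automatic,
as `Ω_{2L}` is bounded). -/
def ScalarAdmissible (L : ℝ) (u : Plane → ℝ) : Prop :=
  MemW12loc u ∧ hessVar (scalarField u) (nucleus L) ≠ ⊤

/-- The scalar energy `E(u) = I((u, 0))`. -/
def energyE (μ ε θ L : ℝ) (u : Plane → ℝ) : ℝ≥0∞ := energyI μ ε θ L (scalarField u)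

def constantRegime (θ L : ℝ) : ℝ := θ ^ 2 * L

def affineRegime (μ θ L : ℝ) : ℝ := μ * θ ^ 2 * Real.log (3 + L)

def linearInterpolationRegime (μ ε θ L : ℝ) : ℝ :=
  μ * θ ^ 2 * Real.log (3 + L / μ) + ε * θ

def singleTruncatedBranchingRegime (μ ε θ L : ℝ) : ℝ :=
  μ * θ ^ 2 * Real.log (3 + ε * L / (μ * θ ^ 2))
    + μ * θ ^ 2 * Real.log (3 + ε / (μ ^ 2 * θ ^ 2))
    + ε ^ (1 / 2 : ℝ) * θ ^ (3 / 2 : ℝ)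

def cornerLaminateRegime (μ ε θ L : ℝ) : ℝ :=
  μ * θ ^ 2 * Real.log (3 + ε * L / (μ * θ ^ 2)) + μ * θ ^ 2 * Real.log (3 + θ / μ)

def branchingRegime (ε θ L : ℝ) : ℝ :=
  ε ^ (2 / 3 : ℝ) * θ ^ (2 / 3 : ℝ) * L ^ (1 / 3 : ℝ) + ε * L

def laminateRegime (μ ε θ L : ℝ) : ℝ :=
  μ ^ (1 / 2 : ℝ) * ε ^ (1 / 2 : ℝ) * θ * L ^ (1 / 2 : ℝ)
    * Real.log (3 + 1 / θ ^ 2) ^ (1 / 2 : ℝ) + ε * L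

def twoScaleBranchingRegime (μ ε θ L : ℝ) : ℝ :=
  μ ^ (1 / 2 : ℝ) * ε ^ (1 / 2 : ℝ) * θ * L ^ (1 / 2 : ℝ)
    * Real.log (3 + ε / (μ ^ 3 * θ ^ 2 * L)) ^ (1 / 2 : ℝ) + ε * L

/-- The minimum of the branching, laminate and two-scale branching regimes. -/
def branchedScaling (μ ε θ L : ℝ) : ℝ :=
  min (branchingRegime ε θ L) (min (laminateRegime μ ε θ L) (twoScaleBranchingRegime μ ε θ L))

/-- The scaling function `𝓘(μ, ε, θ, L)`, the minimum of all eight regimes. -/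
def scaling (μ ε θ L : ℝ) : ℝ :=
  min (constantRegime θ L) <|
  min (affineRegime μ θ L) <|
  min (linearInterpolationRegime μ ε θ L) <|
  min (singleTruncatedBranchingRegime μ ε θ L) <|
  min (cornerLaminateRegime μ ε θ L) <|
  min (branchingRegime ε θ L) <|
  min (laminateRegime μ ε θ L) (twoScaleBranchingRegime μ ε θ L)

end Nucleus

end

/-!
# Scaling of the energy of a nucleus of martensite

Existence of minimizers is the direct method. A sequence of bounded energy has strain bounded in
`L²` of every square, so after subtraction of an infinitesimal rigid motion, which `J` does not see,
Korn's and Poincaré's inequalities (`korn_poincare`) bound the field and its gradient there. The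
inequality for smooth fields comes from a cut-off and an integration by parts and passes to
`W^{1,2}_loc` by mollification. A subsequence of the gradients then converges weakly in `L²_loc`. In
the nucleus the bound on the total variation of the second derivative makes the gradients precompact
in `L¹` of compact subsets (`tendsto_setIntegral_abs_sub`), hence convergent almost everywhere along
a subsequence. The exterior energy and the total variation are lower semicontinuous under weak
convergence, and Fatou's lemma handles the two-well energy, which is not convex.

For the upper bounds `J (v, 0) ≤ I (v, 0) = E v` (`energyJ_le_energyI`), so scalar competitors
suffice, one for each regime. All of them are built from affine functions by sums, products, minima,
maxima and inverses of positive functions. They are thus locally Lipschitz, their classical partial derivatives `lpart` are the weak ones, and every estimate reduces to a case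
distinction valid almost everywhere. The total variation of the second derivative is estimated on
lines (`SliceBounds`, `hessVar_scalarField_le`): only the variation of `∂₂ v` in the second
direction and that of `∂₁ v` in both directions are needed, because mixed derivatives commute.

The constructions are the following.
* Branching (`exists_stripFn`): a tooth with slopes `lam` and `lam - 1` is split into two teeth of
  half the size each time the distance to the ends decreases by a factor three.
* Laminates with `N` periods (`hasCompetitor_periodic`). The steep part of each period has width `r`
  and widens linearly outside the nucleus (`wedge`), which costs `log (1 + h / r)`; its average slope
  may itself be realized by a branching. A steep part of width `θ * h` is an exact laminate, one of
  width `h` a branching up to the ends, and one of width `μ * L` the two-scale branching.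
* The affine deformation (`hasCompetitor_rise`). Above the nucleus its trace is spread over a length
  that grows with the height (`decay`), so that the exterior energy is logarithmic.
* The linear interpolation in the vertical direction (`hasCompetitor_linear`), whose trace on the
  upper side rises linearly near the ends.
* Up to the distance `l` from the ends either a corner or one truncated branching cell (`NearField`),
  joined to the affine deformation in the middle (`hasCompetitor_shoulder`).

Each regime of the scaling law is then obtained by balancing the parameters `h`, `r` and `l`; where
this leaves the admissible range, the competitor of another regime is at least as good.
-/


noncomputable section

namespace Nucleus

open ENNReal (ofReal ofReal_le_ofReal ofReal_mul ofReal_add ofReal_ne_top ofReal_pow ofReal_toReal ofReal_add_le)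
open Real (log log_nonneg log_le_log)
open Filter Topology ContinuousLinearMap

local notation "pd" => partialDeriv

variable {L θ μ ε h r l t s a b k p q n M R C δ Λ κ η α β σ c lam X D H : ℝ} {x : Plane} {U V W : Set Plane} {I J : Set ℝ}
  {f g v w φ ψ F G : Plane → ℝ}

/-! ### Mollification -/

/-- The Cauchy–Schwarz inequality with a weight. -/
theorem sq_lintegral_mul_le {α : Type*} [MeasurableSpace α] {ν : Measure α} {a b : α → ℝ≥0∞}
    (ha : AEMeasurable a ν) (hb : AEMeasurable b ν) :
    (∫⁻ x, a x * b x ∂ν) ^ 2 ≤ (∫⁻ x, a x ∂ν) * ∫⁻ x, a x * b x ^ 2 ∂ν := by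
  have h := ENNReal.lintegral_mul_le_Lp_mul_Lq ν (p := 2) (q := 2)
      (by norm_num [Real.holderConjugate_iff])
    (f := fun x => a x ^ (1 / 2 : ℝ)) (g := fun x => a x ^ (1 / 2 : ℝ) * b x)
    (ha.pow_const _) ((ha.pow_const _).mul hb)
  have e1 : ∀ x, a x ^ (1 / 2 : ℝ) * a x ^ (1 / 2 : ℝ) = a x := fun x => by
    rw [← ENNReal.rpow_add_of_nonneg _ _ (by norm_num) (by norm_num)]; norm_num
  have e2 : ∀ x : ℝ≥0∞, (x ^ (1 / 2 : ℝ)) ^ (2 : ℝ) = x := fun x => by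
    rw [← ENNReal.rpow_mul]; norm_num
  simp only [Pi.mul_apply, ← mul_assoc, e1, e2, ENNReal.mul_rpow_of_nonneg _ _ (zero_le_two)] at h
  calc (∫⁻ x, a x * b x ∂ν) ^ 2 = (∫⁻ x, a x * b x ∂ν) ^ (2 : ℝ) := by norm_cast
    _ ≤ _ := ENNReal.rpow_le_rpow h zero_le_two
    _ = _ := by
      rw [ENNReal.mul_rpow_of_nonneg _ _ zero_le_two, e2, e2]
      congr 2; ext x; norm_cast

theorem eLpNorm_two_sq {α : Type*} [MeasurableSpace α] {ν : Measure α} (f : α → ℝ) :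
    eLpNorm f 2 ν ^ 2 = ∫⁻ x, ofReal (f x ^ 2) ∂ν := by
  rw [eLpNorm_eq_lintegral_rpow_enorm_toReal (by norm_num) (by norm_num)]
  have : ∀ x, ‖f x‖ₑ ^ (2 : ℝ≥0∞).toReal = ofReal (f x ^ 2) := fun x => by
    rw [ENNReal.toReal_ofNat, Real.enorm_eq_ofReal_abs,
      ENNReal.ofReal_rpow_of_nonneg (abs_nonneg _) zero_le_two]
    norm_num
  simp only [this]
  rw [← ENNReal.rpow_natCast, ← ENNReal.rpow_mul]; norm_num

/-- A sequence of smooth mollifiers on the plane, of radius `2 / (n + 2) ≤ 1`. -/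
def mollBump (n : ℕ) : ContDiffBump (0 : Plane) :=
  ⟨1 / (n + 2), 2 / (n + 2), by positivity, by gcongr; norm_num⟩

/-- The `n`-th mollification of `f`. -/
def moll (n : ℕ) (f : Plane → ℝ) : Plane → ℝ :=
  convolution ((mollBump n).normed volume) f (lsmul ℝ ℝ) volume

theorem tendsto_mollBump_rOut : Tendsto (fun n => (mollBump n).rOut) atTop (𝓝 0) := by
  have : Tendsto (fun n : ℕ => (2 : ℝ) / (n + 2)) atTop (𝓝 0) := by
    refine Tendsto.div_atTop tendsto_const_nhds ?_
    exact tendsto_atTop_add_const_right _ _ tendsto_natCast_atTop_atTop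
  exact this

theorem mollBump_rOut_le (n : ℕ) : (mollBump n).rOut ≤ 1 := by
  change (2 : ℝ) / (n + 2) ≤ 1
  rw [div_le_one (by positivity)]; linarith [(n.cast_nonneg : (0 : ℝ) ≤ n)]

theorem moll_apply (n : ℕ) (f : Plane → ℝ) (x : Plane) :
    moll n f x = ∫ t, (mollBump n).normed volume t * f (x - t) := rfl

theorem moll_apply' (n : ℕ) (f : Plane → ℝ) (x : Plane) :
    moll n f x = ∫ t, (mollBump n).normed volume (x - t) * f t := by
  unfold moll; rw [convolution_eq_swap]; rfl

theorem contDiff_moll (n : ℕ) (hf : LocallyIntegrable f volume) :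
    ContDiff ℝ ∞ (moll n f) :=
  (mollBump n).hasCompactSupport_normed.contDiff_convolution_left _
    (mollBump n).contDiff_normed hf

theorem ae_tendsto_moll (hf : LocallyIntegrable f volume) :
    ∀ᵐ x, Tendsto (fun n => moll n f x) atTop (𝓝 (f x)) := by
  refine ContDiffBump.ae_convolution_tendsto_right_of_locallyIntegrable (K := 2)
    tendsto_mollBump_rOut (.of_forall fun n => ?_) hf
  change (2 : ℝ) / (n + 2) ≤ 2 * (1 / (n + 2))
  rw [mul_one_div]

theorem moll_add (n : ℕ) (hf : LocallyIntegrable f volume) (hg : LocallyIntegrable g volume) :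
    moll n (f + g) = moll n f + moll n g :=
  have h := fun {f : Plane → ℝ} => (mollBump n).hasCompactSupport_normed.convolutionExists_left
    (lsmul ℝ ℝ) (mollBump n).continuous_normed (g := f) (μ := volume)
  (h hf).distrib_add (h hg)

theorem normed_eq_zero {n : ℕ} {t : Plane} (h : (mollBump n).rOut ≤ ‖t‖) :
    (mollBump n).normed volume t = 0 := by
  rw [← Function.notMem_support, (mollBump n).support_normed_eq]
  simpa using h

theorem lintegral_normed (n : ℕ) :
    ∫⁻ t, ofReal ((mollBump n).normed volume t) = 1 := by
  rw [← ofReal_integral_eq_lintegral_ofReal (mollBump n).integrable_normed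
    (.of_forall (mollBump n).nonneg_normed), (mollBump n).integral_normed]
  simp

theorem enorm_sq_eq (y : ℝ) : ‖y‖ₑ ^ 2 = ofReal (y ^ 2) := by
  rw [Real.enorm_eq_ofReal_abs, ← ofReal_pow (abs_nonneg _), sq_abs]

/-- Translations act continuously on `L²`. -/
theorem tendsto_eLpNorm_translate_sub (hf : MemLp f 2 volume) :
    Tendsto (fun t => eLpNorm (fun x => f (x - t) - f x) 2 volume) (𝓝 0) (𝓝 0) := by
  let T : Plane → C(Plane, Plane) := fun t => ⟨fun x => x - t, by fun_prop⟩
  have hT : Continuous T := ContinuousMap.continuous_of_continuous_uncurry _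
    (show Continuous fun p : Plane × Plane => p.2 - p.1 by fun_prop)
  have hp : ∀ t, MeasurePreserving (T t) volume volume := measurePreserving_sub_right volume
  have h := ((continuous_const (y := hf.toLp)).compMeasurePreservingLp hT hp (by simp)).tendsto 0
  rw [Lp.tendsto_Lp_iff_tendsto_eLpNorm'] at h
  refine h.congr fun t => eLpNorm_congr_ae ?_
  filter_upwards [Lp.coeFn_compMeasurePreserving hf.toLp (hp t),
    (hp t).quasiMeasurePreserving.ae hf.coeFn_toLp,
    Lp.coeFn_compMeasurePreserving hf.toLp (hp 0), hf.coeFn_toLp] with x h1 h2 h3 h4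
  simp_all [T]

/-- Mollifications converge in `L²`. -/
theorem tendsto_eLpNorm_moll_sub (hf : MemLp f 2 volume) :
    Tendsto (fun n => eLpNorm (moll n f - f) 2 volume) atTop (𝓝 0) := by
  have hρm : ∀ n, Measurable fun t => ofReal ((mollBump n).normed volume t) :=
    fun n => (mollBump n).continuous_normed.measurable.ennreal_ofReal
  have hm := hf.1.comp_quasiMeasurePreserving (quasiMeasurePreserving_sub volume volume)
  have T := tendsto_eLpNorm_translate_sub hf
  rw [ENNReal.tendsto_nhds_zero] at T ⊢
  intro ε hε
  obtain ⟨r, hr, hT⟩ := Metric.eventually_nhds_iff.1 (T ε hε)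
  filter_upwards [tendsto_mollBump_rOut.eventually_lt_const hr] with n hn
  have key : ∀ x, ofReal ((moll n f - f) x ^ 2)
      ≤ ∫⁻ t, ofReal ((mollBump n).normed volume t) * ofReal ((f (x - t) - f x) ^ 2) := by
    intro x
    have h1 : ‖(moll n f - f) x‖ₑ
        ≤ ∫⁻ t, ofReal ((mollBump n).normed volume t) * ‖f (x - t) - f x‖ₑ := by
      have e : (moll n f - f) x = ∫ t, (mollBump n).normed volume t * (f (x - t) - f x) := by
        have h : Integrable fun t => (mollBump n).normed volume t * f (x - t) :=
          (mollBump n).hasCompactSupport_normed.convolutionExists_left (lsmul ℝ ℝ)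
            (mollBump n).continuous_normed (hf.locallyIntegrable (by norm_num)) x
        simp only [mul_sub]
        refine .trans ?_ (integral_sub h ((mollBump n).integrable_normed.mul_const _)).symm
        rw [integral_mul_const, (mollBump n).integral_normed, one_mul]; rfl
      rw [e]
      refine (enorm_integral_le_lintegral_enorm _).trans (lintegral_mono fun t => ?_)
      rw [enorm_mul, Real.enorm_eq_ofReal ((mollBump n).nonneg_normed t)]
    have h2 := sq_lintegral_mul_le (hρm n).aemeasurable (b := fun t => ‖f (x - t) - f x‖ₑ)
      ((hf.1.comp_quasiMeasurePreserving
        (quasiMeasurePreserving_sub_left volume x)).sub aestronglyMeasurable_const).enorm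
    simp only [lintegral_normed, one_mul, enorm_sq_eq] at h2
    exact (enorm_sq_eq _).symm.trans_le ((pow_le_pow_left' h1 2).trans h2)
  rw [← ENNReal.pow_le_pow_left_iff two_ne_zero, eLpNorm_two_sq]
  refine (lintegral_mono key).trans ?_
  rw [lintegral_lintegral_swap (((hρm n).comp measurable_snd).aemeasurable.mul
    ((hm.sub hf.1.comp_fst).aemeasurable.pow_const 2).ennreal_ofReal)]
  calc _ ≤ ∫⁻ t, ofReal ((mollBump n).normed volume t) * ε ^ 2 := lintegral_mono fun t => by
        rw [lintegral_const_mul' _ _ ofReal_ne_top, ← eLpNorm_two_sq fun x => f (x - t) - f x]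
        rcases lt_or_ge (dist t 0) r with h | h
        · gcongr; exact hT h
        · rw [normed_eq_zero (hn.le.trans (by simpa using h))]; simp
    _ = _ := by rw [lintegral_mul_const _ (hρm n), lintegral_normed, one_mul]

/-- The values of `moll n f` on a set depend only on the values of `f` on its `1`-neighbourhood. -/
theorem moll_congr (n : ℕ) (h : ∀ t ∈ Metric.closedBall x 1,
    f t = g t) : moll n f x = moll n g x := by
  rw [moll_apply', moll_apply']
  congr 1; ext t
  by_cases ht : t ∈ Metric.closedBall x 1
  · rw [h t ht]
  · rw [normed_eq_zero, zero_mul, zero_mul]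
    rw [Metric.mem_closedBall, dist_comm, dist_eq_norm, not_le] at ht
    exact (mollBump_rOut_le n).trans ht.le

/-- Mollifications of `L²_loc` functions converge in `L²` on compact sets. -/
theorem tendsto_eLpNorm_moll_sub_restrict (hf : MemL2loc f) {C : Set Plane} (hC : IsCompact C) :
    Tendsto (fun n => eLpNorm (moll n f - f) 2 (volume.restrict C)) atTop (𝓝 0) := by
  set C' := Metric.cthickening 1 C
  have hC' : IsCompact C' := hC.cthickening
  have hm : MemLp (C'.indicator f) 2 volume := by
    rw [memLp_indicator_iff_restrict hC'.measurableSet]; exact hf C' hC'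
  refine tendsto_of_tendsto_of_tendsto_of_le_of_le tendsto_const_nhds
    (tendsto_eLpNorm_moll_sub hm) (fun _ => zero_le) fun n => ?_
  have : eLpNorm (moll n f - f) 2 (volume.restrict C)
      = eLpNorm (moll n (C'.indicator f) - C'.indicator f) 2 (volume.restrict C) := by
    apply eLpNorm_congr_ae
    filter_upwards [ae_restrict_mem hC.measurableSet] with x hx
    have hx' : ∀ t ∈ Metric.closedBall x 1, t ∈ C' := fun t ht =>
      Metric.mem_cthickening_of_dist_le t x 1 C hx (Metric.mem_closedBall.1 ht)
    simp only [Pi.sub_apply]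
    rw [moll_congr n (g := C'.indicator f) fun t ht => (indicator_of_mem (hx' t ht) f).symm,
      indicator_of_mem (hx' x (Metric.mem_closedBall_self zero_le_one))]
  rw [this]
  exact eLpNorm_restrict_le _ _ _ _

theorem fderiv_comp_const_sub (hf : ContDiff ℝ ∞ f) (x t : Plane) :
    fderiv ℝ (fun t => f (x - t)) t = -fderiv ℝ f (x - t) := by
  have : HasFDerivAt (fun t => f (x - t)) _ t :=
    (hf.differentiable (by simp)).differentiableAt.hasFDerivAt.comp t
      ((hasFDerivAt_id t).const_sub x)
  rw [this.fderiv]; simp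

/-- Mollification commutes with weak differentiation. -/
theorem partialDeriv_moll (n : ℕ) {i : Fin 2} {u : Plane → ℝ} (hu : MemL2loc u)
    (hg : IsWeakPartial i u g) (x : Plane) : pd i (moll n u) x = moll n g x := by
  set ρ := (mollBump n).normed (volume : Measure Plane)
  have hρ : ContDiff ℝ ∞ ρ := (mollBump n).contDiff_normed
  have hρc : HasCompactSupport ρ := (mollBump n).hasCompactSupport_normed
  have hd := hρc.hasFDerivAt_convolution_left (lsmul ℝ ℝ) (hρ.of_le (by simp))
    hu.locallyIntegrable x
  have h1 : pd i (moll n u) x = ∫ t, fderiv ℝ ρ (x - t) (dir i) * u t := by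
    unfold partialDeriv moll
    rw [hd.fderiv, convolution_eq_swap]
    rw [ContinuousLinearMap.integral_apply]
    · rfl
    · have := (hρc.fderiv (𝕜 := ℝ)).convolutionExists_left (precompL Plane
          (lsmul ℝ ℝ : ℝ →L[ℝ] ℝ →L[ℝ] ℝ))
        (hρ.continuous_fderiv (by simp)) hu.locallyIntegrable x
      exact this.integrable_swap
  have htest : IsTest univ fun t => ρ (x - t) := by
    refine ⟨hρ.comp (contDiff_const.sub contDiff_id), ?_, subset_univ _⟩
    exact hρc.comp_homeomorph (Homeomorph.subLeft x)
  have h2 := hg.2 _ htest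
  have h3 : ∀ t, pd i (fun t => ρ (x - t)) t = - fderiv ℝ ρ (x - t) (dir i) := fun t => by
    rw [partialDeriv, fderiv_comp_const_sub hρ]; rfl
  rw [h1, moll_apply']
  simp only [h3] at h2
  have e1 : ∫ t, fderiv ℝ ρ (x - t) (dir i) * u t = - ∫ t, u t * -fderiv ℝ ρ (x - t) (dir i) := by
    rw [← integral_neg]; congr 1; ext t; ring
  rw [e1, h2, neg_neg]
  congr 1; ext t; ring

/-! ### Weak compactness in `L²_loc` -/

/-- The closed square of half side length `R` (a ball of the sup norm of `ℝ × ℝ`). -/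
def sq (R : ℝ) : Set Plane := Metric.closedBall 0 R

theorem isCompact_sq (R : ℝ) : IsCompact (sq R) := isCompact_closedBall _ _

theorem measurableSet_sq (R : ℝ) : MeasurableSet (sq R) := measurableSet_closedBall

theorem sq_eq (R : ℝ) : sq R = Icc (-R) R ×ˢ Icc (-R) R := by
  unfold sq
  rw [show (0 : Plane) = ((0 : ℝ), (0 : ℝ)) from rfl, ← closedBall_prod_same,
    Real.closedBall_eq_Icc]
  simp

theorem exists_subset_sq {C : Set Plane} (hC : IsCompact C) : ∃ R : ℕ, C ⊆ sq R := by
  obtain ⟨r, hr⟩ := hC.isBounded.subset_closedBall 0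
  obtain ⟨R, hR⟩ := exists_nat_ge r
  exact ⟨R, hr.trans (Metric.closedBall_subset_closedBall hR)⟩

theorem MemL2loc.aestronglyMeasurable (hg : MemL2loc g) :
    AEStronglyMeasurable g volume := hg.locallyIntegrable.aestronglyMeasurable

theorem memL2loc_of_sq (h : ∀ R : ℕ, MemLp g 2 (volume.restrict (sq R))) :
    MemL2loc g := by
  intro C hC
  obtain ⟨R, hR⟩ := exists_subset_sq hC
  exact (h R).mono_measure (Measure.restrict_mono hR le_rfl)

/-- Weak convergence in `L²_loc`: convergence of the integrals against square integrable
functions of compact support. -/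
def WeakLim (f : ℕ → Plane → ℝ) (g : Plane → ℝ) : Prop :=
  ∀ ψ : Plane → ℝ, MemLp ψ 2 volume → HasCompactSupport ψ →
    Tendsto (fun n => ∫ x, f n x * ψ x) atTop (𝓝 (∫ x, g x * ψ x))

theorem WeakLim.comp {f : ℕ → Plane → ℝ} (h : WeakLim f g) {φ : ℕ → ℕ}
    (hφ : StrictMono φ) : WeakLim (f ∘ φ) g := fun ψ h1 h2 =>
  (h ψ h1 h2).comp hφ.tendsto_atTop

theorem exists_weakLim_Lp (F : ℕ → Lp ℝ 2 (volume : Measure Plane)) (hF : ∀ n, ‖F n‖ ≤ M) :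
    ∃ φ : ℕ → ℕ, StrictMono φ ∧ ∃ G : Lp ℝ 2 (volume : Measure Plane), ∀ H,
      Tendsto (fun n => inner ℝ (F (φ n)) H) atTop (𝓝 (inner ℝ G H)) := by
  have : Fact ((2 : ℝ≥0∞) ≠ (⊤ : ℝ≥0∞)) := ⟨by norm_num⟩
  have hs := WeakDual.isSeqCompact_closedBall ℝ (Lp ℝ 2 (volume : Measure Plane)) 0 M
  set T := InnerProductSpace.toDual ℝ (Lp ℝ 2 (volume : Measure Plane))
  obtain ⟨a, -, φ, hφ, ha⟩ := hs (x := fun n => StrongDual.toWeakDual (T (F n))) (fun n => by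
    simp only [mem_preimage, Metric.mem_closedBall, dist_zero_right]
    change ‖T (F n)‖ ≤ M
    simpa using hF n)
  refine ⟨φ, hφ, T.symm (WeakDual.toStrongDual a), fun H => ?_⟩
  have h1 := (WeakDual.eval_continuous H).continuousAt.tendsto.comp ha
  have h2 : inner ℝ (T.symm (WeakDual.toStrongDual a)) H = a H :=
    InnerProductSpace.toDual_symm_apply
  rw [h2]
  exact h1

/-- A sequence which is bounded in `L²` of every square has a weakly convergent subsequence. -/
theorem exists_weakLim {f : ℕ → Plane → ℝ} (hf : ∀ n, MemL2loc (f n)) {C : ℕ → ℝ}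
    (hC : ∀ (R : ℕ) (n : ℕ), eLpNorm (f n) 2 (volume.restrict (sq R)) ≤ ofReal (C R)) :
    ∃ φ : ℕ → ℕ, StrictMono φ ∧ ∃ g, MemL2loc g ∧ WeakLim (f ∘ φ) g := by
  set a : ℕ → ℝ := fun R => (2 ^ R * (1 + |C R|))⁻¹ with ha
  have ha0 : ∀ R, 0 < a R := fun R => by positivity
  -- a positive weight that makes the whole sequence bounded in `L²` of the plane
  set s : Plane → ℝ := fun x => a ⌈‖x‖⌉₊ with hs
  have hs0 : ∀ x, 0 < s x := fun x => ha0 _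
  have hsm : Measurable s := (measurable_of_countable a).comp
    (Nat.measurable_ceil.comp measurable_norm)
  have hsb : ∀ R : ℕ, ∃ B : ℝ, 0 ≤ B ∧ ∀ x ∈ sq R, (s x)⁻¹ ≤ B := by
    intro R
    refine ⟨∑ r ∈ Finset.range (R + 1), (a r)⁻¹,
      Finset.sum_nonneg fun r _ => (inv_pos.2 (ha0 r)).le, fun x hx => ?_⟩
    have h1 : ⌈‖x‖⌉₊ ∈ Finset.range (R + 1) := by
      rw [Finset.mem_range, Nat.lt_succ_iff, Nat.ceil_le]
      simpa [sq] using hx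
    exact Finset.single_le_sum (f := fun r => (a r)⁻¹) (fun r _ => (inv_pos.2 (ha0 r)).le) h1
  have hinv : ∀ ψ : Plane → ℝ, MemLp ψ 2 volume → HasCompactSupport ψ →
      MemLp (fun x => ψ x * (s x)⁻¹) 2 volume := by
    intro ψ hψ hc
    obtain ⟨R, hR⟩ := exists_subset_sq hc.isCompact
    obtain ⟨B, hB0, hB⟩ := hsb R
    refine (hψ.const_mul B).mono (hψ.1.mul hsm.inv.aestronglyMeasurable)
      (.of_forall fun x => ?_)
    by_cases hx : x ∈ tsupport ψ
    · rw [norm_mul, norm_mul, mul_comm, Real.norm_of_nonneg (inv_pos.2 (hs0 x)).le,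
        Real.norm_of_nonneg hB0]
      gcongr
      exact hB x (hR hx)
    · simp [image_eq_zero_of_notMem_tsupport hx]
  -- boundedness
  have hbd : ∀ n, eLpNorm (fun x => f n x * s x) 2 volume ^ 2 ≤ 4 := by
    intro n
    rw [eLpNorm_two_sq]
    set S : ℕ → Set Plane := fun R => {x | ⌈‖x‖⌉₊ = R} with hS
    have hSm : ∀ R, MeasurableSet (S R) := fun R =>
      (Nat.measurable_ceil.comp measurable_norm) (measurableSet_singleton R)
    have hU : (⋃ R, S R) = univ := by ext x; simp [hS]
    rw [← setLIntegral_univ, ← hU]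
    refine (lintegral_iUnion_le _ _).trans ?_
    have h4 : ∑' R : ℕ, ofReal ((1 / 2) ^ R) = 2 := by
      rw [← ENNReal.ofReal_tsum_of_nonneg (fun _ => by positivity) summable_geometric_two,
        tsum_geometric_two]; norm_num
    refine le_trans (ENNReal.tsum_le_tsum fun R => ?_) (h4.le.trans (by norm_num))
    have hsub : S R ⊆ sq R := fun x hx => by
      have : ⌈‖x‖⌉₊ ≤ R := le_of_eq hx
      simpa [sq] using Nat.ceil_le.1 this
    have hfC : ∫⁻ x in sq R, ofReal (f n x ^ 2) ≤ ofReal (C R ^ 2) := by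
      rw [← eLpNorm_two_sq]
      calc _ ≤ (ofReal (C R)) ^ 2 := pow_le_pow_left' (hC R n) 2
        _ ≤ ofReal |C R| ^ 2 := by gcongr; exact le_abs_self _
        _ = _ := by rw [← ofReal_pow (abs_nonneg _), sq_abs]
    calc ∫⁻ x in S R, ofReal ((f n x * s x) ^ 2)
        = ∫⁻ x in S R, ofReal (a R ^ 2) * ofReal (f n x ^ 2) := by
          refine setLIntegral_congr_fun (hSm R) fun x hx => ?_
          have : s x = a R := by simp only [hs]; rw [show ⌈‖x‖⌉₊ = R from hx]
          simp only [this]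
          rw [← ofReal_mul (by positivity)]; ring_nf
      _ = ofReal (a R ^ 2) * ∫⁻ x in S R, ofReal (f n x ^ 2) :=
          lintegral_const_mul' _ _ ofReal_ne_top
      _ ≤ ofReal (a R ^ 2) * ofReal (C R ^ 2) := by
          gcongr
          exact (lintegral_mono_set hsub).trans hfC
      _ ≤ ofReal ((1 / 2) ^ R) := by
          rw [← ofReal_mul (by positivity)]
          apply ofReal_le_ofReal
          have e1 : a R * |C R| ≤ (1 / 2) ^ R := by
            simp only [ha]
            rw [mul_inv, mul_assoc, one_div, inv_pow]
            refine mul_le_of_le_one_right (by positivity) ?_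
            rw [inv_mul_le_iff₀ (by positivity)]; linarith
          have e2 : a R * |C R| ≤ 1 := e1.trans (pow_le_one₀ (by norm_num) (by norm_num))
          have e3 : 0 ≤ a R * |C R| := by have := ha0 R; positivity
          calc a R ^ 2 * C R ^ 2 = (a R * |C R|) * (a R * |C R|) := by rw [← sq_abs (C R)]; ring
            _ ≤ (a R * |C R|) * 1 := by gcongr
            _ ≤ _ := by linarith
  have hm : ∀ n, MemLp (fun x => f n x * s x) 2 volume := fun n =>
    ⟨(hf n).aestronglyMeasurable.mul hsm.aestronglyMeasurable, by
      by_contra h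
      rw [not_lt, top_le_iff] at h
      have := hbd n
      rw [h] at this
      simp at this⟩
  have hnorm : ∀ n, ‖(hm n).toLp‖ ≤ 2 := by
    intro n
    rw [Lp.norm_toLp]
    refine ENNReal.toReal_le_of_le_ofReal (by norm_num) ?_
    rw [← ENNReal.pow_le_pow_left_iff two_ne_zero]
    refine (hbd n).trans ?_
    norm_num
  obtain ⟨φ, hφ, G, hG⟩ := exists_weakLim_Lp (fun n => (hm n).toLp) hnorm
  refine ⟨φ, hφ, fun x => G x * (s x)⁻¹, ?_, ?_⟩
  · refine memL2loc_of_sq fun R => ?_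
    obtain ⟨B, hB0, hB⟩ := hsb R
    refine ((Lp.memLp G).restrict (sq R) |>.const_mul B).mono
      (((Lp.memLp G).1.mul hsm.inv.aestronglyMeasurable).restrict) ?_
    filter_upwards [ae_restrict_mem (measurableSet_sq R)] with x hx
    rw [norm_mul, norm_mul, mul_comm, Real.norm_of_nonneg (inv_pos.2 (hs0 x)).le,
      Real.norm_of_nonneg hB0]
    gcongr
    exact hB x hx
  · intro ψ hψ hc
    have h1 := hG ((hinv ψ hψ hc).toLp)
    simp only [L2.inner_def] at h1
    have e1 : ∀ n, ∫ x, inner ℝ (((hm (φ n)).toLp) x) (((hinv ψ hψ hc).toLp) x)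
        = ∫ x, (f ∘ φ) n x * ψ x := by
      intro n
      refine integral_congr_ae ?_
      filter_upwards [(hm (φ n)).coeFn_toLp, (hinv ψ hψ hc).coeFn_toLp] with x h1 h2
      rw [h1, h2]
      simp only [RCLike.inner_apply, conj_trivial, Function.comp_apply]
      have := (hs0 x).ne'
      field_simp
    have e2 : ∫ x, inner ℝ (G x) (((hinv ψ hψ hc).toLp) x) = ∫ x, G x * (s x)⁻¹ * ψ x := by
      refine integral_congr_ae ?_
      filter_upwards [(hinv ψ hψ hc).coeFn_toLp] with x h2
      rw [h2]
      simp only [RCLike.inner_apply, conj_trivial]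
      ring
    rw [e2] at h1
    refine h1.congr fun n => e1 n

theorem IsTest.memLp (h : IsTest U φ) : MemLp φ 2 volume :=
  h.1.continuous.memLp_of_hasCompactSupport h.2.1

theorem IsTest.partialDeriv (h : IsTest U φ) (i : Fin 2) :
    IsTest U (pd i φ) := by
  refine ⟨(h.1.fderiv_right (m := ∞) (by simp)).clm_apply contDiff_const, ?_, ?_⟩
  · exact (h.2.1.fderiv (𝕜 := ℝ)).comp_left (g := fun L : Plane →L[ℝ] ℝ => L (dir i)) rfl
  · refine (closure_mono ?_).trans ((tsupport_fderiv_subset ℝ (f := φ)).trans h.2.2)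
    intro x hx h0
    apply hx
    simp [Nucleus.partialDeriv, h0]

theorem IsTest.mono (h : IsTest U φ) (hUV : U ⊆ V) :
    IsTest V φ := ⟨h.1, h.2.1, h.2.2.trans hUV⟩

/-- Weak derivatives pass to weak limits. -/
theorem IsWeakPartial.of_weakLim {i : Fin 2} {u g : ℕ → Plane → ℝ} {u' g' : Plane → ℝ} (h : ∀ n,
    IsWeakPartial i (u n) (g n)) (hu : WeakLim u u') (hg : WeakLim g g')
    (hg' : MemL2loc g') : IsWeakPartial i u' g' := by
  refine ⟨hg', fun φ hφ => ?_⟩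
  have h1 := hu _ (hφ.partialDeriv i).memLp (hφ.partialDeriv i).2.1
  have h2 := (hg _ hφ.memLp hφ.2.1).neg
  refine tendsto_nhds_unique h1 (h2.congr fun n => ((h n).2 φ hφ).symm)

/-! ### The Korn–Poincaré inequality for smooth fields -/

/-- The weight `ρ(t) = (3/4)(1 - t²)`, a probability density on `[-1, 1]` vanishing at `±1`. -/
def wt (t : ℝ) : ℝ := 3 / 4 * (1 - t ^ 2)

/-- The derivative of `wt`. -/
def wt' (t : ℝ) : ℝ := -(3 / 2) * t

theorem hasDerivAt_wt (t : ℝ) : HasDerivAt wt (wt' t) t := by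
  have h : HasDerivAt (fun t : ℝ => 3 / 4 * (1 - t ^ 2)) (3 / 4 * (0 - 2 * t ^ 1 * 1)) t :=
    (((hasDerivAt_const t (1 : ℝ)).sub ((hasDerivAt_id t).pow 2)).const_mul (3 / 4))
  rw [show wt' t = 3 / 4 * (0 - 2 * t ^ 1 * 1) by unfold wt'; ring]
  exact h

@[fun_prop] theorem continuous_wt : Continuous wt := by unfold wt; fun_prop
@[fun_prop] theorem continuous_wt' : Continuous wt' := by unfold wt'; fun_prop

/-- Short for `Continuous.intervalIntegrable`. -/
theorem cii {f : ℝ → ℝ} (hf : Continuous f) : IntervalIntegrable f volume a b :=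
  hf.intervalIntegrable a b

theorem integral_wt : ∫ t in -1..1, wt t = 1 := by
  unfold wt
  rw [intervalIntegral.integral_const_mul, intervalIntegral.integral_sub (by simp)
    (cii (by fun_prop))]
  simp only [intervalIntegral.integral_const, integral_pow]; norm_num

theorem integral_mul_wt : ∫ t in -1..1, t * wt t = 0 := by
  have : ∀ t : ℝ, t * wt t = 3 / 4 * (t ^ 1 - t ^ 3) := fun t => by unfold wt; ring
  simp only [this]
  rw [intervalIntegral.integral_const_mul, intervalIntegral.integral_sub
    (cii (by fun_prop))
    (cii (by fun_prop))]
  simp only [integral_pow]; norm_num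

theorem wt_nonneg (ht : t ∈ Icc (-1 : ℝ) 1) : 0 ≤ wt t := by
  unfold wt; nlinarith [ht.1, ht.2]

theorem abs_wt_le (ht : t ∈ Icc (-1 : ℝ) 1) : |wt t| ≤ 1 := by
  rw [abs_of_nonneg (wt_nonneg ht)]; unfold wt; nlinarith [sq_nonneg t]

theorem abs_wt'_le (ht : t ∈ Icc (-1 : ℝ) 1) : |wt' t| ≤ 2 := by
  unfold wt'; rw [abs_le]; constructor <;> linarith [ht.1, ht.2]

theorem abs_integral_le_of_abs_le {f g : ℝ → ℝ} (hg : Continuous g)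
    (h : ∀ t ∈ Icc (-1 : ℝ) 1, |f t| ≤ g t) :
    |∫ t in -1..1, f t| ≤ ∫ t in -1..1, g t := by
  rw [← Real.norm_eq_abs]
  exact intervalIntegral.norm_integral_le_of_norm_le (by norm_num)
    (.of_forall fun t ht => h t ⟨ht.1.le, ht.2⟩) (hg.intervalIntegrable _ _)

/-- A continuous function which varies by at most `M` differs from its weighted mean
by at most `M`. -/
theorem abs_sub_mean_le {f : ℝ → ℝ} (hf : Continuous f) (h : ∀ t ∈ Icc (-1 : ℝ) 1,
    |c - f t| ≤ M) : |c - ∫ t in -1..1, f t * wt t| ≤ M := by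
  have e : c - ∫ t in -1..1, f t * wt t = ∫ t in -1..1, (c - f t) * wt t := by
    have : ∀ t, (c - f t) * wt t = c * wt t - f t * wt t := fun t => by ring
    simp only [this]
    rw [intervalIntegral.integral_sub (cii (by fun_prop))
      (cii (by fun_prop)),
      intervalIntegral.integral_const_mul, integral_wt, mul_one]
  have hM : ∫ t in -1..1, M * wt t = M := by
    rw [intervalIntegral.integral_const_mul, integral_wt, mul_one]
  rw [e]
  calc |∫ t in -1..1, (c - f t) * wt t| ≤ ∫ t in -1..1, M * wt t := by
        refine abs_integral_le_of_abs_le (by fun_prop) fun t ht => ?_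
        rw [abs_mul, abs_of_nonneg (wt_nonneg ht)]
        exact mul_le_mul_of_nonneg_right (h t ht) (wt_nonneg ht)
    _ = M := hM

theorem abs_intervalIntegral_le {f : ℝ → ℝ} (hf : Continuous f) (ha : a ∈ Icc (-R) R) (hb : b ∈ Icc
    (-R) R) :
    |∫ t in a..b, f t| ≤ ∫ t in (-R)..R, |f t| := by
  have hR : -R ≤ R := ha.1.trans ha.2
  refine (intervalIntegral.norm_integral_le_integral_norm_uIoc (f := f)).trans ?_
  rw [intervalIntegral.integral_of_le hR]
  refine setIntegral_mono_set ?_ (.of_forall fun _ => abs_nonneg _) ?_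
  · exact (Continuous.integrableOn_Icc (by fun_prop)).mono_set Ioc_subset_Icc_self
  · refine .of_forall fun x hx => ?_
    exact ⟨lt_of_le_of_lt (le_min ha.1 hb.1) hx.1, hx.2.trans (max_le ha.2 hb.2)⟩

theorem abs_sub_le_integral_deriv {f f' : ℝ → ℝ} (hf : ∀ t, HasDerivAt f (f' t) t)
    (hf' : Continuous f') (ha : a ∈ Icc (-R) R) (hb : b ∈ Icc (-R) R) :
    |f a - f b| ≤ ∫ t in (-R)..R, |f' t| := by
  rw [← intervalIntegral.integral_eq_sub_of_hasDerivAt (fun t _ => hf t)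
    (hf'.intervalIntegrable _ _)]
  exact abs_intervalIntegral_le hf' hb ha

theorem continuous_integral {f : ℝ → ℝ → ℝ} (hf : Continuous (Function.uncurry f)) :
    Continuous fun s => ∫ t in a..b, f s t :=
  intervalIntegral.continuous_parametric_intervalIntegral_of_continuous' hf _ _

theorem hasDerivAt_fst {u : Plane → ℝ} (hu : ContDiff ℝ 1 u) (t s : ℝ) :
    HasDerivAt (fun t => u (t, s)) (pd 0 u (t, s)) t :=
  ((hu.differentiable one_ne_zero (t, s)).hasFDerivAt).comp_hasDerivAt t
    ((hasDerivAt_id t).prodMk (hasDerivAt_const t s))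

theorem hasDerivAt_snd {u : Plane → ℝ} (hu : ContDiff ℝ 1 u) (t s : ℝ) :
    HasDerivAt (fun s => u (t, s)) (pd 1 u (t, s)) s :=
  ((hu.differentiable one_ne_zero (t, s)).hasFDerivAt).comp_hasDerivAt s
    ((hasDerivAt_const s t).prodMk (hasDerivAt_id s))

@[fun_prop] theorem continuous_partialDeriv {u : Plane → ℝ} (hu : ContDiff ℝ 1 u) (i : Fin 2) :
    Continuous (pd i u) :=
  (hu.continuous_fderiv one_ne_zero).clm_apply continuous_const

/-- The weighted mean of `u` over the unit square, as an iterated integral. -/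
def mom (u : Plane → ℝ) : ℝ := ∫ s in -1..1, (∫ t in -1..1, u (t, s) * wt t) * wt s

/-- A weighted mean of `-∂₁ v`, written without derivatives of `v`. -/
def rot (v : Plane → ℝ) : ℝ := ∫ t in -1..1, (∫ s in -1..1, v (t, s) * wt s) * wt' t

/-- Away from an affine function of the other variable, the first component of a displacement is
controlled by integrals of the strain along lines and over the square. -/
theorem abs_sub_mom_sub_rot_le {u : Plane → ℝ} (hu : ContDiff ℝ 1 u) (hv : ContDiff ℝ 1 v)
    (hR : 1 ≤ R) {x y : ℝ} (hx : x ∈ Icc (-R) R) (hy : y ∈ Icc (-R) R) :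
    |u (x, y) - mom u - rot v * y| ≤ (∫ t in (-R)..R, |pd 0 u (t, y)|)
      + ((∫ s in (-R)..R, ∫ t in (-R)..R, |pd 1 u (t, s) + pd 0 v (t, s)|)
        + 8 * R * ∫ t in (-R)..R, ∫ s in (-R)..R, |pd 1 v (t, s)|) := by
  have sub1 : Icc (-1 : ℝ) 1 ⊆ Icc (-R) R := Icc_subset_Icc (by linarith) hR
  set e : ℝ → ℝ → ℝ := fun s t => pd 1 u (t, s) + pd 0 v (t, s) with he
  have hec : Continuous (Function.uncurry e) := by simp only [he, Function.uncurry_def]; fun_prop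
  set a : ℝ → ℝ := fun s => ∫ t in -1..1, u (t, s) * wt t with ha
  have hac : Continuous a := continuous_integral (by fun_prop)
  set b : ℝ → ℝ := fun t => ∫ s in -1..1, v (t, s) * wt s with hb
  have hbc : Continuous b := continuous_integral (by fun_prop)
  set E2 : ℝ → ℝ := fun t => ∫ s in (-R)..R, |pd 1 v (t, s)| with hE2
  have hE2c : Continuous E2 := continuous_integral (by fun_prop)
  have hE2n : ∀ t, 0 ≤ E2 t := fun t =>
    intervalIntegral.integral_nonneg (by linarith) fun _ _ => abs_nonneg _
  set A2 : ℝ := ∫ t in (-R)..R, E2 t with hA2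
  set F : ℝ → ℝ := fun s => ∫ t in (-R)..R, |e s t| with hF
  have hFc : Continuous F := continuous_integral (by fun_prop)
  have sub1' : ∀ {f : ℝ → ℝ}, Continuous f → (∀ t, 0 ≤ f t) →
      ∫ t in -1..1, f t ≤ ∫ t in (-R)..R, f t := fun {f} hf h0 =>
    intervalIntegral.integral_mono_interval (by linarith) (by norm_num) hR
      (.of_forall h0) (hf.intervalIntegrable _ _)
  -- the transverse derivative of the partial mean `a`
  set G : ℝ → ℝ := fun s => ∫ t in -1..1, pd 1 u (t, s) * wt t with hG
  have hGc : Continuous G := continuous_integral (by fun_prop)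
  have haG : ∀ s s', a s - a s' = ∫ σ in s'..s, G σ := by
    intro s s'
    have h1 : a s - a s' = ∫ t in -1..1, ∫ σ in s'..s, pd 1 u (t, σ) * wt t := by
      simp only [ha]
      rw [← intervalIntegral.integral_sub (cii (by fun_prop))
        (cii (by fun_prop))]
      refine intervalIntegral.integral_congr fun t _ => ?_
      rw [intervalIntegral.integral_mul_const, intervalIntegral.integral_eq_sub_of_hasDerivAt
        (f := fun σ => u (t, σ)) (fun σ _ => hasDerivAt_snd hu t σ)
        (cii (by fun_prop))]
      ring
    rw [h1, intervalIntegral_intervalIntegral_swap]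
    have : Continuous (Function.uncurry fun t σ : ℝ => pd 1 u (t, σ) * wt t) := by
      simp only [Function.uncurry_def]; fun_prop
    exact (this.continuousOn.integrableOn_compact (isCompact_uIcc.prod isCompact_uIcc)).mono_set
      (prod_mono uIoc_subset_uIcc uIoc_subset_uIcc)
  -- `v` is close to its partial mean `b`
  have hvb : ∀ t, ∀ s ∈ Icc (-R) R, |v (t, s) - b t| ≤ E2 t := fun t s hs =>
    abs_sub_mean_le (f := fun s => v (t, s)) (by fun_prop) fun s' hs' =>
      abs_sub_le_integral_deriv (f := fun s => v (t, s)) (fun σ => hasDerivAt_snd hv t σ)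
        (by fun_prop) hs (sub1 hs')
  have hGk : ∀ s ∈ Icc (-R) R, |G s - rot v| ≤ F s + 2 * A2 := by
    intro s hs
    have ibp : ∫ t in -1..1, pd 0 v (t, s) * wt t
        = - ∫ t in -1..1, v (t, s) * wt' t := by
      have := intervalIntegral.integral_mul_deriv_eq_deriv_mul (a := (-1 : ℝ)) (b := 1)
        (u := fun t => v (t, s)) (v := wt) (u' := fun t => pd 0 v (t, s)) (v' := wt')
        (fun t _ => hasDerivAt_fst hv t s) (fun t _ => hasDerivAt_wt t)
        (cii (by fun_prop))
        (cii (by fun_prop))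
      have w1 : wt 1 = 0 := by norm_num [wt]
      have w2 : wt (-1) = 0 := by norm_num [wt]
      simp only [w1, w2] at this
      linarith
    have h1 : G s - rot v = (∫ t in -1..1, e s t * wt t)
        + ∫ t in -1..1, (v (t, s) - b t) * wt' t := by
      have h2 : (∫ t in -1..1, e s t * wt t) = G s
          + ∫ t in -1..1, pd 0 v (t, s) * wt t := by
        simp only [he, hG, add_mul]
        exact intervalIntegral.integral_add (cii (by fun_prop))
          (cii (by fun_prop))
      have h3 : ∫ t in -1..1, (v (t, s) - b t) * wt' t
          = (∫ t in -1..1, v (t, s) * wt' t) - rot v := by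
        simp only [sub_mul, rot]
        exact intervalIntegral.integral_sub (cii (by fun_prop))
          (cii (by fun_prop))
      rw [h2, h3, ibp]; ring
    rw [h1]
    refine (abs_add_le _ _).trans (add_le_add ?_ ?_)
    · calc |∫ t in -1..1, e s t * wt t| ≤ ∫ t in -1..1, |e s t| := by
            refine abs_integral_le_of_abs_le (by fun_prop) fun t ht => ?_
            rw [abs_mul]
            exact mul_le_of_le_one_right (abs_nonneg _) (abs_wt_le ht)
        _ ≤ F s := sub1' (by fun_prop) fun _ => abs_nonneg _
    · calc |∫ t in -1..1, (v (t, s) - b t) * wt' t| ≤ ∫ t in -1..1, 2 * E2 t := by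
            refine abs_integral_le_of_abs_le (by fun_prop) fun t ht => ?_
            rw [abs_mul, mul_comm]
            exact mul_le_mul (abs_wt'_le ht) (hvb t s hs) (abs_nonneg _) zero_le_two
        _ ≤ 2 * A2 := by
            rw [intervalIntegral.integral_const_mul]
            exact mul_le_mul_of_nonneg_left (sub1' hE2c hE2n) zero_le_two
  have hvar : ∀ s' ∈ Icc (-1 : ℝ) 1,
      |(a y - rot v * y) - (a s' - rot v * s')| ≤ (∫ s in (-R)..R, F s) + 4 * R * A2 := by
    intro s' hs'
    have h1 : (a y - rot v * y) - (a s' - rot v * s') = ∫ σ in s'..y, (G σ - rot v) := by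
      rw [intervalIntegral.integral_sub (hGc.intervalIntegrable _ _) (by simp), ← haG]
      simp; ring
    rw [h1]
    refine (abs_intervalIntegral_le (by fun_prop) (sub1 hs') hy).trans ?_
    calc ∫ t in (-R)..R, |G t - rot v| ≤ ∫ t in (-R)..R, (F t + 2 * A2) :=
          intervalIntegral.integral_mono_on (by linarith)
            (cii (by fun_prop))
            (cii (by fun_prop)) fun t ht => hGk t ht
      _ = _ := by
          rw [intervalIntegral.integral_add (hFc.intervalIntegrable _ _) (by simp)]
          simp; ring
  have h2 := abs_sub_mean_le (f := fun s => a s - rot v * s) (by fun_prop) hvar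
  have h3 : ∫ s in -1..1, (a s - rot v * s) * wt s = mom u := by
    have : ∀ s, (a s - rot v * s) * wt s = a s * wt s - rot v * (s * wt s) := fun s => by ring
    simp only [this]
    rw [intervalIntegral.integral_sub (cii (by fun_prop))
      (cii (by fun_prop)), intervalIntegral.integral_const_mul,
      integral_mul_wt]
    simp [mom, ha]
  rw [h3] at h2
  have h4 : |u (x, y) - a y| ≤ ∫ t in (-R)..R, |pd 0 u (t, y)| :=
    abs_sub_mean_le (f := fun t => u (t, y)) (by fun_prop) fun t ht =>
      abs_sub_le_integral_deriv (f := fun t => u (t, y)) (fun σ => hasDerivAt_fst hu σ y)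
        (by fun_prop) hx (sub1 ht)
  have h5 : u (x, y) - mom u - rot v * y
      = (u (x, y) - a y) + (a y - rot v * y - mom u) := by ring
  have hA20 : 0 ≤ A2 := intervalIntegral.integral_nonneg (by linarith) fun t _ => hE2n t
  rw [h5]
  refine (abs_add_le _ _).trans (add_le_add h4 (h2.trans ?_))
  have : 4 * R * A2 ≤ 8 * R * A2 := by nlinarith
  linarith

/-- The squared `L²` norm of `f` on the square `sq R`. -/
def nsq (f : Plane → ℝ) (R : ℝ) : ℝ≥0∞ := ∫⁻ x in sq R, ofReal (f x ^ 2)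

theorem volume_restrict_sq (R : ℝ) : (volume : Measure Plane).restrict (sq R)
    = ((volume : Measure ℝ).restrict (Icc (-R) R)).prod (volume.restrict (Icc (-R) R)) := by
  rw [sq_eq, Measure.prod_restrict]; rfl

theorem volume_sq_ne_top (R : ℝ) : volume (sq R) ≠ ⊤ := (isCompact_sq R).measure_lt_top.ne

/-- The weighted mean of `u` over the unit square. -/
def mean (u : Plane → ℝ) : ℝ := ∫ x in sq 1, u x * (wt x.1 * wt x.2)

/-- Minus a weighted mean of `∂₁ v` over the unit square. -/
def rotMean (v : Plane → ℝ) : ℝ := ∫ x in sq 1, v x * (wt' x.1 * wt x.2)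

theorem integral_sq_eq (hf : Continuous f) (hR : 0 ≤ R) :
    ∫ x in sq R, f x = (∫ s in (-R)..R, ∫ t in (-R)..R, f (t, s)) ∧
      ∫ x in sq R, f x = ∫ t in (-R)..R, ∫ s in (-R)..R, f (t, s) := by
  have h1 : Integrable f ((volume.restrict (Icc (-R) R)).prod (volume.restrict (Icc (-R) R))) := by
    rw [← volume_restrict_sq]
    exact hf.continuousOn.integrableOn_compact (isCompact_sq R)
  simp only [intervalIntegral.integral_of_le (show -R ≤ R by linarith),
    ← integral_Icc_eq_integral_Ioc, volume_restrict_sq]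
  exact ⟨integral_prod_symm _ h1, integral_prod _ h1⟩

theorem mom_eq {u : Plane → ℝ} (hu : Continuous u) : mom u = mean u := by
  unfold mom mean
  rw [(integral_sq_eq (by fun_prop) zero_le_one).1]
  refine intervalIntegral.integral_congr fun s _ => ?_
  simp only [← mul_assoc]
  rw [intervalIntegral.integral_mul_const]

theorem rot_eq (hv : Continuous v) : rot v = rotMean v := by
  unfold rot rotMean
  rw [(integral_sq_eq (by fun_prop) zero_le_one).2]
  refine intervalIntegral.integral_congr fun s _ => ?_
  simp only [mul_comm (wt' _), ← mul_assoc]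
  rw [intervalIntegral.integral_mul_const]

theorem rotMean_eq_deriv (hv : ContDiff ℝ 1 v) :
    rotMean v = - mean (pd 0 v) := by
  unfold rotMean mean
  rw [(integral_sq_eq (by fun_prop) zero_le_one).1, (integral_sq_eq (by fun_prop) zero_le_one).1,
    ← intervalIntegral.integral_neg]
  refine intervalIntegral.integral_congr fun s _ => ?_
  simp only [← mul_assoc]
  rw [intervalIntegral.integral_mul_const, intervalIntegral.integral_mul_const]
  have := intervalIntegral.integral_mul_deriv_eq_deriv_mul (a := (-1 : ℝ)) (b := 1)
    (u := fun t => v (t, s)) (v := wt) (u' := fun t => pd 0 v (t, s)) (v' := wt')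
    (fun t _ => hasDerivAt_fst hv t s) (fun t _ => hasDerivAt_wt t)
    (cii (by fun_prop))
    (cii (by fun_prop))
  have w1 : wt 1 = 0 := by norm_num [wt]
  have w2 : wt (-1) = 0 := by norm_num [wt]
  simp only [w1, w2, mul_zero, sub_zero, zero_sub] at this
  rw [this]; ring

theorem measurePreserving_swap_sq (R : ℝ) : MeasurePreserving (Prod.swap : Plane → Plane)
    (volume.restrict (sq R)) (volume.restrict (sq R)) := by
  rw [volume_restrict_sq]; exact Measure.measurePreserving_swap

theorem mean_swap (u : Plane → ℝ) : mean (u ∘ Prod.swap) = mean u := by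
  unfold mean
  rw [← (measurePreserving_swap_sq 1).integral_comp
    (MeasurableEquiv.prodComm (α := ℝ) (β := ℝ)).measurableEmbedding]
  refine integral_congr_ae (.of_forall fun x => ?_)
  simp only [Function.comp, Prod.swap]
  ring

theorem nsq_swap (f : Plane → ℝ) (R : ℝ) : nsq (f ∘ Prod.swap) R = nsq f R := by
  unfold nsq
  exact (measurePreserving_swap_sq R).lintegral_comp_emb
    (MeasurableEquiv.prodComm (α := ℝ) (β := ℝ)).measurableEmbedding
    (fun x => ofReal (f x ^ 2))

theorem partialDeriv_swap {u : Plane → ℝ} (hu : ContDiff ℝ 1 u) (i : Fin 2) :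
    pd i (u ∘ Prod.swap) = pd (1 - i) u ∘ Prod.swap := by
  ext ⟨t, s⟩
  have hs : ContDiff ℝ 1 (u ∘ Prod.swap) :=
    hu.comp (contDiff_snd.prodMk contDiff_fst)
  fin_cases i
  · exact (hasDerivAt_fst hs t s).unique (hasDerivAt_snd hu s t)
  · exact (hasDerivAt_snd hs t s).unique (hasDerivAt_fst hu s t)

theorem sq_lintegral_le {α : Type*} [MeasurableSpace α] {ν : Measure α} {b : α → ℝ≥0∞}
    (hb : AEMeasurable b ν) : (∫⁻ x, b x ∂ν) ^ 2 ≤ ν univ * ∫⁻ x, b x ^ 2 ∂ν := by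
  simpa using sq_lintegral_mul_le (ν := ν) (a := fun _ => 1) aemeasurable_const hb

theorem ofReal_integral_abs {f : ℝ → ℝ} (hf : Continuous f) (hR : 0 ≤ R) :
    ofReal (∫ t in (-R)..R, |f t|) = ∫⁻ t in Icc (-R) R, ‖f t‖ₑ := by
  rw [intervalIntegral.integral_of_le (by linarith), ← integral_Icc_eq_integral_Ioc,
    ofReal_integral_eq_lintegral_ofReal (Continuous.integrableOn_Icc (by fun_prop))
      (.of_forall fun _ => abs_nonneg _)]
  simp only [Real.enorm_eq_ofReal_abs]

theorem ofReal_integral_sq_abs (hf : Continuous f) (R : ℝ) :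
    ofReal (∫ x in sq R, |f x|) = ∫⁻ x in sq R, ‖f x‖ₑ := by
  rw [ofReal_integral_eq_lintegral_ofReal
    (hf.abs.continuousOn.integrableOn_compact (isCompact_sq R))
    (.of_forall fun _ => abs_nonneg _)]
  simp only [Real.enorm_eq_ofReal_abs]

theorem sq_ofReal_integral_abs_le (hf : Continuous f) (R : ℝ) :
    ofReal (∫ x in sq R, |f x|) ^ 2 ≤ volume (sq R) * nsq f R := by
  rw [ofReal_integral_sq_abs hf]
  refine (sq_lintegral_le hf.enorm.aemeasurable).trans ?_
  simp only [enorm_sq_eq, Measure.restrict_apply_univ]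
  rfl

theorem lintegral_sq_line_le (hf : Continuous f) (hR : 0 ≤ R) :
    ∫⁻ x in sq R, ofReal (∫ t in (-R)..R, |f (t, x.2)|) ^ 2
      ≤ ofReal (2 * R) ^ 2 * nsq f R := by
  have hv : volume.restrict (Icc (-R) R) univ = ofReal (2 * R) := by
    rw [Measure.restrict_apply_univ, Real.volume_Icc]; ring_nf
  have hc : Continuous fun s : ℝ => ∫ t in (-R)..R, |f (t, s)| := continuous_integral (by fun_prop)
  rw [volume_restrict_sq, lintegral_prod_symm (fun x : ℝ × ℝ =>
    ofReal (∫ t in (-R)..R, |f (t, x.2)|) ^ 2)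
    ((hc.comp continuous_snd).measurable.ennreal_ofReal.pow_const 2).aemeasurable]
  simp only [lintegral_const, hv]
  rw [lintegral_mul_const _ (hc.measurable.ennreal_ofReal.pow_const 2), mul_comm,
    pow_two (ofReal (2 * R)), mul_assoc]
  gcongr
  unfold nsq
  rw [volume_restrict_sq, lintegral_prod_symm _ (by fun_prop), ← lintegral_const_mul _
    (by
      have : Measurable fun x : Plane => ofReal (f x ^ 2) := by fun_prop
      exact this.lintegral_prod_left')]
  refine lintegral_mono fun s => ?_
  rw [ofReal_integral_abs (f := fun t => f (t, s)) (by fun_prop) hR]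
  refine (sq_lintegral_le (Continuous.aemeasurable (by fun_prop))).trans ?_
  rw [hv]; simp only [enorm_sq_eq]; exact le_rfl

/-- The squared `L²` norm of (a multiple of) the strain of `(u, v)`. -/
def nstrain (e11 e12 e22 : Plane → ℝ) (R : ℝ) : ℝ≥0∞ := nsq e11 R + nsq e12 R + nsq e22 R

/-- The Poincaré-type constant of the square `sq R`. -/
def kpConst (R : ℝ) : ℝ≥0∞ :=
  3 * (ofReal (2 * R) ^ 2 + volume (sq R) * volume (sq R)
    + volume (sq R) * (ofReal (8 * R) ^ 2 * volume (sq R)))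

theorem kpConst_ne_top (R : ℝ) : kpConst R ≠ ⊤ := by
  have := volume_sq_ne_top R
  unfold kpConst; finiteness

/-- Korn–Poincaré for the first component: the affine function that is subtracted only involves the
mean of `u` and the rotation, measured by a mean of `v`. -/
theorem nsq_sub_affine_le {u : Plane → ℝ} (hu : ContDiff ℝ 1 u) (hv : ContDiff ℝ 1 v)
    (hR : 1 ≤ R) :
    nsq (fun x => u x - mean u - rotMean v * x.2) R
      ≤ kpConst R * nstrain (pd 0 u)
          (fun x => pd 1 u x + pd 0 v x) (pd 1 v) R := by
  have hR0 : 0 ≤ R := by linarith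
  set e12 : Plane → ℝ := fun x => pd 1 u x + pd 0 v x with he12
  have ce : Continuous e12 := by fun_prop
  set N := nstrain (pd 0 u) e12 (pd 1 v) R
  set A := ofReal (∫ x in sq R, |e12 x|)
  set B := ofReal (∫ x in sq R, |pd 1 v x|)
  have hpt : ∀ x ∈ sq R, ofReal ((u x - mean u - rotMean v * x.2) ^ 2)
      ≤ 3 * (ofReal (∫ t in (-R)..R, |pd 0 u (t, x.2)|) ^ 2
        + (A ^ 2 + (ofReal (8 * R) * B) ^ 2)) := by
    rintro ⟨x, y⟩ hx
    rw [sq_eq] at hx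
    have h := abs_sub_mom_sub_rot_le hu hv hR hx.1 hx.2
    rw [mom_eq hu.continuous, rot_eq hv.continuous,
      ← (integral_sq_eq (f := fun x => |e12 x|) (by fun_prop) hR0).1,
      ← (integral_sq_eq (f := fun x => |pd 1 v x|) (by fun_prop) hR0).2] at h
    set a := ∫ t in (-R)..R, |pd 0 u (t, y)|
    have ha : 0 ≤ a := intervalIntegral.integral_nonneg (by linarith) fun _ _ => abs_nonneg _
    have hA : 0 ≤ ∫ x in sq R, |e12 x| := integral_nonneg fun _ => abs_nonneg _
    have hB : 0 ≤ ∫ x in sq R, |pd 1 v x| := integral_nonneg fun _ => abs_nonneg _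
    rw [show (3 : ℝ≥0∞) = ofReal 3 by simp, ← ofReal_mul (by positivity),
      ← ofReal_pow ha, ← ofReal_pow hA, ← ofReal_pow (by positivity),
      ← ofReal_add (by positivity) (by positivity),
      ← ofReal_add (by positivity) (by positivity), ← ofReal_mul (by positivity)]
    apply ofReal_le_ofReal
    rw [← sq_abs]
    set b := ∫ x in sq R, |e12 x|
    set c := 8 * R * ∫ x in sq R, |pd 1 v x|
    have h2 := pow_le_pow_left₀ (abs_nonneg _) h 2
    refine h2.trans ?_
    nlinarith [sq_nonneg (a - b), sq_nonneg (b - c), sq_nonneg (a - c)]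
  calc nsq (fun x => u x - mean u - rotMean v * x.2) R
      ≤ ∫⁻ x in sq R, 3 * (ofReal (∫ t in (-R)..R, |pd 0 u (t, x.2)|) ^ 2
        + (A ^ 2 + (ofReal (8 * R) * B) ^ 2)) :=
        setLIntegral_mono' (measurableSet_sq R) hpt
    _ = 3 * ((∫⁻ x in sq R, ofReal (∫ t in (-R)..R, |pd 0 u (t, x.2)|) ^ 2)
        + (A ^ 2 + (ofReal (8 * R) * B) ^ 2) * volume (sq R)) := by
        rw [lintegral_const_mul' _ _ (by simp), lintegral_add_right _ measurable_const]
        simp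
    _ ≤ 3 * (ofReal (2 * R) ^ 2 * N
        + (volume (sq R) * N + ofReal (8 * R) ^ 2 * (volume (sq R) * N)) * volume (sq R)) := by
        rw [mul_pow]
        gcongr
        · exact (lintegral_sq_line_le (by fun_prop) hR0).trans (by
            gcongr; exact le_self_add.trans le_self_add)
        · exact (sq_ofReal_integral_abs_le ce R).trans (by
            gcongr; exact le_add_self.trans le_self_add)
        · exact (sq_ofReal_integral_abs_le (by fun_prop) R).trans (by gcongr; exact le_add_self)
    _ = _ := by unfold kpConst; ring

theorem ofReal_sq_add_le (p q : ℝ) :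
    ofReal ((p + q) ^ 2) ≤ 2 * (ofReal (p ^ 2) + ofReal (q ^ 2)) := by
  rw [← ofReal_add (sq_nonneg _) (sq_nonneg _), ← ENNReal.ofReal_ofNat 2,
    ← ofReal_mul (by positivity)]
  exact ofReal_le_ofReal (by nlinarith [sq_nonneg (p - q)])

theorem nsq_le_of_le (R : ℝ) {c d : ℝ≥0∞} (k : Plane → ℝ)
    (hf : nsq f R ≤ c) (hk : nsq k R ≤ d) (hm : Continuous f)
    (h : ∀ x, g x = f x + k x) : nsq g R ≤ 2 * (c + d) := by
  calc nsq g R ≤ ∫⁻ x in sq R, 2 * (ofReal (f x ^ 2) + ofReal (k x ^ 2)) := by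
        refine lintegral_mono fun x => ?_
        rw [h]; exact ofReal_sq_add_le ..
    _ = 2 * (nsq f R + nsq k R) := by
        rw [lintegral_const_mul' _ _ (by simp), lintegral_add_left (by fun_prop)]; rfl
    _ ≤ _ := by gcongr

theorem nsq_mul_le {k : Plane → ℝ} (h : ∀ x ∈ sq R, |k x| ≤ c) :
    nsq k R ≤ ofReal (c ^ 2) * volume (sq R) := by
  rw [← setLIntegral_const]
  refine setLIntegral_mono' (measurableSet_sq R) fun x hx => ofReal_le_ofReal ?_
  rw [← sq_abs]; exact pow_le_pow_left₀ (abs_nonneg _) (h x hx) 2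

theorem abs_snd_le (hx : x ∈ sq R) : |x.2| ≤ R := by
  rw [sq_eq] at hx; exact abs_le.2 hx.2

/-- The weighted mean is bounded by the `L²` norm. -/
theorem sq_mean_le (hf : Continuous f) :
    ofReal (mean f ^ 2) ≤ volume (sq 1) * nsq f 1 := by
  refine le_trans ?_ (sq_ofReal_integral_abs_le hf 1)
  rw [← sq_abs, ofReal_pow (abs_nonneg _)]
  gcongr
  unfold mean
  rw [← Real.norm_eq_abs]
  refine norm_integral_le_of_norm_le (hf.abs.continuousOn.integrableOn_compact (isCompact_sq 1)) ?_
  filter_upwards [ae_restrict_mem (measurableSet_sq 1)] with x hx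
  rw [sq_eq] at hx
  rw [Real.norm_eq_abs, abs_mul, abs_mul]
  exact mul_le_of_le_one_right (abs_nonneg _)
    (mul_le_one₀ (abs_wt_le hx.1) (abs_nonneg _) (abs_wt_le hx.2))

theorem nsq_mono (f : Plane → ℝ) {S : ℝ} (h : R ≤ S) : nsq f R ≤ nsq f S :=
  lintegral_mono_set (Metric.closedBall_subset_closedBall h)

/-- The Korn–Poincaré inequality on squares, for continuously differentiable fields. -/
theorem nsq_add_nsq_le (hR : 1 ≤ R) : ∃ K : ℝ≥0∞, K ≠ ⊤ ∧
    ∀ u v : Plane → ℝ, ContDiff ℝ 1 u → ContDiff ℝ 1 v →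
      nsq u R + nsq v R ≤ K * (nstrain (pd 0 u)
          (fun x => pd 1 u x + pd 0 v x) (pd 1 v) R
          + ofReal (mean u ^ 2) + ofReal (mean v ^ 2)
          + ofReal (rotMean v ^ 2)) := by
  set V := volume (sq R)
  have hV : V ≠ ⊤ := volume_sq_ne_top R
  set k := kpConst R
  have hk : k ≠ ⊤ := kpConst_ne_top R
  set r := ofReal (R ^ 2)
  set V1 := volume (sq 1)
  have hV1 : V1 ≠ ⊤ := volume_sq_ne_top 1
  refine ⟨2 * (k + 2 * (1 + r) * V) + 2 * (k + 2 * (1 + r * (2 * (V1 + 1))) * V),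
    by finiteness, fun u v hu hv => ?_⟩
  set e12 : Plane → ℝ := fun x => pd 1 u x + pd 0 v x with he12
  set N := nstrain (pd 0 u) e12 (pd 1 v) R with hN
  set a := ofReal (mean u ^ 2)
  set b := ofReal (mean v ^ 2)
  set c := ofReal (rotMean v ^ 2)
  set T := N + a + b + c
  have hNT : N ≤ T := le_self_add.trans (le_self_add.trans le_self_add)
  have haT : a ≤ T := le_add_self.trans (le_self_add.trans le_self_add)
  have hbT : b ≤ T := le_add_self.trans le_self_add
  have hcT : c ≤ T := le_add_self
  have hab : ∀ p q y : ℝ, |y| ≤ R → |p + q * y| ≤ |p| + |q| * R := by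
    intro p q y hy
    refine (abs_add_le _ _).trans ?_
    rw [abs_mul]; gcongr
  have haff : ∀ p q : ℝ, ofReal ((|p| + |q| * R) ^ 2)
      ≤ 2 * (ofReal (p ^ 2) + r * ofReal (q ^ 2)) := by
    intro p q
    refine (ofReal_sq_add_le _ _).trans_eq ?_
    rw [mul_pow, sq_abs, sq_abs, ofReal_mul (sq_nonneg _), mul_comm r]
  have hu' : nsq u R ≤ 2 * (k * N + 2 * (a + r * c) * V) := by
    refine nsq_le_of_le R (fun x => mean u + rotMean v * x.2) (nsq_sub_affine_le hu hv hR)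
      ((nsq_mul_le fun x hx => hab _ _ _ (abs_snd_le hx)).trans ?_)
      (by fun_prop) (fun x => by ring)
    gcongr
    exact haff _ _
  -- the second component: exchange the coordinates
  have hus : ContDiff ℝ 1 (u ∘ Prod.swap) := hu.comp (contDiff_snd.prodMk contDiff_fst)
  have hvs : ContDiff ℝ 1 (v ∘ Prod.swap) := hv.comp (contDiff_snd.prodMk contDiff_fst)
  set c' := ofReal (rotMean (u ∘ Prod.swap) ^ 2)
  have hsw : nsq (fun x => (v ∘ Prod.swap) x - mean (v ∘ Prod.swap)
      - rotMean (u ∘ Prod.swap) * x.2) R ≤ k * N := by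
    refine (nsq_sub_affine_le hvs hus hR).trans (le_of_eq ?_)
    congr 1
    rw [hN]
    unfold nstrain
    have e1 : (fun x => pd 1 (v ∘ Prod.swap) x + pd 0 (u ∘ Prod.swap) x)
        = e12 ∘ Prod.swap := by
      rw [partialDeriv_swap hu, partialDeriv_swap hv]
      ext x
      simp only [he12, Function.comp, sub_self, sub_zero, add_comm]
    rw [e1, nsq_swap, partialDeriv_swap hu, partialDeriv_swap hv, nsq_swap, nsq_swap]
    simp only [sub_zero, sub_self]
    ring
  have hv' : nsq v R ≤ 2 * (k * N + 2 * (b + r * c') * V) := by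
    rw [← nsq_swap v]
    refine nsq_le_of_le R (fun x => mean (v ∘ Prod.swap) + rotMean (u ∘ Prod.swap) * x.2) hsw
      ((nsq_mul_le fun x hx => hab _ _ _ (abs_snd_le hx)).trans ?_)
      (by fun_prop) (fun x => by ring)
    gcongr
    rw [mean_swap]
    exact haff _ _
  have hc' : c' ≤ 2 * (V1 * N + c) := by
    have e1 : rotMean (u ∘ Prod.swap) = - mean e12 - rotMean v := by
      rw [rotMean_eq_deriv hus, rotMean_eq_deriv hv, partialDeriv_swap hu, mean_swap]
      have : mean e12 = mean (pd 1 u) + mean (pd 0 v) := by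
        unfold mean
        rw [← integral_add]
        · simp only [he12, add_mul]
        · exact (Continuous.continuousOn (by fun_prop)).integrableOn_compact (isCompact_sq 1)
        · exact (Continuous.continuousOn (by fun_prop)).integrableOn_compact (isCompact_sq 1)
      rw [this]; simp only [sub_zero]; ring
    have h1 : c' ≤ 2 * (ofReal (mean e12 ^ 2) + c) := by
      simp only [c', e1, ← neg_add', neg_sq]; exact ofReal_sq_add_le ..
    refine h1.trans ?_
    gcongr
    refine (sq_mean_le (by fun_prop)).trans ?_
    gcongr
    refine (nsq_mono _ hR).trans ?_
    rw [hN]; unfold nstrain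
    rw [add_right_comm]; exact le_add_self
  calc nsq u R + nsq v R ≤ 2 * (k * T + 2 * (T + r * T) * V)
        + 2 * (k * T + 2 * (T + r * (2 * (V1 * T + T))) * V) :=
        add_le_add (hu'.trans (by gcongr)) (hv'.trans (by gcongr; exact hc'.trans (by gcongr)))
    _ = _ := by ring

/-! ### Korn's inequality -/

theorem partialDeriv_mul (hf : ContDiff ℝ 1 f) (hg : ContDiff ℝ 1 g) (i : Fin 2)
    (x : Plane) : pd i (fun y => f y * g y) x
      = f x * pd i g x + g x * pd i f x := by
  unfold partialDeriv
  have := ((hf.differentiable one_ne_zero x).hasFDerivAt.mul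
    (hg.differentiable one_ne_zero x).hasFDerivAt).fderiv
  change fderiv ℝ (f * g) x (dir i) = _
  rw [this]; simp

theorem partialDeriv_comm (hf : ContDiff ℝ ∞ f) (i j : Fin 2) (x : Plane) :
    pd i (pd j f) x = pd j (pd i f) x := by
  have h : ∀ k l : Fin 2, pd k (pd l f) x
      = fderiv ℝ (fderiv ℝ f) x (dir k) (dir l) := by
    intro k l
    unfold partialDeriv
    have hd : HasFDerivAt (fderiv ℝ f) (fderiv ℝ (fderiv ℝ f) x) x :=
      ((hf.fderiv_right (m := ∞) (by simp)).differentiable (by simp) x).hasFDerivAt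
    have := (hd.clm_apply (hasFDerivAt_const (dir l) x)).fderiv
    rw [this]; simp
  rw [h, h]
  exact second_derivative_symmetric
    (fun y => (hf.differentiable (by simp) y).hasFDerivAt)
    ((hf.fderiv_right (m := ∞) (by simp)).differentiable (by simp) x).hasFDerivAt _ _

theorem IsTest.integrable_mul (h : IsTest U φ)
    (h' : IsTest V ψ) : Integrable fun x => φ x * ψ x :=
  (h.1.continuous.mul h'.1.continuous).integrable_of_hasCompactSupport h.2.1.mul_right

theorem integral_mul_partialDeriv (h : IsTest U φ)
    (h' : IsTest V ψ) (i : Fin 2) :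
    ∫ x, φ x * pd i ψ x = - ∫ x, pd i φ x * ψ x :=
  integral_mul_fderiv_eq_neg_fderiv_mul_of_integrable ((h.partialDeriv i).integrable_mul h')
    (h.integrable_mul (h'.partialDeriv i)) (h.integrable_mul h')
    (fun x _ => h.1.differentiable (by simp) x) (fun x _ => h'.1.differentiable (by simp) x)

/-- Korn's first inequality: for compactly supported fields the mixed products of the two
off-diagonal derivatives integrate to the product of the diagonal ones. -/
theorem integral_grad_sq_le (h : IsTest U φ) (h' : IsTest V ψ) :
    Integrable (fun x => pd 0 φ x ^ 2 + pd 1 φ x ^ 2 + (pd 0 ψ x ^ 2 + pd 1 ψ x ^ 2)) ∧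
    Integrable (fun x => 2 * pd 0 φ x ^ 2 + (pd 1 φ x + pd 0 ψ x) ^ 2 + 2 * pd 1 ψ x ^ 2) ∧
    ∫ x, (pd 0 φ x ^ 2 + pd 1 φ x ^ 2 + (pd 0 ψ x ^ 2 + pd 1 ψ x ^ 2))
      ≤ ∫ x, (2 * pd 0 φ x ^ 2 + (pd 1 φ x + pd 0 ψ x) ^ 2 + 2 * pd 1 ψ x ^ 2) := by
  have i := fun i j => (h.partialDeriv i).integrable_mul (h.partialDeriv j)
  have j := fun i j => (h'.partialDeriv i).integrable_mul (h'.partialDeriv j)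
  have m := fun i j => (h.partialDeriv i).integrable_mul (h'.partialDeriv j)
  have key : ∫ x, pd 1 φ x * pd 0 ψ x = ∫ x, pd 0 φ x * pd 1 ψ x := by
    rw [integral_mul_partialDeriv (h.partialDeriv 1) h',
      integral_mul_partialDeriv (h.partialDeriv 0) h']
    simp only [partialDeriv_comm h.1 0 1]
  have hS := ((i 0 0).add (i 1 1)).add ((j 0 0).add (j 1 1))
  have hB := ((i 0 0).add (j 1 1)).add ((m 0 1).const_mul 2)
  have hC := ((m 1 0).sub (m 0 1)).const_mul 2
  have hT := (hS.add hB).add hC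
  refine ⟨hS.congr (.of_forall fun x => ?_), hT.congr (.of_forall fun x => ?_), ?_⟩
  · simp; ring
  · simp; ring
  have e := integral_add' (hS.add hB) hC
  rw [integral_add' hS hB, integral_const_mul, integral_sub' (m 1 0) (m 0 1), key, sub_self,
    mul_zero, add_zero] at e
  refine le_of_eq_of_le (integral_congr_ae (.of_forall fun x => ?_)) ((le_add_of_nonneg_right
    (integral_nonneg fun x => ?_)).trans (e.ge.trans_eq (integral_congr_ae (.of_forall
        fun x => ?_))))
  · simp; ring
  · simp; nlinarith [sq_nonneg (pd 0 φ x + pd 1 ψ x)]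
  · simp; ring

/-- The pointwise estimate for the strain of a product with a cut-off function `e`. -/
theorem korn_pointwise {e d u v : ℝ} (he : e ^ 2 ≤ 1) (hp : p ^ 2 ≤ M) (hq : q ^ 2 ≤ M) :
    2 * (e * a + u * p) ^ 2 + (e * b + u * q + (e * c + v * p)) ^ 2 + 2 * (e * d + v * q) ^ 2
      ≤ (4 + 7 * M) * (a ^ 2 + (b + c) ^ 2 + d ^ 2 + (u ^ 2 + v ^ 2)) := by
  have k : ∀ {x y : ℝ} (z : ℝ), x ≤ y → z ^ 2 * x ≤ z ^ 2 * y := fun z h =>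
    mul_le_mul_of_nonneg_left h (sq_nonneg z)
  have hM := (sq_nonneg p).trans hp
  linarith [sq_nonneg (e * a - u * p), sq_nonneg (e * d - v * q), sq_nonneg (e * (b + c) - u * q),
    sq_nonneg (u * q - v * p), sq_nonneg (e * (b + c) - v * p), k a he, k d he, k (b + c) he,
        k u hp,
    k v hp, k u hq, k v hq, k a hM, k d hM, k (b + c) hM, k (b + c) zero_le_one,
    sq_nonneg u, sq_nonneg v]

/-- A smooth cut-off function which equals `1` on `sq R`. -/
theorem exists_cutoff (R : ℝ) (hR : 0 ≤ R) : ∃ η : Plane → ℝ, IsTest univ η ∧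
    tsupport η ⊆ sq (R + 2) ∧ (∀ x ∈ Metric.closedBall (0 : Plane) (R + 1), η x = 1) ∧
    (∀ x, |η x| ≤ 1) ∧ ∃ B : ℝ, 0 ≤ B ∧ ∀ i x, |pd i η x| ≤ B := by
  let b : ContDiffBump (0 : Plane) := ⟨R + 1, R + 2, by linarith, by linarith⟩
  have ht : IsTest univ b := ⟨b.contDiff, b.hasCompactSupport, subset_univ _⟩
  refine ⟨b, ht, b.tsupport_eq.le, fun x hx => b.one_of_mem_closedBall hx, fun x => ?_, ?_⟩
  · rw [abs_of_nonneg b.nonneg]; exact b.le_one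
  · obtain ⟨B0, h0⟩ := (ht.partialDeriv 0).2.1.exists_bound_of_continuous
      (ht.partialDeriv 0).1.continuous
    obtain ⟨B1, h1⟩ := (ht.partialDeriv 1).2.1.exists_bound_of_continuous
      (ht.partialDeriv 1).1.continuous
    refine ⟨max B0 B1, (norm_nonneg _).trans ((h0 0).trans (le_max_left _ _)), fun i x => ?_⟩
    fin_cases i
    · exact (h0 x).trans (le_max_left _ _)
    · exact (h1 x).trans (le_max_right _ _)

/-- The squared `L²` norm of the gradient of `(u, v)`. -/
def ngrad (g h : Fin 2 → Plane → ℝ) (R : ℝ) : ℝ≥0∞ :=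
  nsq (g 0) R + nsq (g 1) R + (nsq (h 0) R + nsq (h 1) R)

/-- Korn's inequality with a cut-off function: the gradient on `sq R` is controlled by the strain and
the field itself on a larger square. -/
theorem ngrad_smooth_le (hR : 0 ≤ R) : ∃ K : ℝ≥0∞, K ≠ ⊤ ∧
    ∀ u v : Plane → ℝ, ContDiff ℝ ∞ u → ContDiff ℝ ∞ v →
      ngrad (fun i => pd i u) (fun i => pd i v) R
        ≤ K * (nstrain (pd 0 u) (fun x => pd 1 u x + pd 0 v x) (pd 1 v) (R + 2)
          + (nsq u (R + 2) + nsq v (R + 2))) := by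
  obtain ⟨η, hη, hηs, hη1, hηb, B, hB0, hB⟩ := exists_cutoff R hR
  refine ⟨ofReal (4 + 7 * B ^ 2), ofReal_ne_top, fun u v hu hv => ?_⟩
  have one : ∀ {f : Plane → ℝ}, ContDiff ℝ ∞ f → ContDiff ℝ 1 f := fun h => h.of_le (by simp)
  have cu := hu.continuous
  have cv := hv.continuous
  have u1 := one hu
  have v1 := one hv
  have tst : ∀ {f : Plane → ℝ}, ContDiff ℝ ∞ f → IsTest univ fun x => η x * f x := fun h =>
    ⟨hη.1.mul h, hη.2.1.mul_right, subset_univ _⟩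
  have d : ∀ {f : Plane → ℝ}, ContDiff ℝ ∞ f → ∀ i x,
      pd i (fun x => η x * f x) x = η x * pd i f x + f x * pd i η x :=
    fun h i x => partialDeriv_mul (one hη.1) (one h) i x
  -- on `sq R` the cut-off is invisible
  have hloc : ∀ x ∈ sq R, ∀ i, ∀ {f : Plane → ℝ}, pd i f x = pd i (fun x => η x * f x) x := by
    intro x hx i f
    have : Metric.ball (0 : Plane) (R + 1) ∈ 𝓝 x := Metric.isOpen_ball.mem_nhds
      (lt_of_le_of_lt (Metric.mem_closedBall.1 hx) (by linarith))
    unfold partialDeriv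
    rw [Filter.EventuallyEq.fderiv_eq (f₁ := f)]
    filter_upwards [this] with y hy
    rw [hη1 y (Metric.ball_subset_closedBall hy), one_mul]
  obtain ⟨iS, iT, hST⟩ := integral_grad_sq_le (tst hu) (tst hv)
  rw [← ENNReal.ofReal_le_ofReal_iff (integral_nonneg fun x => by positivity),
    ofReal_integral_eq_lintegral_ofReal iS (.of_forall fun x => by positivity),
    ofReal_integral_eq_lintegral_ofReal iT (.of_forall fun x => by positivity)] at hST
  refine le_trans (le_trans (le_of_eq ?_) (setLIntegral_le_lintegral (sq R) _)) (hST.trans ?_)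
  · unfold ngrad nsq
    rw [← lintegral_add_left (by fun_prop), ← lintegral_add_left (by fun_prop),
      ← lintegral_add_left (by fun_prop)]
    refine setLIntegral_congr_fun (measurableSet_sq R) fun x hx => ?_
    have p : ∀ y : ℝ, 0 ≤ y ^ 2 := sq_nonneg
    have q : ∀ (f : Plane → ℝ) i, pd i f x = _ := fun f i => hloc x hx i
    have p' : ∀ y z : ℝ, 0 ≤ y ^ 2 + z ^ 2 := fun y z => by positivity
    simp only [q u, q v, ofReal_add (p' _ _) (p' _ _), ofReal_add (p _) (p _)]
  rw [← setLIntegral_eq_of_support_subset (s := sq (R + 2)) ?_]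
  · unfold nstrain nsq
    rw [← lintegral_add_left (by fun_prop), ← lintegral_add_left (by fun_prop),
      ← lintegral_add_left (by fun_prop), ← lintegral_add_left (by fun_prop),
      ← lintegral_const_mul' _ _ ofReal_ne_top]
    refine lintegral_mono fun x => ?_
    rw [← ofReal_add (by positivity) (by positivity), ← ofReal_add (by positivity) (by positivity),
      ← ofReal_add (by positivity) (by positivity), ← ofReal_add (by positivity) (by positivity),
      ← ofReal_mul (by positivity)]
    simp only [d hu, d hv]
    have k := fun i => sq_le_sq' (neg_le_of_abs_le (hB i x)) (le_of_abs_le (hB i x))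
    exact ofReal_le_ofReal (korn_pointwise ((sq_le_one_iff_abs_le_one _).2 (hηb x)) (k 0) (k 1))
  · refine Function.support_subset_iff'.2 fun x hx => ?_
    have h1 : η x = 0 := image_eq_zero_of_notMem_tsupport fun h => hx (hηs h)
    have h2 : ∀ i, pd i η x = 0 := fun i => image_eq_zero_of_notMem_tsupport fun h => hx
      ((IsTest.partialDeriv (U := sq (R + 2)) ⟨hη.1, hη.2.1, hηs⟩ i).2.2 h)
    simp [d hu, d hv, h1, h2]

theorem memL2loc_of_continuous (hf : Continuous f) : MemL2loc f := fun _ hC =>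
  (memLp_two_iff_integrable_sq hf.aestronglyMeasurable).2
    ((hf.pow 2).continuousOn.integrableOn_compact hC)

theorem MemL2loc.contDiff_moll (hg : MemL2loc g) (n : ℕ) : ContDiff ℝ ∞ (moll n g) :=
  Nucleus.contDiff_moll n hg.locallyIntegrable

theorem MemL2loc.memLp_moll (hg : MemL2loc g) (n : ℕ) (R : ℝ) :
    MemLp (moll n g) 2 (volume.restrict (sq R)) :=
  memL2loc_of_continuous (hg.contDiff_moll n).continuous _ (isCompact_sq R)

theorem tendsto_toLp_moll (hg : MemL2loc g) (R : ℝ) :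
    Tendsto (fun n => (hg.memLp_moll n R).toLp) atTop (𝓝 (hg _ (isCompact_sq R)).toLp) :=
  (Lp.tendsto_Lp_iff_tendsto_eLpNorm'' _ _ _ _).2
    (tendsto_eLpNorm_moll_sub_restrict hg (isCompact_sq R))

theorem tendsto_nsq_moll (hg : MemL2loc g) (R : ℝ) :
    Tendsto (fun n => nsq (moll n g) R) atTop (𝓝 (nsq g R)) := by
  have h := (tendsto_toLp_moll hg R).norm
  simp only [Lp.norm_toLp] at h
  have e : ∀ {k : Plane → ℝ}, MemLp k 2 (volume.restrict (sq R)) →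
      ofReal ((eLpNorm k 2 (volume.restrict (sq R))).toReal ^ 2) = nsq k R := by
    intro k hk
    rw [ofReal_pow ENNReal.toReal_nonneg, ofReal_toReal hk.2.ne, eLpNorm_two_sq]
    rfl
  rw [← e (hg _ (isCompact_sq R))]
  exact (ENNReal.tendsto_ofReal (h.pow 2)).congr fun n => e (hg.memLp_moll n R)

theorem tendsto_integral_moll_mul (hg : MemL2loc g) (hw : Continuous w) (R : ℝ) :
    Tendsto (fun n => ∫ x in sq R, moll n g x * w x) atTop (𝓝 (∫ x in sq R, g x * w x)) := by
  have hwm := memL2loc_of_continuous hw _ (isCompact_sq R)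
  have h := Filter.Tendsto.inner (𝕜 := ℝ) (tendsto_toLp_moll hg R)
    (tendsto_const_nhds (x := hwm.toLp))
  have e : ∀ {k : Plane → ℝ} (hk : MemLp k 2 (volume.restrict (sq R))),
      inner ℝ hk.toLp hwm.toLp = ∫ x in sq R, k x * w x := by
    intro k hk
    rw [L2.inner_def]
    refine integral_congr_ae ?_
    filter_upwards [hk.coeFn_toLp, hwm.coeFn_toLp] with x h1 h2
    rw [h1, h2]
    simp [mul_comm]
  rw [← e (hg _ (isCompact_sq R))]
  exact h.congr fun n => e (hg.memLp_moll n R)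

theorem MemL2loc.add (hf : MemL2loc f) (hg : MemL2loc g) :
    MemL2loc fun x => f x + g x := fun C hC => (hf C hC).add (hg C hC)

/-- The Korn–Poincaré inequality for `W^{1,2}_loc` fields: the field and its gradient are
controlled in `L²` of squares by the strain and by three weighted means. -/
theorem korn_poincare (R : ℕ) : ∃ K : ℝ≥0∞, K ≠ ⊤ ∧ ∀ (u v : Plane → ℝ) (g h : Fin 2 → Plane → ℝ),
    MemL2loc u → MemL2loc v → (∀ i, IsWeakPartial i u (g i)) → (∀ i, IsWeakPartial i v (h i)) →
      nsq u R + nsq v R + ngrad g h R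
        ≤ K * (nstrain (g 0) (fun x => g 1 x + h 0 x) (h 1) (R + 2)
          + ofReal (mean u ^ 2) + ofReal (mean v ^ 2)
          + ofReal (rotMean v ^ 2)) := by
  have hR : (0 : ℝ) ≤ R := R.cast_nonneg
  obtain ⟨K1, hK1, h1⟩ := nsq_add_nsq_le (R := R + 2) (by linarith)
  obtain ⟨K2, hK2, h2⟩ := ngrad_smooth_le hR
  refine ⟨K1 + K2 * (1 + K1), by finiteness, fun u v g h hu hv hg hh => ?_⟩
  have conv := fun {f : Plane → ℝ} => tendsto_nsq_moll (g := f)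
  have cm : ∀ {f : Plane → ℝ}, MemL2loc f → ∀ {w : Plane → ℝ}, Continuous w →
      Tendsto (fun n => ofReal ((∫ x in sq 1, moll n f x * w x) ^ 2)) atTop
        (𝓝 (ofReal ((∫ x in sq 1, f x * w x) ^ 2))) := fun hf w hw =>
    ENNReal.tendsto_ofReal ((tendsto_integral_moll_mul hf hw 1).pow 2)
  have key : ∀ n, nsq (moll n u) R + nsq (moll n v) R
        + ngrad (fun i => moll n (g i)) (fun i => moll n (h i)) R
      ≤ (K1 + K2 * (1 + K1)) * (nstrain (moll n (g 0)) (moll n (g 1 + h 0))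
          (moll n (h 1)) (R + 2) + ofReal (mean (moll n u) ^ 2)
          + ofReal (mean (moll n v) ^ 2) + ofReal (rotMean (moll n v) ^ 2)) := by
    intro n
    have dg : ∀ i, pd i (moll n u) = moll n (g i) := fun i =>
      funext fun x => partialDeriv_moll n hu (hg i) x
    have dh : ∀ i, pd i (moll n v) = moll n (h i) := fun i =>
      funext fun x => partialDeriv_moll n hv (hh i) x
    have a1 := h1 _ _ ((hu.contDiff_moll n).of_le (by simp)) ((hv.contDiff_moll n).of_le (by simp))
    have a2 := h2 _ _ (hu.contDiff_moll n) (hv.contDiff_moll n)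
    simp only [dg, dh] at a1 a2
    have e := moll_add n (hg 1).1.locallyIntegrable (hh 0).1.locallyIntegrable
    change _ = fun x => moll n (g 1) x + moll n (h 0) x at e
    rw [← e] at a1 a2
    set N := nstrain (moll n (g 0)) (moll n (g 1 + h 0)) (moll n (h 1)) (R + 2)
    set Q := N + ofReal (mean (moll n u) ^ 2)
          + ofReal (mean (moll n v) ^ 2) + ofReal (rotMean (moll n v) ^ 2)
    have hNQ : N ≤ Q := le_self_add.trans (le_self_add.trans le_self_add)
    calc _ ≤ (nsq (moll n u) (R + 2) + nsq (moll n v) (R + 2)) + K2 * (N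
          + (nsq (moll n u) (R + 2) + nsq (moll n v) (R + 2))) := by
          gcongr
          · exact nsq_mono _ (by linarith)
          · exact nsq_mono _ (by linarith)
      _ ≤ K1 * Q + K2 * (Q + K1 * Q) := by gcongr
      _ = _ := by ring
  refine le_of_tendsto_of_tendsto' (b := atTop) ?_ ?_ key
  · unfold ngrad
    exact ((conv hu _).add (conv hv _)).add (((conv (hg 0).1 _).add (conv (hg 1).1 _)).add
      ((conv (hh 0).1 _).add (conv (hh 1).1 _)))
  · refine ENNReal.Tendsto.const_mul ?_ (Or.inr (by finiteness))
    unfold nstrain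
    refine (((((conv (hg 0).1 _).add (conv ((hg 1).1.add (hh 0).1) _)).add
      (conv (hh 1).1 _)).add (cm hu (by fun_prop))).add (cm hv (by fun_prop))).add
      (cm hv (by fun_prop))

/-! ### Strong compactness from a bound on the variation -/

/-- The first order distributional derivatives of `g` on `U`, tested with functions bounded by
one, are bounded by `C`. -/
def VarBound (U : Set Plane) (C : ℝ) (g : Plane → ℝ) : Prop :=
  ∀ (i : Fin 2) (φ : Plane → ℝ), IsTest U φ → (∀ x, |φ x| ≤ 1) →
    |∫ x, g x * pd i φ x| ≤ C

/-- The `L¹` norm is determined by duality with test functions. -/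
theorem setIntegral_abs_le_of_test (hf : LocallyIntegrable f volume)
    {K : Set Plane} (hU : IsOpen U) (hK : IsCompact K) (hKU : K ⊆ U) (h : ∀ φ, IsTest U φ → (∀ x,
        |φ x| ≤ 1) → |∫ x, f x * φ x| ≤ C) :
    ∫ x in K, |f x| ≤ C := by
  obtain ⟨δ, hδ, hδU⟩ := hK.exists_cthickening_subset_open hU hKU
  set f' := hf.aestronglyMeasurable.mk f with hf'
  have hff' : f =ᵐ[volume] f' := hf.aestronglyMeasurable.ae_eq_mk
  have hf'm : StronglyMeasurable f' := hf.aestronglyMeasurable.stronglyMeasurable_mk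
  -- mollify the sign of `f` on `K`
  set s : Plane → ℝ := K.indicator fun x => if 0 ≤ f' x then 1 else -1 with hs
  have hsm : Measurable s := Measurable.indicator (Measurable.ite
    (measurableSet_le measurable_const hf'm.measurable) measurable_const measurable_const)
    hK.measurableSet
  have hs1 : ∀ x, |s x| ≤ 1 := by
    intro x
    by_cases hx : x ∈ K
    · simp only [hs, indicator_of_mem hx]
      split_ifs <;> simp
    · simp [hs, indicator_of_notMem hx]
  have hsl : LocallyIntegrable s volume := by
    refine (locallyIntegrable_const (1 : ℝ)).mono hsm.aestronglyMeasurable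
      (.of_forall fun x => ?_)
    simpa using hs1 x
  have hmb : ∀ n x, |moll n s x| ≤ 1 := by
    intro n x
    rw [moll_apply]
    calc |∫ t, (mollBump n).normed volume t * s (x - t)|
        ≤ ∫ t, (mollBump n).normed volume t := by
          rw [← Real.norm_eq_abs]
          refine norm_integral_le_of_norm_le (mollBump n).integrable_normed
            (.of_forall fun t => ?_)
          rw [norm_mul, Real.norm_of_nonneg ((mollBump n).nonneg_normed t)]
          exact mul_le_of_le_one_right ((mollBump n).nonneg_normed t) (hs1 _)
      _ = 1 := (mollBump n).integral_normed
  set K' := Metric.cthickening δ K with hK'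
  have hK'c : IsCompact K' := hK.cthickening
  have hout : ∀ᶠ n in atTop, ∀ x ∉ K', moll n s x = 0 := by
    filter_upwards [tendsto_mollBump_rOut.eventually_lt_const hδ] with n hn x hx
    have : s x = 0 := by
      refine indicator_of_notMem (fun h => hx (Metric.self_subset_cthickening K h)) _
    rw [← this]
    refine ContDiffBump.normed_convolution_eq_right (φ := mollBump n) fun t ht => ?_
    rw [this]
    refine indicator_of_notMem (fun h => hx ?_) _
    refine Metric.mem_cthickening_of_dist_le x t δ K h ?_
    rw [dist_comm]; exact ((Metric.mem_ball.1 ht).trans hn).le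
  have htest : ∀ᶠ n in atTop, IsTest U (moll n s) := by
    filter_upwards [hout] with n hn
    have hc : tsupport (moll n s) ⊆ K' := by
      refine closure_minimal (fun x hx => ?_) hK'c.isClosed
      by_contra h'; exact hx (hn x h')
    exact ⟨contDiff_moll n hsl, hK'c.of_isClosed_subset (isClosed_tsupport _) hc, hc.trans hδU⟩
  have hfK' : Integrable (K'.indicator f) volume := by
    rw [integrable_indicator_iff hK'c.measurableSet]
    exact hf.integrableOn_isCompact hK'c
  have hlim : Tendsto (fun n => ∫ x, f x * moll n s x) atTop (𝓝 (∫ x, f x * s x)) := by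
    refine tendsto_integral_filter_of_dominated_convergence (fun x => |K'.indicator f x|) ?_ ?_
      hfK'.abs ?_
    · exact .of_forall fun n => hf.aestronglyMeasurable.mul
        (contDiff_moll n hsl).continuous.aestronglyMeasurable
    · filter_upwards [hout] with n hn
      refine .of_forall fun x => ?_
      by_cases hx : x ∈ K'
      · rw [indicator_of_mem hx, norm_mul]
        exact mul_le_of_le_one_right (abs_nonneg _) (hmb n x)
      · rw [hn x hx]; simp
    · filter_upwards [ae_tendsto_moll hsl] with x hx
      exact hx.const_mul _
  have hle : |∫ x, f x * s x| ≤ C := by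
    refine le_of_tendsto hlim.abs ?_
    filter_upwards [htest] with n hn
    exact h _ hn (hmb n)
  refine le_trans (le_of_eq ?_) ((le_abs_self _).trans hle)
  rw [← integral_indicator hK.measurableSet]
  refine integral_congr_ae ?_
  filter_upwards [hff'] with x hx
  by_cases hxK : x ∈ K
  · simp only [hs, indicator_of_mem hxK, ← hx]
    grind
  · simp [hs, indicator_of_notMem hxK]

/-- Test functions whose translates of size less than `δ` stay in `U`. -/
theorem abs_convolution_sub_le (hg : LocallyIntegrable g volume)
    (hC : VarBound U C g) (hVU : ∀ x ∈ V, Metric.ball x δ ⊆ U) (hψ : IsTest V ψ)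
    (hψ1 : ∀ x, |ψ x| ≤ 1) {y : Plane} (hy : ‖y‖ < δ) :
    |convolution g (fun z => ψ (-z)) (lsmul ℝ ℝ) volume y
      - convolution g (fun z => ψ (-z)) (lsmul ℝ ℝ) volume 0| ≤ 2 * C * ‖y‖ := by
  set k : Plane → ℝ := fun z => ψ (-z)
  have hkc : HasCompactSupport k := hψ.2.1.comp_homeomorph (Homeomorph.neg Plane)
  have hk : ContDiff ℝ ∞ k := hψ.1.comp contDiff_neg
  have hd := fun z => hkc.hasFDerivAt_convolution_right (lsmul ℝ ℝ) hg (hk.of_le (by simp)) z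
  have key : ∀ z, ‖z‖ < δ → ∀ i,
      |((convolution g (fderiv ℝ k) ((lsmul ℝ ℝ : ℝ →L[ℝ] ℝ →L[ℝ] ℝ).precompR Plane) volume) z)
        (dir i)| ≤ C := by
    intro z hz i
    have h1 : ((convolution g (fderiv ℝ k) ((lsmul ℝ ℝ : ℝ →L[ℝ] ℝ →L[ℝ] ℝ).precompR Plane)
        volume) z) (dir i) = - ∫ t, g t * pd i (fun x => ψ (x - z)) t := by
      unfold convolution
      rw [ContinuousLinearMap.integral_apply, ← integral_neg]
      · congr 1; ext t
        have e2 := fderiv_comp_const_sub hψ.1 0 (z - t)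
        simp only [zero_sub, neg_sub] at e2
        rw [partialDeriv, fderiv_comp_sub, precompR_apply, e2]
        simp
      · exact (hkc.fderiv (𝕜 := ℝ)).convolutionExists_right _ hg
          (hk.continuous_fderiv (by simp)) z
    rw [h1, abs_neg]
    refine hC i _ ⟨hψ.1.comp (contDiff_id.sub contDiff_const), ?_, ?_⟩ fun x => hψ1 _
    · exact hψ.2.1.comp_homeomorph (Homeomorph.subRight z)
    · intro x hx
      refine hVU _ (hψ.2.2 (tsupport_comp_subset_preimage ψ (f := fun x : Plane => x - z)
        (by fun_prop) hx)) ?_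
      rw [Metric.mem_ball, dist_eq_norm]; simpa using hz
  have hbound : ∀ z ∈ Metric.ball (0 : Plane) δ,
      ‖(convolution g (fderiv ℝ k) ((lsmul ℝ ℝ : ℝ →L[ℝ] ℝ →L[ℝ] ℝ).precompR Plane) volume) z‖
        ≤ 2 * C := by
    intro z hz
    have hz' : ‖z‖ < δ := by simpa using hz
    have hC0 : 0 ≤ C := (abs_nonneg _).trans (key z hz' 0)
    refine ContinuousLinearMap.opNorm_le_bound _ (by positivity) fun v => ?_
    have hv : v = v.1 • dir 0 + v.2 • dir 1 := by
      ext <;> simp [dir]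
    set A := (convolution g (fderiv ℝ k) ((lsmul ℝ ℝ : ℝ →L[ℝ] ℝ →L[ℝ] ℝ).precompR Plane) volume) z
    have h0 := key z hz' 0
    have h1 := key z hz' 1
    calc ‖A v‖ = ‖v.1 * A (dir 0) + v.2 * A (dir 1)‖ := by
          conv_lhs => rw [hv]
          simp only [map_add, map_smul, smul_eq_mul]
      _ ≤ |v.1| * |A (dir 0)| + |v.2| * |A (dir 1)| := by
          rw [← abs_mul, ← abs_mul]; exact abs_add_le _ _
      _ ≤ ‖v‖ * C + ‖v‖ * C := by
          gcongr
          · exact norm_fst_le v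
          · exact norm_snd_le v
      _ = 2 * C * ‖v‖ := by ring
  have := (convex_ball (0 : Plane) δ).norm_image_sub_le_of_norm_hasFDerivWithin_le
    (fun z _ => (hd z).hasFDerivWithinAt) hbound (Metric.mem_ball_self
        ((norm_nonneg y).trans_lt hy))
    (by simpa using hy : y ∈ Metric.ball (0 : Plane) δ)
  simpa using this

/-- Mollification of a function of bounded variation moves it little in `L¹`. -/
theorem setIntegral_abs_sub_moll_le {K : Set Plane} (hδ : 0 < δ) (hg : LocallyIntegrable g volume)
    (hC : VarBound U C g) (hK : IsCompact K)
    (hKU : Metric.thickening (2 * δ) K ⊆ U) {n : ℕ} (hn : (mollBump n).rOut < δ) :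
    ∫ x in K, |g x - moll n g x| ≤ 2 * C * (mollBump n).rOut := by
  have hC0 : 0 ≤ C := by
    have := hC 0 0 ⟨contDiff_const, HasCompactSupport.zero, by simp [tsupport]⟩ (by simp)
    grind
  have hml := (contDiff_moll n hg).continuous.locallyIntegrable (μ := (volume : Measure Plane))
  refine setIntegral_abs_le_of_test (f := fun x => g x - moll n g x)
    (hg.sub hml) (U := Metric.thickening δ K) Metric.isOpen_thickening hK
    (Metric.self_subset_thickening hδ K) fun ψ hψ hψ1 => ?_
  set k : Plane → ℝ := fun z => ψ (-z)
  have hkc : HasCompactSupport k := hψ.2.1.comp_homeomorph (Homeomorph.neg Plane)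
  have hk : Continuous k := hψ.1.continuous.comp continuous_neg
  set F := convolution g k (lsmul ℝ ℝ) volume with hF
  set ρ := (mollBump n).normed (volume : Measure Plane)
  have hρc : HasCompactSupport ρ := (mollBump n).hasCompactSupport_normed
  have hρ : Continuous ρ := (mollBump n).continuous_normed
  have hFc : Continuous F := hkc.continuous_convolution_right (lsmul ℝ ℝ) hg hk
  have hgn : LocallyIntegrable (fun x => ‖g x‖) volume :=
    hg.mono hg.aestronglyMeasurable.norm (.of_forall fun x => by simp)
  have hVU : ∀ x ∈ Metric.thickening δ K, Metric.ball x δ ⊆ U := by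
    intro x hx z hz
    apply hKU
    rw [Metric.mem_thickening_iff] at hx ⊢
    obtain ⟨a, ha, hxa⟩ := hx
    exact ⟨a, ha, by linarith [dist_triangle z x a, Metric.mem_ball.1 hz]⟩
  have e0 : ∫ x, g x * ψ x = F 0 := by
    simp [hF, convolution, k]
  have e1 : ∫ x, moll n g x * ψ x = ∫ t, ρ t * F (-t) := by
    have h1 : convolution (moll n g) k (lsmul ℝ ℝ) volume 0 = ∫ x, moll n g x * ψ x := by
      simp [convolution, k]
    have h2 : convolution ρ F (lsmul ℝ ℝ) volume 0 = ∫ t, ρ t * F (-t) := by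
      simp [convolution]
    rw [← h1, ← h2]
    refine convolution_assoc (lsmul ℝ ℝ) (lsmul ℝ ℝ) (lsmul ℝ ℝ) (lsmul ℝ ℝ)
      (by intros; simp [mul_assoc]) hρ.aestronglyMeasurable hg.aestronglyMeasurable
      hk.aestronglyMeasurable ?_ ?_ ?_
    · exact .of_forall fun x =>
        hρc.convolutionExists_left (lsmul ℝ ℝ) hρ hg x
    · exact .of_forall fun x =>
        hkc.norm.convolutionExists_right (mul ℝ ℝ) hgn hk.norm x
    · refine hρc.norm.convolutionExists_left (mul ℝ ℝ) hρ.norm ?_ 0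
      exact (hkc.norm.continuous_convolution_right (mul ℝ ℝ) hgn
        hk.norm).locallyIntegrable
  have i1 : Integrable fun x => g x * ψ x := by
    have := hg.integrable_smul_right_of_hasCompactSupport hψ.1.continuous hψ.2.1
    simpa using this
  have i2 : Integrable fun x => moll n g x * ψ x := by
    have := hml.integrable_smul_right_of_hasCompactSupport hψ.1.continuous hψ.2.1
    simpa using this
  have i3 : Integrable fun t => ρ t * F (-t) :=
    (hρ.mul (hFc.comp continuous_neg)).integrable_of_hasCompactSupport hρc.mul_right
  have e2 : ∫ x, (g x - moll n g x) * ψ x = ∫ t, ρ t * (F 0 - F (-t)) := by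
    simp only [sub_mul, mul_sub]
    rw [integral_sub i1 i2, integral_sub ((mollBump n).integrable_normed.mul_const _) i3, e0, e1,
      integral_mul_const, (mollBump n).integral_normed, one_mul]
  rw [e2, ← Real.norm_eq_abs]
  calc ‖∫ t, ρ t * (F 0 - F (-t))‖ ≤ ∫ t, ρ t * (2 * C * (mollBump n).rOut) := by
        refine norm_integral_le_of_norm_le ((mollBump n).integrable_normed.mul_const _)
          (.of_forall fun t => ?_)
        rw [norm_mul, Real.norm_of_nonneg ((mollBump n).nonneg_normed t)]
        by_cases ht : t ∈ Metric.ball (0 : Plane) (mollBump n).rOut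
        · have ht' : ‖-t‖ < (mollBump n).rOut := by simpa using ht
          refine mul_le_mul_of_nonneg_left ?_ ((mollBump n).nonneg_normed t)
          have := abs_convolution_sub_le hg hC hVU hψ hψ1 (ht'.trans hn)
          rw [Real.norm_eq_abs, abs_sub_comm]
          exact this.trans (by gcongr)
        · have : ρ t = 0 := normed_eq_zero (by simpa using ht)
          change ρ t * _ ≤ ρ t * _
          simp [this]
    _ = 2 * C * (mollBump n).rOut := by
      rw [integral_mul_const, (mollBump n).integral_normed, one_mul]

theorem VarBound.of_weakLim {g : ℕ → Plane → ℝ} {g' : Plane → ℝ} (h : ∀ n, VarBound U C (g n))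
    (hg : WeakLim g g') : VarBound U C g' := by
  intro i φ hφ h1
  have := (hg _ (hφ.partialDeriv i).memLp (hφ.partialDeriv i).2.1).abs
  exact le_of_tendsto this (.of_forall fun n => h n i φ hφ h1)

theorem setIntegral_sq_le_of_nsq_le (hg : MemL2loc g) (h : nsq g R ≤ ofReal C)
    (hC : 0 ≤ C) : ∫ x in sq R, g x ^ 2 ≤ C := by
  rw [integral_eq_lintegral_of_nonneg_ae (.of_forall fun x => sq_nonneg _)
    (hg _ (isCompact_sq R)).integrable_sq.aestronglyMeasurable]
  exact ENNReal.toReal_le_of_le_ofReal hC h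

/-- A fixed mollification of a weakly convergent sequence converges in `L¹` of compact sets. -/
theorem tendsto_setIntegral_abs_moll_sub {g : ℕ → Plane → ℝ} {g' : Plane → ℝ} (hg : ∀ n, MemL2loc
    (g n)) (hg' : MemL2loc g') (hlim : WeakLim g g') {C : ℕ → ℝ}
    (hC : ∀ (R : ℕ) (n : ℕ), nsq (g n) R ≤ ofReal (C R)) {K : Set Plane} (hK : IsCompact K)
        (m : ℕ) :
    Tendsto (fun n => ∫ x in K, |moll m (g n) x - moll m g' x|) atTop (𝓝 0) := by
  obtain ⟨R, hR⟩ := exists_subset_sq (hK.cthickening (r := 1))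
  set ρ := (mollBump m).normed (volume : Measure Plane)
  have hρ : Continuous ρ := (mollBump m).continuous_normed
  obtain ⟨M, hM⟩ := hρ.bounded_above_of_compact_support (mollBump m).hasCompactSupport_normed
  have hM0 : 0 ≤ M := (norm_nonneg _).trans (hM 0)
  have hloc := fun n => (hg n).locallyIntegrable
  have hcont : ∀ n, Continuous (moll m (g n)) := fun n => (contDiff_moll m (hloc n)).continuous
  have hcont' : Continuous (moll m g') := (contDiff_moll m hg'.locallyIntegrable).continuous
  have hvol : volume (sq R) ≠ ⊤ := volume_sq_ne_top R
  have hfin : IsFiniteMeasure (volume.restrict K : Measure Plane) :=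
    ⟨by simpa using hK.measure_lt_top⟩
  have hfin' : IsFiniteMeasure (volume.restrict (sq R) : Measure Plane) :=
    ⟨by simpa using hvol.lt_top⟩
  have hbd : ∀ n, ∀ x ∈ K, |moll m (g n) x| ≤ M * (volume.real (sq R) + |C R|) := by
    intro n x hx
    have h1 : Integrable (fun t => g n t ^ 2) (volume.restrict (sq R)) :=
  (hg n _ (isCompact_sq R)).integrable_sq
    have h2 : IntegrableOn (fun t => M * (1 + g n t ^ 2)) (sq R) volume :=
      ((integrable_const 1).add h1).const_mul M
    calc |moll m (g n) x| ≤ ∫ t, (sq (R : ℝ)).indicator (fun t => M * (1 + g n t ^ 2)) t := by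
          rw [moll_apply', ← Real.norm_eq_abs]
          refine norm_integral_le_of_norm_le (h2.integrable_indicator (measurableSet_sq _))
            (.of_forall fun t => ?_)
          by_cases ht : t ∈ Metric.closedBall x 1
          · have : t ∈ sq (R : ℝ) := hR (Metric.mem_cthickening_of_dist_le t x 1 K hx
              (Metric.mem_closedBall.1 ht))
            rw [indicator_of_mem this, norm_mul]
            refine mul_le_mul (hM _) ?_ (norm_nonneg _) hM0
            rw [Real.norm_eq_abs]
            nlinarith [sq_abs (g n t), sq_nonneg (|g n t| - 1)]
          · have h0 : ρ (x - t) = 0 := normed_eq_zero <| (mollBump_rOut_le m).trans <| by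
              rw [Metric.mem_closedBall, dist_comm, dist_eq_norm, not_le] at ht; exact ht.le
            change ‖ρ (x - t) * g n t‖ ≤ _
            rw [h0, zero_mul, norm_zero]
            exact indicator_nonneg (fun t _ => by positivity) _
      _ = M * (volume.real (sq R) + ∫ t in sq R, g n t ^ 2) := by
          rw [integral_indicator (measurableSet_sq _), integral_const_mul,
            integral_add (integrable_const 1) h1]
          simp
      _ ≤ _ := by
          gcongr
          exact setIntegral_sq_le_of_nsq_le (hg n)
            ((hC R n).trans (ofReal_le_ofReal (le_abs_self _))) (abs_nonneg _)
  obtain ⟨B', hB'⟩ : ∃ B', ∀ x ∈ K, |moll m g' x| ≤ B' := by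
    obtain ⟨B, hB⟩ := (hK.image hcont').isBounded.exists_norm_le
    exact ⟨B, fun x hx => hB _ (mem_image_of_mem _ hx)⟩
  have h0 : (0 : ℝ) = ∫ x in K, (0 : ℝ) := by simp
  rw [h0]
  refine tendsto_integral_of_dominated_convergence
    (fun _ => M * (volume.real (sq R) + |C R|) + B') (fun n => ?_) (integrable_const _)
    (fun n => ?_) (.of_forall fun x => ?_)
  · fun_prop
  · filter_upwards [ae_restrict_mem hK.measurableSet] with x hx
    rw [Real.norm_eq_abs, abs_abs]
    grind
  · have htest : MemLp (fun t => ρ (x - t)) 2 volume ∧ HasCompactSupport fun t => ρ (x - t) := by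
      have hc : HasCompactSupport fun t => ρ (x - t) :=
        (mollBump m).hasCompactSupport_normed.comp_homeomorph (Homeomorph.subLeft x)
      exact ⟨(hρ.comp (continuous_const.sub continuous_id)).memLp_of_hasCompactSupport hc, hc⟩
    have h1 := hlim _ htest.1 htest.2
    have e : ∀ f : Plane → ℝ, ∫ t, f t * ρ (x - t) = moll m f x := fun f => by
      rw [moll_apply']; congr 1; ext t; rw [mul_comm]
    simp only [e] at h1
    have := (h1.sub_const (moll m g' x)).abs
    simpa using this

/-- Weak convergence together with a uniform bound on the variation implies strong convergence
in `L¹` of compact subsets. -/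
theorem tendsto_setIntegral_abs_sub {g : ℕ → Plane → ℝ} {g' : Plane → ℝ} (hg : ∀ n, MemL2loc (g n))
    (hg' : MemL2loc g') (hlim : WeakLim g g') {C : ℕ → ℝ}
    (hC : ∀ (R : ℕ) (n : ℕ), nsq (g n) R ≤ ofReal (C R)) {K : Set Plane} (hU : IsOpen U)
        (hK : IsCompact K) (hKU : K ⊆ U) {A : ℝ} (hA : ∀ n, VarBound U A (g n)) :
    Tendsto (fun n => ∫ x in K, |g n x - g' x|) atTop (𝓝 0) := by
  have hA' : VarBound U A g' := VarBound.of_weakLim hA hlim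
  obtain ⟨δ', hδ', hδU⟩ := hK.exists_thickening_subset_open hU hKU
  obtain ⟨δ, hδ, rfl⟩ : ∃ δ : ℝ, 0 < δ ∧ δ' = 2 * δ := ⟨δ' / 2, by positivity, by ring⟩
  rw [Metric.tendsto_atTop]
  intro η hη
  have h1 : Tendsto (fun m => 4 * A * (mollBump m).rOut) atTop (𝓝 0) := by
    simpa using tendsto_mollBump_rOut.const_mul (4 * A)
  obtain ⟨m, hm1, hm2⟩ := ((h1.eventually_lt_const (half_pos hη)).and
    (tendsto_mollBump_rOut.eventually_lt_const hδ)).exists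
  obtain ⟨N, hN⟩ := Metric.tendsto_atTop.1
    (tendsto_setIntegral_abs_moll_sub hg hg' hlim hC hK m) (η / 2) (half_pos hη)
  refine ⟨N, fun n hn => ?_⟩
  have hN' := hN n hn
  rw [Real.dist_eq, sub_zero, abs_of_nonneg (integral_nonneg fun x => abs_nonneg _)] at hN' ⊢
  have int : ∀ f : Plane → ℝ, LocallyIntegrable f volume → IntegrableOn f K volume := fun f hf =>
    hf.integrableOn_isCompact hK
  have hml : ∀ f : Plane → ℝ, LocallyIntegrable f volume → LocallyIntegrable (moll m f) volume :=
    fun f hf => (contDiff_moll m hf).continuous.locallyIntegrable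
  have l1 := (hg n).locallyIntegrable
  have l2 := hg'.locallyIntegrable
  have a1 : IntegrableOn (fun x => |g n x - moll m (g n) x|) K volume :=
    ((int _ l1).sub (int _ (hml _ l1))).abs
  have a2 : IntegrableOn (fun x => |moll m (g n) x - moll m g' x|) K volume :=
    ((int _ (hml _ l1)).sub (int _ (hml _ l2))).abs
  have a3 : IntegrableOn (fun x => |g' x - moll m g' x|) K volume :=
    ((int _ l2).sub (int _ (hml _ l2))).abs
  have b1 := setIntegral_abs_sub_moll_le hδ l1 (hA n) hK hδU hm2
  have b3 := setIntegral_abs_sub_moll_le hδ l2 hA' hK hδU hm2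
  calc ∫ x in K, |g n x - g' x|
      ≤ ∫ x in K, (|g n x - moll m (g n) x| + |moll m (g n) x - moll m g' x|
          + |g' x - moll m g' x|) := by
        refine integral_mono ((int _ l1).sub (int _ l2)).abs ((a1.add a2).add a3) fun x => ?_
        grind
    _ = (∫ x in K, |g n x - moll m (g n) x|) + (∫ x in K, |moll m (g n) x - moll m g' x|)
          + ∫ x in K, |g' x - moll m g' x| := by
        rw [← integral_add a1 a2]; exact integral_add (a1.add a2) a3
    _ < η := by linarith

theorem nucleus_isOpen (L : ℝ) : IsOpen (nucleus L) := isOpen_Ioo.prod isOpen_Ioo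

theorem nucleus_volume_ne_top (L : ℝ) : volume (nucleus L) ≠ ⊤ := by
  unfold nucleus
  rw [Measure.volume_eq_prod, Measure.prod_prod]
  simp [ENNReal.mul_ne_top]

/-- Convergence in `L¹` of the compact subsets of an open set of finite measure yields almost
everywhere convergence along a subsequence. -/
theorem exists_subseq_ae_tendsto {D : ℕ → Plane → ℝ} (hD0 : ∀ n x, 0 ≤ D n x)
    (hD : ∀ n, LocallyIntegrable (D n) volume) (hU : IsOpen U)
    (hUm : volume U ≠ ⊤)
    (h : ∀ K ⊆ U, IsCompact K → Tendsto (fun n => ∫ x in K, D n x) atTop (𝓝 0)) :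
    ∃ φ : ℕ → ℕ, StrictMono φ ∧
      ∀ᵐ x ∂(volume.restrict U), Tendsto (fun n => D (φ n) x) atTop (𝓝 0) := by
  have hm : TendstoInMeasure (volume.restrict U) D atTop (fun _ => (0 : ℝ)) := by
    refine tendstoInMeasure_of_ne_top fun ε hε hε' => ?_
    rw [ENNReal.tendsto_nhds_zero]
    intro η hη
    obtain ⟨K, hKU, hK, hKη⟩ := hU.measurableSet.exists_isCompact_sdiff_lt hUm
      (ε := η / 2) (ENNReal.half_pos hη.ne').ne'
    have h1 : Tendsto (fun n => ε⁻¹ * ofReal (∫ x in K, D n x)) atTop (𝓝 0) := by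
      have := ENNReal.Tendsto.const_mul (a := ε⁻¹) (ENNReal.tendsto_ofReal (h K hKU hK))
        (Or.inr (by simp [hε.ne']))
      simpa using this
    filter_upwards [(ENNReal.tendsto_nhds_zero.1 h1) (η / 2) (ENNReal.half_pos hη.ne')] with n hn
    have h2 : (volume.restrict K) {x | ε ≤ edist (D n x) 0} ≤ η / 2 := by
      refine le_trans ?_ hn
      have e1 : ∀ x, edist (D n x) 0 = ofReal (D n x) := fun x => by
        rw [edist_zero_right, Real.enorm_eq_ofReal (hD0 n x)]
      have h3 := mul_meas_ge_le_lintegral₀ (μ := volume.restrict K)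
        (hD n).aestronglyMeasurable.restrict.aemeasurable.ennreal_ofReal ε
      rw [← ofReal_integral_eq_lintegral_ofReal ((hD n).integrableOn_isCompact hK)
        (Eventually.of_forall (hD0 n))] at h3
      simp only [e1]
      rw [← ENNReal.div_eq_inv_mul, ENNReal.le_div_iff_mul_le (Or.inl hε.ne') (Or.inl hε'),
          mul_comm]
      exact h3
    have h4 : volume.restrict U ≤ volume.restrict K + (volume.restrict
        (U \ K) : Measure Plane) := by
      have := Measure.restrict_union_le (μ := (volume : Measure Plane)) K (U \ K)
      rwa [union_sdiff_cancel hKU] at this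
    calc (volume.restrict U) {x | ε ≤ edist (D n x) 0}
        ≤ (volume.restrict K + volume.restrict (U \ K)) {x | ε ≤ edist (D n x) 0} := h4 _
      _ ≤ η / 2 + η / 2 := by
          rw [Measure.add_apply]
          gcongr
          refine (measure_mono (subset_univ _)).trans ?_
          rw [Measure.restrict_apply_univ]; exact hKη.le
      _ = η := ENNReal.add_halves η
  exact hm.exists_seq_tendsto_ae

/-! ### Compactness of fields and lower semicontinuity -/

theorem setIntegral_mul_partialDeriv (hφ : IsTest U φ)
    (g : Plane → ℝ) (i : Fin 2) :
    ∫ x in U, g x * pd i φ x = ∫ x, g x * pd i φ x := by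
  refine setIntegral_eq_integral_of_forall_compl_eq_zero fun x hx => ?_
  have : pd i φ x = 0 :=
    image_eq_zero_of_notMem_tsupport fun h => hx ((hφ.partialDeriv i).2.2 h)
  rw [this, mul_zero]

theorem IsTest.neg (h : IsTest U φ) :
    IsTest U fun x => -φ x := by
  refine ⟨h.1.neg, h.2.1.comp_left (g := fun y : ℝ => -y) (by simp), ?_⟩
  have : tsupport (fun x => -φ x) = tsupport φ := by
    unfold tsupport; congr 1; ext x; simp
  rw [this]; exact h.2.2

theorem partialDeriv_neg (φ : Plane → ℝ) (i : Fin 2) (x : Plane) :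
    pd i (fun y => -φ y) x = -pd i φ x := by
  simp [partialDeriv, fderiv_fun_neg]

theorem isTest_zero (U : Set Plane) : IsTest U fun _ => 0 :=
  ⟨contDiff_const, HasCompactSupport.zero, by simp [tsupport]⟩

theorem partialDeriv_zero (i : Fin 2) (x : Plane) : pd i (fun _ => 0) x = 0 := by
  simp [partialDeriv]

/-- The total variation of the second derivative bounds that of each partial derivative. -/
theorem varBound_of_hessVar_le {u : Field} (hM : 0 ≤ M)
    (h : hessVar u U ≤ ofReal M) (k j : Fin 2) :
    VarBound U M (weakPartial j fun y => u y k) := by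
  have key : ∀ (i : Fin 2) (φ : Plane → ℝ), IsTest U φ → (∀ x, |φ x| ≤ 1) →
      ∫ x, weakPartial j (fun y => u y k) x * pd i φ x ≤ M := by
    intro i φ hφ h1
    set Φ : Fin 2 → Fin 2 → Fin 2 → Plane → ℝ := fun a b c =>
      if a = i ∧ b = j ∧ c = k then φ else fun _ => 0 with hΦ
    have hΦt : IsTestTensor U Φ := by
      refine ⟨fun a b c => ?_, fun x => ?_⟩
      · simp only [hΦ]; split_ifs
        exacts [hφ, isTest_zero U]
      · have : φ x ^ 2 ≤ 1 := by rw [← sq_abs]; exact pow_le_one₀ (abs_nonneg _) (h1 x)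
        fin_cases i <;> fin_cases j <;> fin_cases k <;> simpa [hΦ, Fin.sum_univ_two] using this
    have h2 : ofReal (∑ a, ∑ b, ∑ c,
        ∫ x in U, weakPartial b (fun y => u y c) x * partialDeriv a (Φ a b c) x)
          ≤ ofReal M := (le_iSup₂_of_le Φ hΦt le_rfl).trans h
    have h3 : (∑ a, ∑ b, ∑ c,
        ∫ x in U, weakPartial b (fun y => u y c) x * partialDeriv a (Φ a b c) x)
          = ∫ x in U, weakPartial j (fun y => u y k) x * pd i φ x := by
      fin_cases i <;> fin_cases j <;> fin_cases k <;>
        simp [hΦ, Fin.sum_univ_two, partialDeriv_zero]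
    rw [h3, ENNReal.ofReal_le_ofReal_iff hM, setIntegral_mul_partialDeriv hφ] at h2
    exact h2
  intro i φ hφ h1
  rw [abs_le]
  refine ⟨?_, key i φ hφ h1⟩
  have := key i _ hφ.neg (fun x => by rw [abs_neg]; exact h1 x)
  simp only [partialDeriv_neg, mul_neg, integral_neg] at this
  linarith

/-- A common subsequence for finitely many sequences bounded in `L²_loc`. -/
theorem exists_weakLim_family {ι : Type*} [Finite ι] {f : ι → ℕ → Plane → ℝ}
    (hf : ∀ i n, MemL2loc (f i n)) {C : ℕ → ℝ}
    (hC : ∀ i, ∀ (R : ℕ) (n : ℕ), nsq (f i n) R ≤ ofReal (C R)) :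
    ∃ φ : ℕ → ℕ, StrictMono φ ∧ ∃ g : ι → Plane → ℝ, ∀ i, MemL2loc (g i) ∧
      WeakLim (fun n => f i (φ n)) (g i) := by
  classical
  have := Fintype.ofFinite ι
  have hC' : ∀ i, ∀ (R : ℕ) (n : ℕ), eLpNorm (f i n) 2 (volume.restrict (sq R))
      ≤ ofReal (Real.sqrt (C R)) := by
    intro i R n
    rw [← ENNReal.pow_le_pow_left_iff two_ne_zero, eLpNorm_two_sq,
      ← ofReal_pow (Real.sqrt_nonneg _)]
    refine (hC i R n).trans (ofReal_le_ofReal ?_)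
    grind
  have key : ∀ s : Finset ι, ∃ φ : ℕ → ℕ, StrictMono φ ∧ ∀ i ∈ s, ∃ g, MemL2loc g ∧
      WeakLim (fun n => f i (φ n)) g := by
    intro s
    induction s using Finset.induction_on with
    | empty => exact ⟨id, strictMono_id, by simp⟩
    | insert a s ha ih =>
      obtain ⟨φ, hφ, h⟩ := ih
      obtain ⟨ψ, hψ, g, hg, hgl⟩ := exists_weakLim (f := fun n => f a (φ n))
        (fun n => hf a _) (C := fun R => Real.sqrt (C R)) fun R n => hC' a R _
      refine ⟨φ ∘ ψ, hφ.comp hψ, fun i hi => ?_⟩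
      rcases Finset.mem_insert.1 hi with rfl | hi
      · exact ⟨g, hg, hgl⟩
      · obtain ⟨g', hg', hl⟩ := h i hi
        exact ⟨g', hg', hl.comp hψ⟩
  obtain ⟨φ, hφ, h⟩ := key Finset.univ
  choose g hg using fun i => h i (Finset.mem_univ i)
  exact ⟨φ, hφ, g, hg⟩

theorem WeakLim.congr_right {f : ℕ → Plane → ℝ} {g' : Plane → ℝ} (h : WeakLim f g)
    (hg : g =ᵐ[volume] g') : WeakLim f g' := by
  intro ψ h1 h2
  have e : ∫ x, g' x * ψ x = ∫ x, g x * ψ x := by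
    refine integral_congr_ae ?_
    filter_upwards [hg] with x hx
    rw [hx]
  rw [e]; exact h ψ h1 h2

/-- The mode of convergence of minimizing sequences: the gradients converge weakly in `L²_loc` of
the plane and almost everywhere in `U`. -/
structure GradConv (U : Set Plane) (u : ℕ → Field) (u' : Field) : Prop where
  weak : ∀ k j, WeakLim (fun n => weakPartial j fun y => u n y k) (weakPartial j fun y => u' y k)
  ae : ∀ᵐ x ∂(volume.restrict U), ∀ k j,
    Tendsto (fun n => weakPartial j (fun y => u n y k) x) atTop
      (𝓝 (weakPartial j (fun y => u' y k) x))

/-- Compactness of fields that are bounded in `W^{1,2}_loc` with bounded second variation in `U`. -/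
theorem exists_gradConv (hU : IsOpen U) (hUm : volume U ≠ ⊤) {u : ℕ → Field}
    (hu : ∀ n, FieldMemW12loc (u n)) (hM : 0 ≤ M)
    (hvar : ∀ n, hessVar (u n) U ≤ ofReal M) {C : ℕ → ℝ}
    (h0 : ∀ k, ∀ (R : ℕ) (n : ℕ), nsq (fun x => u n x k) R ≤ ofReal (C R))
    (h1 : ∀ k j, ∀ (R : ℕ) (n : ℕ), nsq (weakPartial j fun x => u n x k) R ≤ ofReal (C R)) :
    ∃ φ : ℕ → ℕ, StrictMono φ ∧ ∃ u' : Field, FieldMemW12loc u' ∧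
      (∀ k, WeakLim (fun n x => u (φ n) x k) fun x => u' x k) ∧
      GradConv U (fun n => u (φ n)) u' := by
  set f : Fin 2 × Option (Fin 2) → ℕ → Plane → ℝ := fun p n =>
    p.2.elim (fun x => u n x p.1) fun j => weakPartial j fun x => u n x p.1 with hf
  have hfm : ∀ p n, MemL2loc (f p n) := by
    rintro ⟨k, _ | j⟩ n
    · exact (hu n k).1
    · exact (isWeakPartial_weakPartial (hu n k) j).1
  have hfC : ∀ p, ∀ (R : ℕ) (n : ℕ), nsq (f p n) R ≤ ofReal (C R) := by
    rintro ⟨k, _ | j⟩ R n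
    · exact h0 k R n
    · exact h1 k j R n
  obtain ⟨φ, hφ, g, hg⟩ := exists_weakLim_family hfm hfC
  set u' : Field := fun x k => g (k, none) x with hu'
  have hpart : ∀ k j, IsWeakPartial j (fun x => u' x k) (g (k, some j)) := fun k j =>
    IsWeakPartial.of_weakLim (fun n => isWeakPartial_weakPartial (hu (φ n) k) j)
      (hg (k, none)).2 (hg (k, some j)).2 (hg (k, some j)).1
  have hu'm : FieldMemW12loc u' := fun k => ⟨(hg (k, none)).1, fun j => ⟨_, hpart k j⟩⟩
  have hwk : ∀ k j, WeakLim (fun n => weakPartial j fun y => u (φ n) y k)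
      (weakPartial j fun y => u' y k) := fun k j =>
    WeakLim.congr_right (hg (k, some j)).2
      ((hpart k j).ae_eq (isWeakPartial_weakPartial (hu'm k) j))
  have hml : ∀ k j n, MemL2loc (weakPartial j fun y => u (φ n) y k) := fun k j n =>
    (isWeakPartial_weakPartial (hu (φ n) k) j).1
  have hml' : ∀ k j, MemL2loc (weakPartial j fun y => u' y k) := fun k j =>
    (isWeakPartial_weakPartial (hu'm k) j).1
  set d : Fin 2 → Fin 2 → ℕ → Plane → ℝ := fun k j n x =>
    |weakPartial j (fun y => u (φ n) y k) x - weakPartial j (fun y => u' y k) x| with hd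
  have hdl : ∀ k j n, LocallyIntegrable (d k j n) volume := fun k j n => by
    have := (hml k j n).locallyIntegrable.sub (hml' k j).locallyIntegrable
    exact this.mono this.aestronglyMeasurable.norm (Eventually.of_forall fun x => by simp [hd])
  have hlim : ∀ k j, ∀ K ⊆ U, IsCompact K →
      Tendsto (fun n => ∫ x in K, d k j n x) atTop (𝓝 0) := fun k j K hKU hK =>
    tendsto_setIntegral_abs_sub (hml k j) (hml' k j) (hwk k j)
      (fun R n => h1 k j R (φ n)) hU hK hKU fun n => varBound_of_hessVar_le hM (hvar (φ n)) k j
  obtain ⟨ψ, hψ, hae⟩ := exists_subseq_ae_tendsto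
    (D := fun n x => ∑ p : Fin 2 × Fin 2, d p.1 p.2 n x)
    (fun n x => Finset.sum_nonneg fun p _ => abs_nonneg _)
    (fun n => locallyIntegrable_finsetSum _ fun p _ => hdl p.1 p.2 n) hU hUm fun K hKU hK => by
      simp only [integral_finsetSum _ fun (p : Fin 2 × Fin 2) _ =>
        (hdl p.1 p.2 _).integrableOn_isCompact hK]
      simpa using tendsto_finsetSum Finset.univ fun (p : Fin 2 × Fin 2) _ => hlim p.1 p.2 K hKU hK
  refine ⟨φ ∘ ψ, hφ.comp hψ, u', hu'm, fun k => (hg (k, none)).2.comp hψ,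
    fun k j => (hwk k j).comp hψ, ?_⟩
  filter_upwards [hae] with x hx k j
  rw [tendsto_iff_dist_tendsto_zero]
  refine squeeze_zero (fun n => dist_nonneg) (fun n => ?_) hx
  change d k j (ψ n) x ≤ _
  exact Finset.single_le_sum (f := fun p : Fin 2 × Fin 2 => d p.1 p.2 (ψ n) x)
    (fun p _ => abs_nonneg _) (Finset.mem_univ (k, j))

theorem hessVar_le_liminf {u : ℕ → Field} {u' : Field} (h : GradConv U u u') :
    hessVar u' U ≤ liminf (fun n => hessVar (u n) U) atTop := by
  refine iSup₂_le fun φ hφ => ?_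
  have h1 : Tendsto (fun n => ofReal (∑ i, ∑ j, ∑ k,
      ∫ x in U, weakPartial j (fun y => u n y k) x * pd i (φ i j k) x)) atTop
      (𝓝 (ofReal (∑ i, ∑ j, ∑ k,
        ∫ x in U, weakPartial j (fun y => u' y k) x * pd i (φ i j k) x))) := by
    refine ENNReal.tendsto_ofReal (tendsto_finsetSum _ fun i _ => tendsto_finsetSum _ fun j _ =>
      tendsto_finsetSum _ fun k _ => ?_)
    simp only [setIntegral_mul_partialDeriv (hφ.1 i j k)]
    exact h.weak k j _ ((hφ.1 i j k).partialDeriv i).memLp ((hφ.1 i j k).partialDeriv i).2.1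
  rw [← h1.liminf_eq]
  refine liminf_le_liminf (.of_forall fun n => ?_)
  exact le_iSup₂_of_le φ hφ le_rfl

theorem WeakLim.const_mul {f : ℕ → Plane → ℝ} (h : WeakLim f g) (c : ℝ) :
    WeakLim (fun n x => c * f n x) fun x => c * g x := by
  intro ψ h1 h2
  simp only [mul_assoc, integral_const_mul]
  exact (h ψ h1 h2).const_mul c

theorem integrable_mul_test (hf : MemL2loc f) (h1 : MemLp ψ 2 volume)
    (h2 : HasCompactSupport ψ) : Integrable fun x => f x * ψ x := by
  have := (hf _ h2.isCompact).integrable_mul (h1.restrict (tsupport ψ))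
  have h3 : IntegrableOn (fun x => f x * ψ x) (tsupport ψ) volume := this
  rwa [integrableOn_iff_integrable_of_support_subset] at h3
  intro x hx
  by_contra h
  exact hx (by simp [image_eq_zero_of_notMem_tsupport h])

theorem WeakLim.add {f f' : ℕ → Plane → ℝ} {g' : Plane → ℝ} (h : WeakLim f g)
    (h' : WeakLim f' g') (hf : ∀ n, MemL2loc (f n)) (hf' : ∀ n, MemL2loc (f' n))
    (hg : MemL2loc g) (hg' : MemL2loc g') :
    WeakLim (fun n x => f n x + f' n x) fun x => g x + g' x := by
  intro ψ h1 h2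
  simp only [add_mul]
  rw [integral_add (integrable_mul_test hg h1 h2) (integrable_mul_test hg' h1 h2)]
  refine ((h ψ h1 h2).add (h' ψ h1 h2)).congr fun n => ?_
  rw [integral_add (integrable_mul_test (hf n) h1 h2) (integrable_mul_test (hf' n) h1 h2)]

/-- Weak lower semicontinuity of the squared `L²` norm. -/
theorem WeakLim.lintegral_sq_le_liminf {f : ℕ → Plane → ℝ} (h : WeakLim f g)
    (hf : ∀ n, MemL2loc (f n)) (hg : MemL2loc g) {S : Set Plane} (hS : MeasurableSet S) :
    ∫⁻ x in S, ofReal (g x ^ 2)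
      ≤ liminf (fun n => ∫⁻ x in S, ofReal (f n x ^ 2)) atTop := by
  -- it suffices to integrate over bounded sets
  have hbd : ∀ R : ℕ, ∫⁻ x in S ∩ sq R, ofReal (g x ^ 2)
      ≤ liminf (fun n => ∫⁻ x in S, ofReal (f n x ^ 2)) atTop := by
    intro R
    set B := S ∩ sq (R : ℝ)
    have hB : MeasurableSet B := hS.inter (measurableSet_sq _)
    have hBs : volume.restrict B ≤ volume.restrict (sq (R : ℝ)) :=
      Measure.restrict_mono inter_subset_right le_rfl
    have hgB : MemLp g 2 (volume.restrict B) := (hg _ (isCompact_sq R)).mono_measure hBs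
    have hfB : ∀ n, MemLp (f n) 2 (volume.restrict B) := fun n =>
      (hf n _ (isCompact_sq R)).mono_measure hBs
    set ψ := B.indicator g
    have hψ : MemLp ψ 2 volume := (memLp_indicator_iff_restrict hB).2 hgB
    have hψc : HasCompactSupport ψ := by
      refine HasCompactSupport.of_support_subset_isCompact (isCompact_sq R) fun x hx => ?_
      by_contra h'
      exact hx (indicator_of_notMem (fun h'' => h' h''.2) _)
    have e : ∀ k : Plane → ℝ, ∫ x, k x * ψ x = ∫ x in B, k x * g x := by
      intro k
      rw [← integral_indicator hB]
      congr 1; ext x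
      by_cases hx : x ∈ B <;> simp [ψ, hx]
    have h1 := h ψ hψ hψc
    simp only [e] at h1
    have h2 : Tendsto (fun n => ofReal (2 * (∫ x in B, f n x * g x)
        - ∫ x in B, g x * g x)) atTop
        (𝓝 (ofReal (2 * (∫ x in B, g x * g x) - ∫ x in B, g x * g x))) :=
      ENNReal.tendsto_ofReal ((h1.const_mul 2).sub_const _)
    have e2 : ∫⁻ x in B, ofReal (g x ^ 2)
        = ofReal (2 * (∫ x in B, g x * g x) - ∫ x in B, g x * g x) := by
      rw [← ofReal_integral_eq_lintegral_ofReal hgB.integrable_sq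
        (.of_forall fun x => sq_nonneg _)]
      grind
    rw [e2, ← h2.liminf_eq]
    refine liminf_le_liminf (.of_forall fun n => ?_)
    refine le_trans ?_ (lintegral_mono_set inter_subset_left : ∫⁻ x in B, _ ≤ _)
    rw [← ofReal_integral_eq_lintegral_ofReal (hfB n).integrable_sq
      (.of_forall fun x => sq_nonneg _)]
    apply ofReal_le_ofReal
    have i1 : Integrable (fun x => f n x * g x) (volume.restrict B) := (hfB n).integrable_mul hgB
    have i2 : Integrable (fun x => g x * g x) (volume.restrict B) := hgB.integrable_mul hgB
    rw [← integral_const_mul, ← integral_sub (i1.const_mul 2) i2]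
    refine integral_mono ((i1.const_mul 2).sub i2) (hfB n).integrable_sq fun x => ?_
    simp only
    nlinarith [sq_nonneg (f n x - g x)]
  have hU : S = ⋃ R : ℕ, S ∩ sq (R : ℝ) := by
    rw [← inter_iUnion, eq_comm, inter_eq_left]
    intro x _
    obtain ⟨R, hR⟩ := exists_nat_ge ‖x‖
    exact mem_iUnion.2 ⟨R, by simpa [sq] using hR⟩
  conv_lhs => rw [hU]
  have hm : Monotone fun R : ℕ => S ∩ sq (R : ℝ) := fun R R' hR =>
    inter_subset_inter_right _ (Metric.closedBall_subset_closedBall (by exact_mod_cast hR))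
  rw [setLIntegral_iUnion_of_directed _ hm.directed_le]
  exact iSup_le hbd

/-! ### Weak derivatives of locally Lipschitz functions -/

/-- A locally Lipschitz function coincides with a Lipschitz function near a given square. -/
theorem exists_lipschitz_eqOn (hf : LocallyLipschitz f) (R : ℝ) :
    ∃ (C : NNReal) (g : Plane → ℝ), LipschitzWith C g ∧ EqOn f g (sq (R + 1)) := by
  obtain ⟨C, hC⟩ := LocallyLipschitzOn.exists_lipschitzOnWith_of_compact (isCompact_sq (R + 1))
    (hf.locallyLipschitzOn (s := sq (R + 1)))
  obtain ⟨g, hg, h⟩ := hC.extend_real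
  exact ⟨C, g, hg, h⟩

theorem lineDeriv_eqOn_sq (h : EqOn f g (sq (R + 1))) (hx : x ∈ sq R)
    (v : Plane) : lineDeriv ℝ f x v = lineDeriv ℝ g x v := by
  apply Filter.EventuallyEq.lineDeriv_eq
  have : Metric.ball (0 : Plane) (R + 1) ∈ 𝓝 x := by
    refine Metric.isOpen_ball.mem_nhds ?_
    simp only [sq, Metric.mem_closedBall, Metric.mem_ball] at hx ⊢
    linarith
  filter_upwards [this] with y hy
  exact h (Metric.ball_subset_closedBall hy)

/-- The classical partial derivative of a locally Lipschitz function. -/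
def lpart (i : Fin 2) (f : Plane → ℝ) (x : Plane) : ℝ := lineDeriv ℝ f x (dir i)

/-- For locally Lipschitz functions, the classical partial derivatives, which exist almost
everywhere, are the weak ones. -/
theorem isWeakPartial_lpart (hf : LocallyLipschitz f) (i : Fin 2) :
    IsWeakPartial i f (lpart i f) := by
  constructor
  · refine memL2loc_of_sq fun R => ?_
    obtain ⟨C, g, hg, h⟩ := exists_lipschitz_eqOn hf R
    have h1 : MemLp (fun x => lineDeriv ℝ g x (dir i)) ∞ (volume.restrict (sq (R : ℝ))) :=
  (hg.memLp_lineDeriv (dir i)).restrict _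
    have hfin : IsFiniteMeasure (volume.restrict (sq (R : ℝ)) : Measure Plane) :=
      ⟨by simpa using (volume_sq_ne_top R).lt_top⟩
    refine (h1.mono_exponent le_top).ae_eq ?_
    filter_upwards [ae_restrict_mem (measurableSet_sq _)] with x hx
    exact (lineDeriv_eqOn_sq h hx _).symm
  · intro φ hφ
    obtain ⟨R, hR⟩ := exists_subset_sq hφ.2.1.isCompact
    obtain ⟨C, g, hg, h⟩ := exists_lipschitz_eqOn hf R
    obtain ⟨D, hD⟩ := (hφ.1.of_le (by simp) : ContDiff ℝ 1 φ).lipschitzWith_of_hasCompactSupport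
      hφ.2.1 (by simp)
    have h1 := hg.integral_lineDeriv_mul_eq (μ := volume) hD hφ.2.1 (dir i)
    have e1 : ∫ x, lineDeriv ℝ g x (dir i) * φ x = ∫ x, lpart i f x * φ x := by
      congr 1; ext x
      by_cases hx : x ∈ tsupport φ
      · unfold lpart; rw [lineDeriv_eqOn_sq h (hR hx)]
      · simp [image_eq_zero_of_notMem_tsupport hx]
    have e2 : ∫ x, lineDeriv ℝ φ x (-dir i) * g x = - ∫ x, f x * pd i φ x := by
      rw [← integral_neg]
      congr 1; ext x
      have h3 : lineDeriv ℝ φ x (-dir i) = -pd i φ x := by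
        rw [lineDeriv_neg]
        unfold partialDeriv
        rw [DifferentiableAt.lineDeriv_eq_fderiv (hφ.1.differentiable (by simp) x)]
      rw [h3]
      by_cases hx : x ∈ tsupport φ
      · rw [h (Metric.closedBall_subset_closedBall (by linarith) (hR hx))]; ring
      · have : pd i φ x = 0 := image_eq_zero_of_notMem_tsupport fun h' =>
          hx ((IsTest.partialDeriv (U := tsupport φ) ⟨hφ.1, hφ.2.1, Subset.rfl⟩ i).2.2 h')
        rw [this]; simp
    grind

theorem memW12loc_of_locallyLipschitz (hf : LocallyLipschitz f) : MemW12loc f :=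
  ⟨memL2loc_of_continuous hf.continuous, fun i => ⟨_, isWeakPartial_lpart hf i⟩⟩

theorem weakPartial_ae_eq_lpart (hf : LocallyLipschitz f) (i : Fin 2) :
    weakPartial i f =ᵐ[volume] lpart i f :=
  (isWeakPartial_weakPartial (memW12loc_of_locallyLipschitz hf) i).ae_eq (isWeakPartial_lpart hf i)

theorem locallyLipschitz_affine (a b c : ℝ) :
    LocallyLipschitz fun x : Plane => a + b * x.1 + c * x.2 :=
  ContDiff.locallyLipschitz (𝕂 := ℝ) (by fun_prop)

theorem lpart_affine (a b c : ℝ) (i : Fin 2) (x : Plane) :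
    lpart i (fun x : Plane => a + b * x.1 + c * x.2) x = ![b, c] i := by
  unfold lpart lineDeriv
  fin_cases i <;> simp [dir]

theorem MemL2loc.const (c : ℝ) : MemL2loc fun _ => c := memL2loc_of_continuous continuous_const

theorem IsWeakPartial.add {i : Fin 2} {u h : Plane → ℝ} (hu : MemL2loc u) (hv : MemL2loc v)
    (hg : IsWeakPartial i u g) (hh : IsWeakPartial i v h) :
    IsWeakPartial i (fun x => u x + v x) fun x => g x + h x := by
  refine ⟨hg.1.add hh.1, fun φ hφ => ?_⟩
  have hd := hφ.partialDeriv i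
  simp only [add_mul]
  rw [integral_add (integrable_mul_test hu hd.memLp hd.2.1)
    (integrable_mul_test hv hd.memLp hd.2.1), integral_add
        (integrable_mul_test hg.1 hφ.memLp hφ.2.1)
    (integrable_mul_test hh.1 hφ.memLp hφ.2.1), hg.2 φ hφ, hh.2 φ hφ]
  ring

theorem MemW12loc.add_affine {u : Plane → ℝ} (hu : MemW12loc u) (a b c : ℝ) :
    MemW12loc (fun x => u x + (a + b * x.1 + c * x.2)) ∧
      ∀ i, weakPartial i (fun x => u x + (a + b * x.1 + c * x.2))
        =ᵐ[volume] fun x => weakPartial i u x + ![b, c] i := by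
  have hl := locallyLipschitz_affine a b c
  have h : ∀ i, IsWeakPartial i (fun x => u x + (a + b * x.1 + c * x.2))
      (fun x => weakPartial i u x + ![b, c] i) := fun i => by
    have := IsWeakPartial.add hu.1 (memL2loc_of_continuous hl.continuous)
      (isWeakPartial_weakPartial hu i) (isWeakPartial_lpart hl i)
    simpa only [lpart_affine] using this
  have hm : MemW12loc (fun x => u x + (a + b * x.1 + c * x.2)) :=
    ⟨hu.1.add (memL2loc_of_continuous hl.continuous), fun i => ⟨_, h i⟩⟩
  exact ⟨hm, fun i => (isWeakPartial_weakPartial hm i).ae_eq (h i)⟩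

theorem integral_partialDeriv_eq_zero (h : IsTest U φ)
    (i : Fin 2) : ∫ x, pd i φ x = 0 := by
  have h1 := (isWeakPartial_lpart (locallyLipschitz_affine 1 0 0) i).2 φ (h.mono (subset_univ _))
  have h0 : ![(0 : ℝ), 0] i = 0 := by fin_cases i <;> rfl
  simp only [lpart_affine, h0] at h1
  simpa using h1

/-! ### The energies under almost everywhere changes and rigid motions -/

theorem matNorm_sq (a : Matrix (Fin 2) (Fin 2) ℝ) :
    matNorm a ^ 2 = a 0 0 ^ 2 + a 0 1 ^ 2 + a 1 0 ^ 2 + a 1 1 ^ 2 := by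
  have h : Matrix.trace (aᵀ * a) = a 0 0 ^ 2 + a 0 1 ^ 2 + a 1 0 ^ 2 + a 1 1 ^ 2 := by
    simp [Matrix.trace, Matrix.mul_apply, Fin.sum_univ_two]; ring
  unfold matNorm
  rw [Real.sq_sqrt (by rw [h]; positivity), h]

theorem matNorm_nonneg (a : Matrix (Fin 2) (Fin 2) ℝ) : 0 ≤ matNorm a := Real.sqrt_nonneg _

theorem matDist_wells_sq (a : Matrix (Fin 2) (Fin 2) ℝ) (θ : ℝ) :
    matDist a (wells θ) ^ 2
      = min (matNorm (a - θ • symE) ^ 2) (matNorm (a + (1 - θ) • symE) ^ 2) := by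
  have e1 : (1 / 2 : ℝ) • !![0, θ; θ, 0] = θ • symE := by
    ext i j; fin_cases i <;> fin_cases j <;> simp [symE] <;> ring
  have e2 : a - (1 / 2 : ℝ) • !![0, -1 + θ; -1 + θ, 0] = a + (1 - θ) • symE := by
    ext i j; fin_cases i <;> fin_cases j <;> simp [symE] <;> ring
  have h : matDist a (wells θ) = min (matNorm (a - θ • symE)) (matNorm (a + (1 - θ) • symE)) := by
    unfold matDist wells
    rw [image_pair, csInf_pair, e1, e2]
  rw [h]
  rcases le_total (matNorm (a - θ • symE)) (matNorm (a + (1 - θ) • symE)) with h | h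
  · rw [min_eq_left h, min_eq_left (pow_le_pow_left₀ (matNorm_nonneg _) h 2)]
  · rw [min_eq_right h, min_eq_right (pow_le_pow_left₀ (matNorm_nonneg _) h 2)]

/-- The symmetric part of a matrix. -/
def symPart (a : Matrix (Fin 2) (Fin 2) ℝ) : Matrix (Fin 2) (Fin 2) ℝ := (1 / 2 : ℝ) • (a + aᵀ)

theorem strain_eq (u : Field) (x : Plane) : strain u x = symPart (grad u x) := rfl

theorem matNorm_symPart_sq_le (a : Matrix (Fin 2) (Fin 2) ℝ) :
    matNorm (symPart a) ^ 2 ≤ matNorm a ^ 2 := by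
  rw [matNorm_sq, matNorm_sq]
  simp only [symPart, Matrix.smul_apply, Matrix.add_apply, Matrix.transpose_apply, smul_eq_mul]
  nlinarith [sq_nonneg (a 0 1 - a 1 0)]

/-- The scalar energy dominates the energy `J`. -/
theorem energyJ_le_energyI (μ ε θ L : ℝ) (u : Field) :
    energyJ μ ε θ L u ≤ energyI μ ε θ L u := by
  unfold energyJ energyI
  simp only [matDist_wells_sq]
  have h : ∀ x, ofReal (matNorm (strain u x) ^ 2) ≤ ofReal (matNorm (grad u x) ^ 2) :=
    fun x => ofReal_le_ofReal (matNorm_symPart_sq_le _)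
  gcongr ofReal μ * ?_ + _ + _
  exact lintegral_mono h

theorem matNorm_symPart_sq_le_matDist (a : Matrix (Fin 2) (Fin 2) ℝ) (h0 : 0 < θ)
    (h1 : θ ≤ 1 / 2) :
    matNorm (symPart a) ^ 2 ≤ 2 * matDist (symPart a) (wells θ) ^ 2 + 1 := by
  have key : ∀ b : Matrix (Fin 2) (Fin 2) ℝ, ∀ c : ℝ, |c| ≤ 1 →
      matNorm b ^ 2 ≤ 2 * matNorm (b - c • symE) ^ 2 + 1 := by
    intro b c hc
    have hc2 : c ^ 2 ≤ 1 := by rw [← sq_abs]; exact pow_le_one₀ (abs_nonneg _) hc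
    rw [matNorm_sq, matNorm_sq]
    simp [symE]
    nlinarith [sq_nonneg (b 0 1 - c), sq_nonneg (b 1 0 - c), sq_nonneg (b 0 0), sq_nonneg (b 1 1)]
  rw [matDist_wells_sq]
  rcases min_choice (matNorm (symPart a - θ • symE) ^ 2)
    (matNorm (symPart a + (1 - θ) • symE) ^ 2) with h | h
  · grind
  · rw [h]
    have := key (symPart a) (-(1 - θ)) (by rw [abs_neg, abs_of_pos (by linarith)]; linarith)
    rwa [neg_smul, sub_neg_eq_add] at this

theorem hessVar_congr {u w : Field} (h : ∀ k j, ∃ c : ℝ, (weakPartial j fun y => u y k)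
      =ᵐ[volume] fun x => weakPartial j (fun y => w y k) x + c)
    (hw : FieldMemW12loc w) : hessVar u U = hessVar w U := by
  unfold hessVar
  refine iSup_congr fun φ => iSup_congr fun hφ => ?_
  congr 1
  refine Finset.sum_congr rfl fun i _ => Finset.sum_congr rfl fun j _ =>
    Finset.sum_congr rfl fun k _ => ?_
  have ht := hφ.1 i j k
  rw [setIntegral_mul_partialDeriv ht, setIntegral_mul_partialDeriv ht]
  obtain ⟨c, hc⟩ := h k j
  have hd := ht.partialDeriv i
  have i1 := integrable_mul_test (isWeakPartial_weakPartial (hw k) j).1 hd.memLp hd.2.1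
  have i2 : Integrable (pd i (φ i j k)) volume :=
    hd.1.continuous.integrable_of_hasCompactSupport hd.2.1
  have z : ∫ x, pd i (φ i j k) x = 0 :=
    integral_partialDeriv_eq_zero ht i
  calc ∫ x, weakPartial j (fun y => u y k) x * pd i (φ i j k) x
      = ∫ x, (weakPartial j (fun y => w y k) x * pd i (φ i j k) x
          + c * pd i (φ i j k) x) := by
        refine integral_congr_ae ?_
        filter_upwards [hc] with x hx
        rw [hx]; ring
    _ = _ := by rw [integral_add i1 (i2.const_mul c), integral_const_mul, z]; ring

theorem energyJ_congr {u w : Field} (hs : strain u =ᵐ[volume] strain w) (hv : hessVar u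
    (nucleus L) = hessVar w (nucleus L)) (μ ε θ : ℝ) :
    energyJ μ ε θ L u = energyJ μ ε θ L w := by
  have h : ∀ (F : Matrix (Fin 2) (Fin 2) ℝ → ℝ≥0∞) (S : Set Plane),
      ∫⁻ x in S, F (strain u x) = ∫⁻ x in S, F (strain w x) := fun F S =>
    lintegral_congr_ae ((ae_restrict_of_ae hs).mono fun x hx => congrArg F hx)
  unfold energyJ
  rw [hv, h fun a => ofReal (matNorm a ^ 2),
    h fun a => ofReal (matDist a (wells θ) ^ 2)]

theorem energyI_congr {u w : Field} (hw : FieldMemW12loc w)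
    (h : ∀ k j, (weakPartial j fun y => u y k) =ᵐ[volume] weakPartial j fun y => w y k)
    (μ ε θ L : ℝ) : energyI μ ε θ L u = energyI μ ε θ L w := by
  have hg : grad u =ᵐ[volume] grad w := by
    filter_upwards [h 0 0, h 0 1, h 1 0, h 1 1] with x h1 h2 h3 h4
    ext k j
    fin_cases k <;> fin_cases j <;> simpa [grad]
  have hv : hessVar u (nucleus L) = hessVar w (nucleus L) :=
    hessVar_congr (fun k j => ⟨0, by simpa using h k j⟩) hw
  have h : ∀ (F : Matrix (Fin 2) (Fin 2) ℝ → ℝ≥0∞) (S : Set Plane),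
      ∫⁻ x in S, F (grad u x) = ∫⁻ x in S, F (grad w x) := fun F S =>
    lintegral_congr_ae ((ae_restrict_of_ae hg).mono fun x hx => congrArg F hx)
  unfold energyI
  simp only [strain_eq]
  rw [hv, h fun a => ofReal (matNorm a ^ 2),
    h fun a => ofReal (min (matNorm (symPart a - θ • symE) ^ 2)
      (matNorm (symPart a + (1 - θ) • symE) ^ 2))]

theorem mean_add_affine {u : Plane → ℝ} (hu : MemL2loc u) (a b c : ℝ) :
    mean (fun x => u x + (a + b * x.1 + c * x.2)) = mean u + a ∧
      rotMean (fun x => u x + (a + b * x.1 + c * x.2)) = rotMean u - b := by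
  have hint : ∀ w : Plane → ℝ, Continuous w →
      Integrable (fun x => u x * w x) (volume.restrict (sq 1)) := fun w hw =>
    (hu _ (isCompact_sq 1)).integrable_mul
      ((memL2loc_of_continuous hw) _ (isCompact_sq 1))
  have hwc : Continuous wt := by unfold wt; fun_prop
  have hwc' : Continuous wt' := by unfold wt'; fun_prop
  have c1 : Continuous fun x : Plane => wt x.1 * wt x.2 := by fun_prop
  have c2 : Continuous fun x : Plane => wt' x.1 * wt x.2 := by fun_prop
  have hc : ∀ w : Plane → ℝ, Continuous w → Integrable w (volume.restrict (sq 1)) := fun w hw =>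
    hw.continuousOn.integrableOn_compact (isCompact_sq 1)
  have i1 : ∫ t in (-1 : ℝ)..1, wt' t = 0 := by
    unfold wt'
    rw [intervalIntegral.integral_const_mul, integral_id]; norm_num
  have i2 : ∫ t in (-1 : ℝ)..1, t * wt' t = -1 := by
    have : ∀ t : ℝ, t * wt' t = -(3 / 2) * t ^ 2 := fun t => by unfold wt'; ring
    simp only [this]
    rw [intervalIntegral.integral_const_mul, integral_pow]; norm_num
  have ii : ∀ f : ℝ → ℝ, Continuous f → IntervalIntegrable f volume (-1) 1 := fun f hf =>
    hf.intervalIntegrable _ _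
  constructor
  · unfold mean
    simp only [add_mul (u _) _ (wt _ * wt _)]
    have e : ∫ x in sq 1, (a + b * x.1 + c * x.2) * (wt x.1 * wt x.2) = a := by
      rw [(integral_sq_eq (by fun_prop) zero_le_one).1]
      have : ∀ s : ℝ, ∫ t in (-1 : ℝ)..1, (a + b * t + c * s) * (wt t * wt s)
          = a * wt s + c * (s * wt s) := by
        intro s
        have e1 : ∀ t : ℝ, (a + b * t + c * s) * (wt t * wt s)
            = (a + c * s) * wt s * wt t + b * wt s * (t * wt t) := fun t => by ring
        simp only [e1]
        rw [intervalIntegral.integral_add (ii _ (by fun_prop)) (ii _ (by fun_prop)),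
          intervalIntegral.integral_const_mul, intervalIntegral.integral_const_mul, integral_wt,
          integral_mul_wt]
        ring
      simp only [this]
      rw [intervalIntegral.integral_add (ii _ (by fun_prop)) (ii _ (by fun_prop)),
        intervalIntegral.integral_const_mul, intervalIntegral.integral_const_mul, integral_wt,
        integral_mul_wt]
      ring
    rw [integral_add (hint _ c1) (hc _ (by fun_prop)), e]
  · unfold rotMean
    simp only [add_mul (u _) _ (wt' _ * wt _)]
    have e : ∫ x in sq 1, (a + b * x.1 + c * x.2) * (wt' x.1 * wt x.2) = -b := by
      rw [(integral_sq_eq (by fun_prop) zero_le_one).1]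
      have : ∀ s : ℝ, ∫ t in (-1 : ℝ)..1, (a + b * t + c * s) * (wt' t * wt s) = -b * wt s := by
        intro s
        have e1 : ∀ t : ℝ, (a + b * t + c * s) * (wt' t * wt s)
            = (a + c * s) * wt s * wt' t + b * wt s * (t * wt' t) := fun t => by ring
        simp only [e1]
        rw [intervalIntegral.integral_add (ii _ (by fun_prop)) (ii _ (by fun_prop)),
          intervalIntegral.integral_const_mul, intervalIntegral.integral_const_mul, i1, i2]
        ring
      simp only [this]
      rw [intervalIntegral.integral_const_mul, integral_wt]
      ring
    rw [integral_add (hint _ c2) (hc _ (by fun_prop)), e]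
    ring

/-- Subtracting an infinitesimal rigid motion normalises the means without changing `J`. -/
theorem exists_normalized {u : Field} (hu : FieldMemW12loc u) (μ ε θ L : ℝ) :
    ∃ w : Field, FieldMemW12loc w ∧ energyJ μ ε θ L w = energyJ μ ε θ L u ∧
      mean (fun x => w x 0) = 0 ∧ mean (fun x => w x 1) = 0 ∧ rotMean (fun x => w x 1) = 0 := by
  set κ := rotMean fun x => u x 1
  set m0 := mean fun x => u x 0
  set m1 := mean fun x => u x 1
  set w : Field := fun x => ![u x 0 + (-m0 + 0 * x.1 + -κ * x.2), u x 1 + (-m1 + κ * x.1 + 0 * x.2)]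
  have h0 := (hu 0).add_affine (-m0) 0 (-κ)
  have h1 := (hu 1).add_affine (-m1) κ 0
  have hw : FieldMemW12loc w := fun k => by
    fin_cases k
    · exact h0.1
    · exact h1.1
  refine ⟨w, hw, energyJ_congr ?_ (hessVar_congr ?_ hu) μ ε θ, ?_, ?_, ?_⟩
  · filter_upwards [h0.2 0, h0.2 1, h1.2 0, h1.2 1] with x a b c d
    have a' : weakPartial 0 (fun y => w y 0) x = weakPartial 0 (fun y => u y 0) x + 0 := a
    have b' : weakPartial 1 (fun y => w y 0) x = weakPartial 1 (fun y => u y 0) x + -κ := b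
    have c' : weakPartial 0 (fun y => w y 1) x = weakPartial 0 (fun y => u y 1) x + κ := c
    have d' : weakPartial 1 (fun y => w y 1) x = weakPartial 1 (fun y => u y 1) x + 0 := d
    ext i j
    fin_cases i <;> fin_cases j <;> simp [strain, grad, a', b', c', d']
    all_goals ring
  · intro k j
    fin_cases k
    · exact ⟨_, h0.2 j⟩
    · exact ⟨_, h1.2 j⟩
  · have := (mean_add_affine (hu 0).1 (-m0) 0 (-κ)).1
    exact this.trans (by simp [m0])
  · have := (mean_add_affine (hu 1).1 (-m1) κ 0).1
    exact this.trans (by simp [m1])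
  · have := (mean_add_affine (hu 1).1 (-m1) κ 0).2
    exact this.trans (by simp [κ])

/-! ### Existence of minimizers -/

theorem add_liminf_le (a b : ℕ → ℝ≥0∞) :
    liminf a atTop + liminf b atTop ≤ liminf (fun n => a n + b n) atTop := by
  rw [liminf_eq_iSup_iInf_of_nat, liminf_eq_iSup_iInf_of_nat, liminf_eq_iSup_iInf_of_nat]
  have hm : ∀ c : ℕ → ℝ≥0∞, Monotone fun n => ⨅ i ≥ n, c i := fun c m n hmn =>
    le_iInf₂ fun i hi => iInf₂_le i (hmn.trans hi)
  rw [ENNReal.iSup_add_iSup_of_monotone (hm a) (hm b)]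
  refine iSup_mono fun n => le_iInf₂ fun i hi => add_le_add (iInf₂_le i hi) (iInf₂_le i hi)

theorem lintegral_matNorm_sq_eq {A : Plane → Matrix (Fin 2) (Fin 2) ℝ}
    (hA : ∀ i j, MemL2loc fun x => A x i j) (S : Set Plane) :
    ∫⁻ x in S, ofReal (matNorm (A x) ^ 2)
      = (∫⁻ x in S, ofReal (A x 0 0 ^ 2)) + (∫⁻ x in S, ofReal (A x 0 1 ^ 2))
        + (∫⁻ x in S, ofReal (A x 1 0 ^ 2)) + ∫⁻ x in S, ofReal (A x 1 1 ^ 2) := by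
  have hm : ∀ i j, AEMeasurable (fun x => ofReal (A x i j ^ 2)) (volume.restrict S) :=
    fun i j => (((hA i j).aestronglyMeasurable.aemeasurable.pow_const 2).ennreal_ofReal).restrict
  have e1 := lintegral_add_left' (hm 0 0) fun x => ofReal (A x 0 1 ^ 2)
  have e2 := lintegral_add_left' ((hm 0 0).add (hm 0 1)) fun x => ofReal (A x 1 0 ^ 2)
  have e3 := lintegral_add_left' (((hm 0 0).add (hm 0 1)).add (hm 1 0))
    fun x => ofReal (A x 1 1 ^ 2)
  simp only [Pi.add_apply] at e2 e3
  rw [← e1, ← e2, ← e3]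
  refine lintegral_congr fun x => ?_
  rw [matNorm_sq, ofReal_add (by positivity) (by positivity),
    ofReal_add (by positivity) (by positivity),
    ofReal_add (by positivity) (by positivity)]

theorem lintegral_matNorm_sq_le_liminf {A : ℕ → Plane → Matrix (Fin 2) (Fin 2) ℝ}
    {B : Plane → Matrix (Fin 2) (Fin 2) ℝ} (hA : ∀ n i j, MemL2loc fun x => A n x i j)
    (hB : ∀ i j, MemL2loc fun x => B x i j)
    (h : ∀ i j, WeakLim (fun n x => A n x i j) fun x => B x i j) {S : Set Plane}
        (hS : MeasurableSet S) :
    ∫⁻ x in S, ofReal (matNorm (B x) ^ 2)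
      ≤ liminf (fun n => ∫⁻ x in S, ofReal (matNorm (A n x) ^ 2)) atTop := by
  have key := fun i j => (h i j).lintegral_sq_le_liminf (fun n => hA n i j) (hB i j) hS
  rw [lintegral_matNorm_sq_eq hB S]
  simp only [lintegral_matNorm_sq_eq (hA _) S]
  refine (add_le_add (add_le_add (add_le_add (key 0 0) (key 0 1)) (key 1 0)) (key 1 1)).trans ?_
  refine (add_le_add_left (add_le_add_left (add_liminf_le _ _) _) _).trans ?_
  exact (add_le_add_left (add_liminf_le _ _) _).trans (add_liminf_le _ _)

theorem memL2loc_grad {u : Field} (hu : FieldMemW12loc u) (k j : Fin 2) :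
    MemL2loc fun x => grad u x k j := (isWeakPartial_weakPartial (hu k) j).1

theorem MemL2loc.const_mul (hf : MemL2loc f) (c : ℝ) :
    MemL2loc fun x => c * f x := fun C hC => (hf C hC).const_mul c

theorem strain_apply (u : Field) (x : Plane) (k j : Fin 2) :
    strain u x k j = 1 / 2 * (grad u x k j + grad u x j k) := rfl

theorem memL2loc_strain {u : Field} (hu : FieldMemW12loc u) (k j : Fin 2) :
    MemL2loc fun x => strain u x k j := by
  simp only [strain_apply]
  exact ((memL2loc_grad hu k j).add (memL2loc_grad hu j k)).const_mul _

theorem GradConv.weak_grad {u : ℕ → Field} {u' : Field} (h : GradConv U u u')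
    (k j : Fin 2) : WeakLim (fun n x => grad (u n) x k j) fun x => grad u' x k j := h.weak k j

theorem GradConv.weak_strain {u : ℕ → Field} {u' : Field} (h : GradConv U u u')
    (hu : ∀ n, FieldMemW12loc (u n)) (hu' : FieldMemW12loc u') (k j : Fin 2) :
    WeakLim (fun n x => strain (u n) x k j) fun x => strain u' x k j := by
  simp only [strain_apply]
  exact ((h.weak_grad k j).add (h.weak_grad j k) (fun n => memL2loc_grad (hu n) k j)
    (fun n => memL2loc_grad (hu n) j k) (memL2loc_grad hu' k j) (memL2loc_grad hu' j k)).const_mul _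

theorem continuous_matNorm : Continuous matNorm := by
  unfold matNorm
  fun_prop

theorem continuous_symPart : Continuous symPart := by
  unfold symPart
  fun_prop

/-- Fatou's lemma for a continuous density of the gradient. -/
theorem GradConv.lintegral_le_liminf {u : ℕ → Field} {u' : Field}
    (h : GradConv U u u') (hu : ∀ n, FieldMemW12loc (u n))
    {W : Matrix (Fin 2) (Fin 2) ℝ → ℝ} (hW : Continuous W) :
    ∫⁻ x in U, ofReal (W (grad u' x))
      ≤ liminf (fun n => ∫⁻ x in U, ofReal (W (grad (u n) x))) atTop := by
  have hlim : ∀ᵐ x ∂(volume.restrict U), Tendsto (fun n => ofReal (W (grad (u n) x))) atTop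
      (𝓝 (ofReal (W (grad u' x)))) := by
    filter_upwards [h.ae] with x hx
    refine ENNReal.tendsto_ofReal (hW.continuousAt.tendsto.comp ?_)
    exact tendsto_pi_nhds.2 fun k => tendsto_pi_nhds.2 fun j => hx k j
  have hmeas : ∀ n, AEMeasurable (fun x => ofReal (W (grad (u n) x)))
      (volume.restrict U) := by
    intro n
    have hofc : Continuous fun p : Fin 2 → Fin 2 → ℝ => W (Matrix.of p) := hW.comp (by fun_prop)
    have hg : AEMeasurable (fun x k j => grad (u n) x k j) (volume : Measure Plane) := by
      refine aemeasurable_pi_lambda _ fun k => aemeasurable_pi_lambda _ fun j => ?_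
      exact (memL2loc_grad (hu n) k j).aestronglyMeasurable.aemeasurable
    exact (hofc.measurable.comp_aemeasurable hg).ennreal_ofReal.restrict
  calc ∫⁻ x in U, ofReal (W (grad u' x))
      = ∫⁻ x in U, liminf (fun n => ofReal (W (grad (u n) x))) atTop := by
        refine lintegral_congr_ae ?_
        filter_upwards [hlim] with x hx
        exact hx.liminf_eq.symm
    _ ≤ _ := lintegral_liminf_le' hmeas

/-- Both energies consist of an exterior energy, a density of the gradient and the second variation;
this is their lower semicontinuity, given that of the exterior energy. -/
theorem GradConv.add_le_liminf {u : ℕ → Field} {u' : Field} (h : GradConv U u u')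
    (hu : ∀ n, FieldMemW12loc (u n)) {A : ℝ≥0∞} {B : ℕ → ℝ≥0∞} (hA : A ≤ liminf B atTop)
    {W : Matrix (Fin 2) (Fin 2) ℝ → ℝ} (hW : Continuous W) (μ ε : ℝ) :
    ofReal μ * A + (∫⁻ x in U, ofReal (W (grad u' x))) + ofReal ε * hessVar u' U
      ≤ liminf (fun n => ofReal μ * B n + (∫⁻ x in U, ofReal (W (grad (u n) x)))
        + ofReal ε * hessVar (u n) U) atTop := by
  refine (add_le_add (add_le_add (mul_le_mul_right hA (ofReal μ)) (h.lintegral_le_liminf hu hW))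
    (mul_le_mul_right (hessVar_le_liminf h) (ofReal ε))).trans ?_
  rw [← ENNReal.liminf_const_mul_of_ne_top ofReal_ne_top,
    ← ENNReal.liminf_const_mul_of_ne_top ofReal_ne_top]
  exact (add_le_add_left (add_liminf_le _ _) _).trans (add_liminf_le _ _)

theorem continuous_wellDens (θ : ℝ) : Continuous fun a : Matrix (Fin 2) (Fin 2) ℝ =>
    min (matNorm (symPart a - θ • symE) ^ 2) (matNorm (symPart a + (1 - θ) • symE) ^ 2) :=
  ((continuous_matNorm.comp (continuous_symPart.sub continuous_const)).pow 2).min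
    ((continuous_matNorm.comp (continuous_symPart.add continuous_const)).pow 2)

theorem energyJ_le_liminf {u : ℕ → Field} {u' : Field}
    (h : GradConv (nucleus L) u u') (hu : ∀ n, FieldMemW12loc (u n)) (hu' : FieldMemW12loc u')
    (μ ε θ : ℝ) : energyJ μ ε θ L u' ≤ liminf (fun n => energyJ μ ε θ L (u n)) atTop :=
  h.add_le_liminf hu (lintegral_matNorm_sq_le_liminf (fun n => memL2loc_strain (hu n))
    (memL2loc_strain hu') (h.weak_strain hu hu') (nucleus_isOpen L).measurableSet.compl)
    (W := fun a => matDist (symPart a) (wells θ) ^ 2)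
    (by simpa only [matDist_wells_sq] using continuous_wellDens θ) μ ε

theorem energyI_le_liminf {u : ℕ → Field} {u' : Field}
    (h : GradConv (nucleus L) u u') (hu : ∀ n, FieldMemW12loc (u n)) (hu' : FieldMemW12loc u')
    (μ ε θ : ℝ) : energyI μ ε θ L u' ≤ liminf (fun n => energyI μ ε θ L (u n)) atTop :=
  h.add_le_liminf hu (lintegral_matNorm_sq_le_liminf (fun n => memL2loc_grad (hu n))
    (memL2loc_grad hu') h.weak_grad (nucleus_isOpen L).measurableSet.compl)
    (continuous_wellDens θ) μ ε

/-- The strain of a field of bounded energy is bounded in `L²` of every square. -/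
theorem nstrain_le_of_energyJ_le (hμ : 0 < μ) (hθ : 0 < θ) (hθ' : θ ≤ 1 / 2)
    {M : ℝ≥0∞} {u : Field} (hu : FieldMemW12loc u) (h : energyJ μ ε θ L u ≤ M) (R : ℝ) :
    nstrain (weakPartial 0 fun x => u x 0)
      (fun x => weakPartial 1 (fun x => u x 0) x + weakPartial 0 (fun x => u x 1) x)
      (weakPartial 1 fun x => u x 1) R
      ≤ 2 * (M / ofReal μ + (2 * M + volume (nucleus L))) := by
  have hμ0 : ofReal μ ≠ 0 := by simpa using hμ
  have ha : ofReal μ * (∫⁻ x in (nucleus L)ᶜ, ofReal (matNorm (strain u x) ^ 2))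
      ≤ M := le_trans (by unfold energyJ; rw [add_assoc]; exact le_self_add) h
  have hb : ∫⁻ x in nucleus L, ofReal (matDist (strain u x) (wells θ) ^ 2) ≤ M :=
    le_trans (by unfold energyJ; exact le_add_right le_add_self) h
  have ha' : ∫⁻ x in (nucleus L)ᶜ, ofReal (matNorm (strain u x) ^ 2)
      ≤ M / ofReal μ := by
    rw [ENNReal.le_div_iff_mul_le (Or.inl hμ0) (Or.inl ofReal_ne_top), mul_comm]
    exact ha
  have hb' : ∫⁻ x in nucleus L, ofReal (matNorm (strain u x) ^ 2)
      ≤ 2 * M + volume (nucleus L) := by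
    calc ∫⁻ x in nucleus L, ofReal (matNorm (strain u x) ^ 2)
        ≤ ∫⁻ x in nucleus L, (2 * ofReal (matDist (strain u x) (wells θ) ^ 2) + 1) := by
          refine lintegral_mono fun x => ?_
          have := matNorm_symPart_sq_le_matDist (grad u x) hθ hθ'
          refine (ofReal_le_ofReal this).trans ?_
          rw [ofReal_add (by positivity) zero_le_one, ofReal_mul zero_le_two]
          simp [strain_eq]
      _ = 2 * (∫⁻ x in nucleus L, ofReal (matDist (strain u x) (wells θ) ^ 2))
            + volume (nucleus L) := by
          rw [lintegral_add_right _ measurable_const, lintegral_const_mul' _ _ (by norm_num)]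
          simp
      _ ≤ _ := by gcongr
  have htot : ∫⁻ x, ofReal (matNorm (strain u x) ^ 2)
      ≤ M / ofReal μ + (2 * M + volume (nucleus L)) := by
    rw [← lintegral_add_compl _ (nucleus_isOpen L).measurableSet, add_comm]
    exact add_le_add ha' hb'
  have hm : ∀ k j, AEMeasurable (fun x => grad u x k j) (volume.restrict (sq R)) := fun k j =>
    (memL2loc_grad hu k j).aestronglyMeasurable.aemeasurable.restrict
  have e1 := lintegral_add_left' (((hm 0 0).pow_const 2).ennreal_ofReal)
    fun x => ofReal ((grad u x 0 1 + grad u x 1 0) ^ 2)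
  have e2 := lintegral_add_left' ((((hm 0 0).pow_const 2).ennreal_ofReal).add
    ((((hm 0 1).add (hm 1 0)).pow_const 2).ennreal_ofReal))
    fun x => ofReal (grad u x 1 1 ^ 2)
  simp only [Pi.add_apply] at e2
  change (∫⁻ x in sq R, ofReal (grad u x 0 0 ^ 2))
    + (∫⁻ x in sq R, ofReal ((grad u x 0 1 + grad u x 1 0) ^ 2))
    + (∫⁻ x in sq R, ofReal (grad u x 1 1 ^ 2)) ≤ _
  rw [← e1, ← e2]
  calc _ ≤ ∫⁻ x in sq R, 2 * ofReal (matNorm (strain u x) ^ 2) := by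
        refine lintegral_mono fun x => ?_
        simp only
        rw [show (2 : ℝ≥0∞) = ofReal 2 by simp, ← ofReal_mul zero_le_two,
          ← ofReal_add (sq_nonneg _) (sq_nonneg _),
          ← ofReal_add (by positivity) (sq_nonneg _)]
        apply ofReal_le_ofReal
        rw [matNorm_sq]
        simp only [strain_apply]
        nlinarith [sq_nonneg (grad u x 0 0), sq_nonneg (grad u x 1 1)]
    _ ≤ 2 * ∫⁻ x, ofReal (matNorm (strain u x) ^ 2) := by
        rw [lintegral_const_mul' _ _ (by norm_num)]
        gcongr
        exact Measure.restrict_le_self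
    _ ≤ _ := by gcongr

/-- Compactness of normalised sequences of bounded energy. -/
theorem exists_limit_of_energyJ_le (hμ : 0 < μ) (hε : 0 < ε) (hθ : 0 < θ)
    (hθ' : θ ≤ 1 / 2) {M : ℝ≥0∞} (hM : M ≠ ⊤) {u : ℕ → Field} (hu : ∀ n, FieldMemW12loc (u n))
    (h : ∀ n, energyJ μ ε θ L (u n) ≤ M) (h0 : ∀ n, mean (fun x => u n x 0) = 0)
    (h1 : ∀ n, mean (fun x => u n x 1) = 0) (h2 : ∀ n, rotMean (fun x => u n x 1) = 0) :
    ∃ φ : ℕ → ℕ, StrictMono φ ∧ ∃ u' : Field, FieldMemW12loc u' ∧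
      (∀ k, WeakLim (fun n x => u (φ n) x k) fun x => u' x k) ∧
      GradConv (nucleus L) (fun n => u (φ n)) u' := by
  have hμ0 : ofReal μ ≠ 0 := by simpa using hμ
  have hε0 : ofReal ε ≠ 0 := by simpa using hε
  choose K hK hKP using korn_poincare
  set B : ℝ≥0∞ := 2 * (M / ofReal μ + (2 * M + volume (nucleus L))) with hB
  have hBt : B ≠ ⊤ := by
    have := nucleus_volume_ne_top L
    have : M / ofReal μ ≠ ⊤ := ENNReal.div_ne_top hM hμ0
    finiteness
  have hbd : ∀ (R : ℕ) n, nsq (fun x => u n x 0) R + nsq (fun x => u n x 1) R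
      + ngrad (fun j => weakPartial j fun x => u n x 0) (fun j => weakPartial j fun x => u n x 1) R
      ≤ ofReal (K R * B).toReal := by
    intro R n
    rw [ofReal_toReal (ENNReal.mul_ne_top (hK R) hBt)]
    refine (hKP R _ _ _ _ (hu n 0).1 (hu n 1).1 (isWeakPartial_weakPartial (hu n 0))
      (isWeakPartial_weakPartial (hu n 1))).trans ?_
    rw [h0 n, h1 n, h2 n]
    simp only [ne_eq, OfNat.ofNat_ne_zero, not_false_eq_true, zero_pow, ENNReal.ofReal_zero,
      add_zero]
    gcongr
    exact nstrain_le_of_energyJ_le hμ hθ hθ' (hu n) (h n) _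
  have hvar : ∀ n, hessVar (u n) (nucleus L) ≤ ofReal (M / ofReal ε).toReal := by
    intro n
    rw [ofReal_toReal (ENNReal.div_ne_top hM hε0),
      ENNReal.le_div_iff_mul_le (Or.inl hε0) (Or.inl ofReal_ne_top), mul_comm]
    exact le_trans (by unfold energyJ; exact le_add_self) (h n)
  refine exists_gradConv (nucleus_isOpen L) (nucleus_volume_ne_top L) hu ENNReal.toReal_nonneg hvar
    (C := fun R => (K R * B).toReal) ?_ ?_
  · intro k R n
    refine le_trans ?_ (hbd R n)
    fin_cases k
    · exact le_add_right le_self_add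
    · exact le_add_right le_add_self
  · intro k j R n
    refine le_trans ?_ ((le_add_self).trans (hbd R n))
    unfold ngrad
    fin_cases k <;> fin_cases j
    · exact le_add_right le_self_add
    · exact le_add_right le_add_self
    · exact le_add_left le_self_add
    · exact le_add_left le_add_self

/-- A minimizing sequence with values bounded by a finite number. -/
theorem exists_minimizing_seq {α : Type*} {P : α → Prop} {F : α → ℝ≥0∞} {a₀ : α} (h₀ : P a₀)
    (hF : F a₀ ≠ ⊤) : ∃ (M : ℝ≥0∞) (m : ℝ≥0∞) (a : ℕ → α), M ≠ ⊤ ∧ (∀ n, P (a n)) ∧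
      (∀ n, F (a n) ≤ M) ∧ (∀ b, P b → m ≤ F b) ∧ Tendsto (fun n => F (a n)) atTop (𝓝 m) := by
  set S := F '' {a | P a} with hS
  have hne : S.Nonempty := ⟨F a₀, a₀, h₀, rfl⟩
  obtain ⟨x, hx, hlim, hmem⟩ := exists_seq_tendsto_sInf hne (OrderBot.bddBelow S)
  have hlt : sInf S < ⊤ := lt_of_le_of_lt (sInf_le ⟨a₀, h₀, rfl⟩) hF.lt_top
  obtain ⟨N, hN⟩ := (hlim.eventually_lt_const hlt).exists
  choose a ha hax using hmem
  refine ⟨x N, sInf S, fun n => a (n + N), hN.ne, fun n => ha _, fun n => ?_,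
    fun b hb => sInf_le ⟨b, hb, rfl⟩, ?_⟩
  · rw [hax]; exact hx (Nat.le_add_left N n)
  · simp only [hax]
    exact (tendsto_add_atTop_iff_nat N).2 hlim

theorem scalarField_zero (v : Plane → ℝ) : (fun y => scalarField v y 0) = v := rfl

theorem scalarField_one (v : Plane → ℝ) : (fun y => scalarField v y 1) = fun _ => 0 := rfl

theorem memW12loc_zero : MemW12loc fun _ => 0 :=
  memW12loc_of_locallyLipschitz (.const 0)

theorem weakPartial_zero_ae (j : Fin 2) :
    weakPartial j (fun _ : Plane => (0 : ℝ)) =ᵐ[volume] fun _ => 0 := by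
  refine (weakPartial_ae_eq_lpart (.const 0) j).trans
    (.of_forall fun x => ?_)
  simp [lpart, lineDeriv]

theorem fieldMemW12loc_scalarField (hv : MemW12loc v) :
    FieldMemW12loc (scalarField v) := fun k => by
  fin_cases k
  · exact hv
  · exact memW12loc_zero

theorem scalarAdmissible_of_energyE_ne_top (hε : 0 < ε) (hv : MemW12loc v)
    (h : energyE μ ε θ L v ≠ ⊤) : ScalarAdmissible L v := by
  refine ⟨hv, fun htop => h ?_⟩
  rw [energyE, energyI, htop, ENNReal.mul_top (ENNReal.ofReal_pos.2 hε).ne', add_top]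

/-- The energy `J` attains its minimum. -/
theorem exists_minimizer_energyJ (hμ : 0 < μ) (hε : 0 < ε) (hθ : 0 < θ)
    (hθ' : θ ≤ 1 / 2) {u₀ : Field} (h₀ : FieldMemW12loc u₀) (hJ : energyJ μ ε θ L u₀ ≠ ⊤) :
    ∃ u : Field, FieldMemW12loc u ∧
      ∀ w : Field, FieldMemW12loc w → energyJ μ ε θ L u ≤ energyJ μ ε θ L w := by
  obtain ⟨M, m, a, hM, ha, haM, hm, hlim⟩ := exists_minimizing_seq h₀ hJ
  choose w hw hwJ h0 h1 h2 using fun n => exists_normalized (ha n) μ ε θ L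
  obtain ⟨φ, hφ, u, hu, -, hconv⟩ := exists_limit_of_energyJ_le hμ hε hθ hθ' hM hw
    (fun n => (hwJ n).trans_le (haM n)) h0 h1 h2
  refine ⟨u, hu, fun b hb => le_trans ?_ (hm b hb)⟩
  refine (energyJ_le_liminf hconv (fun n => hw (φ n)) hu μ ε θ).trans (le_of_eq ?_)
  simp only [hwJ]
  exact (hlim.comp hφ.tendsto_atTop).liminf_eq

/-- The scalar energy `E` attains its minimum. -/
theorem exists_minimizer_energyE (hμ : 0 < μ) (hε : 0 < ε) (hθ : 0 < θ)
    (hθ' : θ ≤ 1 / 2) (hw : ScalarAdmissible L w) (hE : energyE μ ε θ L w ≠ ⊤) :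
    ∃ v : Plane → ℝ, ScalarAdmissible L v ∧
      ∀ w, ScalarAdmissible L w → energyE μ ε θ L v ≤ energyE μ ε θ L w := by
  obtain ⟨M, m, a, hM, ha, haM, hm, hlim⟩ := exists_minimizing_seq hw hE
  clear hw
  set w : ℕ → Plane → ℝ := fun n x => a n x + (-mean (a n) + 0 * x.1 + 0 * x.2) with hwdef
  have hadd := fun n => (ha n).1.add_affine (-mean (a n)) 0 0
  have hw : ∀ n, MemW12loc (w n) := fun n => (hadd n).1
  have hwE : ∀ n, energyE μ ε θ L (w n) = energyE μ ε θ L (a n) := by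
    intro n
    refine energyI_congr (fieldMemW12loc_scalarField (ha n).1) (fun k j => ?_) μ ε θ L
    fin_cases k
    · refine ((hadd n).2 j).trans (.of_forall fun x => ?_)
      fin_cases j <;> exact add_zero _
    · exact EventuallyEq.rfl
  have hz : mean (fun _ => 0) = 0 := by simp [mean]
  have hz' : rotMean (fun _ => 0) = 0 := by simp [rotMean]
  obtain ⟨φ, hφ, u, hu, hul, hconv⟩ := exists_limit_of_energyJ_le hμ hε hθ hθ' hM
    (u := fun n => scalarField (w n)) (fun n => fieldMemW12loc_scalarField (hw n))
    (fun n => (energyJ_le_energyI μ ε θ L _).trans ((hwE n).trans_le (haM n)))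
    (fun n => by
      have := (mean_add_affine (ha n).1.1 (-mean (a n)) 0 0).1
      exact this.trans (by simp)) (fun n => hz) (fun n => hz')
  -- the second component of the limit vanishes
  have hu1 : (fun x => u x 1) =ᵐ[volume] fun _ => 0 := by
    refine ae_eq_of_integral_contDiff_smul_eq (hu 1).1.locallyIntegrable
      (locallyIntegrable_const 0) fun φ hφ hc => ?_
    have ht : IsTest univ φ := ⟨hφ, hc, subset_univ _⟩
    simp only [smul_eq_mul, mul_comm (φ _)]
    exact tendsto_nhds_unique (hul 1 φ ht.memLp hc) tendsto_const_nhds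
  set v : Plane → ℝ := fun x => u x 0 with hvdef
  have hv : MemW12loc v := hu 0
  have hpart : ∀ k j, (weakPartial j fun y => scalarField v y k)
      =ᵐ[volume] weakPartial j fun y => u y k := by
    intro k j
    fin_cases k
    · exact EventuallyEq.rfl
    · have h1 := isWeakPartial_weakPartial (hu 1) j
      have h2 : IsWeakPartial j (fun _ => 0) (weakPartial j fun y => u y 1) := by
        refine ⟨h1.1, fun φ hφ => ?_⟩
        rw [← h1.2 φ hφ]
        refine integral_congr_ae ?_
        filter_upwards [hu1] with x hx
        rw [hx]
      exact (isWeakPartial_weakPartial memW12loc_zero j).ae_eq h2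
  have hE : energyE μ ε θ L v ≤ m := by
    have h1 : energyE μ ε θ L v = energyI μ ε θ L u := energyI_congr hu hpart μ ε θ L
    rw [h1]
    refine (energyI_le_liminf hconv (fun n => fieldMemW12loc_scalarField (hw (φ n))) hu
      μ ε θ).trans (le_of_eq ?_)
    have h2 : (fun n => energyI μ ε θ L (scalarField (w (φ n))))
        = fun n => energyE μ ε θ L (a (φ n)) := funext fun n => hwE (φ n)
    rw [h2]
    exact (hlim.comp hφ.tendsto_atTop).liminf_eq
  have hmM : m ≤ M := le_of_tendsto hlim (.of_forall haM)
  exact ⟨v, scalarAdmissible_of_energyE_ne_top hε hv (ne_top_of_le_ne_top hM (hE.trans hmM)),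
    fun b hb => hE.trans (hm b hb)⟩

/-! ### Almost everywhere calculus for locally Lipschitz functions -/

/-- Local Lipschitz continuity, the regularity of all competitors. -/
notation "LocLip" => LocallyLipschitz

attribute [fun_prop] LocallyLipschitz LocallyLipschitz.id LocallyLipschitz.const
  LocallyLipschitz.comp LocallyLipschitz.prodMk LocallyLipschitz.min LocallyLipschitz.max
  LocallyLipschitz.add LocallyLipschitz.neg LocallyLipschitz.sub

@[fun_prop] theorem locallyLipschitz_fst : LocLip (Prod.fst : Plane → ℝ) :=
  ContDiff.locallyLipschitz (𝕂 := ℝ) (by fun_prop)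

@[fun_prop] theorem locallyLipschitz_snd : LocLip (Prod.snd : Plane → ℝ) :=
  ContDiff.locallyLipschitz (𝕂 := ℝ) (by fun_prop)

@[fun_prop] theorem locallyLipschitz_mul (hf : LocLip f) (hg : LocLip g) :
    LocLip fun x => f x * g x :=
  (ContDiff.locallyLipschitz (𝕂 := ℝ) (f := fun p : ℝ × ℝ => p.1 * p.2) (by fun_prop)).comp
    (hf.prodMk hg)

theorem locallyLipschitz_inv (hf : LocLip f) (h0 : ∀ x, f x ≠ 0) :
    LocLip fun x => (f x)⁻¹ := fun x => by
  obtain ⟨K, t, ht, hK⟩ := hf x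
  obtain ⟨K', t', ht', hK'⟩ := (contDiffAt_inv ℝ (h0 x)).exists_lipschitzOnWith
  exact ⟨K' * K, t ∩ f ⁻¹' t', inter_mem ht (hf.continuous.continuousAt ht'),
    hK'.comp (hK.mono inter_subset_left) fun y hy => hy.2⟩

@[fun_prop] theorem LocallyLipschitz_neg (hf : LocLip f) :
    LocLip fun x => -f x :=
  (LipschitzWith.id (α := ℝ)).neg.locallyLipschitz.comp hf

@[fun_prop] theorem LocallyLipschitz_sum {ι : Type*} (s : Finset ι) {f : ι → Plane → ℝ}
    (hf : ∀ i, LocLip (f i)) : LocLip fun x => ∑ i ∈ s, f i x := by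
  classical
  induction s using Finset.induction_on with
  | empty => simpa using LocallyLipschitz.const (0 : ℝ)
  | insert a s ha ih => simp only [Finset.sum_insert ha]; fun_prop

theorem ae_lineDifferentiableAt (hf : LocLip f) (i : Fin 2) :
    ∀ᵐ x, LineDifferentiableAt ℝ f x (dir i) := by
  have h : ∀ R : ℕ, ∀ᵐ x, x ∈ sq (R : ℝ) → LineDifferentiableAt ℝ f x (dir i) := by
    intro R
    obtain ⟨C, g, hg, hfg⟩ := exists_lipschitz_eqOn hf R
    filter_upwards [hg.ae_lineDifferentiableAt (μ := volume) (dir i)] with x hx hxR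
    have : f =ᶠ[𝓝 x] g := by
      have : Metric.ball (0 : Plane) (R + 1) ∈ 𝓝 x := by
        refine Metric.isOpen_ball.mem_nhds ?_
        simp only [sq, Metric.mem_closedBall, Metric.mem_ball] at hxR ⊢
        linarith
      filter_upwards [this] with y hy
      exact hfg (Metric.ball_subset_closedBall hy)
    exact this.lineDifferentiableAt_iff.2 hx
  rw [← ae_all_iff] at h
  filter_upwards [h] with x hx
  obtain ⟨R, hR⟩ := exists_nat_ge ‖x‖
  exact hx R (by simpa [sq] using hR)

theorem deriv_min_eq {a b : ℝ → ℝ} (ha : DifferentiableAt ℝ a t)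
    (hm : DifferentiableAt ℝ (fun s => min (a s) (b s)) t) (h : a t ≤ b t) :
    deriv (fun s => min (a s) (b s)) t = deriv a t := by
  have h1 : IsLocalMin (fun s => a s - min (a s) (b s)) t := by
    refine .of_forall fun s => ?_
    grind
  have h2 := h1.deriv_eq_zero
  rw [deriv_fun_sub ha hm] at h2
  linarith

/-- The partial derivatives of a minimum are almost everywhere those of the smaller function. -/
theorem lpart_min (hf : LocLip f) (hg : LocLip g)
    (i : Fin 2) : ∀ᵐ x, (f x ≤ g x → lpart i (fun y => min (f y) (g y)) x = lpart i f x) ∧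
      (g x ≤ f x → lpart i (fun y => min (f y) (g y)) x = lpart i g x) := by
  filter_upwards [ae_lineDifferentiableAt hf i, ae_lineDifferentiableAt hg i,
    ae_lineDifferentiableAt (hf.min hg) i] with x h1 h2 h3
  refine ⟨fun h => deriv_min_eq (t := 0) h1 h3 (by simpa using h), fun h => ?_⟩
  have h3' : DifferentiableAt ℝ (fun t : ℝ => min (g (x + t • dir i)) (f (x + t • dir i))) 0 := by
    simp_rw [min_comm (g _)]
    exact h3
  have := deriv_min_eq (t := 0) h2 h3' (by simpa using h)
  unfold lpart lineDeriv
  simp_rw [min_comm (f _)]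
  exact this

theorem lpart_add (hf : LocLip f) (hg : LocLip g)
    (i : Fin 2) : ∀ᵐ x, lpart i (fun y => f y + g y) x = lpart i f x + lpart i g x := by
  filter_upwards [ae_lineDifferentiableAt hf i, ae_lineDifferentiableAt hg i] with x h1 h2
  exact deriv_fun_add h1 h2

theorem lpart_neg (f : Plane → ℝ) (i : Fin 2) (x : Plane) :
    lpart i (fun y => -f y) x = -lpart i f x := by
  unfold lpart lineDeriv
  exact deriv.fun_neg

theorem lpart_const_mul (c : ℝ) (f : Plane → ℝ) (i : Fin 2) (x : Plane) :
    lpart i (fun y => c * f y) x = c * lpart i f x := by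
  unfold lpart lineDeriv
  exact deriv_const_mul_field c

theorem lpart_sub (hf : LocLip f) (hg : LocLip g)
    (i : Fin 2) : ∀ᵐ x, lpart i (fun y => f y - g y) x = lpart i f x - lpart i g x := by
  filter_upwards [ae_lineDifferentiableAt hf i, ae_lineDifferentiableAt hg i] with x h1 h2
  exact deriv_fun_sub h1 h2

theorem lpart_mul (hf : LocLip f) (hg : LocLip g)
    (i : Fin 2) : ∀ᵐ x, lpart i (fun y => f y * g y) x
      = lpart i f x * g x + f x * lpart i g x := by
  filter_upwards [ae_lineDifferentiableAt hf i, ae_lineDifferentiableAt hg i] with x h1 h2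
  have := deriv_fun_mul h1 h2
  simpa [lpart, lineDeriv] using this

theorem lpart_max (hf : LocLip f) (hg : LocLip g)
    (i : Fin 2) : ∀ᵐ x, (g x ≤ f x → lpart i (fun y => max (f y) (g y)) x = lpart i f x) ∧
      (f x ≤ g x → lpart i (fun y => max (f y) (g y)) x = lpart i g x) := by
  have e : (fun y => max (f y) (g y)) = fun y => -min (-f y) (-g y) := by
    grind
  filter_upwards [lpart_min (LocallyLipschitz_neg hf) (LocallyLipschitz_neg hg) i] with x hx
  rw [e, lpart_neg]
  refine ⟨fun h => ?_, fun h => ?_⟩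
  · rw [hx.1 (neg_le_neg h), lpart_neg, neg_neg]
  · rw [hx.2 (neg_le_neg h), lpart_neg, neg_neg]

theorem lpart_const (c : ℝ) (i : Fin 2) (x : Plane) : lpart i (fun _ => c) x = 0 := by
  simp [lpart, lineDeriv]

theorem lpart_congr (h : f =ᶠ[𝓝 x] g) (i : Fin 2) :
    lpart i f x = lpart i g x := h.lineDeriv_eq

/-- The partial derivatives of the translate in the second variable. -/
theorem lpart_translate (f : Plane → ℝ) (p : ℝ) (i : Fin 2) (x : Plane) :
    lpart i (fun y => f (y.1, y.2 - p)) x = lpart i f (x.1, x.2 - p) := by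
  unfold lpart lineDeriv
  have e : ∀ t : ℝ, ((x + t • dir i).1, (x + t • dir i).2 - p) = (x.1, x.2 - p) + t • dir i := by
    intro t
    ext
    · simp
    · simp; ring
  simp only [e]

theorem locallyLipschitz_translate (hf : LocLip f) (p : ℝ) :
    LocLip fun y : Plane => f (y.1, y.2 - p) := by
  fun_prop

theorem ae_translate {P : Plane → Prop} (h : ∀ᵐ x, P x) (p : ℝ) :
    ∀ᵐ x : Plane, P (x.1, x.2 - p) := by
  have := (measurePreserving_sub_right (volume : Measure Plane) (0, p)).quasiMeasurePreserving.ae h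
  filter_upwards [this] with x hx
  have e : x - ((0 : ℝ), p) = (x.1, x.2 - p) := by ext <;> simp
  rwa [e] at hx

theorem lpart_sum {ι : Type*} (s : Finset ι) {f : ι → Plane → ℝ}
    (hf : ∀ i, LocLip (f i)) (i : Fin 2) :
    ∀ᵐ x, lpart i (fun y => ∑ j ∈ s, f j y) x = ∑ j ∈ s, lpart i (f j) x := by
  have : ∀ᵐ x, ∀ j ∈ s, LineDifferentiableAt ℝ (f j) x (dir i) := by
    rw [Finset.eventually_all]
    exact fun j _ => ae_lineDifferentiableAt (hf j) i
  filter_upwards [this] with x hx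
  exact deriv_fun_sum hx

/-! ### Total variation by slicing -/

/-- The function `g` of one variable is integrable on `I`, and its distributional derivative on
`I` has total variation at most `n`. -/
def SliceVar (I : Set ℝ) (g : ℝ → ℝ) (n : ℝ) : Prop :=
  IntegrableOn g I ∧ ∀ ψ : ℝ → ℝ, ContDiff ℝ 1 ψ → HasCompactSupport ψ → tsupport ψ ⊆ I →
    (∀ t, |ψ t| ≤ 1) → |∫ t in I, g t * deriv ψ t| ≤ n

theorem deriv_eq_zero_of_tsupport {ψ : ℝ → ℝ} (h : tsupport ψ ⊆ I)
    (ht : t ∉ I) : deriv ψ t = 0 := by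
  refine Function.notMem_support.1 fun h' => ht (h ?_)
  exact support_deriv_subset h'

theorem SliceVar.nonneg {g : ℝ → ℝ} (h : SliceVar I g n) : 0 ≤ n :=
  (abs_nonneg _).trans (h.2 (fun _ => 0) contDiff_const HasCompactSupport.zero
    (by simp [tsupport]) (by simp))

theorem SliceVar.mono {g : ℝ → ℝ} {m : ℝ} (h : SliceVar I g n) (hJ : J ⊆ I)
    (hn : n ≤ m) : SliceVar J g m := by
  refine ⟨h.1.mono_set hJ, fun ψ h1 h2 h3 h4 => ?_⟩
  have e : ∀ K : Set ℝ, tsupport ψ ⊆ K → ∫ t in K, g t * deriv ψ t = ∫ t, g t * deriv ψ t :=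
    fun K hK => setIntegral_eq_integral_of_forall_compl_eq_zero fun t ht => by
      rw [deriv_eq_zero_of_tsupport hK ht, mul_zero]
  rw [e J h3, ← e I (h3.trans hJ)]
  exact (h.2 ψ h1 h2 (h3.trans hJ) h4).trans hn

theorem SliceVar.congr_ae {g g' : ℝ → ℝ} (h : SliceVar I g n)
    (hg : g' =ᵐ[volume.restrict I] g) : SliceVar I g' n := by
  refine ⟨h.1.congr hg.symm, fun ψ h1 h2 h3 h4 => ?_⟩
  have e : ∫ t in I, g' t * deriv ψ t = ∫ t in I, g t * deriv ψ t :=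
    integral_congr_ae (hg.mono fun t ht => by simp only [ht])
  rw [e]
  exact h.2 ψ h1 h2 h3 h4

theorem integrableOn_mul_deriv {g ψ : ℝ → ℝ} (hg : IntegrableOn g I)
    (h1 : ContDiff ℝ 1 ψ) (h2 : HasCompactSupport ψ) :
    IntegrableOn (fun t => g t * deriv ψ t) I := by
  have hc : Continuous (deriv ψ) := h1.continuous_deriv le_rfl
  obtain ⟨C, hC⟩ := h2.deriv.exists_bound_of_continuous hc
  exact hg.mul_bdd (c := C) hc.aestronglyMeasurable (.of_forall hC)

theorem SliceVar.add {g g' : ℝ → ℝ} {n' : ℝ} (h : SliceVar I g n)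
    (h' : SliceVar I g' n') : SliceVar I (fun t => g t + g' t) (n + n') := by
  refine ⟨h.1.add h'.1, fun ψ h1 h2 h3 h4 => ?_⟩
  simp only [add_mul]
  rw [integral_add (integrableOn_mul_deriv h.1 h1 h2) (integrableOn_mul_deriv h'.1 h1 h2)]
  exact (abs_add_le _ _).trans (add_le_add (h.2 ψ h1 h2 h3 h4) (h'.2 ψ h1 h2 h3 h4))

theorem sliceVar_zero (I : Set ℝ) : SliceVar I (fun _ => 0) 0 :=
  ⟨integrable_zero _ _ _, fun ψ _ _ _ _ => by simp⟩

theorem SliceVar.sum {ι : Type*} (s : Finset ι) {g : ι → ℝ → ℝ} {n : ι → ℝ}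
    (h : ∀ i ∈ s, SliceVar I (g i) (n i)) :
    SliceVar I (fun t => ∑ i ∈ s, g i t) (∑ i ∈ s, n i) := by
  classical
  induction s using Finset.induction_on with
  | empty => simpa using sliceVar_zero I
  | insert a s ha ih =>
    simp only [Finset.sum_insert ha]
    exact (h a (Finset.mem_insert_self a s)).add
      (ih fun i hi => h i (Finset.mem_insert_of_mem hi))

theorem SliceVar.const_mul {g : ℝ → ℝ} (h : SliceVar I g n) (c : ℝ) :
    SliceVar I (fun t => c * g t) (|c| * n) := by
  refine ⟨h.1.const_mul c, fun ψ h1 h2 h3 h4 => ?_⟩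
  simp only [mul_assoc, integral_const_mul, abs_mul]
  exact mul_le_mul_of_nonneg_left (h.2 ψ h1 h2 h3 h4) (abs_nonneg c)

theorem SliceVar.translate {g : ℝ → ℝ} (h : SliceVar univ g n) (p : ℝ) :
    SliceVar univ (fun t => g (t - p)) n := by
  have h1 : Integrable g := integrableOn_univ.1 h.1
  refine ⟨integrableOn_univ.2 (h1.comp_sub_right p), fun ψ c1 c2 c3 c4 => ?_⟩
  have e1 : ContDiff ℝ 1 fun t => ψ (t + p) := c1.comp (contDiff_id.add contDiff_const)
  have := h.2 (fun t => ψ (t + p)) e1 (c2.comp_homeomorph (Homeomorph.addRight p)) (subset_univ _)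
    fun t => c4 _
  simp only [setIntegral_univ, deriv_comp_add_const] at this ⊢
  rw [← integral_add_right_eq_self _ p]
  simpa using this

/-- The indicator function of an interval has total variation at most two. -/
theorem sliceVar_indicator (hJ : J.OrdConnected) (hv : volume (J ∩ I) ≠ ⊤)
    (c : ℝ) : SliceVar I (J.indicator fun _ => c) (2 * |c|) := by
  have hJm : MeasurableSet J := hJ.measurableSet
  refine ⟨?_, fun ψ c1 c2 c3 c4 => ?_⟩
  · rw [IntegrableOn, integrable_indicator_iff hJm]
    refine (integrableOn_const_iff).2 (Or.inr ?_)
    rw [Measure.restrict_apply hJm]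
    exact hv.lt_top
  have e0 : ∫ t in I, J.indicator (fun _ => c) t * deriv ψ t
      = ∫ t, J.indicator (fun _ => c) t * deriv ψ t :=
    setIntegral_eq_integral_of_forall_compl_eq_zero fun t ht => by
      rw [deriv_eq_zero_of_tsupport c3 ht, mul_zero]
  obtain ⟨R, hR⟩ := c2.isCompact.isBounded.subset_closedBall 0
  rw [Real.closedBall_eq_Icc, zero_sub, zero_add] at hR
  set J' := J ∩ Icc (-R) R with hJ'
  have e1 : ∫ t, J.indicator (fun _ => c) t * deriv ψ t = c * ∫ t in J', deriv ψ t := by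
    rw [← integral_const_mul, ← integral_indicator (hJm.inter measurableSet_Icc)]
    congr 1; ext t
    by_cases ht : t ∈ Icc (-R) R
    · by_cases htJ : t ∈ J <;> simp [htJ, ht.1, ht.2]
    · have h : t ∉ J' := fun h => ht h.2
      rw [indicator_of_notMem h, deriv_eq_zero_of_tsupport hR ht, mul_zero]
  have e2 : |∫ t in J', deriv ψ t| ≤ 2 := by
    rcases J'.eq_empty_or_nonempty with h0 | hne
    · rw [h0]; simp
    have hbb : BddBelow J' := ⟨-R, fun t ht => ht.2.1⟩
    have hba : BddAbove J' := ⟨R, fun t ht => ht.2.2⟩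
    have hoc : J'.OrdConnected := hJ.inter ordConnected_Icc
    set a := sInf J'
    set b := sSup J'
    have hab : a ≤ b := csInf_le_csSup hne hbb hba
    have hsub1 : Ioo a b ⊆ J' := by
      intro t ht
      obtain ⟨p, hp, hpt⟩ := exists_lt_of_csInf_lt hne ht.1
      obtain ⟨q, hq, htq⟩ := exists_lt_of_lt_csSup hne ht.2
      exact hoc.out hp hq ⟨hpt.le, htq.le⟩
    have hsub2 : J' ⊆ Icc a b := fun t ht => ⟨csInf_le hbb ht, le_csSup hba ht⟩
    have hae : J' =ᵐ[volume] Ioc a b := by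
      refine EventuallyLE.antisymm ?_ ?_
      · exact (LE.le.eventuallyLE hsub2).trans Ioc_ae_eq_Icc.symm.le
      · exact Ioo_ae_eq_Ioc.symm.le.trans (LE.le.eventuallyLE hsub1)
    rw [setIntegral_congr_set hae, ← intervalIntegral.integral_of_le hab,
      intervalIntegral.integral_deriv_eq_sub (fun t _ => c1.differentiable (by simp) t)
        ((c1.continuous_deriv le_rfl).intervalIntegrable _ _)]
    grind
  rw [e0, e1, abs_mul, mul_comm 2]
  exact mul_le_mul_of_nonneg_left e2 (abs_nonneg c)

theorem nucleus_restrict (L : ℝ) : (volume : Measure Plane).restrict (nucleus L)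
    = ((volume : Measure ℝ).restrict (Ioo 0 (2 * L))).prod (volume.restrict (Ioo 0 1)) := by
  rw [nucleus, Measure.prod_restrict]; rfl

/-- The integral over a line of the product with the derivative of a test function. -/
theorem enorm_integral_slice_le {γ : ℝ → Plane} {π : Plane → ℝ} {i : Fin 2} (hγ : ContDiff ℝ 1 γ)
    (hπ : Continuous π) (hπγ : ∀ t, π (γ t) = t) (hφ : IsTest (nucleus L) φ)
    (h1 : ∀ x, |φ x| ≤ 1) (hI : ∀ t, γ t ∈ nucleus L → t ∈ I)
    (hd : ∀ t, HasDerivAt (fun t => φ (γ t)) (pd i φ (γ t)) t)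
    (hs : SliceVar I (fun t => g (γ t)) n) :
    ‖∫ t in I, g (γ t) * pd i φ (γ t)‖ₑ ≤ ofReal n := by
  rw [Real.enorm_eq_ofReal_abs]
  refine ofReal_le_ofReal ?_
  simp only [← (hd _).deriv]
  exact hs.2 _ ((hφ.1.of_le (by simp)).comp hγ) (.of_support_subset_isCompact
    (hφ.2.1.isCompact.image hπ) fun t ht => ⟨γ t, subset_tsupport _ ht, hπγ t⟩)
    (fun t ht => hI t (hφ.2.2 (tsupport_comp_subset_preimage φ hγ.continuous ht))) fun t => h1 _

theorem integrable_mul_test_nucleus (hg : MemL2loc g) (hφ : IsTest (nucleus L) φ) (i : Fin 2) :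
    Integrable (fun x => g x * pd i φ x) (((volume : Measure ℝ).restrict
      (Ioo 0 (2 * L))).prod (volume.restrict (Ioo 0 1))) := by
  rw [← nucleus_restrict]
  exact (integrable_mul_test hg (hφ.partialDeriv i).memLp (hφ.partialDeriv i).2.1).restrict

/-- The variation in the second direction, by Fubini's theorem. -/
theorem ofReal_integral_mul_partialDeriv_one_le (hg : MemL2loc g)
    (hφ : IsTest (nucleus L) φ) (h1 : ∀ x, |φ x| ≤ 1) {n : ℝ → ℝ}
    (hn : ∀ᵐ s ∂(volume.restrict (Ioo 0 (2 * L))), SliceVar (Ioo 0 1) (fun t => g (s, t)) (n s)) :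
    ofReal (∫ x in nucleus L, g x * pd 1 φ x) ≤ ∫⁻ s in Ioo 0 (2 * L), ofReal (n s) := by
  rw [nucleus_restrict, integral_prod _ (integrable_mul_test_nucleus hg hφ 1)]
  refine (Real.ofReal_le_enorm _).trans ((enorm_integral_le_lintegral_enorm _).trans
    (lintegral_mono_ae (hn.mono fun s hs => ?_)))
  exact enorm_integral_slice_le (γ := fun t => (s, t)) (by fun_prop) continuous_snd (fun _ => rfl)
    hφ h1 (fun t ht => ht.2) (hasDerivAt_snd (hφ.1.of_le (by simp)) s) hs

/-- The variation in the first direction, by Fubini's theorem. -/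
theorem ofReal_integral_mul_partialDeriv_zero_le (hg : MemL2loc g)
    (hφ : IsTest (nucleus L) φ) (h1 : ∀ x, |φ x| ≤ 1) {n : ℝ → ℝ}
    (hn : ∀ᵐ t ∂(volume.restrict (Ioo 0 1)), SliceVar (Ioo 0 (2 * L)) (fun s => g (s, t)) (n t)) :
    ofReal (∫ x in nucleus L, g x * pd 0 φ x) ≤ ∫⁻ t in Ioo 0 1, ofReal (n t) := by
  rw [nucleus_restrict, integral_prod_symm _ (integrable_mul_test_nucleus hg hφ 0)]
  refine (Real.ofReal_le_enorm _).trans ((enorm_integral_le_lintegral_enorm _).trans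
    (lintegral_mono_ae (hn.mono fun t ht => ?_)))
  exact enorm_integral_slice_le (γ := fun s => (s, t)) (by fun_prop) continuous_fst (fun _ => rfl)
    hφ h1 (fun t ht => ht.1) (fun s => hasDerivAt_fst (hφ.1.of_le (by simp)) s t) ht

/-- The mixed second derivatives commute in the sense of distributions. -/
theorem integral_lpart_comm (hv : LocLip v) (hφ : IsTest U φ) (i j : Fin 2) :
    ∫ x, lpart j v x * pd i φ x = ∫ x, lpart i v x * pd j φ x := by
  have h1 := (isWeakPartial_lpart hv j).2 _ ((hφ.partialDeriv i).mono (subset_univ _))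
  have h2 := (isWeakPartial_lpart hv i).2 _ ((hφ.partialDeriv j).mono (subset_univ _))
  have e : ∀ x, pd j (pd i φ) x = pd i (pd j φ) x :=
    fun x => partialDeriv_comm hφ.1 j i x
  grind

/-- Bounds for the variation of the partial derivatives of `v` along almost every line. -/
structure SliceBounds (L : ℝ) (v : Plane → ℝ) (n22 n12 n11 : ℝ → ℝ) : Prop where
  snd_snd : ∀ᵐ s ∂volume.restrict (Ioo 0 (2 * L)),
    SliceVar (Ioo 0 1) (fun t => lpart 1 v (s, t)) (n22 s)
  fst_snd : ∀ᵐ s ∂volume.restrict (Ioo 0 (2 * L)),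
    SliceVar (Ioo 0 1) (fun t => lpart 0 v (s, t)) (n12 s)
  fst_fst : ∀ᵐ t ∂volume.restrict (Ioo 0 1),
    SliceVar (Ioo 0 (2 * L)) (fun s => lpart 0 v (s, t)) (n11 t)

variable {n22 n12 n11 : ℝ → ℝ}

/-- The total variation of the second derivative in terms of one-dimensional slices. -/
theorem hessVar_scalarField_le (hv : LocLip v)
    (h : SliceBounds L v n22 n12 n11) :
    hessVar (scalarField v) (nucleus L)
      ≤ (∫⁻ s in Ioo 0 (2 * L), ofReal (n22 s))
        + 2 * (∫⁻ s in Ioo 0 (2 * L), ofReal (n12 s))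
        + ∫⁻ t in Ioo 0 1, ofReal (n11 t) := by
  refine iSup₂_le fun φ hφ => ?_
  have hb : ∀ i j x, |φ i j 0 x| ≤ 1 := by
    intro i j x
    rw [← sq_le_one_iff_abs_le_one]
    refine le_trans ?_ (hφ.2 x)
    exact (Finset.single_le_sum (f := fun k => φ i j k x ^ 2) (fun i _ => by positivity)
      (Finset.mem_univ 0)).trans ((Finset.single_le_sum (f := fun j => ∑ k, φ i j k x ^ 2)
      (fun i _ => by positivity) (Finset.mem_univ j)).trans (Finset.single_le_sum
      (f := fun i => ∑ j, ∑ k, φ i j k x ^ 2) (fun i _ => by positivity) (Finset.mem_univ i)))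
  have hm : ∀ j, MemL2loc (lpart j v) := fun j => (isWeakPartial_lpart hv j).1
  have e0 : ∀ i j, ∫ x in nucleus L, weakPartial j (fun y => scalarField v y 0) x
      * pd i (φ i j 0) x = ∫ x in nucleus L, lpart j v x * pd i (φ i j 0) x := by
    intro i j
    refine integral_congr_ae (ae_restrict_of_ae ?_)
    filter_upwards [weakPartial_ae_eq_lpart hv j] with x hx
    rw [scalarField_zero, hx]
  have e1 : ∀ i j, ∫ x in nucleus L, weakPartial j (fun y => scalarField v y 1) x
      * pd i (φ i j 1) x = 0 := by
    intro i j
    refine integral_eq_zero_of_ae (ae_restrict_of_ae ?_)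
    filter_upwards [weakPartial_zero_ae j] with x hx
    rw [scalarField_one, hx]; simp
  simp only [Fin.sum_univ_two, e0, e1, add_zero]
  have ht := fun i j => hφ.1 i j 0
  have a11 := ofReal_integral_mul_partialDeriv_zero_le (hm 0) (ht 0 0) (hb 0 0) h.fst_fst
  have a22 := ofReal_integral_mul_partialDeriv_one_le (hm 1) (ht 1 1) (hb 1 1) h.snd_snd
  have a12 := ofReal_integral_mul_partialDeriv_one_le (hm 0) (ht 1 0) (hb 1 0) h.fst_snd
  have a21 := ofReal_integral_mul_partialDeriv_one_le (hm 0) (ht 0 1) (hb 0 1) h.fst_snd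
  rw [setIntegral_mul_partialDeriv (ht 0 1), ← integral_lpart_comm hv (ht 0 1),
    ← setIntegral_mul_partialDeriv (ht 0 1)] at a21
  refine ofReal_add_le.trans ((add_le_add ofReal_add_le
    ofReal_add_le).trans ?_)
  refine (add_le_add (add_le_add a11 a21) (add_le_add a12 a22)).trans (le_of_eq ?_)
  ring

/-- An upper bound for the elastic energy density of `(v, 0)` with gradient `(a, b)` in the nucleus. -/
def wellDens (θ a b : ℝ) : ℝ := a ^ 2 + min ((b - θ) ^ 2) ((b + 1 - θ) ^ 2)

/-- The energy `E` of a locally Lipschitz function in terms of its classical partial derivatives. -/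
theorem energyE_le (hv : LocLip v) :
    energyE μ ε θ L v
      ≤ ofReal μ * (∫⁻ x in (nucleus L)ᶜ, ofReal (lpart 0 v x ^ 2 + lpart 1 v x ^ 2))
        + (∫⁻ x in nucleus L, ofReal (wellDens θ (lpart 0 v x) (lpart 1 v x)))
        + ofReal ε * hessVar (scalarField v) (nucleus L) := by
  have hg : ∀ᵐ x, grad (scalarField v) x = !![lpart 0 v x, lpart 1 v x; 0, 0] := by
    filter_upwards [weakPartial_ae_eq_lpart hv 0, weakPartial_ae_eq_lpart hv 1,
      weakPartial_zero_ae 0, weakPartial_zero_ae 1] with x h0 h1 h2 h3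
    ext k j
    fin_cases k <;> fin_cases j
    exacts [h0, h1, h2, h3]
  unfold energyE energyI
  refine add_le_add (add_le_add (mul_le_mul_right (lintegral_mono_ae (ae_restrict_of_ae ?_)) _)
    (lintegral_mono_ae (ae_restrict_of_ae ?_))) le_rfl
  · filter_upwards [hg] with x hx
    rw [hx, matNorm_sq]
    simp
  · filter_upwards [hg] with x hx
    refine ofReal_le_ofReal ?_
    rw [strain_eq, hx, matNorm_sq, matNorm_sq, wellDens]
    simp only [symPart, symE]
    simp
    rcases min_choice ((lpart 1 v x - θ) ^ 2) ((lpart 1 v x + 1 - θ) ^ 2) with h | h <;> rw [h]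
    · left
      nlinarith
    · right
      nlinarith

/-! ### Tent functions -/

/-- The distance of the first coordinate to the ends of `[0, 2L]`, negative outside. -/
def depth (L s : ℝ) : ℝ := min s (2 * L - s)

/-- A bound for the number of teeth of a branching of length `l` met at the abscissa `s`. -/
notation "rate(" l "," L "," s ")" => (l / depth L s) ^ (3 / 4 : ℝ)

/-- A function of the abscissa that is piecewise affine in the depth, with values in `[0, 1]`. -/
notation "trace(" α "," β "," L "," s ")" => max (min (α + β * depth L s) 1) 0

@[fun_prop] theorem locallyLipschitz_depth (L : ℝ) :
    LocLip fun x : Plane => depth L x.1 := by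
  unfold depth; fun_prop

theorem lpart_affine' (a b c : ℝ) (h : ∀ x, f x = a + b * x.1 + c * x.2)
    (x : Plane) : lpart 0 f x = b ∧ lpart 1 f x = c := by
  have : f = fun x => a + b * x.1 + c * x.2 := funext h
  rw [this]; exact ⟨lpart_affine a b c 0 x, lpart_affine a b c 1 x⟩

/-- A piecewise affine tent over the interval `[a, b]` of the second variable, truncated at a
height that grows linearly from `0` with the distance from the ends of the nucleus. -/
def tent (L α β a b σ k H : ℝ) (x : Plane) : ℝ :=
  max (min (min (α * (x.2 - a)) (β * (b - x.2)))
    (min (min (σ * (x.1 - k)) (σ * (2 * L - x.1 - k))) H)) 0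

section Tent

@[fun_prop] theorem locallyLipschitz_tent : LocLip (tent L α β a b σ k H) := by
  unfold tent; fun_prop

/-- The partial derivatives of a tent function. -/
theorem lpart_tent (hα : 0 < α) (hβ : 0 < β) (hσ : 0 < σ) :
    ∀ᵐ x : Plane,
      (lpart 1 (tent L α β a b σ k H) x =
        {z | 0 < α * (z - a) ∧ α * (z - a) ≤ β * (b - z) ∧ α * (z - a) ≤
          min (min (σ * (x.1 - k)) (σ * (2 * L - x.1 - k))) H}.indicator (fun _ => α) x.2
        + {z | 0 < β * (b - z) ∧ β * (b - z) < α * (z - a) ∧ β * (b - z) ≤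
          min (min (σ * (x.1 - k)) (σ * (2 * L - x.1 - k))) H}.indicator (fun _ => -β) x.2) ∧
      (lpart 0 (tent L α β a b σ k H) x =
        {y : Plane | y.1 ≤ 2 * L - y.1 ∧ 0 < σ * (y.1 - k) ∧ σ * (y.1 - k) < H ∧
          σ * (y.1 - k) < α * (y.2 - a) ∧ σ * (y.1 - k) < β * (b - y.2)}.indicator (fun _ => σ) x
        + {y : Plane | 2 * L - y.1 < y.1 ∧ 0 < σ * (2 * L - y.1 - k) ∧ σ * (2 * L - y.1 - k) < H ∧
          σ * (2 * L - y.1 - k) < α * (y.2 - a) ∧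
          σ * (2 * L - y.1 - k) < β * (b - y.2)}.indicator (fun _ => -σ) x) := by
  have l1 : LocLip fun x : Plane => α * (x.2 - a) := by fun_prop
  have l2 : LocLip fun x : Plane => β * (b - x.2) := by fun_prop
  have l3 : LocLip fun x : Plane => σ * (x.1 - k) := by fun_prop
  have l4 : LocLip fun x : Plane => σ * (2 * L - x.1 - k) := by fun_prop
  have d1 := lpart_affine' (f := fun x : Plane => α * (x.2 - a)) (-α * a) 0 α fun x => by ring
  have d2 := lpart_affine' (f := fun x : Plane => β * (b - x.2)) (β * b) 0 (-β) fun x => by ring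
  have d3 := lpart_affine' (f := fun x : Plane => σ * (x.1 - k)) (-σ * k) σ 0 fun x => by ring
  have d4 := lpart_affine' (f := fun x : Plane => σ * (2 * L - x.1 - k)) (σ * (2 * L - k)) (-σ) 0
    fun x => by ring
  have l12 := l1.min l2
  have l34 := l3.min l4
  have lH : LocLip fun _ : Plane => H := .const H
  have l34H := l34.min lH
  filter_upwards [lpart_min l1 l2 0, lpart_min l1 l2 1, lpart_min l3 l4 0, lpart_min l3 l4 1,
    lpart_min l34 lH 0, lpart_min l34 lH 1, lpart_min l12 l34H 0, lpart_min l12 l34H 1,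
    lpart_max (l12.min l34H) (.const 0) 0, lpart_max (l12.min l34H)
        (.const 0) 1] with x e1 e2 e3 e4 e5 e6 e7 e8 e9 e10
  simp only [(d1 x).1, (d1 x).2, (d2 x).1, (d2 x).2, (d3 x).1, (d3 x).2, (d4 x).1, (d4 x).2,
    lpart_const] at e1 e2 e3 e4 e5 e6 e7 e8 e9 e10
  have hσe : σ * (x.1 - k) ≤ σ * (2 * L - x.1 - k) ↔ x.1 ≤ 2 * L - x.1 := by
    rw [mul_le_mul_iff_right₀ hσ]; grind
  rw [show tent L α β a b σ k H = fun x : Plane => max (min (min (α * (x.2 - a)) (β * (b - x.2)))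
    (min (min (σ * (x.1 - k)) (σ * (2 * L - x.1 - k))) H)) 0 from rfl]
  simp only [indicator_apply, mem_setOf_eq]
  generalize α * (x.2 - a) = f at *
  generalize β * (b - x.2) = g at *
  generalize σ * (x.1 - k) = p at *
  generalize σ * (2 * L - x.1 - k) = q at *
  generalize 2 * L - x.1 = w at *
  generalize x.1 = w' at *
  constructor <;> grind

end Tent

theorem ae_slice_fst {P : Plane → Prop} (h : ∀ᵐ x, P x) : ∀ᵐ s : ℝ, ∀ᵐ t : ℝ, P (s, t) :=
  Measure.ae_ae_of_ae_prod h

theorem ae_slice_snd {P : Plane → Prop} (h : ∀ᵐ x, P x) : ∀ᵐ t : ℝ, ∀ᵐ s : ℝ, P (s, t) := by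
  have h' := (Measure.measurePreserving_swap (μ := volume)
    (ν := volume)).quasiMeasurePreserving.ae h
  exact Measure.ae_ae_of_ae_prod h'

section Tent

theorem volume_inter_ne_top (h : J ∩ I ⊆ Icc p q) :
    volume (J ∩ I) ≠ ⊤ :=
  ((measure_mono h).trans_lt (by simp)).ne

theorem sliceVar_indicator' (p q : ℝ)
    (hJ : ∀ z ∈ J, ∀ z' ∈ J, ∀ t, z ≤ t → t ≤ z' → t ∈ J)
    (hv : ∀ z ∈ J, z ∈ I → p ≤ z ∧ z ≤ q) (c : ℝ) :
    SliceVar I (J.indicator fun _ => c) (2 * |c|) :=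
  sliceVar_indicator ⟨fun z hz z' hz' t ht => hJ z hz z' hz' t ht.1 ht.2⟩
    (volume_inter_ne_top (p := p) (q := q) fun z hz => hv z hz.1 hz.2) c

theorem tent_slice_one_snd (hα : 0 < α) (hβ : 0 < β) (hσ : 0 < σ) :
    ∀ᵐ s : ℝ, SliceVar univ (fun t => lpart 1 (tent L α β a b σ k H) (s, t)) (2 * (α + β)) := by
  filter_upwards [ae_slice_fst (lpart_tent (L := L) (k := k) (H := H)
    hα hβ hσ)] with s hs
  set q := min (min (σ * (s - k)) (σ * (2 * L - s - k))) H
  have h1 : SliceVar univ ({z | 0 < α * (z - a) ∧ α * (z - a) ≤ β * (b - z) ∧ α *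
      (z - a) ≤ q}.indicator
      fun _ => α) (2 * |α|) := by
    refine sliceVar_indicator' a b ?_ ?_ α
    · intro z hz z' hz' t ht ht'
      have h1 : α * (z - a) ≤ α * (t - a) := by gcongr
      have h3 : α * (t - a) ≤ α * (z' - a) := by gcongr
      have h4 : β * (b - z') ≤ β * (b - t) := by gcongr
      grind
    · intro z hz _
      have h1 := (mul_pos_iff_of_pos_left hα).1 hz.1
      have h2 := (mul_pos_iff_of_pos_left hβ).1 (hz.1.trans_le hz.2.1)
      constructor <;> linarith
  have h2 : SliceVar univ ({z | 0 < β * (b - z) ∧ β * (b - z) < α * (z - a) ∧ β *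
      (b - z) ≤ q}.indicator
      fun _ => -β) (2 * |-β|) := by
    refine sliceVar_indicator' a b ?_ ?_ (-β)
    · intro z hz z' hz' t ht ht'
      have h3 : α * (z - a) ≤ α * (t - a) := by gcongr
      have h4 : β * (b - t) ≤ β * (b - z) := by gcongr
      have h5 : β * (b - z') ≤ β * (b - t) := by gcongr
      grind
    · intro z hz _
      have h1 := (mul_pos_iff_of_pos_left hα).1 (hz.1.trans hz.2.1)
      have h2 := (mul_pos_iff_of_pos_left hβ).1 hz.1
      constructor <;> linarith
  refine ((h1.add h2).congr_ae ?_).mono subset_rfl (le_of_eq ?_)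
  · exact ae_restrict_of_ae (hs.mono fun t ht => ht.1)
  grind

theorem tent_slice_zero_snd (hα : 0 < α) (hβ : 0 < β) (hσ : 0 < σ) :
    ∀ᵐ s : ℝ, SliceVar univ (fun t => lpart 0 (tent L α β a b σ k H) (s, t)) (4 * σ) := by
  filter_upwards [ae_slice_fst (lpart_tent (L := L) (k := k) (H := H)
    hα hβ hσ)] with s hs
  have h1 : ∀ (P : Prop) (p c : ℝ), (P → 0 < p) → SliceVar univ ({z | P ∧ p < α * (z - a) ∧
      p < β * (b - z)}.indicator fun _ => c) (2 * |c|) := by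
    intro P p c hp
    refine sliceVar_indicator' a b ?_ ?_ c
    · intro z hz z' hz' t ht ht'
      have h3 : α * (z - a) ≤ α * (t - a) := by gcongr
      have h4 : β * (b - z') ≤ β * (b - t) := by gcongr
      grind
    · intro z hz _
      have h1 := (mul_pos_iff_of_pos_left hα).1 ((hp hz.1).trans hz.2.1)
      have h2 := (mul_pos_iff_of_pos_left hβ).1 ((hp hz.1).trans hz.2.2)
      constructor <;> linarith
  refine (((h1 (s ≤ 2 * L - s ∧ 0 < σ * (s - k) ∧ σ * (s - k) < H) (σ * (s - k)) σ
    fun h => h.2.1).add (h1 (2 * L - s < s ∧ 0 < σ * (2 * L - s - k) ∧ σ * (2 * L - s - k) < H)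
    (σ * (2 * L - s - k)) (-σ) fun h => h.2.1)).congr_ae ?_).mono subset_rfl (le_of_eq ?_)
  · refine ae_restrict_of_ae (hs.mono fun t ht => ht.2.trans ?_)
    simp only [indicator_apply, mem_setOf_eq, and_assoc]
  grind

theorem tent_slice_zero_fst (hα : 0 < α) (hβ : 0 < β) (hσ : 0 < σ) :
    ∀ᵐ t : ℝ, SliceVar (Ioo 0 (2 * L)) (fun s => lpart 0 (tent L α β a b σ k H) (s, t))
      (4 * σ) := by
  filter_upwards [ae_slice_snd (lpart_tent (L := L) (k := k) (H := H)
    hα hβ hσ)] with t ht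
  have h1 : SliceVar (Ioo 0 (2 * L)) ({s : ℝ | s ≤ 2 * L - s ∧ 0 < σ * (s - k) ∧ σ * (s - k) < H ∧
      σ * (s - k) < α * (t - a) ∧ σ * (s - k) < β * (b - t)}.indicator fun _ => σ) (2 * |σ|) := by
    refine sliceVar_indicator' 0 (2 * L) ?_ (fun z _ hz => ⟨hz.1.le, hz.2.le⟩) σ
    intro z hz z' hz' t ht ht'
    have h3 : σ * (z - k) ≤ σ * (t - k) := by gcongr
    have h4 : σ * (t - k) ≤ σ * (z' - k) := by gcongr
    grind
  have h2 : SliceVar (Ioo 0 (2 * L)) ({s : ℝ | 2 * L - s < s ∧ 0 < σ * (2 * L - s - k) ∧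
      σ * (2 * L - s - k) < H ∧ σ * (2 * L - s - k) < α * (t - a) ∧
      σ * (2 * L - s - k) < β * (b - t)}.indicator fun _ => -σ) (2 * |-σ|) := by
    refine sliceVar_indicator' 0 (2 * L) ?_ (fun z _ hz => ⟨hz.1.le, hz.2.le⟩) (-σ)
    intro z hz z' hz' t ht ht'
    have h3 : σ * (2 * L - t - k) ≤ σ * (2 * L - z - k) := by gcongr
    have h4 : σ * (2 * L - z' - k) ≤ σ * (2 * L - t - k) := by gcongr
    exact ⟨by linarith [hz.1], hz'.2.1.trans_le h4, h3.trans_lt hz.2.2.1,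
      h3.trans_lt hz.2.2.2.1, h3.trans_lt hz.2.2.2.2⟩
  refine ((h1.add h2).congr_ae ?_).mono subset_rfl (le_of_eq ?_)
  · refine ae_restrict_of_ae (ht.mono fun s hs => hs.2.trans ?_)
    simp only [indicator_apply, mem_setOf_eq]
  grind

end Tent

/-! ### Self-similar branching -/

/-- The periodic laminate profile over one period `[0, r]`, with slopes `lam` and `lam - 1`. -/
def tooth (lam r z : ℝ) : ℝ := max (min (lam * z) ((1 - lam) * (r - z))) 0

/-- Branching construction on a strip of width `r`. At distance at least `l` from the ends of the
nucleus it is a single tooth; `K` is the number of times the period is halved. Each halving takes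
place while the distance from the ends decreases by a factor three. -/
def branch (L lam : ℝ) : ℕ → ℝ → ℝ → Plane → ℝ
  | 0, r, l => tent L lam (1 - lam) 0 r (lam * r / l) 0 (lam * r)
  | K + 1, r, l => fun x => branch L lam K (r / 2) (l / 3) x
      + branch L lam K (r / 2) (l / 3) (x.1, x.2 - r / 2)
      + tent L 1 1 ((1 - lam) * r / 2) (r - lam * r / 2) (3 * lam * r / (4 * l)) (l / 3)
        (lam * r / 2) x

theorem branch_succ_apply (L lam : ℝ) (K : ℕ) (r l : ℝ) (x : Plane) :
    branch L lam (K + 1) r l x = branch L lam K (r / 2) (l / 3) x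
      + branch L lam K (r / 2) (l / 3) (x.1, x.2 - r / 2)
      + tent L 1 1 ((1 - lam) * r / 2) (r - lam * r / 2) (3 * lam * r / (4 * l)) (l / 3)
        (lam * r / 2) x := rfl

theorem tent_eq (hσ : 0 < σ) (x : Plane) : tent L α β a b σ k H x
    = max (min (min (α * (x.2 - a)) (β * (b - x.2))) (min (σ * (depth L x.1 - k)) H)) 0 := by
  rw [tent, depth, ← min_sub_sub_right, mul_min_of_nonneg _ _ hσ.le]

theorem ae_snd_ne (c : ℝ) : ∀ᵐ x : Plane, x.2 ≠ c :=
  (Measure.quasiMeasurePreserving_snd (μ := volume)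
    (ν := volume)).ae (Measure.ae_ne volume c)

theorem ae_depth_ne (L c : ℝ) : ∀ᵐ s : ℝ, depth L s ≠ c := by
  filter_upwards [Measure.ae_ne volume c, Measure.ae_ne volume (2 * L - c)] with s h1 h2 h
  rcases min_choice s (2 * L - s) with h3 | h3 <;> rw [depth, h3] at h
  · exact h1 h
  · exact h2 (by linarith)

theorem ae_depth_fst_ne (L c : ℝ) : ∀ᵐ x : Plane, depth L x.1 ≠ c :=
  (Measure.quasiMeasurePreserving_fst (μ := volume)
    (ν := volume)).ae (ae_depth_ne L c)

theorem continuous_depth (L : ℝ) : Continuous (depth L) := by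
  unfold depth; fun_prop

theorem lpart_eq_zero_of_forall (hU : IsOpen U)
    (h : ∀ x ∈ U, f x = 0) (hx : x ∈ U) (i : Fin 2) : lpart i f x = 0 := by
  rw [lpart_congr (g := fun _ => 0) (eventually_of_mem (hU.mem_nhds hx) h), lpart_const]

section Branch

@[fun_prop] theorem locallyLipschitz_branch (L lam : ℝ) (K : ℕ) :
    ∀ r l : ℝ, LocLip (branch L lam K r l) := by
  induction K with
  | zero => intro r l; exact locallyLipschitz_tent
  | succ K ih => intro r l; unfold branch; fun_prop

theorem branch_eq_zero (h0 : 0 < lam) (h1 : lam ≤ 1 / 2) (K : ℕ) : ∀ {r l : ℝ}, 0 < r → 0 < l →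
    ∀ x : Plane, (x.2 ≤ 0 ∨ r ≤ x.2 ∨ depth L x.1 ≤ 0) → branch L lam K r l x = 0 := by
  induction K with
  | zero =>
    intro r l hr hl x hx
    have hσ : 0 < lam * r / l := by positivity
    rw [branch, tent_eq hσ, max_eq_right]
    rcases hx with hx | hx | hx
    · exact (min_le_left _ _).trans ((min_le_left _ _).trans (by nlinarith))
    · exact (min_le_left _ _).trans ((min_le_right _ _).trans (by nlinarith))
    · exact (min_le_right _ _).trans ((min_le_left _ _).trans (by nlinarith))
  | succ K ih =>
    intro r l hr hl x hx
    have hσ : 0 < 3 * lam * r / (4 * l) := by positivity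
    have hlr : lam * r ≤ r / 2 := by nlinarith
    have hlr' : 0 < lam * r := by positivity
    have e1 : branch L lam K (r / 2) (l / 3) x = 0 := by
      grind
    have e2 : branch L lam K (r / 2) (l / 3) (x.1, x.2 - r / 2) = 0 := by
      grind
    rw [branch_succ_apply, e1, e2, tent_eq hσ, max_eq_right]
    · ring
    rcases hx with hx | hx | hx
    · grind
    · grind
    · exact (min_le_right _ _).trans ((min_le_left _ _).trans (by nlinarith))

/-- A tooth consists of two teeth of half the size and a trapezoid with slopes one. -/
theorem tooth_halving (h0 : 0 < lam) (h1 : lam ≤ 1 / 2) (hr : 0 < r) (z : ℝ) :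
    tooth lam (r / 2) z + tooth lam (r / 2) (z - r / 2)
      + max (min (min (1 * (z - (1 - lam) * r / 2)) (1 * (r - lam * r / 2 - z))) (lam * r / 2)) 0
      = tooth lam r z := by
  unfold tooth
  have a1 : 0 ≤ z → 0 ≤ lam * z ∧ 2 * (lam * z) ≤ z := fun h => ⟨by positivity, by nlinarith⟩
  have a2 : z ≤ 0 → lam * z ≤ 0 ∧ z ≤ 2 * (lam * z) := fun h => ⟨by nlinarith, by nlinarith⟩
  have b1 : r / 2 ≤ z → 0 ≤ lam * (z - r / 2) ∧ 2 * (lam * (z - r / 2)) ≤ z - r / 2 :=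
    fun h => ⟨mul_nonneg h0.le (by linarith), by nlinarith⟩
  have b2 : z ≤ r / 2 → lam * (z - r / 2) ≤ 0 ∧ z - r / 2 ≤ 2 * (lam * (z - r / 2)) :=
    fun h => ⟨by nlinarith, by nlinarith⟩
  have c1 : r ≤ z → 0 ≤ lam * (z - r) ∧ 2 * (lam * (z - r)) ≤ z - r :=
    fun h => ⟨mul_nonneg h0.le (by linarith), by nlinarith⟩
  have c2 : z ≤ r → lam * (z - r) ≤ 0 ∧ z - r ≤ 2 * (lam * (z - r)) :=
    fun h => ⟨by nlinarith, by nlinarith⟩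
  have d1 : 0 < lam * r := by positivity
  have d2 : 2 * (lam * r) ≤ r := by nlinarith
  have e1 : (1 - lam) * (r / 2 - z) = r / 2 - z - lam * r / 2 + lam * z := by ring
  have e2 : (1 - lam) * (r / 2 - (z - r / 2)) = r - z - lam * r + lam * z := by ring
  have e3 : (1 - lam) * (r - z) = r - z - lam * r + lam * z := by ring
  have e4 : (1 - lam) * r / 2 = r / 2 - lam * r / 2 := by ring
  have e5 : lam * (z - r / 2) = lam * z - lam * r / 2 := by ring
  have e6 : lam * (z - r) = lam * z - lam * r := by ring
  rw [e1, e2, e3, e4, e5]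
  rw [e5] at b1 b2
  rw [e6] at c1 c2
  generalize lam * z = p at *
  generalize lam * r = q at *
  clear e1 e2 e3 e4 e5 e6 h0 h1
  rcases le_total z 0 with hz | hz
  · grind
  rcases le_total z (r / 2) with hz2 | hz2
  · grind
  rcases le_total z r with hz3 | hz3
  · obtain ⟨h2, h3⟩ := b1 hz2
    obtain ⟨h4, h5⟩ := c2 hz3
    clear a1 a2 b1 b2 c1 c2
    grind
  grind

theorem branch_eq_tooth (h0 : 0 < lam) (h1 : lam ≤ 1 / 2) (K : ℕ) : ∀ {r l : ℝ}, 0 < r → 0 < l →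
    ∀ x : Plane, l ≤ depth L x.1 → branch L lam K r l x = tooth lam r x.2 := by
  induction K with
  | zero =>
    intro r l hr hl x hx
    have hσ : 0 < lam * r / l := by positivity
    rw [branch, tent_eq hσ, sub_zero, tooth, sub_zero]
    have h2 : lam * r ≤ lam * r / l * depth L x.1 := by
      rw [div_mul_eq_mul_div, le_div_iff₀ hl]; gcongr
    rw [min_eq_right h2]
    rcases le_total x.2 r with h3 | h3
    · rw [min_eq_left]
      exact (min_le_left _ _).trans (by gcongr)
    · have h4 : min (lam * x.2) ((1 - lam) * (r - x.2)) ≤ 0 :=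
        (min_le_right _ _).trans (by nlinarith)
      grind
  | succ K ih =>
    intro r l hr hl x hx
    have hσ : 0 < 3 * lam * r / (4 * l) := by positivity
    rw [branch_succ_apply, ih (by positivity) (by positivity) x (by linarith),
      ih (by positivity) (by positivity) (x.1, x.2 - r / 2) (by simp only; linarith),
      tent_eq hσ, ← tooth_halving h0 h1 hr]
    have h2 : lam * r / 2 ≤ 3 * lam * r / (4 * l) * (depth L x.1 - l / 3) := by
      rw [div_mul_eq_mul_div, le_div_iff₀ (by positivity)]
      nlinarith [mul_pos h0 hr]
    rw [min_eq_right h2]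

end Branch

theorem three_rpow_ge : (3 / 2 : ℝ) ≤ 3 ^ (3 / 8 : ℝ) := by
  refine (pow_le_pow_iff_left₀ (by norm_num) (by positivity) (n := 8) (by norm_num)).1 ?_
  rw [← Real.rpow_natCast (3 ^ (3 / 8 : ℝ)) 8, ← Real.rpow_mul (by norm_num)]
  norm_num

theorem three_rpow_ge' : (2 : ℝ) ≤ 3 ^ (3 / 4 : ℝ) := by
  have h : (3 : ℝ) ^ (3 / 4 : ℝ) = 3 ^ (3 / 8 : ℝ) * 3 ^ (3 / 8 : ℝ) := by
    rw [← Real.rpow_add (by norm_num)]; norm_num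
  rw [h]
  nlinarith [three_rpow_ge]

section Branch

theorem isOpen_depth_lt (L c : ℝ) : IsOpen {x : Plane | depth L x.1 < c} :=
  isOpen_lt ((continuous_depth L).comp continuous_fst) continuous_const

theorem isOpen_lt_depth (L c : ℝ) : IsOpen {x : Plane | c < depth L x.1} :=
  isOpen_lt continuous_const ((continuous_depth L).comp continuous_fst)

theorem lpart_branch_eq_zero (h0 : 0 < lam) (h1 : lam ≤ 1 / 2) (K : ℕ) (hr : 0 < r)
    (hl : 0 < l) (hx : x.2 < 0 ∨ r < x.2 ∨ depth L x.1 < 0) (i : Fin 2) :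
    lpart i (branch L lam K r l) x = 0 := by
  have hU : IsOpen {x : Plane | x.2 < 0 ∨ r < x.2 ∨ depth L x.1 < 0} :=
    (isOpen_lt continuous_snd continuous_const).union
      ((isOpen_lt continuous_const continuous_snd).union (isOpen_depth_lt L 0))
  refine lpart_eq_zero_of_forall hU (fun y hy => branch_eq_zero h0 h1 K hr hl y ?_) hx i
  grind

theorem lpart_tent_eq_zero (hσ : 0 < σ) (hx : depth L x.1 < k) (i : Fin 2) : lpart i
    (tent L α β a b σ k H) x = 0 := by
  refine lpart_eq_zero_of_forall (isOpen_depth_lt L k) (fun y hy => ?_) hx i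
  have hy' : depth L y.1 < k := hy
  rw [tent_eq hσ, max_eq_right]
  exact (min_le_right _ _).trans ((min_le_left _ _).trans (by nlinarith))

theorem lpart_left_of_eq_tooth (h0 : 0 < lam) (hF : ∀ x : Plane,
    l ≤ depth L x.1 → F x = tooth lam r x.2)
    (hx : l < depth L x.1) (h2 : 0 < x.2) (h3 : x.2 < (1 - lam) * r) :
    lpart 0 F x = 0 ∧ lpart 1 F x = lam := by
  have hU : IsOpen {y : Plane | l < depth L y.1 ∧ 0 < y.2 ∧ y.2 < (1 - lam) * r} :=
    (isOpen_lt_depth L l).inter ((isOpen_lt continuous_const continuous_snd).inter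
      (isOpen_lt continuous_snd continuous_const))
  have he : F =ᶠ[𝓝 x] fun y => lam * y.2 := by
    refine eventually_of_mem (hU.mem_nhds ⟨hx, h2, h3⟩) fun y hy => ?_
    rw [hF y hy.1.le, tooth, min_eq_left, max_eq_left]
    · exact mul_nonneg h0.le hy.2.1.le
    · nlinarith [hy.2.2]
  rw [lpart_congr he, lpart_congr he]
  exact lpart_affine' 0 0 lam (fun y => by ring) x

theorem lpart_right_of_eq_tooth (h1 : lam ≤ 1) (hF : ∀ x : Plane,
    l ≤ depth L x.1 → F x = tooth lam r x.2)
    (hx : l < depth L x.1) (h2 : (1 - lam) * r < x.2) (h3 : x.2 < r) :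
    lpart 0 F x = 0 ∧ lpart 1 F x = lam - 1 := by
  have hU : IsOpen {y : Plane | l < depth L y.1 ∧ (1 - lam) * r < y.2 ∧ y.2 < r} :=
    (isOpen_lt_depth L l).inter ((isOpen_lt continuous_const continuous_snd).inter
      (isOpen_lt continuous_snd continuous_const))
  have he : F =ᶠ[𝓝 x] fun y => (1 - lam) * (r - y.2) := by
    refine eventually_of_mem (hU.mem_nhds ⟨hx, h2, h3⟩) fun y hy => ?_
    rw [hF y hy.1.le, tooth, min_eq_right, max_eq_left]
    · exact mul_nonneg (by linarith) (by linarith [hy.2.2])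
    · nlinarith [hy.2.1]
  rw [lpart_congr he, lpart_congr he]
  exact lpart_affine' ((1 - lam) * r) 0 (lam - 1) (fun y => by ring) x

theorem tooth_eq_zero (h0 : 0 < lam) (h1 : lam ≤ 1) {z : ℝ} (hz : z ≤ 0 ∨ r ≤ z) :
    tooth lam r z = 0 := by
  rw [tooth, max_eq_right]
  rcases hz with hz | hz
  · exact (min_le_left _ _).trans (by nlinarith)
  · exact (min_le_right _ _).trans (by nlinarith)

theorem lpart_of_eq_tooth (h0 : 0 < lam) (h1 : lam ≤ 1) (hr : 0 < r) (hF : ∀ x : Plane,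
    l ≤ depth L x.1 → F x = tooth lam r x.2) :
    ∀ᵐ x : Plane, l < depth L x.1 → lpart 0 F x = 0 ∧
      lpart 1 F x = (Ioo 0 ((1 - lam) * r)).indicator (fun _ => lam) x.2
        + (Ioo ((1 - lam) * r) r).indicator (fun _ => lam - 1) x.2 := by
  filter_upwards [ae_snd_ne 0, ae_snd_ne r, ae_snd_ne ((1 - lam) * r)] with x e1 e2 e3 hx
  have h4 : 0 ≤ (1 - lam) * r := mul_nonneg (by linarith) hr.le
  have h5 : (1 - lam) * r < r := by nlinarith
  have hU : IsOpen {y : Plane | l < depth L y.1 ∧ (y.2 < 0 ∨ r < y.2)} :=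
    (isOpen_lt_depth L l).inter ((isOpen_lt continuous_snd continuous_const).union
      (isOpen_lt continuous_const continuous_snd))
  have hz : (x.2 < 0 ∨ r < x.2) → ∀ i, lpart i F x = 0 := by
    refine fun h => lpart_eq_zero_of_forall hU (fun y hy => ?_) (x := x) ⟨hx, h⟩
    rw [hF y hy.1.le, tooth_eq_zero h0 h1 (hy.2.imp le_of_lt le_of_lt)]
  simp only [indicator_apply, mem_Ioo]
  rcases lt_or_gt_of_ne e1 with h | h
  · grind
  rcases lt_or_gt_of_ne e3 with h' | h'
  · rw [if_pos ⟨h, h'⟩, if_neg (by intro h'; linarith), add_zero]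
    exact lpart_left_of_eq_tooth h0 hF hx h h'
  rcases lt_or_gt_of_ne e2 with h'' | h''
  · rw [if_neg (by intro h'; linarith), if_pos ⟨h', h''⟩, zero_add]
    exact lpart_right_of_eq_tooth h1 hF hx h' h''
  grind

theorem sliceVar_indicator_Ioo (p q c : ℝ) :
    SliceVar univ ((Ioo p q).indicator fun _ => c) (2 * |c|) :=
  sliceVar_indicator ordConnected_Ioo
    (volume_inter_ne_top (p := p) (q := q) fun _ hz => Ioo_subset_Icc_self hz.1) c

theorem slice_of_eq_tooth (h0 : 0 < lam) (h1 : lam ≤ 1) (hr : 0 < r) (hF : ∀ x : Plane,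
    l ≤ depth L x.1 → F x = tooth lam r x.2) :
    ∀ᵐ s : ℝ, l < depth L s → SliceVar univ (fun t => lpart 1 F (s, t)) 2 ∧
      SliceVar univ (fun t => lpart 0 F (s, t)) 0 := by
  filter_upwards [ae_slice_fst (lpart_of_eq_tooth h0 h1 hr hF)] with s hs hsl
  constructor
  · refine (((sliceVar_indicator_Ioo 0 ((1 - lam) * r) lam).add
      (sliceVar_indicator_Ioo ((1 - lam) * r) r (lam - 1))).congr_ae
      (ae_restrict_of_ae (hs.mono fun t ht => (ht hsl).2))).mono subset_rfl (le_of_eq ?_)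
    grind
  · exact (sliceVar_zero univ).congr_ae (ae_restrict_of_ae (hs.mono fun t ht => (ht hsl).1))

theorem lpart_branch_full (h0 : 0 < lam) (h1 : lam ≤ 1 / 2) (K : ℕ) (hr : 0 < r)
    (hl : 0 < l) : ∀ᵐ x : Plane, l < depth L x.1 → lpart 0 (branch L lam K r l) x = 0 :=
  (lpart_of_eq_tooth h0 (h1.trans (by norm_num)) hr (branch_eq_tooth h0 h1 K hr hl)).mono
    fun _ hx h => (hx h).1

theorem lpart_branch_succ (L lam : ℝ) (K : ℕ) (r l : ℝ) (i : Fin 2) :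
    ∀ᵐ x : Plane, lpart i (branch L lam (K + 1) r l) x
      = lpart i (branch L lam K (r / 2) (l / 3)) x
        + lpart i (branch L lam K (r / 2) (l / 3)) (x.1, x.2 - r / 2)
        + lpart i (tent L 1 1 ((1 - lam) * r / 2) (r - lam * r / 2) (3 * lam * r / (4 * l)) (l / 3)
          (lam * r / 2)) x := by
  have hB := locallyLipschitz_branch L lam K (r / 2) (l / 3)
  have hB' : LocLip fun x : Plane => branch L lam K (r / 2) (l / 3) (x.1, x.2 - r / 2) := by
    fun_prop
  filter_upwards [lpart_add (hB.add hB') (locallyLipschitz_tent (L := L)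
    (a := (1 - lam) * r / 2) (σ := 3 * lam * r / (4 * l)) (k := l / 3)
    (H := lam * r / 2)) i, lpart_add hB hB' i] with x h1 h2
  rw [← lpart_translate, ← h2, ← h1]
  rfl

theorem lpart_one_tent_cases (hα : 0 < α) (hβ : 0 < β) (hσ : 0 < σ) :
    ∀ᵐ x : Plane,
      (lpart 1 (tent L α β a b σ k H) x = 0 ∧ (α * (x.2 - a) ≤ 0 ∨ β * (b - x.2) ≤ 0 ∨
        min (σ * (depth L x.1 - k)) H < α * (x.2 - a) ∧
          min (σ * (depth L x.1 - k)) H < β * (b - x.2))) ∨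
      (lpart 1 (tent L α β a b σ k H) x = α ∧ 0 < α * (x.2 - a) ∧ α * (x.2 - a) ≤ β * (b - x.2) ∧
        α * (x.2 - a) ≤ H) ∨
      (lpart 1 (tent L α β a b σ k H) x = -β ∧ 0 < β * (b - x.2) ∧ β * (b - x.2) < α * (x.2 - a) ∧
        β * (b - x.2) ≤ H) := by
  filter_upwards [lpart_tent (L := L) (a := a) (b := b) (k := k) (H := H) hα hβ hσ] with x hx
  have e : σ * (depth L x.1 - k) = min (σ * (x.1 - k)) (σ * (2 * L - x.1 - k)) := by
    rw [depth, ← min_sub_sub_right, mul_min_of_nonneg _ _ hσ.le]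
  have h := hx.1
  rw [← e] at h
  simp only [indicator_apply, mem_setOf_eq] at h
  grind

theorem abs_lpart_zero_tent_le (hα : 0 < α) (hβ : 0 < β) (hσ : 0 < σ) :
    ∀ᵐ x : Plane, |lpart 0 (tent L α β a b σ k H) x| ≤ σ := by
  filter_upwards [lpart_tent (L := L) (k := k) (H := H) hα hβ hσ] with x hx
  rw [hx.2]
  simp only [indicator_apply, mem_setOf_eq]
  split_ifs with h1 h2 h2
  · linarith [h1.1, h2.1]
  · rw [add_zero, abs_of_pos hσ]
  · rw [zero_add, abs_neg, abs_of_pos hσ]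
  · simpa using hσ.le

/-- The second derivative direction of the branching construction takes values in the two wells,
except close to the ends of the nucleus. -/
theorem branch_slopes (h0 : 0 < lam) (h1 : lam ≤ 1 / 2) (K : ℕ) : ∀ {r l : ℝ}, 0 < r → 0 < l →
    ∀ᵐ x : Plane, 0 < x.2 → x.2 < r → lpart 1 (branch L lam K r l) x = lam ∨
      lpart 1 (branch L lam K r l) x = lam - 1 ∨
      (lpart 1 (branch L lam K r l) x = 0 ∧ depth L x.1 < l / 3 ^ K) := by
  have h1' : 0 < 1 - lam := by linarith
  induction K with
  | zero =>
    intro r l hr hl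
    have hσ : 0 < lam * r / l := by positivity
    filter_upwards [lpart_one_tent_cases (L := L) (a := 0) (b := r) (k := 0) (H := lam * r)
      h0 h1' hσ] with x hx hx1 hx2
    simp only [branch, pow_zero, div_one, sub_zero] at hx ⊢
    rcases hx with hx | hx | hx
    · refine Or.inr (Or.inr ⟨hx.1, ?_⟩)
      by_contra! h
      have e1 : lam * r ≤ lam * r / l * depth L x.1 := by
        rw [div_mul_eq_mul_div, le_div_iff₀ hl]; gcongr
      rw [min_eq_right e1] at hx
      rcases hx.2 with h2 | h2 | h2
      · nlinarith
      · nlinarith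
      nlinarith
    · exact Or.inl hx.1
    grind
  | succ K ih =>
    intro r l hr hl
    have hr' : 0 < r / 2 := by positivity
    have hl' : 0 < l / 3 := by positivity
    have hσ : 0 < 3 * lam * r / (4 * l) := by positivity
    have hlr : 0 < lam * r := by positivity
    have hlr' : lam * r ≤ r / 2 := by nlinarith
    filter_upwards [lpart_branch_succ L lam K r l 1, ih hr' hl', ae_translate (ih hr' hl') (r / 2),
      lpart_one_tent_cases (L := L) (a := (1 - lam) * r / 2) (b := r - lam * r / 2) (k := l / 3)
      (H := lam * r / 2) one_pos one_pos hσ, ae_snd_ne (r / 2), ae_depth_fst_ne L (l / 3),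
      ae_snd_ne ((1 - lam) * (r / 2)), ae_snd_ne (r - lam * r / 2)]
      with x e1 e2 e3 e4 e5 e6 e9 e10 hx1 hx2
    rw [e1, pow_succ', ← div_div l 3]
    rcases lt_or_gt_of_ne e6 with h6 | h6
    · rw [lpart_tent_eq_zero hσ h6, add_zero]
      rcases lt_or_gt_of_ne e5 with h5 | h5
      · rw [lpart_branch_eq_zero h0 h1 K hr' hl' (x := (x.1, x.2 - r / 2))
          (Or.inl (by simp only; linarith)), add_zero]
        exact e2 hx1 h5
      · rw [lpart_branch_eq_zero h0 h1 K hr' hl' (x := x) (Or.inr (Or.inl h5)), zero_add]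
        grind
    rcases lt_or_gt_of_ne e5 with h5 | h5
    · rw [lpart_branch_eq_zero h0 h1 K hr' hl' (x := (x.1, x.2 - r / 2))
        (Or.inl (by simp only; linarith)), add_zero]
      rcases lt_or_gt_of_ne e9 with h9 | h9
      · grind
      · rw [(lpart_right_of_eq_tooth (h1.trans (by norm_num))
            (branch_eq_tooth h0 h1 K hr' hl') h6 h9 h5).2]
        grind
    · rw [lpart_branch_eq_zero h0 h1 K hr' hl' (x := x) (Or.inr (Or.inl h5)), zero_add]
      rcases lt_or_gt_of_ne e10 with h9 | h9
      · rw [(lpart_left_of_eq_tooth h0 (branch_eq_tooth h0 h1 K hr' hl') (x := (x.1,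
            x.2 - r / 2)) h6 (by simp only; linarith)
          (by simp only; linarith)).2]
        grind
      grind

end Branch

section Branch

theorem rpow_div_three {m γ : ℝ} (hl : 0 < l) (hm : 0 < m) :
    (l / m) ^ γ = 3 ^ γ * (l / 3 / m) ^ γ := by
  rw [← Real.mul_rpow (by norm_num) (by positivity)]
  congr 1; field_simp

theorem one_le_div_rpow {m γ : ℝ} (hm : 0 < m) (hml : m ≤ l) (hγ : 0 ≤ γ) : 1 ≤ (l / m) ^ γ :=
  Real.one_le_rpow ((one_le_div hm).2 hml) hγ

theorem branch_abs_lpart_zero (h0 : 0 < lam) (h1 : lam ≤ 1 / 2) (K : ℕ) : ∀ {r l : ℝ}, 0 < r →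
    0 < l → ∀ᵐ x : Plane, 0 < depth L x.1 → depth L x.1 < l →
      |lpart 0 (branch L lam K r l) x| ≤ lam * r / l * (l / depth L x.1) ^ (3 / 8 : ℝ) := by
  have h1' : 0 < 1 - lam := by linarith
  induction K with
  | zero =>
    intro r l hr hl
    have hσ : 0 < lam * r / l := by positivity
    filter_upwards [abs_lpart_zero_tent_le (L := L) (k := 0) (H := lam * r)
      h0 h1' hσ] with x hx hx1 hx2
    rw [branch]
    exact hx.trans (le_mul_of_one_le_right hσ.le (one_le_div_rpow hx1 hx2.le (by norm_num)))
  | succ K ih =>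
    intro r l hr hl
    have hr' : 0 < r / 2 := by positivity
    have hl' : 0 < l / 3 := by positivity
    have hσ : 0 < 3 * lam * r / (4 * l) := by positivity
    filter_upwards [lpart_branch_succ L lam K r l 0, ih hr' hl', ae_translate (ih hr' hl') (r / 2),
      abs_lpart_zero_tent_le (L := L) (a := (1 - lam) * r / 2) (k := l / 3)
      (H := lam * r / 2) one_pos one_pos hσ, ae_snd_ne (r / 2), ae_depth_fst_ne L (l / 3),
      lpart_branch_full (L := L) h0 h1 K hr' hl',
      ae_translate (lpart_branch_full (L := L) h0 h1 K hr' hl') (r / 2)]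
      with x e1 e2 e3 e4 e5 e6 e7 e8 hx1 hx2
    rw [e1]
    rcases lt_or_gt_of_ne e6 with h6 | h6
    · rw [lpart_tent_eq_zero hσ h6, add_zero]
      have key : lam * (r / 2) / (l / 3) * (l / 3 / depth L x.1) ^ (3 / 8 : ℝ)
          ≤ lam * r / l * (l / depth L x.1) ^ (3 / 8 : ℝ) := by
        rw [rpow_div_three hl hx1]
        have e : lam * (r / 2) / (l / 3) = lam * r / l * (3 / 2) := by field_simp
        rw [e, mul_assoc]
        gcongr
        exact three_rpow_ge
      rcases lt_or_gt_of_ne e5 with h5 | h5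
      · rw [lpart_branch_eq_zero h0 h1 K hr' hl' (x := (x.1, x.2 - r / 2))
          (Or.inl (by simp only; linarith)), add_zero]
        exact (e2 hx1 h6).trans key
      · rw [lpart_branch_eq_zero h0 h1 K hr' hl' (x := x) (Or.inr (Or.inl h5)), zero_add]
        exact (e3 hx1 h6).trans key
    · rw [e7 h6, e8 h6, zero_add, zero_add]
      refine e4.trans (le_trans ?_ (le_mul_of_one_le_right (by positivity)
        (one_le_div_rpow hx1 hx2.le (by norm_num))))
      rw [div_le_div_iff₀ (by positivity) hl]
      nlinarith [mul_pos (mul_pos h0 hr) hl]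

/-- For almost every line parallel to the second axis, the slice of the branching construction of
generation `K + 1` is controlled by two slices of generation `K` and by a slice of a tent. -/
theorem branch_slice_succ (K : ℕ) (i : Fin 2) {n n' : ℝ → ℝ} {P : ℝ → Prop}
    (hB : ∀ᵐ s : ℝ, P s →
      SliceVar univ (fun t => lpart i (branch L lam K (r / 2) (l / 3)) (s, t)) (n s))
    (hT : ∀ᵐ s : ℝ, P s → SliceVar univ (fun t => lpart i (tent L 1 1 ((1 - lam) * r / 2)
      (r - lam * r / 2) (3 * lam * r / (4 * l)) (l / 3) (lam * r / 2)) (s, t)) (n' s)) :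
    ∀ᵐ s : ℝ, P s →
      SliceVar univ (fun t => lpart i (branch L lam (K + 1) r l) (s, t)) (2 * n s + n' s) := by
  filter_upwards [hB, hT, ae_slice_fst (lpart_branch_succ L lam K r l i)] with s h1 h2 h3 hP
  refine ((((h1 hP).add ((h1 hP).translate (r / 2))).add (h2 hP)).congr_ae
    (ae_restrict_of_ae h3)).mono subset_rfl (le_of_eq (by ring))

/-- A line parallel to the second axis meets at most a multiple of `rate(l,L,s)` teeth, because
`2 ≤ 3 ^ (3 / 4)`. -/
theorem branch_slice_one (h0 : 0 < lam) (h1 : lam ≤ 1 / 2) (K : ℕ) : ∀ {r l : ℝ}, 0 < r →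
    0 < l → ∀ᵐ s : ℝ, (0 < depth L s ∧ depth L s < l) →
      SliceVar univ (fun t => lpart 1 (branch L lam K r l) (s, t))
        (8 * rate(l,L,s)) := by
  have h1' : 0 < 1 - lam := by linarith
  induction K with
  | zero =>
    intro r l hr hl
    have hσ : 0 < lam * r / l := by positivity
    filter_upwards [tent_slice_one_snd (L := L) (k := 0) (H := lam * r)
      h0 h1' hσ] with s hs hsl
    rw [branch]
    refine hs.mono subset_rfl ?_
    linarith [one_le_div_rpow hsl.1 hsl.2.le (γ := 3 / 4) (by norm_num)]
  | succ K ih =>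
    intro r l hr hl
    have hr' : 0 < r / 2 := by positivity
    have hl' : 0 < l / 3 := by positivity
    have hσ : 0 < 3 * lam * r / (4 * l) := by positivity
    have c1 := branch_slice_succ (P := fun s => 0 < depth L s ∧ depth L s < l / 3)
      (n' := fun _ => 0) K 1 (ih hr' hl') (.of_forall fun s hs => by
        simp only [lpart_tent_eq_zero hσ (x := (s, _)) hs.2]; exact sliceVar_zero _)
    have c2 := branch_slice_succ (P := fun s => l / 3 < depth L s) (n' := fun _ => 2 * (1 + 1))
      K 1 ((slice_of_eq_tooth h0 (h1.trans (by norm_num)) hr'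
          (branch_eq_tooth h0 h1 K hr' hl')).mono fun s hs h => (hs h).1)
      ((tent_slice_one_snd one_pos one_pos hσ).mono fun s hs _ => hs)
    filter_upwards [c1, c2, ae_depth_ne L (l / 3)] with s h2 h3 h4 h5
    rcases lt_or_gt_of_ne h4 with h | h
    · refine (h2 ⟨h5.1, h⟩).mono subset_rfl ?_
      rw [rpow_div_three hl h5.1]
      have : (0 : ℝ) ≤ (l / 3 / depth L s) ^ (3 / 4 : ℝ) :=
        Real.rpow_nonneg (div_nonneg hl'.le h5.1.le) _
      nlinarith [three_rpow_ge']
    · refine (h3 h).mono subset_rfl ?_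
      linarith [one_le_div_rpow h5.1 h5.2.le (γ := 3 / 4) (by norm_num)]

theorem branch_slice_zero (h0 : 0 < lam) (h1 : lam ≤ 1 / 2) (K : ℕ) : ∀ {r l : ℝ}, 0 < r →
    0 < l → ∀ᵐ s : ℝ, (0 < depth L s ∧ depth L s < l) →
      SliceVar univ (fun t => lpart 0 (branch L lam K r l) (s, t))
        (4 * (lam * r) / max (depth L s) (l / 3 ^ K)) := by
  have h1' : 0 < 1 - lam := by linarith
  induction K with
  | zero =>
    intro r l hr hl
    have hσ : 0 < lam * r / l := by positivity
    filter_upwards [tent_slice_zero_snd (L := L) (a := 0) (b := r) (k := 0) (H := lam * r)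
      h0 h1' hσ] with s hs hsl
    rw [branch]
    grind
  | succ K ih =>
    intro r l hr hl
    have hr' : 0 < r / 2 := by positivity
    have hl' : 0 < l / 3 := by positivity
    have hσ : 0 < 3 * lam * r / (4 * l) := by positivity
    have c1 := branch_slice_succ (P := fun s => 0 < depth L s ∧ depth L s < l / 3)
      (n' := fun _ => 0) K 0 (ih hr' hl') (Eventually.of_forall fun s hs => by
        simp only [lpart_tent_eq_zero hσ (x := (s, _)) hs.2]; exact sliceVar_zero _)
    have c2 := branch_slice_succ (P := fun s => l / 3 < depth L s)
      (n' := fun _ => 4 * (3 * lam * r / (4 * l)))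
      K 0 ((slice_of_eq_tooth h0 (h1.trans (by norm_num)) hr'
          (branch_eq_tooth h0 h1 K hr' hl')).mono fun s hs h => (hs h).2)
      ((tent_slice_zero_snd one_pos one_pos hσ).mono fun s hs _ => hs)
    filter_upwards [c1, c2, ae_depth_ne L (l / 3)] with s h2 h3 h4 h5
    rcases lt_or_gt_of_ne h4 with h | h
    · refine (h2 ⟨h5.1, h⟩).mono subset_rfl (le_of_eq ?_)
      rw [pow_succ', ← div_div l 3]; ring
    · refine (h3 h).mono subset_rfl ?_
      have e1 : max (depth L s) (l / 3 ^ (K + 1)) ≤ l :=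
        max_le h5.2.le (div_le_self hl.le (one_le_pow₀ (by norm_num)))
      have e2 : 0 < max (depth L s) (l / 3 ^ (K + 1)) := lt_max_of_lt_left h5.1
      calc 2 * 0 + 4 * (3 * lam * r / (4 * l)) = 3 * (lam * r) / l := by field_simp; ring
        _ ≤ 4 * (lam * r) / max (depth L s) (l / 3 ^ (K + 1)) := by
          gcongr
          norm_num

theorem branch_slice_fst (h0 : 0 < lam) (h1 : lam ≤ 1 / 2) (K : ℕ) : ∀ {r l : ℝ}, 0 < r →
    0 < l → ∀ᵐ t : ℝ, SliceVar (Ioo 0 (2 * L)) (fun s => lpart 0 (branch L lam K r l) (s, t))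
        (lam * r / l * (10 * (3 / 2) ^ K - 6)) := by
  have h1' : 0 < 1 - lam := by linarith
  induction K with
  | zero =>
    intro r l hr hl
    have hσ : 0 < lam * r / l := by positivity
    filter_upwards [tent_slice_zero_fst (L := L) (a := 0) (b := r) (k := 0) (H := lam * r)
      h0 h1' hσ] with s hs
    rw [branch]
    grind
  | succ K ih =>
    intro r l hr hl
    have hr' : 0 < r / 2 := by positivity
    have hl' : 0 < l / 3 := by positivity
    have hσ : 0 < 3 * lam * r / (4 * l) := by positivity
    have hsub : ∀ᵐ t : ℝ, SliceVar (Ioo 0 (2 * L))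
        (fun s => lpart 0 (branch L lam K (r / 2) (l / 3)) (s, t - r / 2))
        (lam * (r / 2) / (l / 3) * (10 * (3 / 2) ^ K - 6)) :=
      (measurePreserving_sub_right (volume : Measure ℝ) (r / 2)).quasiMeasurePreserving.ae
        (ih hr' hl')
    filter_upwards [ih hr' hl', hsub, tent_slice_zero_fst (L := L) (a := (1 - lam) * r / 2)
      (b := r - lam * r / 2) (k := l / 3) (H := lam * r / 2) one_pos one_pos hσ,
      ae_slice_snd (lpart_branch_succ L lam K r l 0), Measure.ae_ne volume (r / 2)]
      with t e1 e2 e3 e4 e5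
    have e : lam * (r / 2) / (l / 3) * (10 * (3 / 2) ^ K - 6) + 4 * (3 * lam * r / (4 * l))
        = lam * r / l * (10 * (3 / 2) ^ (K + 1) - 6) := by
      grind
    rw [← e]
    rcases lt_or_gt_of_ne e5 with h5 | h5
    · refine (e1.add e3).congr_ae (ae_restrict_of_ae (e4.mono fun s hs => ?_))
      beta_reduce
      rw [hs, lpart_branch_eq_zero h0 h1 K hr' hl' (x := (s, t - r / 2))
        (Or.inl (by simp only; linarith)), add_zero]
    · refine (e2.add e3).congr_ae (ae_restrict_of_ae (e4.mono fun s hs => ?_))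
      beta_reduce
      rw [hs, lpart_branch_eq_zero h0 h1 K hr' hl' (x := (s, t)) (Or.inr (Or.inl h5)), zero_add]

end Branch

/-- A function on the strip `0 < x₂ < r` that agrees with a tooth at distance at least `l` from the
ends of the nucleus and vanishes at the ends, with the estimates of the branching construction.
The parameter `η` multiplies the elastic energy: it is `1` for a branching and `0` for an exact
laminate. -/
structure StripFn (L lam r l η : ℝ) (F : Plane → ℝ) : Prop where
  lip : LocLip F
  eq_zero : ∀ x : Plane, (x.2 ≤ 0 ∨ r ≤ x.2 ∨ depth L x.1 ≤ 0) → F x = 0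
  eq_tooth : ∀ x : Plane, l ≤ depth L x.1 → F x = tooth lam r x.2
  dens : ∀ᵐ x : Plane, 0 < depth L x.1 → depth L x.1 < l → 0 < x.2 → x.2 < r →
    wellDens lam (lpart 0 F x) (lpart 1 F x) ≤ η * (lam ^ 2 * (r ^ 2 / l ^ 2
      * rate(l,L,x.1) + {s | s < r ^ 2 / l}.indicator (fun _ => 1)
        (depth L x.1)))
  slice_one : ∀ᵐ s : ℝ, (0 < depth L s ∧ depth L s < l) →
    SliceVar univ (fun t => lpart 1 F (s, t)) (8 * rate(l,L,s))
  slice_zero : ∀ᵐ s : ℝ, (0 < depth L s ∧ depth L s < l) →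
    SliceVar univ (fun t => lpart 0 F (s, t)) (4 * rate(l,L,s))
  slice_fst : ∀ᵐ t : ℝ, SliceVar (Ioo 0 (2 * L)) (fun s => lpart 0 F (s, t)) 10

theorem stripFn_zero : StripFn L 1 r l 0 fun _ => 0 where
  lip := LocallyLipschitz.const 0
  eq_zero _ _ := rfl
  eq_tooth x _ := by
    rw [tooth, sub_self, zero_mul, max_eq_right (min_le_right _ _)]
  dens := .of_forall fun x _ _ _ _ => by
    rw [lpart_const, lpart_const, wellDens]
    norm_num
  slice_one := .of_forall fun s hs => by
    simp only [lpart_const]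
    exact (sliceVar_zero _).mono subset_rfl (mul_nonneg (by norm_num)
      (Real.rpow_nonneg (div_nonneg (hs.1.trans hs.2).le hs.1.le) _))
  slice_zero := .of_forall fun s hs => by
    simp only [lpart_const]
    exact (sliceVar_zero _).mono subset_rfl (mul_nonneg (by norm_num)
      (Real.rpow_nonneg (div_nonneg (hs.1.trans hs.2).le hs.1.le) _))
  slice_fst := .of_forall fun t => by
    simp only [lpart_const]
    exact (sliceVar_zero _).mono subset_rfl (by norm_num)

/-- The number of generations, chosen as small as possible. -/
theorem exists_generation (hq : 1 ≤ q) : ∃ K : ℕ, q ≤ 3 ^ K ∧ (3 : ℝ) ^ K ≤ 3 * q := by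
  have hex : ∃ K : ℕ, q ≤ 3 ^ K := (pow_unbounded_of_one_lt q (by norm_num : (1 : ℝ) < 3)).imp
    fun _ h => h.le
  classical
  refine ⟨Nat.find hex, Nat.find_spec hex, ?_⟩
  rcases h : Nat.find hex with _ | n
  · rw [pow_zero]; linarith
  · have := Nat.find_min hex (m := n) (by omega)
    rw [pow_succ]; linarith

/-- The number of generations is chosen such that `3 ^ K` is comparable to `(l / r) ^ 2`: then the
energy of the transition layer at the ends is of the order of the energy of the refinement. -/
theorem exists_stripFn (L : ℝ) (h0 : 0 < lam) (h1 : lam ≤ 1 / 2) (hr : 0 < r)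
    (hrl : r ≤ l) : ∃ F, StripFn L lam r l 1 F := by
  have hl : 0 < l := hr.trans_le hrl
  have hq : 1 ≤ (l / r) ^ 2 := one_le_pow₀ ((one_le_div hr).2 hrl)
  obtain ⟨K, hK1, hK2⟩ := exists_generation hq
  have h3 : (0 : ℝ) < 3 ^ K := by positivity
  have hδ : l / 3 ^ K ≤ r ^ 2 / l := by
    rw [div_pow, div_le_iff₀ (by positivity)] at hK1
    rw [div_le_div_iff₀ h3 hl]
    nlinarith
  have hδ' : r ^ 2 ≤ 3 * (l * (l / 3 ^ K)) := by
    rw [div_pow, ← mul_div_assoc, le_div_iff₀ (by positivity)] at hK2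
    rw [← mul_div_assoc, ← mul_div_assoc, le_div_iff₀ h3]
    nlinarith
  refine ⟨branch L lam K r l, locallyLipschitz_branch L lam K r l, branch_eq_zero h0 h1 K hr hl,
    branch_eq_tooth h0 h1 K hr hl, ?_, branch_slice_one h0 h1 K hr hl, ?_, ?_⟩
  · filter_upwards [branch_slopes (L := L) h0 h1 K hr hl,
      branch_abs_lpart_zero (L := L) h0 h1 K hr hl] with x e1 e2 hx1 hx2 hx3 hx4
    have ha : lpart 0 (branch L lam K r l) x ^ 2
        ≤ lam ^ 2 * (r ^ 2 / l ^ 2 * rate(l,L,x.1)) := by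
      rw [← sq_abs]
      refine (pow_le_pow_left₀ (abs_nonneg _) (e2 hx1 hx2) 2).trans (le_of_eq ?_)
      rw [mul_pow, ← Real.rpow_natCast, ← Real.rpow_natCast ((l / depth L x.1) ^ (3 / 8 : ℝ)) 2,
        ← Real.rpow_mul (by positivity)]
      norm_num
      ring
    have hi : 0 ≤ {s | s < r ^ 2 / l}.indicator (fun _ => (1 : ℝ)) (depth L x.1) :=
      indicator_nonneg (fun _ _ => zero_le_one) _
    have hmul : 0 ≤ lam ^ 2 * {s | s < r ^ 2 / l}.indicator (fun _ => (1 : ℝ)) (depth L x.1) := by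
      positivity
    rw [one_mul, mul_add]
    refine add_le_add ha ?_
    rcases e1 hx3 hx4 with h | h | h
    · rw [h, sub_self]
      exact (min_le_left _ _).trans (by simpa using hmul)
    · rw [h]
      exact (min_le_right _ _).trans (by simpa using hmul)
    · rw [h.1, indicator_of_mem (show depth L x.1 ∈ {s | s < r ^ 2 / l} from
        h.2.trans_le hδ)]
      exact (min_le_left _ _).trans (by simp)
  · filter_upwards [branch_slice_zero (L := L) h0 h1 K hr hl] with s hs hsl
    refine (hs hsl).mono subset_rfl ?_
    have hm := hsl.1
    set M := max (depth L s) (l / 3 ^ K) with hM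
    have hM0 : 0 < M := lt_max_of_lt_left hm
    have hrM : r ≤ 2 * M * rate(l,L,s) := by
      have a1 : (l / M) ^ (1 / 2 : ℝ) ≤ rate(l,L,s) := by
        refine (Real.rpow_le_rpow (by positivity)
          (div_le_div_of_nonneg_left hl.le hm (le_max_left _ _)) (by norm_num)).trans ?_
        exact Real.rpow_le_rpow_of_exponent_le ((one_le_div hm).2 hsl.2.le) (by norm_num)
      refine le_trans ?_ (mul_le_mul_of_nonneg_left a1 (by positivity))
      rw [← Real.sqrt_eq_rpow]
      refine abs_le_of_sq_le_sq' ?_ (by positivity) |>.2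
      rw [mul_pow, Real.sq_sqrt (by positivity)]
      have : l * (l / 3 ^ K) ≤ l * M := by
        gcongr; exact le_max_right _ _
      calc r ^ 2 ≤ 3 * (l * M) := hδ'.trans (by linarith)
        _ ≤ 4 * (l * M) := by nlinarith [mul_pos hl hM0]
        _ = (2 * M) ^ 2 * (l / M) := by field_simp; ring
    rw [div_le_iff₀ hM0]
    have : lam * r ≤ 1 / 2 * (2 * M * rate(l,L,s)) := by gcongr
    nlinarith
  · filter_upwards [branch_slice_fst (L := L) h0 h1 K hr hl] with t ht
    refine ht.mono subset_rfl ?_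
    have a : ((3 : ℝ) / 2) ^ K ≤ 2 * (l / r) := by
      refine abs_le_of_sq_le_sq' ?_ (by positivity) |>.2
      rw [← pow_mul, mul_comm K 2, pow_mul, mul_pow]
      calc ((3 / 2 : ℝ) ^ 2) ^ K ≤ 3 ^ K := by gcongr; norm_num
        _ ≤ 3 * (l / r) ^ 2 := hK2
        _ ≤ 2 ^ 2 * (l / r) ^ 2 := by gcongr; norm_num
    have hrl' : r / l * (l / r) = 1 := by field_simp
    calc lam * r / l * (10 * (3 / 2) ^ K - 6) ≤ lam * r / l * (10 * (2 * (l / r))) := by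
          gcongr; linarith
      _ = lam * 20 := by field_simp; ring
      _ ≤ 10 := by linarith

/-! ### Decay in the austenite -/

/-- The distance of the first coordinate to the interval `[0, 2L]`. -/
def outDist (L s : ℝ) : ℝ := max (-depth L s) 0

theorem outDist_nonneg (L s : ℝ) : 0 ≤ outDist L s := le_max_right _ _

@[fun_prop] theorem locallyLipschitz_outDist (L : ℝ) :
    LocLip fun x : Plane => outDist L x.1 := by
  unfold outDist; fun_prop

theorem lpart_inv (hf : LocLip f) (hf0 : ∀ x, f x ≠ 0) (i : Fin 2) :
    ∀ᵐ x, lpart i (fun y => (f y)⁻¹) x = -lpart i f x / f x ^ 2 := by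
  filter_upwards [ae_lineDifferentiableAt hf i] with x hx
  have := deriv_fun_inv'' (c := fun t : ℝ => f (x + t • dir i)) hx (hf0 _)
  simpa [lpart, lineDeriv] using this

theorem lpart_depth (L : ℝ) : ∀ᵐ x : Plane, |lpart 0 (fun y => depth L y.1) x| ≤ 1 ∧
    lpart 1 (fun y : Plane => depth L y.1) x = 0 := by
  have d1 := lpart_affine' 0 1 0 fun x => by ring
  have d2 := lpart_affine' (f := fun x : Plane => 2 * L - x.1) (2 * L) (-1) 0 fun x => by ring
  filter_upwards [lpart_min locallyLipschitz_fst (g := fun x => 2 * L - x.1) (by fun_prop) 0,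
    lpart_min locallyLipschitz_fst (g := fun x => 2 * L - x.1) (by fun_prop) 1] with x e1 e2
  simp only [(d1 x).1, (d1 x).2, (d2 x).1, (d2 x).2] at e1 e2
  rw [show (fun y : Plane => depth L y.1) = fun y => min y.1 (2 * L - y.1) from rfl]
  grind

theorem lpart_outDist (L : ℝ) : ∀ᵐ x : Plane, |lpart 0 (fun y => outDist L y.1) x| ≤ 1 ∧
    lpart 1 (fun y => outDist L y.1) x = 0 := by
  have h1 := LocallyLipschitz_neg (locallyLipschitz_depth L)
  filter_upwards [lpart_depth L, lpart_max h1 (.const 0) 0, lpart_max h1 (.const 0) 1]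
    with x e e1 e2
  simp only [lpart_const, lpart_neg] at e1 e2
  rw [show (fun y : Plane => outDist L y.1) = fun y : Plane => max (-depth L y.1) 0 from rfl]
  grind

/-- The laminate over one period `[0, h]`, with slopes `θ` and `-θ(h - r)/r` inside the nucleus,
and its extension to the austenite, in which the steep part widens linearly. -/
def wedge (L θ h r : ℝ) (x : Plane) : ℝ :=
  max (min (θ * x.2) (θ * (h - r) * (h - x.2) * (r + outDist L x.1)⁻¹) - θ * outDist L x.1) 0

section Wedge

theorem locallyLipschitz_add_outDist_inv (hr : 0 < r) :
    LocLip fun x : Plane => (r + outDist L x.1)⁻¹ :=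
  locallyLipschitz_inv (by fun_prop) fun x => (add_pos_of_pos_of_nonneg hr (outDist_nonneg _ _)).ne'

theorem locallyLipschitz_wedge (hr : 0 < r) : LocLip (wedge L θ h r) := by
  have := locallyLipschitz_add_outDist_inv (L := L) hr
  unfold wedge; fun_prop

theorem wedge_eq_zero (hθ : 0 < θ) (hr : 0 < r) (hrh : r ≤ h)
    (hx : x.2 ≤ 0 ∨ h ≤ x.2 ∨ h ≤ outDist L x.1) : wedge L θ h r x = 0 := by
  have hs := outDist_nonneg L x.1
  have hq : 0 ≤ (r + outDist L x.1)⁻¹ := by positivity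
  have hA : 0 ≤ θ * (h - r) := mul_nonneg hθ.le (by linarith)
  rw [wedge, max_eq_right]
  by_cases h1 : x.2 ≤ 0
  · have := min_le_left (θ * x.2) (θ * (h - r) * (h - x.2) * (r + outDist L x.1)⁻¹)
    nlinarith
  by_cases h2 : h ≤ x.2
  · have := min_le_right (θ * x.2) (θ * (h - r) * (h - x.2) * (r + outDist L x.1)⁻¹)
    have h3 : θ * (h - r) * (h - x.2) * (r + outDist L x.1)⁻¹ ≤ 0 :=
      mul_nonpos_of_nonpos_of_nonneg (mul_nonpos_of_nonneg_of_nonpos hA (by linarith)) hq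
    nlinarith
  · have h3 : h ≤ outDist L x.1 := by tauto
    have := min_le_left (θ * x.2) (θ * (h - r) * (h - x.2) * (r + outDist L x.1)⁻¹)
    nlinarith

/-- The squared gradient of the wedge decays like the inverse square of the distance from the
nucleus, on a region whose width is proportional to that distance. -/
theorem wedge_sq_grad_le (hθ : 0 < θ) (hr : 0 < r) (hrh : 2 * r ≤ h) :
    ∀ᵐ x : Plane, lpart 0 (wedge L θ h r) x ^ 2 + lpart 1 (wedge L θ h r) x ^ 2
      ≤ if outDist L x.1 < h then (Ioo 0 h).indicator (fun _ => 4 * θ ^ 2) x.2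
        + (Ico (h - 2 * (r + outDist L x.1)) h).indicator
          (fun _ => 3 * (θ * h) ^ 2 * ((r + outDist L x.1)⁻¹) ^ 2) x.2 else 0 := by
  have h0 := locallyLipschitz_outDist L
  have hrs : LocLip fun x : Plane => r + outDist L x.1 := by fun_prop
  have hq := locallyLipschitz_add_outDist_inv (L := L) hr
  have hs : LocLip fun x : Plane => θ * outDist L x.1 := by fun_prop
  have h1 : LocLip fun x : Plane => θ * x.2 := by fun_prop
  have h2 : LocLip fun x : Plane => θ * (h - r) * (h - x.2) := by fun_prop
  have d1 := lpart_affine' (f := fun x : Plane => θ * x.2) 0 0 θ fun x => by ring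
  have d2 := lpart_affine' (f := fun x : Plane => θ * (h - r) * (h - x.2))
    (θ * (h - r) * h) 0 (-(θ * (h - r))) fun x => by ring
  have h3 := locallyLipschitz_mul h2 hq
  have hm := h1.min h3
  have hf := hm.sub hs
  have hne : ∀ x : Plane, r + outDist L x.1 ≠ 0 := fun x =>
    (add_pos_of_pos_of_nonneg hr (outDist_nonneg _ _)).ne'
  have e : ∀ i : Fin 2, ∀ᵐ x : Plane,
      (wedge L θ h r x = 0 ∧ lpart i (wedge L θ h r) x = 0) ∨
      (θ * outDist L x.1 < θ * x.2 ∧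
        θ * outDist L x.1 < θ * (h - r) * (h - x.2) * (r + outDist L x.1)⁻¹ ∧
        (lpart i (wedge L θ h r) x = lpart i (fun y : Plane => θ * y.2) x
          - θ * lpart i (fun y : Plane => outDist L y.1) x ∨
        (θ * (h - r) * (h - x.2) * (r + outDist L x.1)⁻¹ ≤ θ * x.2 ∧
        lpart i (wedge L θ h r) x
          = lpart i (fun y : Plane => θ * (h - r) * (h - y.2)) x * (r + outDist L x.1)⁻¹
            + θ * (h - r) * (h - x.2) * (-lpart i (fun y : Plane => outDist L y.1) x
              / (r + outDist L x.1) ^ 2)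
          - θ * lpart i (fun y : Plane => outDist L y.1) x))) := by
    intro i
    filter_upwards [lpart_max hf (.const 0) i, lpart_sub hm hs i, lpart_min h1 h3 i,
        lpart_mul h2 hq i,
      lpart_inv hrs hne i, lpart_add (.const r) h0 i] with x e1 e2 e3 e4 e5 e6
    simp only [lpart_const, zero_add, lpart_const_mul] at e1 e2 e6
    rw [show wedge L θ h r = fun x : Plane => max (min (θ * x.2)
      (θ * (h - r) * (h - x.2) * (r + outDist L x.1)⁻¹) - θ * outDist L x.1) 0 from rfl]
    grind
  filter_upwards [e 0, e 1, lpart_outDist L] with x e0 e1 e2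
  rw [(d1 x).1, (d2 x).1] at e0
  rw [(d1 x).2, (d2 x).2, e2.2] at e1
  have he := e2.1
  generalize lpart 0 (fun y : Plane => outDist L y.1) x = d at *
  generalize lpart 0 (wedge L θ h r) x = p at *
  generalize lpart 1 (wedge L θ h r) x = p' at *
  set s := outDist L x.1 with hsdef
  have hs0 : 0 ≤ s := outDist_nonneg _ _
  have hrs0 : 0 < r + s := by linarith
  set q := (r + s)⁻¹ with hqdef
  have hq0 : 0 < q := inv_pos.2 hrs0
  have hqr : q * (r + s) = 1 := inv_mul_cancel₀ hrs0.ne'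
  have hA : 0 ≤ θ * (h - r) := mul_nonneg hθ.le (by linarith)
  have hh : 0 < h := by linarith
  set I1 := (Ioo 0 h).indicator (fun _ => 4 * θ ^ 2) x.2 with hI1
  set I2 := (Ico (h - 2 * (r + s)) h).indicator (fun _ => 3 * (θ * h) ^ 2 * q ^ 2) x.2 with hI2
  have i1 : 0 ≤ I1 := indicator_nonneg (fun _ _ => by positivity) _
  have i2 : 0 ≤ I2 := indicator_nonneg (fun _ _ => by positivity) _
  have hd2 : d ^ 2 ≤ 1 := by rw [← sq_abs]; exact pow_le_one₀ (abs_nonneg _) he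
  have region : θ * s < θ * x.2 → θ * s < θ * (h - r) * (h - x.2) * q → I1 = 4 * θ ^ 2 ∧
      x.2 < h ∧ s < h := by
    intro a1 a2
    have b1 : s < x.2 := lt_of_mul_lt_mul_left a1 hθ.le
    have b2 : x.2 < h := by
      by_contra! hcon
      have : θ * (h - r) * (h - x.2) * q ≤ 0 := mul_nonpos_of_nonpos_of_nonneg
        (mul_nonpos_of_nonneg_of_nonpos hA (by linarith)) hq0.le
      nlinarith
    exact ⟨indicator_of_mem (mem_Ioo.2 ⟨by linarith, b2⟩) _, b2, by linarith⟩
  have region' : x.2 < h → s < h → θ * (h - r) * (h - x.2) * q ≤ θ * x.2 →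
      I2 = 3 * (θ * h) ^ 2 * q ^ 2 ∧ 0 ≤ θ * (h - r) * (h - x.2) * q ∧
      θ * (h - r) * (h - x.2) * q ≤ θ * h := by
    intro b1 b2 b3
    refine ⟨?_, mul_nonneg (mul_nonneg hA (by linarith)) hq0.le, b3.trans (by gcongr)⟩
    refine indicator_of_mem (mem_Ico.2 ⟨?_, b1⟩) _
    have c1 : (h - r) * (h - x.2) ≤ x.2 * (r + s) := by
      have : θ * ((h - r) * (h - x.2)) ≤ θ * (x.2 * (r + s)) := by
        calc θ * ((h - r) * (h - x.2)) = θ * (h - r) * (h - x.2) * q * (r + s) := by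
              rw [mul_assoc _ q, hqr]; ring
          _ ≤ θ * x.2 * (r + s) := by gcongr
          _ = _ := by ring
      exact le_of_mul_le_mul_left this hθ
    have c2 : h / 2 * (h - x.2) ≤ h * (r + s) := by nlinarith
    have c3 : h - x.2 ≤ 2 * (r + s) := by
      refine le_of_mul_le_mul_left ?_ hh
      linarith
    linarith
  have k0 : p ^ 2 ≤ I1 / 2 + 2 / 3 * I2 := by
    rcases e0 with ⟨-, e0⟩ | ⟨a1, a2, a3⟩
    · rw [e0]; grind
    obtain ⟨j1, b1, b2⟩ := region a1 a2
    rcases a3 with a3 | ⟨a3, a4⟩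
    · rw [a3, j1, zero_sub, neg_sq, mul_pow]
      linarith [mul_le_of_le_one_right (sq_nonneg θ) hd2, sq_nonneg θ]
    · obtain ⟨j2, c1, c2⟩ := region' b1 b2 a3
      have e5 : p = -d * (θ * (h - r) * (h - x.2) * q * q + θ) := by
        rw [a4, div_eq_mul_inv, ← inv_pow]; ring
      rw [e5, j1, j2, mul_pow, neg_sq]
      have c3 : (θ * (h - r) * (h - x.2) * q * q + θ) ^ 2
          ≤ 2 * (θ * h * q) ^ 2 + 2 * θ ^ 2 := by
        have : (θ * (h - r) * (h - x.2) * q * q) ^ 2 ≤ (θ * h * q) ^ 2 := by gcongr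
        linarith [sq_nonneg (θ * (h - r) * (h - x.2) * q * q - θ)]
      exact (mul_le_of_le_one_left (sq_nonneg _) hd2).trans (c3.trans (le_of_eq (by ring)))
  have k1 : p' ^ 2 ≤ I1 / 4 + 1 / 3 * I2 := by
    rcases e1 with ⟨-, e1⟩ | ⟨a1, a2, a3⟩
    · rw [e1]; grind
    obtain ⟨j1, b1, b2⟩ := region a1 a2
    rcases a3 with a3 | ⟨a3, a4⟩
    · grind
    · obtain ⟨j2, c1, c2⟩ := region' b1 b2 a3
      have e5 : p' = -(θ * (h - r) * q) := by
        rw [a4]; ring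
      rw [e5, j1, j2, neg_sq]
      have : (θ * (h - r) * q) ^ 2 ≤ (θ * h * q) ^ 2 := by
        gcongr
        linarith
      linarith [sq_nonneg θ]
  split_ifs with hsh
  · linarith
  have e0 : p = 0 := by grind
  have e1 : p' = 0 := by grind
  simp [e0, e1]

end Wedge

theorem lintegral_Ioo_eq {f : ℝ → ℝ} (hab : a ≤ b) (hf : IntervalIntegrable f volume a b)
    (h0 : ∀ x ∈ Ioo a b, 0 ≤ f x) :
    ∫⁻ x in Ioo a b, ofReal (f x) = ofReal (∫ x in a..b, f x) := by
  have hf' : IntegrableOn f (Ioo a b) :=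
    ((intervalIntegrable_iff_integrableOn_Ioo_of_le hab).1 hf)
  rw [intervalIntegral.integral_of_le hab, integral_Ioc_eq_integral_Ioo,
    ofReal_integral_eq_lintegral_ofReal hf' (ae_restrict_of_forall_mem measurableSet_Ioo h0)]

theorem lintegral_outDist (hL : 0 < L) {f : ℝ → ℝ≥0∞} (hf : Measurable f) :
    ∫⁻ x in (Ioo 0 (2 * L))ᶜ, f (outDist L x) = 2 * ∫⁻ s in Ioi 0, f s := by
  have hU : (Ioo 0 (2 * L))ᶜ = Iic 0 ∪ Ici (2 * L) := by
    grind
  have hdisj : Disjoint (Iic (0 : ℝ)) (Ici (2 * L)) :=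
    disjoint_left.2 fun x hx hx' => by
      grind
  rw [hU, lintegral_union measurableSet_Ici hdisj]
  have e1 : ∫⁻ x in Iic 0, f (outDist L x) = ∫⁻ s in Ioi 0, f s := by
    rw [setLIntegral_congr_fun measurableSet_Iic (g := fun x => f (-x)) fun x hx => ?_]
    · have := (Measure.measurePreserving_neg volume).setLIntegral_comp_preimage
        (measurableSet_Ici (a := (0 : ℝ))) hf
      rw [setLIntegral_congr Ioi_ae_eq_Ici, ← this]
      congr 2
      ext x; simp
    · have h1 : x ≤ 0 := hx
      rw [outDist, depth, min_eq_left (by linarith), max_eq_left (by linarith)]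
  have e2 : ∫⁻ x in Ici (2 * L), f (outDist L x) = ∫⁻ s in Ioi 0, f s := by
    rw [setLIntegral_congr_fun measurableSet_Ici (g := fun x => f (x - 2 * L)) fun x hx => ?_]
    · have := (measurePreserving_sub_right volume (2 * L)).setLIntegral_comp_preimage
        (measurableSet_Ici (a := (0 : ℝ))) hf
      rw [setLIntegral_congr Ioi_ae_eq_Ici, ← this]
      congr 2
      ext x; simp
    · have h1 : 2 * L ≤ x := hx
      rw [outDist, depth, min_eq_right (by linarith), max_eq_left (by linarith)]
      congr 1; ring
  rw [e1, e2, two_mul]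

theorem lintegral_depth (hL : 0 < L) {f : ℝ → ℝ≥0∞} (hf : Measurable f) :
    ∫⁻ x in Ioo 0 (2 * L), f (depth L x) = 2 * ∫⁻ s in Ioo 0 L, f s := by
  have hU : Ioo 0 (2 * L) = Ioo 0 L ∪ Ico L (2 * L) := (Ioo_union_Ico_eq_Ioo hL (by linarith)).symm
  have hdisj : Disjoint (Ioo 0 L) (Ico L (2 * L)) :=
    disjoint_left.2 fun x hx hx' => absurd hx.2 (not_lt.2 hx'.1)
  rw [hU, lintegral_union measurableSet_Ico hdisj]
  have e1 : ∫⁻ x in Ioo 0 L, f (depth L x) = ∫⁻ s in Ioo 0 L, f s := by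
    refine setLIntegral_congr_fun measurableSet_Ioo fun x hx => ?_
    rw [depth, min_eq_left (by linarith [hx.2])]
  have e2 : ∫⁻ x in Ico L (2 * L), f (depth L x) = ∫⁻ s in Ioo 0 L, f s := by
    rw [setLIntegral_congr_fun measurableSet_Ico (g := fun x => f (2 * L - x)) fun x hx => ?_]
    · have := (Measure.measurePreserving_sub_left (volume : Measure ℝ)
        (2 * L)).setLIntegral_comp_preimage (measurableSet_Ioc (a := (0 : ℝ)) (b := L)) hf
      rw [setLIntegral_congr Ioo_ae_eq_Ioc, ← this]
      congr 2
      grind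
    · rw [depth, min_eq_right (by linarith [hx.1])]
  rw [e1, e2, two_mul]

theorem lintegral_rpow_le (hl : 0 < l) (hlb : l ≤ b) :
    ∫⁻ s in Ioo 0 b, ofReal ((l / s) ^ (3 / 4 : ℝ)) ≤ ofReal (4 * b) := by
  have hb : 0 < b := hl.trans_le hlb
  have e : ∀ s ∈ Ioo 0 b, ofReal ((l / s) ^ (3 / 4 : ℝ))
      ≤ ofReal (b ^ (3 / 4 : ℝ) * s ^ (-(3 / 4) : ℝ)) := by
    intro s hs
    refine ofReal_le_ofReal ?_
    rw [Real.rpow_neg hs.1.le, ← div_eq_mul_inv, ← Real.div_rpow hb.le hs.1.le]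
    exact Real.rpow_le_rpow (div_nonneg hl.le hs.1.le) (by have := hs.1; gcongr) (by norm_num)
  refine (setLIntegral_mono' measurableSet_Ioo e).trans ?_
  rw [lintegral_Ioo_eq hb.le ((intervalIntegral.intervalIntegrable_rpow' (by norm_num)).const_mul _)
    fun x hx => mul_nonneg (Real.rpow_nonneg hb.le _) (Real.rpow_nonneg hx.1.le _),
    intervalIntegral.integral_const_mul, integral_rpow (Or.inl (by norm_num))]
  refine ofReal_le_ofReal (le_of_eq ?_)
  rw [Real.zero_rpow (by norm_num), sub_zero, mul_div_assoc', ← Real.rpow_add hb]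
  norm_num
  ring

theorem integral_inv_add (hr : 0 < r) (hh : 0 ≤ h) :
    ∫ s in (0 : ℝ)..h, (r + s)⁻¹ = log (1 + h / r) := by
  rw [intervalIntegral.integral_comp_add_left (fun s => s⁻¹), integral_inv_of_pos (by linarith)
    (by linarith), add_zero, add_div, div_self hr.ne']

section Wedge

/-- The product of the complement of an interval with the line. -/
theorem restrict_compl_prod_univ (L : ℝ) :
    (volume : Measure Plane).restrict ((Ioo 0 (2 * L))ᶜ ×ˢ univ)
      = ((volume : Measure ℝ).restrict (Ioo 0 (2 * L))ᶜ).prod volume := by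
  rw [← Measure.restrict_univ (μ := (volume : Measure ℝ)), Measure.prod_restrict,
    Measure.restrict_univ]
  rfl

/-- The energy of a wedge beyond the lateral sides of the nucleus. -/
theorem wedge_exterior (hL : 0 < L) (hθ : 0 < θ) (hr : 0 < r) (hrh : 2 * r ≤ h) :
    ∫⁻ x in (Ioo 0 (2 * L))ᶜ ×ˢ univ, ofReal
      (lpart 0 (wedge L θ h r) x ^ 2 + lpart 1 (wedge L θ h r) x ^ 2)
      ≤ ofReal (20 * (θ * h) ^ 2 * log (1 + h / r)) := by
  have hh : 0 < h := by linarith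
  set g : ℝ → ℝ≥0∞ := (Iio h).indicator fun s =>
    ofReal (4 * θ ^ 2 * h + 6 * (θ * h) ^ 2 * (r + s)⁻¹) with hg
  have hgm : Measurable g := by
    refine Measurable.indicator ?_ measurableSet_Iio
    fun_prop
  have e : ∀ (S : Set ℝ) (c t : ℝ), ofReal (S.indicator (fun _ => c) t)
      = S.indicator (fun _ => ofReal c) t := fun S c t => by by_cases h : t ∈ S <;> simp [h]
  calc
    _ ≤ ∫⁻ s in (Ioo 0 (2 * L))ᶜ, ∫⁻ t, ofReal
        (lpart 0 (wedge L θ h r) (s, t) ^ 2 + lpart 1 (wedge L θ h r) (s, t) ^ 2) := by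
        rw [restrict_compl_prod_univ]
        exact lintegral_prod_le _
    _ ≤ ∫⁻ s in (Ioo 0 (2 * L))ᶜ, g (outDist L s) := by
        refine lintegral_mono_ae (ae_restrict_of_ae ?_)
        filter_upwards [ae_slice_fst (wedge_sq_grad_le (L := L) hθ hr hrh)] with s h's
        refine (lintegral_mono_ae (h's.mono fun t ht => ofReal_le_ofReal ht)).trans ?_
        have hs0 := outDist_nonneg L s
        by_cases hs : outDist L s < h
        · rw [hg, indicator_of_mem (show outDist L s ∈ Iio h from hs)]
          simp only [if_pos hs]
          refine (lintegral_mono fun t => ofReal_add_le).trans ?_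
          simp only [e]
          rw [lintegral_add_left (measurable_const.indicator measurableSet_Ioo),
            lintegral_indicator measurableSet_Ioo, lintegral_indicator measurableSet_Ico,
            setLIntegral_const, setLIntegral_const, Real.volume_Ioo, Real.volume_Ico,
            ← ofReal_mul (by positivity), ← ofReal_mul (by positivity),
            ← ofReal_add (by nlinarith [sq_nonneg θ]) (by
              refine mul_nonneg (by positivity) ?_
              linarith)]
          grind
        · simp [hs]
    _ = 2 * ∫⁻ s in Ioi 0, g s := lintegral_outDist hL hgm
    _ = 2 * ∫⁻ s in Ioo 0 h, ofReal (4 * θ ^ 2 * h + 6 * (θ * h) ^ 2 * (r + s)⁻¹) := by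
        rw [hg, lintegral_indicator measurableSet_Iio, Measure.restrict_restrict measurableSet_Iio,
          inter_comm, Ioi_inter_Iio]
    _ = ofReal (2 * (4 * (θ * h) ^ 2 + 6 * (θ * h) ^ 2 * log (1 + h / r))) := by
        have hcont : IntervalIntegrable (fun s => (r + s)⁻¹) volume 0 h := by
          refine ContinuousOn.intervalIntegrable (ContinuousOn.inv₀ (by fun_prop) fun s hs => ?_)
          rw [uIcc_of_le hh.le] at hs
          linarith [hs.1]
        rw [lintegral_Ioo_eq hh.le (intervalIntegrable_const.add (hcont.const_mul _))
          fun s hs => by have := hs.1; positivity]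
        rw [intervalIntegral.integral_add intervalIntegrable_const (hcont.const_mul _),
          intervalIntegral.integral_const_mul (6 * (θ * h) ^ 2), integral_inv_add hr hh.le,
          intervalIntegral.integral_const, ofReal_mul (by norm_num)]
        congr 1
        · simp
        · congr 1; rw [smul_eq_mul]; ring
    _ ≤ ofReal (20 * (θ * h) ^ 2 * log (1 + h / r)) := by
        refine ofReal_le_ofReal ?_
        have h3 : 3 ≤ 1 + h / r := by
          have : 2 ≤ h / r := by rw [le_div_iff₀ hr]; exact hrh
          linarith
        have h1 : 1 ≤ log (1 + h / r) := by
          rw [Real.le_log_iff_exp_le (by linarith)]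
          exact (Real.exp_one_lt_d9.le.trans (by norm_num)).trans h3
        nlinarith

end Wedge

/-! ### One period of the branched laminates -/

/-- One period of a laminate with period `h`; the steep part, of width `r`, is decorated by `F`. -/
def cell (L θ h r : ℝ) (F : Plane → ℝ) (x : Plane) : ℝ :=
  wedge L θ h r x + F (x.1, x.2 - (h - r))

theorem outDist_eq_zero (hs : 0 ≤ depth L s) : outDist L s = 0 :=
  max_eq_right (by linarith)

theorem depth_pos : 0 < depth L s ↔ s ∈ Ioo 0 (2 * L) := by
  rw [depth, lt_min_iff, mem_Ioo, sub_pos]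

section Cell

theorem lpart_wedge_inside (hθ : 0 < θ) (hr : 0 < r) (hrh : r ≤ h) :
    ∀ᵐ x : Plane, 0 < depth L x.1 → lpart 0 (wedge L θ h r) x = 0 ∧
      lpart 1 (wedge L θ h r) x = (Ioo 0 (h - r)).indicator (fun _ => θ) x.2
        + (Ioo (h - r) h).indicator (fun _ => θ - θ * h / r) x.2 := by
  have hA : 0 ≤ θ * (h - r) := mul_nonneg hθ.le (by linarith)
  filter_upwards [ae_snd_ne 0, ae_snd_ne h, ae_snd_ne (h - r)] with x e1 e2 e3 hx
  have hU : IsOpen {y : Plane | 0 < depth L y.1 ∧ (y.2 < 0 ∨ h < y.2)} :=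
    (isOpen_lt_depth L 0).inter ((isOpen_lt continuous_snd continuous_const).union
      (isOpen_lt continuous_const continuous_snd))
  have hz : (x.2 < 0 ∨ h < x.2) → ∀ i, lpart i (wedge L θ h r) x = 0 := by
    refine fun hxz => lpart_eq_zero_of_forall hU (fun y hy => ?_) (x := x) ⟨hx, hxz⟩
    refine wedge_eq_zero hθ hr hrh ?_
    grind
  simp only [indicator_apply, mem_Ioo]
  rcases lt_or_gt_of_ne e1 with h1 | h1
  · grind
  rcases lt_or_gt_of_ne e3 with h3 | h3
  · rw [if_pos ⟨h1, h3⟩, if_neg (by intro h'; linarith), add_zero]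
    have hV : IsOpen {y : Plane | 0 < depth L y.1 ∧ 0 < y.2 ∧ y.2 < h - r} :=
      (isOpen_lt_depth L 0).inter ((isOpen_lt continuous_const continuous_snd).inter
        (isOpen_lt continuous_snd continuous_const))
    have he : wedge L θ h r =ᶠ[𝓝 x] fun y => θ * y.2 := by
      refine eventually_of_mem (hV.mem_nhds ⟨hx, h1, h3⟩) fun y hy => ?_
      have hy0 : (0 : ℝ) < y.2 := hy.2.1
      have hy1 : y.2 < h - r := hy.2.2
      rw [wedge, outDist_eq_zero hy.1.le, add_zero, mul_zero, sub_zero, min_eq_left, max_eq_left]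
      · positivity
      · rw [← div_eq_mul_inv, le_div_iff₀ hr, mul_assoc, mul_assoc]
        gcongr
        nlinarith
    rw [lpart_congr he, lpart_congr he]
    exact lpart_affine' 0 0 θ (fun y => by ring) x
  rcases lt_or_gt_of_ne e2 with h2 | h2
  · rw [if_neg (by intro h'; linarith), if_pos ⟨h3, h2⟩, zero_add]
    have hV : IsOpen {y : Plane | 0 < depth L y.1 ∧ h - r < y.2 ∧ y.2 < h} :=
      (isOpen_lt_depth L 0).inter ((isOpen_lt continuous_const continuous_snd).inter
        (isOpen_lt continuous_snd continuous_const))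
    have he : wedge L θ h r =ᶠ[𝓝 x] fun y => θ * (h - r) * (h - y.2) * r⁻¹ := by
      refine eventually_of_mem (hV.mem_nhds ⟨hx, h3, h2⟩) fun y hy => ?_
      have hy0 : h - r < y.2 := hy.2.1
      have hy1 : y.2 < h := hy.2.2
      rw [wedge, outDist_eq_zero hy.1.le, add_zero, mul_zero, sub_zero, min_eq_right, max_eq_left]
      · exact mul_nonneg (mul_nonneg hA (by linarith)) (inv_nonneg.2 hr.le)
      · rw [← div_eq_mul_inv, div_le_iff₀ hr, mul_assoc, mul_assoc]
        gcongr <;> linarith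
    rw [lpart_congr he, lpart_congr he]
    have := lpart_affine' (f := fun y => θ * (h - r) * (h - y.2) * r⁻¹)
      (θ * (h - r) * h * r⁻¹) 0 (-(θ * (h - r) * r⁻¹)) (fun y => by ring) x
    grind
  grind

theorem locallyLipschitz_cell (hr : 0 < r) (hF : StripFn L (θ * h / r) r l η F) :
    LocLip (cell L θ h r F) :=
  (locallyLipschitz_wedge hr).add (locallyLipschitz_translate hF.lip _)

theorem cell_eq_zero (hθ : 0 < θ) (hr : 0 < r) (hrh : r ≤ h) (hF : StripFn L (θ * h / r) r l η F)
    (hx : x.2 ≤ 0 ∨ h ≤ x.2) : cell L θ h r F x = 0 := by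
  rw [cell, wedge_eq_zero hθ hr hrh (hx.imp id Or.inl), zero_add]
  refine hF.eq_zero _ ?_
  grind

theorem lpart_cell_eq_zero (hθ : 0 < θ) (hr : 0 < r) (hrh : r ≤ h)
    (hF : StripFn L (θ * h / r) r l η F) (hx : x.2 < 0 ∨ h < x.2) (i : Fin 2) :
    lpart i (cell L θ h r F) x = 0 := by
  have hU : IsOpen {y : Plane | y.2 < 0 ∨ h < y.2} :=
    (isOpen_lt continuous_snd continuous_const).union (isOpen_lt continuous_const continuous_snd)
  exact lpart_eq_zero_of_forall hU (fun y hy => cell_eq_zero hθ hr hrh hF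
    (hy.imp le_of_lt le_of_lt)) hx i

theorem lpart_cell (hr : 0 < r) (hF : StripFn L (θ * h / r) r l η F) (i : Fin 2) :
    ∀ᵐ x : Plane, lpart i (cell L θ h r F) x
      = lpart i (wedge L θ h r) x + lpart i F (x.1, x.2 - (h - r)) := by
  filter_upwards [lpart_add (locallyLipschitz_wedge (L := L) (θ := θ) (h := h) hr)
    (locallyLipschitz_translate hF.lip (h - r)) i] with x hx
  rw [← lpart_translate, ← hx]
  rfl

theorem StripFn.lpart_eq_zero (hF : StripFn L lam r l η F)
    (hx : x.2 < 0 ∨ r < x.2 ∨ depth L x.1 < 0) (i : Fin 2) : lpart i F x = 0 := by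
  have hU : IsOpen {x : Plane | x.2 < 0 ∨ r < x.2 ∨ depth L x.1 < 0} :=
    (isOpen_lt continuous_snd continuous_const).union
      ((isOpen_lt continuous_const continuous_snd).union (isOpen_depth_lt L 0))
  refine lpart_eq_zero_of_forall hU (fun y hy => hF.eq_zero y ?_) hx i
  grind

/-- Beyond the lateral sides the decoration vanishes and only the wedge contributes; for `r = h` there is
no wedge either. -/
theorem cell_exterior (hL : 0 < L) (hθ : 0 < θ) (hr : 0 < r)
    (hκ : (r = h ∧ κ = 0) ∨ (2 * r ≤ h ∧ κ = 1)) (hF : StripFn L (θ * h / r) r l η F) :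
    ∫⁻ x in (Ioo 0 (2 * L))ᶜ ×ˢ univ, ofReal
      (lpart 0 (cell L θ h r F) x ^ 2 + lpart 1 (cell L θ h r F) x ^ 2)
      ≤ ofReal (κ * (20 * (θ * h) ^ 2 * log (1 + h / r))) := by
  have e : ∀ᵐ x : Plane, x ∈ (Ioo 0 (2 * L))ᶜ ×ˢ univ → ∀ i : Fin 2,
      lpart i (cell L θ h r F) x = lpart i (wedge L θ h r) x := by
    filter_upwards [lpart_cell hr hF 0, lpart_cell hr hF 1, ae_depth_fst_ne L 0] with x h0 h1 h2
    intro hx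
    have h3 : depth L x.1 < 0 :=
      lt_of_le_of_ne (not_lt.1 fun h' => hx.1 (depth_pos.1 h')) h2
    have h4 : ∀ i, lpart i F (x.1, x.2 - (h - r)) = 0 :=
      hF.lpart_eq_zero (x := (x.1, x.2 - (h - r))) (Or.inr (Or.inr h3))
    rw [Fin.forall_fin_two, h0, h1, h4, h4, add_zero, add_zero]
    exact ⟨rfl, rfl⟩
  have hms : MeasurableSet ((Ioo 0 (2 * L))ᶜ ×ˢ (univ : Set ℝ)) :=
    measurableSet_Ioo.compl.prod MeasurableSet.univ
  have e' : ∫⁻ x in (Ioo 0 (2 * L))ᶜ ×ˢ univ, ofReal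
      (lpart 0 (cell L θ h r F) x ^ 2 + lpart 1 (cell L θ h r F) x ^ 2)
      = ∫⁻ x in (Ioo 0 (2 * L))ᶜ ×ˢ univ, ofReal
      (lpart 0 (wedge L θ h r) x ^ 2 + lpart 1 (wedge L θ h r) x ^ 2) := by
    refine lintegral_congr_ae ((ae_restrict_iff' hms).2 (e.mono fun x hx hm => ?_))
    simp only [hx hm]
  rw [e']
  rcases hκ with ⟨rfl, rfl⟩ | ⟨h2, rfl⟩
  · have : wedge L θ r r = fun _ => 0 := by
      ext x
      rw [wedge, max_eq_right]
      have := min_le_right (θ * x.2) (θ * (r - r) * (r - x.2) * (r + outDist L x.1)⁻¹)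
      have h3 := mul_nonneg hθ.le (outDist_nonneg L x.1)
      grind
    simp only [this, lpart_const]
    simp
  · rw [one_mul]; exact wedge_exterior hL hθ hr h2

/-- Inside the nucleus, the elastic energy of the cell is that of the decoration `F`. -/
theorem cell_dens (hθ : 0 < θ) (hθ' : θ * h ≤ r) (hr : 0 < r) (hrh : r ≤ h)
    (hF : StripFn L (θ * h / r) r l η F) :
    ∀ᵐ x : Plane, 0 < depth L x.1 → 0 < x.2 → x.2 < h →
      wellDens θ (lpart 0 (cell L θ h r F) x) (lpart 1 (cell L θ h r F) x)
      ≤ {y : Plane | h - r < y.2 ∧ depth L y.1 < l}.indicator (fun y =>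
        η * ((θ * h / r) ^ 2 * (r ^ 2 / l ^ 2 * rate(l,L,y.1)
          + {s | s < r ^ 2 / l}.indicator (fun _ => 1) (depth L y.1)))) x := by
  have hh : 0 < h := hr.trans_le hrh
  have hlam : 0 < θ * h / r := by positivity
  have hlam' : θ * h / r ≤ 1 := (div_le_one hr).2 hθ'
  filter_upwards [lpart_cell hr hF 0, lpart_cell hr hF 1, lpart_wedge_inside (L := L) hθ hr hrh,
    ae_snd_ne (h - r), ae_translate hF.dens (h - r), ae_depth_fst_ne L l,
    ae_translate (lpart_of_eq_tooth hlam hlam' hr hF.eq_tooth) (h - r),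
    ae_snd_ne (h - r + (1 - θ * h / r) * r)]
    with x e0 e1 e2 e3 e4 e5 e6 e7 hx0 hx1 hx2
  rw [e0, e1, (e2 hx0).1, (e2 hx0).2, zero_add]
  rcases lt_or_gt_of_ne e3 with h3 | h3
  · have h4 : ∀ i, lpart i F (x.1, x.2 - (h - r)) = 0 :=
      hF.lpart_eq_zero (x := (x.1, x.2 - (h - r))) (Or.inl (by simp only; linarith))
    rw [h4, h4, indicator_of_mem (show x.2 ∈ Ioo 0 (h - r) from ⟨hx1, h3⟩),
      indicator_of_notMem (show x.2 ∉ Ioo (h - r) h from fun h' => by linarith [h'.1]),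
      indicator_of_notMem (fun h' => by linarith [h'.1]), wellDens]
    simp
  rw [indicator_of_notMem (show x.2 ∉ Ioo 0 (h - r) from fun h' => by linarith [h'.2]),
    indicator_of_mem (show x.2 ∈ Ioo (h - r) h from ⟨h3, hx2⟩), zero_add]
  have hw : ∀ a b : ℝ, wellDens θ a (θ - θ * h / r + b) = wellDens (θ * h / r) a b := by
    intro a b
    rw [wellDens, wellDens]
    congr 3 <;> ring
  rw [hw]
  rcases lt_or_gt_of_ne e5 with h5 | h5
  · rw [indicator_of_mem (show x ∈ {y : Plane | h - r < y.2 ∧ depth L y.1 < l} from ⟨h3, h5⟩)]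
    grind
  · rw [indicator_of_notMem (fun h' => by linarith [h'.2]), (e6 h5).1, (e6 h5).2]
    simp only [indicator_apply, mem_Ioo]
    rcases lt_or_gt_of_ne e7 with h7 | h7
    · rw [if_pos ⟨by linarith, by linarith⟩, if_neg (by rintro ⟨h', -⟩; linarith), wellDens]
      simp
    · rw [if_neg (by rintro ⟨-, h'⟩; linarith), if_pos ⟨by linarith, by linarith⟩, wellDens]
      simp

theorem cell_slice_one (hθ : 0 < θ) (hθ2 : θ ≤ 1 / 2) (hθ' : θ * h ≤ r) (hr : 0 < r) (hrh : r ≤ h)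
    (hF : StripFn L (θ * h / r) r l η F) (hl : 0 < l) :
    ∀ᵐ s : ℝ, 0 < depth L s → SliceVar univ (fun t => lpart 1 (cell L θ h r F) (s, t))
      (6 + 8 * rate(l,L,s)) := by
  have hh : 0 < h := hr.trans_le hrh
  have hlam : 0 < θ * h / r := by positivity
  have hlam' : θ * h / r ≤ 1 := (div_le_one hr).2 hθ'
  have hlam2 : θ ≤ θ * h / r := by rw [le_div_iff₀ hr]; gcongr
  filter_upwards [ae_slice_fst (lpart_cell hr hF 1), ae_slice_fst (lpart_wedge_inside (L := L)
    hθ hr hrh), hF.slice_one, slice_of_eq_tooth hlam hlam' hr hF.eq_tooth, ae_depth_ne L l]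
    with s e1 e2 e3 e4 e5 hs
  have hp : 0 ≤ rate(l,L,s) := by positivity
  have c1 := (sliceVar_indicator_Ioo 0 (h - r) θ).add
    (sliceVar_indicator_Ioo (h - r) h (θ - θ * h / r))
  have c2 : SliceVar univ (fun t => lpart 1 F (s, t)) (2 + 8 * rate(l,L,s)) := by
    rcases lt_or_gt_of_ne e5 with h5 | h5
    · exact (e3 ⟨hs, h5⟩).mono subset_rfl (by linarith)
    · exact (e4 h5).1.mono subset_rfl (by linarith)
  refine ((c1.add (c2.translate (h - r))).congr_ae (ae_restrict_of_ae ?_)).mono subset_rfl ?_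
  · filter_upwards [e1, e2] with t h1 h2
    rw [h1, (h2 hs).2]
  grind

theorem cell_slice_zero (hθ : 0 < θ) (hθ' : θ * h ≤ r) (hr : 0 < r) (hrh : r ≤ h)
    (hF : StripFn L (θ * h / r) r l η F) (hl : 0 < l) :
    ∀ᵐ s : ℝ, 0 < depth L s → SliceVar univ (fun t => lpart 0 (cell L θ h r F) (s, t))
      (4 * rate(l,L,s)) := by
  have hh : 0 < h := hr.trans_le hrh
  have hlam : 0 < θ * h / r := by positivity
  have hlam' : θ * h / r ≤ 1 := (div_le_one hr).2 hθ'
  filter_upwards [ae_slice_fst (lpart_cell hr hF 0), ae_slice_fst (lpart_wedge_inside (L := L)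
    hθ hr hrh), hF.slice_zero, slice_of_eq_tooth hlam hlam' hr hF.eq_tooth, ae_depth_ne L l]
    with s e1 e2 e3 e4 e5 hs
  have hp : 0 ≤ rate(l,L,s) := by positivity
  have c2 : SliceVar univ (fun t => lpart 0 F (s, t)) (4 * rate(l,L,s)) := by
    rcases lt_or_gt_of_ne e5 with h5 | h5
    · exact e3 ⟨hs, h5⟩
    · exact (e4 h5).2.mono subset_rfl (by linarith)
  refine (c2.translate (h - r)).congr_ae (ae_restrict_of_ae ?_)
  filter_upwards [e1, e2] with t h1 h2
  rw [h1, (h2 hs).1, zero_add]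

theorem cell_slice_fst (hθ : 0 < θ) (hr : 0 < r) (hrh : r ≤ h)
    (hF : StripFn L (θ * h / r) r l η F) :
    ∀ᵐ t : ℝ, SliceVar (Ioo 0 (2 * L)) (fun s => lpart 0 (cell L θ h r F) (s, t)) 10 := by
  have hsub : ∀ᵐ t : ℝ, SliceVar (Ioo 0 (2 * L)) (fun s => lpart 0 F (s, t - (h - r))) 10 :=
    (measurePreserving_sub_right volume (h - r)).quasiMeasurePreserving.ae
      hF.slice_fst
  filter_upwards [hsub, ae_slice_snd (lpart_cell hr hF 0), ae_slice_snd (lpart_wedge_inside (L := L)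
    hθ hr hrh)] with t e1 e2 e3
  refine e1.congr_ae ((ae_restrict_iff' measurableSet_Ioo).2 ?_)
  filter_upwards [e2, e3] with s h2 h3 hs
  rw [h2, (h3 (depth_pos.2 hs)).1, zero_add]

end Cell

theorem measurable_lpart (hf : LocLip f) (i : Fin 2) :
    Measurable (lpart i f) := measurable_lineDeriv hf.continuous

theorem lintegral_add_rpow_le (hl : 0 < l) (hlL : l ≤ L) (ha : 0 ≤ a) (hb : 0 ≤ b) :
    ∫⁻ s in Ioo 0 (2 * L), ofReal (a + b * rate(l,L,s))
      ≤ ofReal (2 * L * a + 8 * L * b) := by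
  have hL : 0 < L := hl.trans_le hlL
  rw [lintegral_depth hL (f := fun s => ofReal (a + b * (l / s) ^ (3 / 4 : ℝ)))
    (by fun_prop)]
  calc 2 * ∫⁻ s in Ioo 0 L, ofReal (a + b * (l / s) ^ (3 / 4 : ℝ))
      ≤ 2 * ∫⁻ s in Ioo 0 L, (ofReal a
          + ofReal b * ofReal ((l / s) ^ (3 / 4 : ℝ))) := by
        gcongr with s
        rw [← ofReal_mul hb]
        exact ofReal_add_le
    _ ≤ 2 * (ofReal a * ofReal L + ofReal b * ofReal (4 * L)) := by
        rw [lintegral_add_left measurable_const, setLIntegral_const, Real.volume_Ioo, sub_zero,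
          lintegral_const_mul _ (by fun_prop)]
        gcongr
        exact lintegral_rpow_le hl hlL
    _ = ofReal (2 * L * a + 8 * L * b) := by
        rw [← ofReal_mul ha, ← ofReal_mul hb, ← ofReal_add (by positivity)
          (by positivity), ← ENNReal.ofReal_ofNat 2, ← ofReal_mul (by norm_num)]
        congr 1; ring

/-- The elastic energy of one branching strip. -/
theorem lintegral_stripDens_le (hr : 0 < r) (hl : 0 < l)
    (hlL : l ≤ L) (hη : 0 ≤ η) :
    ∫⁻ x in Ioo 0 (2 * L) ×ˢ Ioo 0 h,
      ofReal ({y : Plane | h - r < y.2 ∧ depth L y.1 < l}.indicator (fun y =>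
        η * (lam ^ 2 * (r ^ 2 / l ^ 2 * rate(l,L,y.1)
          + {s | s < r ^ 2 / l}.indicator (fun _ => 1) (depth L y.1)))) x)
      ≤ ofReal (10 * η * lam ^ 2 * r ^ 3 / l) := by
  have hL : 0 < L := hl.trans_le hlL
  have hce := continuous_depth L
  set φ : ℝ → ℝ := fun m => η * (lam ^ 2 * (r ^ 2 / l ^ 2 * (l / m) ^ (3 / 4 : ℝ)
    + {s | s < r ^ 2 / l}.indicator (fun _ => 1) m)) with hφ
  have hφm : Measurable φ := by
    have : Measurable ({s | s < r ^ 2 / l}.indicator (fun _ : ℝ => (1 : ℝ))) :=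
      measurable_const.indicator measurableSet_Iio
    fun_prop
  set g : ℝ → ℝ≥0∞ := (Iio l).indicator fun m => ofReal (φ m) with hg
  have hgm : Measurable g := Measurable.indicator (by fun_prop) measurableSet_Iio
  have e1 : ∀ x : Plane, ofReal ({y : Plane | h - r < y.2 ∧ depth L y.1 < l}.indicator
      (fun y => φ (depth L y.1)) x)
      = g (depth L x.1) * (Ioi (h - r)).indicator (fun _ => 1) x.2 := by
    intro x
    simp only [hg, indicator_apply, mem_ofPred_eq, mem_Iio, mem_Ioi]
    by_cases h1 : h - r < x.2 <;> by_cases h2 : depth L x.1 < l <;> simp [h1, h2]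
  have hgm' : Measurable fun s => g (depth L s) := hgm.comp hce.measurable
  refine (lintegral_mono fun x => (e1 x).le).trans ?_
  rw [Measure.volume_eq_prod, ← Measure.prod_restrict, lintegral_prod_mul hgm'.aemeasurable
    ((measurable_const.indicator measurableSet_Ioi).aemeasurable), lintegral_depth hL hgm]
  have e3 : ∫⁻ y in Ioo 0 h, (Ioi (h - r)).indicator (fun _ => (1 : ℝ≥0∞)) y
      ≤ ofReal r := by
    rw [lintegral_indicator measurableSet_Ioi, setLIntegral_const, one_mul,
      Measure.restrict_apply measurableSet_Ioi]
    refine (measure_mono (show Ioi (h - r) ∩ Ioo 0 h ⊆ Ioo (h - r) h from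
      fun t ht => ⟨ht.1, ht.2.2⟩)).trans (le_of_eq ?_)
    rw [Real.volume_Ioo]
    congr 1; ring
  have e4 : ∫⁻ s in Ioo 0 L, g s ≤ ofReal (η * lam ^ 2 * (5 * r ^ 2 / l)) := by
    calc ∫⁻ s in Ioo 0 L, g s ≤ ∫⁻ s in Ioo 0 l, ofReal (φ s) := by
          rw [hg, lintegral_indicator measurableSet_Iio,
            Measure.restrict_restrict measurableSet_Iio]
          exact lintegral_mono_set fun s hs => ⟨hs.2.1, hs.1⟩
      _ ≤ ∫⁻ s in Ioo 0 l, ofReal (η * lam ^ 2) * (ofReal (r ^ 2 / l ^ 2)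
          * ofReal ((l / s) ^ (3 / 4 : ℝ)) + (Iio (r ^ 2 / l)).indicator (fun _ => 1) s) := by
          refine lintegral_mono fun s => ?_
          simp only [hφ]
          rw [← ofReal_mul (by positivity), ← mul_assoc, ofReal_mul (by positivity)]
          gcongr
          refine ofReal_add_le.trans (le_of_eq ?_)
          congr 1
          by_cases hs : s < r ^ 2 / l <;> simp [hs]
      _ ≤ ofReal (η * lam ^ 2) * (ofReal (r ^ 2 / l ^ 2) * ofReal (4 * l)
          + ofReal (r ^ 2 / l)) := by
          rw [lintegral_const_mul' _ _ ofReal_ne_top, lintegral_add_left (by fun_prop),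
            lintegral_const_mul _ (by fun_prop), lintegral_indicator measurableSet_Iio,
            setLIntegral_const, one_mul, Measure.restrict_apply measurableSet_Iio]
          gcongr
          · exact lintegral_rpow_le hl le_rfl
          · refine (measure_mono (show Iio (r ^ 2 / l) ∩ Ioo 0 l ⊆ Ioo 0 (r ^ 2 / l) from
              fun t ht => ⟨ht.2.1, ht.1⟩)).trans (le_of_eq ?_)
            rw [Real.volume_Ioo, sub_zero]
      _ = ofReal (η * lam ^ 2 * (5 * r ^ 2 / l)) := by
          rw [← ofReal_mul (by positivity), ← ofReal_add (by positivity)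
            (by positivity), ← ofReal_mul (by positivity)]
          grind
  refine (mul_le_mul' (mul_le_mul' le_rfl e4) e3).trans (le_of_eq ?_)
  rw [← ENNReal.ofReal_ofNat 2, ← ofReal_mul (by norm_num),
    ← ofReal_mul (by positivity)]
  congr 1
  field_simp
  ring

/-- The periodic repetition of a cell of height `h`. -/
def periodic (h : ℝ) (N : ℕ) (V : Plane → ℝ) (x : Plane) : ℝ :=
  ∑ j ∈ Finset.range N, V (x.1, x.2 - j * h)

section Periodic

variable {N : ℕ} {V : Plane → ℝ}

theorem locallyLipschitz_periodic (hV : LocLip V) :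
    LocLip (periodic h N V) :=
  LocallyLipschitz_sum _ fun j => locallyLipschitz_translate hV (j * h)

theorem lpart_periodic (hV : LocLip V) (i : Fin 2) :
    ∀ᵐ x, lpart i (periodic h N V) x
      = ∑ j ∈ Finset.range N, lpart i V (x.1, x.2 - j * h) := by
  filter_upwards [lpart_sum (Finset.range N)
    (fun j : ℕ => locallyLipschitz_translate hV (j * h)) i] with x hx
  simp only [lpart_translate] at hx
  exact hx

theorem succ_mul_le_one (hh : 0 < h) (hN : N * h = 1) {k : ℕ} (hk : k ∈ Finset.range N) :
    ((k : ℝ) + 1) * h ≤ 1 := by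
  have : (k : ℝ) + 1 ≤ N := by exact_mod_cast Finset.mem_range.1 hk
  nlinarith

/-- At most one cell contributes. -/
theorem sum_lpart_cases (hh : 0 < h) (hN : N * h = 1)
    (hV0 : ∀ x : Plane, (x.2 < 0 ∨ h < x.2) → ∀ i, lpart i V x = 0) (ht : ∀ j : ℕ, t ≠ j * h) :
    (∃ j ∈ Finset.range N, 0 < t - j * h ∧ t - j * h < h ∧
      ∀ i s, ∑ k ∈ Finset.range N, lpart i V (s, t - k * h) = lpart i V (s, t - j * h)) ∨
      (t ∉ Ioo 0 1 ∧ ∀ i s, ∑ k ∈ Finset.range N, lpart i V (s, t - k * h) = 0) := by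
  by_cases hx : t ∈ Ioo 0 1
  · left
    have hxh : 0 ≤ t / h := div_nonneg hx.1.le hh.le
    set j := ⌊t / h⌋₊ with hj
    have h1 : j * h < t := lt_of_le_of_ne ((le_div_iff₀ hh).1 (Nat.floor_le hxh)) (ht j).symm
    have h2 : t < (j + 1) * h := (div_lt_iff₀ hh).1 (Nat.lt_floor_add_one _)
    have hjN : j < N := by
      have : (j : ℝ) * h < N * h := by rw [hN]; exact h1.trans hx.2
      exact_mod_cast lt_of_mul_lt_mul_right this hh.le
    refine ⟨j, Finset.mem_range.2 hjN, by linarith, by linarith, fun i s => ?_⟩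
    rw [Finset.sum_eq_single_of_mem j (Finset.mem_range.2 hjN)]
    intro k _ hkj
    refine hV0 _ ?_ i
    rcases lt_or_gt_of_ne hkj with hk | hk
    · right
      have : (k : ℝ) + 1 ≤ j := by exact_mod_cast hk
      nlinarith
    · left
      have : (j : ℝ) + 1 ≤ k := by exact_mod_cast hk
      nlinarith
  · refine Or.inr ⟨hx, fun i s => Finset.sum_eq_zero fun k hk => hV0 _ ?_ i⟩
    have hk0 : 0 ≤ (k : ℝ) * h := by positivity
    have hk1 := succ_mul_le_one hh hN hk
    grind

theorem lpart_periodic_cases (hh : 0 < h) (hN : N * h = 1) (hV : LocLip V)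
    (hV0 : ∀ x : Plane, (x.2 < 0 ∨ h < x.2) → ∀ i, lpart i V x = 0) :
    ∀ᵐ x : Plane, (∃ j ∈ Finset.range N, 0 < x.2 - j * h ∧ x.2 - j * h < h ∧
        ∀ i, lpart i (periodic h N V) x = lpart i V (x.1, x.2 - j * h)) ∨
      (x.2 ∉ Ioo 0 1 ∧ ∀ i, lpart i (periodic h N V) x = 0) := by
  have hne : ∀ᵐ x : Plane, ∀ j : ℕ, x.2 ≠ j * h := ae_all_iff.2 fun j => ae_snd_ne _
  filter_upwards [hne, lpart_periodic hV 0, lpart_periodic hV 1] with x e1 e2 e3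
  have e4 : ∀ i, lpart i (periodic h N V) x
      = ∑ j ∈ Finset.range N, lpart i V (x.1, x.2 - j * h) := Fin.forall_fin_two.2 ⟨e2, e3⟩
  refine (sum_lpart_cases hh hN hV0 e1).imp ?_ ?_
  · grind
  · rintro ⟨h1, h2⟩
    exact ⟨h1, fun i => (e4 i).trans (h2 i x.1)⟩

theorem lintegral_sum_translate {g : Plane → ℝ≥0∞} (hg : Measurable g) (h : ℝ) (N : ℕ) :
    ∫⁻ x : Plane, ∑ j ∈ Finset.range N, g (x.1, x.2 - j * h) = N * ∫⁻ x, g x := by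
  rw [lintegral_finsetSum (Finset.range N) (f := fun (j : ℕ) (x : Plane) => g (x.1, x.2 - j * h))
    fun j _ => hg.comp (by fun_prop)]
  have : ∀ p : ℝ, ∫⁻ x : Plane, g (x.1, x.2 - p) = ∫⁻ x, g x := by
    intro p
    have := lintegral_sub_right_eq_self (μ := volume) g (0, p)
    rw [← this]
    refine lintegral_congr fun x => ?_
    congr 1
    ext <;> simp
  simp only [this, Finset.sum_const, Finset.card_range, nsmul_eq_mul]

/-- The integral over `T` of a density of the gradient of a periodic function is at most `N` times
the integral over `S`, if the translates of `S` cover the part of `T` that meets the cells. -/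
theorem setLIntegral_periodic_le (hh : 0 < h) (hN : N * h = 1) (hV : LocLip V)
    (hV0 : ∀ x : Plane, (x.2 < 0 ∨ h < x.2) → ∀ i, lpart i V x = 0) {f : ℝ → ℝ → ℝ}
    (hf : Measurable (Function.uncurry f)) {S T : Set Plane} (hS : MeasurableSet S)
    (hT : MeasurableSet T) (hST : ∀ x ∈ T, ∀ j ∈ Finset.range N, 0 < x.2 - j * h →
      x.2 - j * h < h → ((x.1, x.2 - j * h) : Plane) ∈ S)
    (h0 : ∀ x ∈ T, x.2 ∉ Ioo 0 1 → f 0 0 ≤ 0) :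
    ∫⁻ x in T, ofReal (f (lpart 0 (periodic h N V) x) (lpart 1 (periodic h N V) x))
      ≤ N * ∫⁻ x in S, ofReal (f (lpart 0 V x) (lpart 1 V x)) := by
  have hgm : Measurable fun x => ofReal (f (lpart 0 V x) (lpart 1 V x)) :=
    (hf.comp ((measurable_lpart hV 0).prodMk (measurable_lpart hV 1))).ennreal_ofReal
  rw [← lintegral_indicator hS, ← lintegral_sum_translate (hgm.indicator hS),
    ← lintegral_indicator hT]
  refine lintegral_mono_ae ?_
  filter_upwards [lpart_periodic_cases hh hN hV hV0] with x hx
  by_cases hxT : x ∈ T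
  · rw [indicator_of_mem hxT]
    rcases hx with ⟨j, hj, h1, h2, h3⟩ | hx
    · rw [h3, h3]
      refine le_trans (le_of_eq ?_) (Finset.single_le_sum (fun _ _ => zero_le) hj)
      rw [indicator_of_mem (hST x hxT j hj h1 h2)]
    · rw [hx.2, hx.2, ENNReal.ofReal_of_nonpos (h0 x hxT hx.1)]
      exact zero_le
  · rw [indicator_of_notMem hxT]; exact zero_le

theorem periodic_slice_snd (hV : LocLip V) (i : Fin 2) {n : ℝ → ℝ} {P : ℝ → Prop}
    (hs : ∀ᵐ s : ℝ, P s → SliceVar univ (fun t => lpart i V (s, t)) (n s)) :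
    ∀ᵐ s : ℝ, P s → SliceVar univ (fun t => lpart i (periodic h N V) (s, t)) (N * n s) := by
  filter_upwards [hs, ae_slice_fst (lpart_periodic (h := h) (N := N) hV i)] with s h1 h2 hP
  have := SliceVar.sum (Finset.range N)
    (g := fun (j : ℕ) t => lpart i V (s, t - j * h)) (n := fun _ => n s)
    fun j _ => (h1 hP).translate (j * h)
  refine (this.congr_ae (ae_restrict_of_ae h2)).mono subset_rfl (le_of_eq ?_)
  simp

theorem periodic_slice_fst (hh : 0 < h) (hN : N * h = 1) (hV : LocLip V)
    (hV0 : ∀ x : Plane, (x.2 < 0 ∨ h < x.2) → ∀ i, lpart i V x = 0) (hs : ∀ᵐ t : ℝ, SliceVar (Ioo 0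
        (2 * L)) (fun s => lpart 0 V (s, t)) n) :
    ∀ᵐ t : ℝ, SliceVar (Ioo 0 (2 * L)) (fun s => lpart 0 (periodic h N V) (s, t)) n := by
  have hs' : ∀ᵐ t : ℝ, ∀ j : ℕ, SliceVar (Ioo 0 (2 * L)) (fun s => lpart 0 V (s, t - j * h)) n :=
    ae_all_iff.2 fun j => (measurePreserving_sub_right volume
      (j * h)).quasiMeasurePreserving.ae hs
  have hne : ∀ᵐ t : ℝ, ∀ j : ℕ, t ≠ j * h := ae_all_iff.2 fun j => Measure.ae_ne volume _
  filter_upwards [hs', hne, ae_slice_snd (lpart_periodic (h := h) (N := N) hV 0)] with t h1 h2 h3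
  rcases sum_lpart_cases hh hN hV0 h2 with ⟨j, -, -, -, h4⟩ | ⟨-, h4⟩
  · refine (h1 j).congr_ae (ae_restrict_of_ae (h3.mono fun s hs => ?_))
    exact hs.trans (h4 0 s)
  · refine ((sliceVar_zero _).mono subset_rfl (h1 0).nonneg).congr_ae
      (ae_restrict_of_ae (h3.mono fun s hs => ?_))
    exact hs.trans (h4 0 s)

end Periodic

/-- There is a locally Lipschitz scalar competitor with energy at most `b`. -/
def HasCompetitor (μ ε θ L b : ℝ) : Prop :=
  ∃ v : Plane → ℝ, LocLip v ∧ energyE μ ε θ L v ≤ ofReal b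

theorem HasCompetitor.mono {b' : ℝ} (h : HasCompetitor μ ε θ L b) (hb : b ≤ b') :
    HasCompetitor μ ε θ L b' :=
  h.imp fun _ hv => ⟨hv.1, hv.2.trans (ofReal_le_ofReal hb)⟩

/-- The energy of a competitor from its exterior energy, its elastic energy and its slices. -/
theorem hasCompetitor_of_bounds {V2 V12 V1 : ℝ} (hv : LocLip v) (hμ : 0 ≤ μ) (hε : 0 ≤ ε)
    (hX0 : 0 ≤ X) (hD0 : 0 ≤ D)
    (hV2 : 0 ≤ V2) (hV12 : 0 ≤ V12) (hV1 : 0 ≤ V1) {n22 n12 n11 : ℝ → ℝ}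
    (hX : ∫⁻ x in (nucleus L)ᶜ, ofReal (lpart 0 v x ^ 2 + lpart 1 v x ^ 2)
      ≤ ofReal X)
    (hD : ∫⁻ x in nucleus L, ofReal (wellDens θ (lpart 0 v x) (lpart 1 v x))
      ≤ ofReal D)
    (h : SliceBounds L v n22 n12 n11)
    (i22 : ∫⁻ s in Ioo 0 (2 * L), ofReal (n22 s) ≤ ofReal V2)
    (i12 : ∫⁻ s in Ioo 0 (2 * L), ofReal (n12 s) ≤ ofReal V12)
    (i11 : ∫⁻ t in Ioo 0 1, ofReal (n11 t) ≤ ofReal V1) :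
    HasCompetitor μ ε θ L (μ * X + D + ε * (V2 + 2 * V12 + V1)) := by
  refine ⟨v, hv, (energyE_le hv).trans ?_⟩
  have hh := (hessVar_scalarField_le hv h).trans
    (add_le_add (add_le_add i22 (mul_le_mul_right i12 2)) i11)
  rw [← ENNReal.ofReal_ofNat 2, ← ofReal_mul (by norm_num),
    ← ofReal_add hV2 (by positivity), ← ofReal_add (by positivity) hV1] at hh
  rw [ofReal_add (by positivity) (by positivity), ofReal_add (by positivity) hD0,
    ofReal_mul hμ, ofReal_mul hε]
  gcongr

theorem slice_snd_restrict {i : Fin 2} {n : ℝ → ℝ}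
    (h : ∀ᵐ s : ℝ, 0 < depth L s → SliceVar univ (fun t => lpart i v (s, t)) (n s)) :
    ∀ᵐ s ∂(volume.restrict (Ioo 0 (2 * L))), SliceVar (Ioo 0 1) (fun t => lpart i v (s, t)) (n s) :=
  (ae_restrict_iff' measurableSet_Ioo).2 (h.mono fun _ hs hsL =>
    (hs (depth_pos.2 hsL)).mono (subset_univ _) le_rfl)

/-- The energy of `N` periods of a branched laminate. -/
theorem hasCompetitor_periodic {N : ℕ} (hμ : 0 ≤ μ)
    (hε : 0 ≤ ε) (hθ : 0 < θ) (hθ2 : θ ≤ 1 / 2) (hL : 1 / 2 ≤ L) (hh : 0 < h) (hN : N * h = 1)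
    (hrθ : θ * h ≤ r) (hrh : r ≤ h) (hl : 0 < l) (hlL : l ≤ L) (hη : 0 ≤ η)
    (hκ : (r = h ∧ κ = 0) ∨ (2 * r ≤ h ∧ κ = 1)) (hF : StripFn L (θ * h / r) r l η F) :
    HasCompetitor μ ε θ L (20 * κ * (μ * θ ^ 2 * h * log (1 + h / r))
      + 10 * η * (θ ^ 2 * h * r / l) + 160 * (ε * L / h)) := by
  have hr : 0 < r := (mul_pos hθ hh).trans_le hrθ
  have hL0 : 0 < L := by linarith
  have hNh : (N : ℝ) = 1 / h := by rw [eq_div_iff hh.ne', hN]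
  have hh1 : h ≤ 1 := by
    have : (1 : ℝ) ≤ N := by
      have : N ≠ 0 := by rintro rfl; simp at hN
      exact_mod_cast Nat.one_le_iff_ne_zero.2 this
    nlinarith
  have hκ0 : 0 ≤ κ := by grind
  have hlog : 0 ≤ log (1 + h / r) := log_nonneg (by linarith [div_pos hh hr])
  have hV := locallyLipschitz_cell (θ := θ) (h := h) hr hF
  have hV0 : ∀ x : Plane, (x.2 < 0 ∨ h < x.2) → ∀ i, lpart i (cell L θ h r F) x = 0 :=
    fun x hx i => lpart_cell_eq_zero hθ hr hrh hF hx i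
  have hdm : Measurable (Function.uncurry (wellDens θ)) := by
    unfold Function.uncurry wellDens; fun_prop
  have hS : MeasurableSet (Ioo 0 (2 * L) ×ˢ Ioo 0 h) := measurableSet_Ioo.prod measurableSet_Ioo
  have hΩ : MeasurableSet (nucleus L) := measurableSet_Ioo.prod measurableSet_Ioo
  have hX := (setLIntegral_periodic_le hh hN hV hV0 (f := fun a b => a ^ 2 + b ^ 2) (by fun_prop)
    (measurableSet_Ioo.compl.prod .univ) hΩ.compl (fun x hx j hj h1 h2 => ⟨fun h' => hx ⟨h',
      (by positivity : 0 ≤ (j : ℝ) * h).trans_lt (sub_pos.1 h1),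
      by linarith [succ_mul_le_one hh hN hj]⟩, mem_univ _⟩) fun _ _ _ => by simp).trans
    (mul_le_mul_right (cell_exterior hL0 hθ hr hκ hF) _)
  have hD : ∫⁻ x in Ioo 0 (2 * L) ×ˢ Ioo 0 h, ofReal (wellDens θ
      (lpart 0 (cell L θ h r F) x) (lpart 1 (cell L θ h r F) x))
      ≤ ofReal (10 * η * (θ * h / r) ^ 2 * r ^ 3 / l) := by
    refine le_trans (lintegral_mono_ae ((ae_restrict_iff' hS).2 ?_))
      (lintegral_stripDens_le (h := h) hr hl hlL hη)
    filter_upwards [cell_dens hθ hrθ hr hrh hF] with x hx hxS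
    exact ofReal_le_ofReal (hx (depth_pos.2 hxS.1) hxS.2.1 hxS.2.2)
  have hD' := (setLIntegral_periodic_le hh hN hV hV0 hdm hS hΩ
    (fun _ hx _ _ h1 h2 => ⟨hx.1, h1, h2⟩) fun _ hx h => absurd hx.2 h).trans
        (mul_le_mul_right hD _)
  rw [← ENNReal.ofReal_natCast, ← ofReal_mul (by positivity)] at hX hD'
  have s22 := periodic_slice_snd (h := h) (N := N) hV 1 (cell_slice_one hθ hθ2 hrθ hr hrh hF hl)
  have s12 := periodic_slice_snd (h := h) (N := N) hV 0 (cell_slice_zero hθ hrθ hr hrh hF hl)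
  have s11 := periodic_slice_fst hh hN hV hV0 (cell_slice_fst hθ hr hrh hF)
  have i22 : ∫⁻ s in Ioo 0 (2 * L), ofReal (N * (6 + 8 * rate(l,L,s)))
      ≤ ofReal (N * (2 * L * 6 + 8 * L * 8)) := by
    simp only [ofReal_mul (Nat.cast_nonneg N)]
    rw [lintegral_const_mul' _ _ ofReal_ne_top]
    gcongr
    exact lintegral_add_rpow_le hl hlL (by norm_num) (by norm_num)
  have i12 : ∫⁻ s in Ioo 0 (2 * L), ofReal (N * (4 * rate(l,L,s)))
      ≤ ofReal (N * (8 * L * 4)) := by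
    simp only [ofReal_mul (Nat.cast_nonneg N)]
    rw [lintegral_const_mul' _ _ ofReal_ne_top]
    gcongr
    simpa using lintegral_add_rpow_le (a := 0) (b := 4) hl hlL le_rfl (by norm_num)
  have i11 : ∫⁻ _t in Ioo (0 : ℝ) 1, ofReal 10 ≤ ofReal 10 := by
    simp
  refine (hasCompetitor_of_bounds (locallyLipschitz_periodic hV) hμ hε (by positivity)
    (by positivity) (by positivity) (by positivity) (by norm_num) hX hD' ⟨slice_snd_restrict s22,
    slice_snd_restrict s12, ae_restrict_of_ae s11⟩ i22 i12 i11).mono ?_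
  rw [hNh]
  have e1 : μ * (1 / h * (κ * (20 * (θ * h) ^ 2 * log (1 + h / r))))
      = 20 * κ * (μ * θ ^ 2 * h * log (1 + h / r)) := by field_simp
  have e2 : 1 / h * (10 * η * (θ * h / r) ^ 2 * r ^ 3 / l) = 10 * η * (θ ^ 2 * h * r / l) := by
    field_simp
  rw [e1, e2]
  have e3 : (10 : ℝ) ≤ 20 * (L / h) := by
    have : L ≤ L / h := by rw [le_div_iff₀ hh]; nlinarith
    linarith
  have e4 : 1 / h * (2 * L * 6 + 8 * L * 8) + 2 * (1 / h * (8 * L * 4)) + 10 ≤ 160 * (L / h) := by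
    grind
  have := mul_le_mul_of_nonneg_left e4 hε
  grind

theorem hasCompetitor_zero (hμ : 0 ≤ μ) (hε : 0 ≤ ε) (hL : 0 ≤ L) :
    HasCompetitor μ ε θ L (2 * (θ ^ 2 * L)) := by
  have hz : ∀ i x, lpart i (fun _ => (0 : ℝ)) x = 0 := fun i x => lpart_const 0 i x
  have h0 : ∀ (I : Set ℝ) (i : Fin 2) (f : ℝ → Plane),
      SliceVar I (fun t => lpart i (fun _ => (0 : ℝ)) (f t)) 0 := fun I i f => by
    simp only [hz]; exact sliceVar_zero I
  refine (hasCompetitor_of_bounds (v := fun _ => 0) (X := 0) (D := θ ^ 2 * (2 * L)) (V2 := 0)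
    (V12 := 0) (V1 := 0) (n22 := fun _ => 0) (n12 := fun _ => 0) (n11 := fun _ => 0)
    (.const 0) hμ hε le_rfl (by positivity) le_rfl le_rfl le_rfl ?_ ?_
    ⟨.of_forall fun s => h0 _ _ _, .of_forall fun s => h0 _ _ _, .of_forall fun s => h0 _ _ _⟩
    (by simp) (by simp) (by simp)).mono
    (le_of_eq (by ring))
  · simp [hz]
  · calc ∫⁻ x in nucleus L, ofReal (wellDens θ (lpart 0 (fun _ => (0 : ℝ)) x)
          (lpart 1 (fun _ => (0 : ℝ)) x))
        ≤ ∫⁻ x in nucleus L, ofReal (θ ^ 2) := by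
          refine lintegral_mono fun x => ofReal_le_ofReal ?_
          rw [hz, hz, wellDens]
          have := min_le_left ((0 - θ) ^ 2) ((0 + 1 - θ) ^ 2)
          nlinarith
      _ = ofReal (θ ^ 2 * (2 * L)) := by
          rw [setLIntegral_const, ofReal_mul (sq_nonneg θ), nucleus]
          congr 1
          rw [Measure.volume_eq_prod, Measure.prod_prod]
          simp

/-! ### Logarithmic decay above the nucleus -/

/-- A function equal to `θ` on the part `depth ≥ k` of the upper side of the nucleus. It decays
linearly in the lateral direction over a length `a` that grows with the height above the nucleus,
and it vanishes at height `M`. For `p = 1` it also decreases towards the middle of the nucleus. -/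
def decay (L θ k a M p : ℝ) (x : Plane) : ℝ :=
  θ * max (1 - max (k - depth L x.1) 0 * (a + max (x.2 - 1) 0)⁻¹
    - (max (x.2 - 1) 0 + p * max (depth L x.1) 0) / M) 0

theorem lpart_pos (hf : LocLip f) (i : Fin 2) :
    ∀ᵐ x, (0 ≤ f x → lpart i (fun y => max (f y) 0) x = lpart i f x) ∧
      (f x ≤ 0 → lpart i (fun y => max (f y) 0) x = 0) := by
  simpa only [lpart_const] using lpart_max hf (.const 0) i

section Decay

theorem locallyLipschitz_decay_aux (ha : 0 < a) : LocLip fun x : Plane =>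
    1 - max (k - depth L x.1) 0 * (a + max (x.2 - 1) 0)⁻¹
      - (max (x.2 - 1) 0 + p * max (depth L x.1) 0) / M := by
  have hq := locallyLipschitz_inv (f := fun x => a + max (x.2 - 1) 0) (by fun_prop)
    fun x => (add_pos_of_pos_of_nonneg ha (le_max_right _ _)).ne'
  simp only [div_eq_mul_inv]
  fun_prop

theorem locallyLipschitz_decay (ha : 0 < a) : LocLip (decay L θ k a M p) :=
  locallyLipschitz_mul (.const θ) ((locallyLipschitz_decay_aux ha).max (.const 0))

theorem abs_div_le_of (hM : 0 < M) (hc : |c| ≤ 1) : |c / M| ≤ 1 / M := by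
  rw [abs_div, abs_of_pos hM]; gcongr

theorem deriv_decay_aux {D Y P : ℝ → ℝ} {D' Y' P' : ℝ} (hD : HasDerivAt D D' 0)
    (hY : HasDerivAt Y Y' 0) (hP : HasDerivAt P P' 0) (hne : a + Y 0 ≠ 0) :
    deriv (fun t => 1 - D t * (a + Y t)⁻¹ - (Y t + p * P t) / M) 0
      = -(D' * (a + Y 0)⁻¹) + D 0 * (Y' * (a + Y 0)⁻¹ ^ 2) - (Y' + p * P') / M := by
  refine ((((hasDerivAt_const (0 : ℝ) (1 : ℝ)).sub (hD.mul ((hY.const_add a).inv hne))).sub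
    ((hY.add (hP.const_mul p)).div_const M)).congr_deriv ?_).deriv
  simp only [Pi.inv_apply]
  field_simp
  ring

/-- The gradient of `decay` at the height `y` is of order `θ / (a + y)` on the layers where it changes in
the lateral direction, and of order `θ / M` elsewhere. -/
theorem decay_sq_grad_le (hθ : 0 < θ) (ha : 0 < a) (hM : 0 < M) (hp0 : 0 ≤ p) (hp1 : p ≤ 1) :
    ∀ᵐ x : Plane, 1 < x.2 →
      lpart 0 (decay L θ k a M p) x ^ 2 + lpart 1 (decay L θ k a M p) x ^ 2
      ≤ if x.2 - 1 ≤ M ∧ k - depth L x.1 ≤ a + (x.2 - 1) ∧ p * depth L x.1 ≤ M then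
        4 * θ ^ 2 * ((if 0 < k - depth L x.1 then (a + (x.2 - 1))⁻¹ else 0) ^ 2 + (1 / M) ^ 2)
        else 0 := by
  have hm := locallyLipschitz_depth L
  have ly : LocLip fun x : Plane => x.2 - 1 := by fun_prop
  have dy := lpart_affine' (f := fun x : Plane => x.2 - 1) (-1) 0 1 fun x => by ring
  have lkm : LocLip fun x : Plane => k - depth L x.1 := by fun_prop
  have dkm : ∀ i, ∀ᵐ x, lpart i (fun x : Plane => k - depth L x.1) x
      = -lpart i (fun x : Plane => depth L x.1) x := fun i =>
    (lpart_sub (.const k) hm i).mono fun x hx => by rw [hx, lpart_const, zero_sub]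
  have hz := lpart_pos (locallyLipschitz_decay_aux (L := L) (k := k) (M := M) (p := p) ha)
  have key : ∀ i, ∀ᵐ x : Plane, 1 < x.2 → 0 < decay L θ k a M p x →
      lpart i (decay L θ k a M p) x = θ * (
        -(lpart i (fun x : Plane => max (k - depth L x.1) 0) x * (a + (x.2 - 1))⁻¹)
        + max (k - depth L x.1) 0 * (lpart i (fun x : Plane => x.2 - 1) x
          * (a + (x.2 - 1))⁻¹ ^ 2)
        - (lpart i (fun x : Plane => x.2 - 1) x
          + p * lpart i (fun x : Plane => max (depth L x.1) 0) x) / M) := by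
    intro i
    filter_upwards [hz i, ae_lineDifferentiableAt (lkm.max (.const 0)) i,
      ae_lineDifferentiableAt (ly.max (.const 0)) i,
      ae_lineDifferentiableAt (hm.max (.const 0)) i, lpart_pos ly i] with x h1 h2 h3 h4 h5 hx hd
    have hpos := (pos_iff_pos_of_mul_pos hd).1 hθ
    have hx0 : 0 < x.2 - 1 := by linarith
    have e := deriv_decay_aux (a := a) (p := p) (M := M) h2.hasLineDerivAt h3.hasLineDerivAt
      h4.hasLineDerivAt (by positivity)
    unfold decay
    rw [lpart_const_mul, h1.1 ((lt_max_iff.1 hpos).resolve_right (lt_irrefl _)).le, ← h5.1 hx0.le]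
    congr 1
    refine Eq.trans e ?_
    simp only [zero_smul, add_zero, max_eq_left hx0.le, lpart]
  filter_upwards [key 0, key 1, lpart_depth L, lpart_pos lkm 0, lpart_pos lkm 1, lpart_pos hm 0,
    lpart_pos hm 1, dkm 0, dkm 1, hz 0, hz 1] with x k0 k1 hE c0 c1 p0 p1 d0 d1 z0 z1 hx
  rcases le_or_gt (decay L θ k a M p x) 0 with hle | hlt
  · have h1 : 1 - max (k - depth L x.1) 0 * (a + max (x.2 - 1) 0)⁻¹
        - (max (x.2 - 1) 0 + p * max (depth L x.1) 0) / M ≤ 0 := by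
      by_contra! hc
      exact absurd hle (not_le.2 (mul_pos hθ (lt_max_of_lt_left hc)))
    have e : ∀ i, lpart i (decay L θ k a M p) x = θ * lpart i (fun x : Plane =>
      max (1 - max (k - depth L x.1) 0 * (a + max (x.2 - 1) 0)⁻¹
      - (max (x.2 - 1) 0 + p * max (depth L x.1) 0) / M) 0) x := fun i => lpart_const_mul _ _ _ _
    rw [e, e, z0.2 h1, z1.2 h1]
    split_ifs <;> simp <;> positivity
  have hx0 : 0 < x.2 - 1 := by linarith
  have hpos : 0 < 1 - max (k - depth L x.1) 0 * (a + (x.2 - 1))⁻¹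
      - ((x.2 - 1) + p * max (depth L x.1) 0) / M := by
    have := (lt_max_iff.1 ((pos_iff_pos_of_mul_pos hlt).1 hθ)).resolve_right (lt_irrefl _)
    grind
  have hk0 := k0 hx hlt
  have hk1 := k1 hx hlt
  rw [(dy x).1] at hk0
  rw [(dy x).2] at hk1
  set y := x.2 - 1
  set D := max (k - depth L x.1) 0
  set P := max (depth L x.1) 0
  set q := (a + y)⁻¹
  have hay : 0 < a + y := by linarith
  have hq0 : 0 < q := inv_pos.2 hay
  have hD0 : 0 ≤ D := le_max_right _ _
  have hP0 : 0 ≤ p * P := mul_nonneg hp0 (le_max_right _ _)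
  have hyM0 : 0 ≤ (y + p * P) / M := by positivity
  have hDq : D * q ≤ 1 := by linarith
  have hDa : D ≤ a + y := by rwa [← div_eq_mul_inv, div_le_one hay] at hDq
  have hyP : y + p * P ≤ M := by
    rw [← div_le_one hM]; linarith [mul_nonneg hD0 hq0.le]
  rw [if_pos ⟨by linarith, (le_max_left _ _).trans hDa,
    (mul_le_mul_of_nonneg_left (le_max_left _ _) hp0).trans (by linarith)⟩]
  set κ := if 0 < k - depth L x.1 then q else 0 with hκ
  have hP0' : |lpart 0 (fun x : Plane => max (depth L x.1) 0) x| ≤ 1 := by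
    grind
  have hP1' : lpart 1 (fun x : Plane => max (depth L x.1) 0) x = 0 := by
    grind
  have hpP : |(0 + p * lpart 0 (fun x : Plane => max (depth L x.1) 0) x) / M| ≤ 1 / M := by
    refine abs_div_le_of hM ?_
    rw [zero_add, abs_mul, abs_of_nonneg hp0]
    exact mul_le_one₀ hp1 (abs_nonneg _) hP0'
  have hS : |lpart 0 (decay L θ k a M p) x| ≤ θ * (κ + 1 / M) ∧
      |lpart 1 (decay L θ k a M p) x| ≤ θ * (κ + 1 / M) := by
    rw [hk0, hk1, hP1', abs_mul, abs_mul, abs_of_pos hθ]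
    have h1M : |(1 + p * 0) / M| ≤ 1 / M := abs_div_le_of hM (by simp)
    rcases le_or_gt (k - depth L x.1) 0 with h | h
    · have hD' : D = 0 := max_eq_right h
      rw [c0.2 h, c1.2 h, hD', hκ, if_neg h.not_gt]
      constructor <;> gcongr <;> grind
    · rw [hκ, if_pos h, c0.1 h.le, c1.1 h.le,
        d0, d1, hE.2]
      constructor
      · gcongr
        refine (abs_sub _ _).trans (add_le_add ?_ hpP)
        rw [zero_mul, mul_zero, add_zero, neg_mul, neg_neg, abs_mul, abs_of_pos hq0]
        exact mul_le_of_le_one_left hq0.le hE.1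
      · gcongr
        refine (abs_sub _ _).trans (add_le_add ?_ h1M)
        rw [neg_zero, zero_mul, neg_zero, zero_add, one_mul, abs_of_nonneg (by positivity)]
        nlinarith
  have hfin : ∀ u : ℝ, |u| ≤ θ * (κ + 1 / M) → u ^ 2 ≤ 2 * θ ^ 2 * (κ ^ 2 + (1 / M) ^ 2) := by
    intro u hu
    rw [← sq_abs]
    refine (pow_le_pow_left₀ (abs_nonneg _) hu 2).trans ?_
    nlinarith [mul_nonneg (sq_nonneg θ) (sq_nonneg (κ - 1 / M))]
  linarith [hfin _ hS.1, hfin _ hS.2]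

end Decay

/-- The layer has one part at each end of the nucleus. -/
theorem volume_depth_layer_le (L k : ℝ) (hb : 0 ≤ b) :
    volume {s : ℝ | 0 < k - depth L s ∧ k - depth L s ≤ b} ≤ ofReal (2 * b) := by
  have hsub : {s : ℝ | 0 < k - depth L s ∧ k - depth L s ≤ b}
      ⊆ Icc (k - b) k ∪ Icc (2 * L - k) (2 * L - k + b) := by
    rintro s ⟨h1, h2⟩
    rcases min_choice s (2 * L - s) with h | h <;> rw [depth, h] at h1 h2
    · grind
    grind
  refine ((measure_mono hsub).trans (measure_union_le _ _)).trans (le_of_eq ?_)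
  rw [Real.volume_Icc, Real.volume_Icc, ← ofReal_add (by linarith) (by linarith)]
  congr 1; ring

section Decay

theorem decay_lintegral_le (hθ : 0 < θ) (ha : 0 < a) (hM : 0 < M) (hp0 : 0 ≤ p) (hp1 : p ≤ 1)
    (hS : ∀ y ∈ Ioo 0 M, volume {s : ℝ | k - depth L s ≤ a + y ∧ p * depth L s ≤ M}
      ≤ ofReal (16 * M)) :
    ∫⁻ x in {x : Plane | 1 < x.2}, ofReal
      (lpart 0 (decay L θ k a M p) x ^ 2 + lpart 1 (decay L θ k a M p) x ^ 2)
      ≤ ofReal (8 * θ ^ 2 * (log (1 + M / a) + 8)) := by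
  have hc := continuous_depth L
  have l0 := measurable_lpart (locallyLipschitz_decay (L := L) (θ := θ) (k := k) (M := M) (p :=
      p) ha) 0
  have l1 := measurable_lpart (locallyLipschitz_decay (L := L) (θ := θ) (k := k) (M := M) (p :=
      p) ha) 1
  have hlog : 0 ≤ log (1 + M / a) := log_nonneg (by linarith [div_pos hM ha])
  rw [show {x : Plane | 1 < x.2} = univ ×ˢ Ioi 1 by ext; simp, Measure.volume_eq_prod,
    ← Measure.prod_restrict, Measure.restrict_univ, lintegral_prod_symm _ (by fun_prop)]
  calc
    _ ≤ ∫⁻ t in Ioi 1, (Iio (1 + M)).indicator (fun t => ofReal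
        (8 * θ ^ 2 * (a + (t - 1))⁻¹ + 64 * θ ^ 2 / M)) t := by
      refine lintegral_mono_ae ((ae_restrict_iff' measurableSet_Ioi).2 ?_)
      filter_upwards [ae_slice_snd (decay_sq_grad_le (L := L) (k := k) hθ ha hM hp0 hp1),
        compl_mem_ae_iff.2 (measure_singleton (1 + M))] with t ht hne h1
      have h1 : 1 < t := h1
      refine (lintegral_mono_ae (ht.mono fun s hs => ofReal_le_ofReal (hs h1))).trans ?_
      rcases lt_or_gt_of_ne hne with h | h
      · set A := {s : ℝ | 0 < k - depth L s ∧ k - depth L s ≤ a + (t - 1)}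
        set B := {s : ℝ | k - depth L s ≤ a + (t - 1) ∧ p * depth L s ≤ M}
        have hA : MeasurableSet A := 
          (measurableSet_lt measurable_const (hc.measurable.const_sub k)).inter
            (measurableSet_le (hc.measurable.const_sub k) measurable_const)
        have hq : 0 < a + (t - 1) := by linarith
        rw [indicator_of_mem (mem_Iio.2 h)]
        calc
          _ ≤ ∫⁻ s, (A.indicator (fun _ => ofReal (4 * θ ^ 2 * (a + (t - 1))⁻¹ ^ 2)) s
              + B.indicator (fun _ => ofReal (4 * θ ^ 2 * (1 / M) ^ 2)) s) := by
            refine lintegral_mono fun s => ?_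
            split_ifs with hc hk
            · rw [indicator_of_mem (show s ∈ A from ⟨hk, hc.2.1⟩),
                indicator_of_mem (show s ∈ B from hc.2), mul_add]
              exact ofReal_add_le
            · rw [indicator_of_mem (show s ∈ B from hc.2)]
              simp
            · simp
          _ ≤ ofReal (4 * θ ^ 2 * (a + (t - 1))⁻¹ ^ 2) * ofReal (2 * (a + (t - 1)))
              + ofReal (4 * θ ^ 2 * (1 / M) ^ 2) * ofReal (16 * M) := by
            rw [lintegral_add_left (measurable_const.indicator hA)]
            refine (add_le_add (lintegral_indicator_const_le _ _)
              (lintegral_indicator_const_le _ _)).trans ?_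
            gcongr
            · exact volume_depth_layer_le L k hq.le
            · exact hS (t - 1) ⟨by linarith, by linarith⟩
          _ = _ := by
            rw [← ofReal_mul (by positivity), ← ofReal_mul (by positivity),
              ← ofReal_add (by positivity) (by positivity)]
            congr 1; field_simp; ring
      · simp [show ¬ t - 1 ≤ M by linarith]
    _ = ofReal (8 * θ ^ 2 * (log (1 + M / a) + 8)) := by
      have hpos : ∀ t ∈ Icc 1 (1 + M), 0 < a + (t - 1) := fun t ht => by linarith [ht.1]
      have hi : IntervalIntegrable (fun t => (a + (t - 1))⁻¹) volume 1 (1 + M) := by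
        refine ContinuousOn.intervalIntegrable (ContinuousOn.inv₀ (by fun_prop) ?_)
        rw [uIcc_of_le (by linarith)]
        exact fun t ht => (hpos t ht).ne'
      rw [setLIntegral_indicator measurableSet_Iio, inter_comm, Ioi_inter_Iio,
        lintegral_Ioo_eq (by linarith) ((hi.const_mul _).add intervalIntegrable_const)
        fun t ht => by have := hpos t (Ioo_subset_Icc_self ht); positivity,
        intervalIntegral.integral_add (hi.const_mul _) intervalIntegrable_const,
        intervalIntegral.integral_const_mul,
        intervalIntegral.integral_comp_sub_right (fun t => (a + t)⁻¹), sub_self,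
        add_sub_cancel_left, integral_inv_add ha hM.le, intervalIntegral.integral_const,
            smul_eq_mul]
      congr 1; field_simp; ring

/-- The exterior energy of a function that vanishes below the nucleus, has slope at most `θ` next
to its lateral sides, and agrees with `decay` above it. -/
theorem exterior_le (hθ : 0 < θ) (ha : 0 < a) (hM : 0 < M) (hp0 : 0 ≤ p) (hp1 : p ≤ 1)
    (hS : ∀ y ∈ Ioo 0 M, volume {s : ℝ | k - depth L s ≤ a + y ∧ p * depth L s ≤ M}
      ≤ ofReal (16 * M)) (hb : ∀ x : Plane, x.2 < 0 → v x = 0)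
    (ht : ∀ x : Plane, 1 < x.2 → v x = decay L θ k a M p x)
    (hs : ∀ᵐ x : Plane, 0 < x.2 → x.2 < 1 → depth L x.1 < 0 →
      lpart 0 v x ^ 2 + lpart 1 v x ^ 2
        ≤ {x : Plane | 0 < depth L x.1 + 1}.indicator (fun _ => θ ^ 2) x) :
    ∫⁻ x in (nucleus L)ᶜ, ofReal (lpart 0 v x ^ 2 + lpart 1 v x ^ 2)
      ≤ ofReal (8 * θ ^ 2 * (log (1 + M / a) + 9)) := by
  have hlog : 0 ≤ log (1 + M / a) := log_nonneg (by linarith [div_pos hM ha])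
  set g : Plane → ℝ≥0∞ := fun x => ofReal
    (lpart 0 (decay L θ k a M p) x ^ 2 + lpart 1 (decay L θ k a M p) x ^ 2)
  set S : Set Plane := (Ioo (-1) 0 ∪ Ioo (2 * L) (2 * L + 1)) ×ˢ Ioo 0 1
  have hSm : MeasurableSet S := (measurableSet_Ioo.union measurableSet_Ioo).prod measurableSet_Ioo
  have hm0 : MeasurableSet {x : Plane | 1 < x.2} := measurableSet_lt (by fun_prop) (by fun_prop)
  have hnm : MeasurableSet (nucleus L) := measurableSet_Ioo.prod measurableSet_Ioo
  have ob : IsOpen {x : Plane | x.2 < 0} := isOpen_lt continuous_snd continuous_const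
  have ot : IsOpen {x : Plane | 1 < x.2} := isOpen_lt continuous_const continuous_snd
  have hvS : volume S ≤ ofReal 2 := by
    rw [Measure.volume_eq_prod, Measure.prod_prod]
    refine (mul_le_mul_left (measure_union_le _ _) _).trans (le_of_eq ?_)
    rw [Real.volume_Ioo, Real.volume_Ioo, Real.volume_Ioo, ← ofReal_add (by norm_num)
      (by linarith), ← ofReal_mul (by linarith)]
    congr 1; ring
  have hpt : ∀ᵐ x ∂(volume.restrict (nucleus L)ᶜ), ofReal
      (lpart 0 v x ^ 2 + lpart 1 v x ^ 2) ≤ S.indicator (fun _ => ofReal (θ ^ 2)) x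
        + {x : Plane | 1 < x.2}.indicator g x := by
    refine (ae_restrict_iff' hnm.compl).2 ?_
    filter_upwards [hs, ae_snd_ne 0, ae_snd_ne 1, ae_depth_fst_ne L 0] with x hx h0 h1 hm hn
    rcases lt_or_gt_of_ne h0 with h0 | h0
    · rw [lpart_eq_zero_of_forall ob hb h0, lpart_eq_zero_of_forall ob hb h0]
      simp
    rcases lt_or_gt_of_ne h1 with h1 | h1
    · have hneg : depth L x.1 < 0 := lt_of_le_of_ne
        (not_lt.1 fun h => hn ⟨depth_pos.1 h, h0, h1⟩) hm
      refine (ofReal_le_ofReal (hx h0 h1 hneg)).trans (le_add_right ?_)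
      by_cases hc : 0 < depth L x.1 + 1
      · rw [indicator_of_mem (show x ∈ {x : Plane | 0 < depth L x.1 + 1} from hc),
          indicator_of_mem (show x ∈ S from ⟨?_, h0, h1⟩)]
        rcases min_choice x.1 (2 * L - x.1) with h | h <;> rw [depth, h] at hc hneg
        · grind
        grind
      · rw [indicator_of_notMem (show x ∉ {x : Plane | 0 < depth L x.1 + 1} from hc)]
        simp
    · have e : ∀ i, lpart i v x = lpart i (decay L θ k a M p) x := fun i =>
        lpart_congr (eventually_of_mem (ot.mem_nhds h1) ht) i
      rw [e, e, indicator_of_mem (show x ∈ {x : Plane | 1 < x.2} from h1)]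
      exact le_add_left le_rfl
  refine (lintegral_mono_ae hpt).trans ?_
  rw [lintegral_add_left (measurable_const.indicator hSm)]
  refine (add_le_add (lintegral_mono' Measure.restrict_le_self le_rfl)
    (lintegral_mono' Measure.restrict_le_self le_rfl)).trans ?_
  rw [lintegral_indicator_const hSm, lintegral_indicator hm0]
  refine (add_le_add (mul_le_mul_right hvS _)
    (decay_lintegral_le hθ ha hM hp0 hp1 hS)).trans ?_
  rw [← ofReal_mul (by positivity), ← ofReal_add (by positivity) (by positivity)]
  refine ofReal_le_ofReal ?_
  nlinarith [sq_nonneg θ]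

end Decay

/-! ### Interpolation between the laminate and the affine deformation -/

theorem sliceVar_affine (b c : ℝ) : SliceVar (Ioo 0 1) (fun t => b + c * t) |c| := by
  refine ⟨(by fun_prop : Continuous fun t : ℝ => b + c * t).integrableOn_Icc.mono_set
    Ioo_subset_Icc_self, fun ψ h1 h2 h3 h4 => ?_⟩
  have e : ∀ (g : ℝ → ℝ), (∀ t ∉ Ioo (0 : ℝ) 1, g t = 0) → ∫ t in Ioo 0 1, g t = ∫ t, g t :=
    fun g hg => setIntegral_eq_integral_of_forall_compl_eq_zero fun t ht => hg t ht
  have hψ : ∀ t ∉ Ioo (0 : ℝ) 1, ψ t = 0 := fun t ht => image_eq_zero_of_notMem_tsupport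
    fun h => ht (h3 h)
  have hc := h1.continuous
  have hd : Continuous (deriv ψ) := h1.continuous_deriv le_rfl
  have ib := integral_mul_deriv_eq_deriv_mul_of_integrable (u := fun t => b + c * t) (v := ψ)
    (u' := fun _ => c) (v' := deriv ψ) (fun t _ => by
      simpa using ((hasDerivAt_id t).const_mul c).const_add b)
    (fun t _ => (h1.differentiable (by norm_num) t).hasDerivAt)
    ((by fun_prop : Continuous fun t => (b + c * t) * deriv ψ t).integrable_of_hasCompactSupport
      h2.deriv.mul_left)
    ((continuous_const.mul hc).integrable_of_hasCompactSupport h2.mul_left)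
    (((by fun_prop : Continuous fun t => (b + c * t) * ψ t)).integrable_of_hasCompactSupport
      h2.mul_left)
  rw [e _ fun t ht => by rw [deriv_eq_zero_of_tsupport h3 ht, mul_zero]]
  rw [ib, abs_neg, ← e _ fun t ht => by rw [hψ t ht, mul_zero]]
  have hle : ∀ t ∈ Ioo (0 : ℝ) 1, ‖c * ψ t‖ ≤ |c| := fun t _ => by
    rw [Real.norm_eq_abs, abs_mul]
    exact mul_le_of_le_one_right (abs_nonneg c) (h4 t)
  have := norm_setIntegral_le_of_norm_le_const (μ := volume) measure_Ioo_lt_top hle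
  rwa [Real.volume_real_Ioo_of_le zero_le_one, sub_zero, mul_one] at this

/-- The laminate whose trace on the upper side of the nucleus is `θ` times the truncation of
`α + β * depth` to `[0, 1]`. -/
def lamin (L θ α β : ℝ) (x : Plane) : ℝ :=
  min (θ * x.2) (θ * trace(α,β,L,x.1) + (1 - θ) * (1 - x.2))

section Lamin

@[fun_prop] theorem locallyLipschitz_lamin : LocLip (lamin L θ α β) := by
  unfold lamin; fun_prop

theorem lpart_trace (L α β : ℝ) : ∀ᵐ x : Plane,
    lpart 0 (fun x : Plane => trace(α,β,L,x.1)) x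
      = (if 0 < α + β * depth L x.1 ∧ α + β * depth L x.1 < 1 then
          (if x.1 < L then β else -β) else 0) ∧
    lpart 1 (fun x : Plane => trace(α,β,L,x.1)) x = 0 := by
  have lm : LocLip fun x : Plane => β * depth L x.1 := by fun_prop
  have lA := (LocallyLipschitz.const α).add lm
  have l2 : LocLip fun x : Plane => 2 * L - x.1 := by fun_prop
  have d1 := lpart_affine' (f := fun x : Plane => x.1) 0 1 0 fun x => by ring
  have d2 := lpart_affine' (f := fun x : Plane => 2 * L - x.1) (2 * L) (-1) 0 fun x => by ring
  have key : ∀ i, ∀ᵐ x : Plane,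
      lpart i (fun x : Plane => trace(α,β,L,x.1)) x
      = (if 0 < α + β * depth L x.1 ∧ α + β * depth L x.1 < 1 then
          β * (if x.1 < L then lpart i (fun x : Plane => x.1) x
            else lpart i (fun x : Plane => 2 * L - x.1) x) else 0) := by
    intro i
    filter_upwards [lpart_pos (lA.min (.const 1)) i, lpart_min lA (.const 1) i,
      lpart_add (.const α) lm i, lpart_min locallyLipschitz_fst l2 i]
      with x h1 h2 h3 h4
    rw [lpart_const, lpart_const_mul, zero_add] at h3
    rw [lpart_const] at h2
    rcases le_or_gt (α + β * depth L x.1) 0 with h | h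
    · grind
    rw [h1.1 (le_min h.le zero_le_one)]
    rcases lt_or_ge (α + β * depth L x.1) 1 with h' | h'
    · rw [h2.1 h'.le, h3, if_pos ⟨h, h'⟩]
      congr 1
      split_ifs with hs
      · exact h4.1 (by linarith)
      · exact h4.2 (by linarith)
    grind
  filter_upwards [key 0, key 1] with x h0 h1
  grind

/-- The two phases of `lamin` are separated by the graph of an affine function of its trace. -/
theorem lpart_lamin (L θ α β : ℝ) : ∀ᵐ x : Plane,
    (x.2 < θ * trace(α,β,L,x.1) + (1 - θ) →
      lpart 0 (lamin L θ α β) x = 0 ∧ lpart 1 (lamin L θ α β) x = θ) ∧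
    (θ * trace(α,β,L,x.1) + (1 - θ) ≤ x.2 →
      lpart 0 (lamin L θ α β) x
        = θ * lpart 0 (fun x : Plane => trace(α,β,L,x.1)) x ∧
      lpart 1 (lamin L θ α β) x = θ - 1) := by
  have l1 : LocLip fun x : Plane => θ * x.2 := by fun_prop
  have d1 := lpart_affine' (f := fun x : Plane => θ * x.2) 0 0 θ fun x => by ring
  have l2 : LocLip fun x : Plane =>
    θ * trace(α,β,L,x.1) := by fun_prop
  have l3 : LocLip fun x : Plane => (1 - θ) * (1 - x.2) := by fun_prop
  have d3 := lpart_affine' (f := fun x : Plane => (1 - θ) * (1 - x.2)) (1 - θ) 0 (-(1 - θ))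
    fun x => by ring
  filter_upwards [lpart_min l1 (l2.add l3) 0,
    lpart_min l1 (l2.add l3) 1, lpart_add l2 l3 0, lpart_add l2 l3 1,
    lpart_trace L α β] with x h0 h1 h2 h3 h4
  rw [lpart_const_mul] at h2 h3
  refine ⟨fun h => ?_, fun h => ?_⟩
  · have hle : θ * x.2 ≤ θ * trace(α,β,L,x.1) + (1 - θ) * (1 - x.2) := by
      linarith
    exact ⟨(h0.1 hle).trans (d1 x).1, (h1.1 hle).trans (d1 x).2⟩
  · have hle : θ * trace(α,β,L,x.1) + (1 - θ) * (1 - x.2) ≤ θ * x.2 := by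
      linarith
    refine ⟨(h0.2 hle).trans ?_, (h1.2 hle).trans ?_⟩
    · rw [h2, (d3 x).1, add_zero]
    grind

theorem lamin_dens (hθ : 0 < θ) : ∀ᵐ x : Plane,
    wellDens θ (lpart 0 (lamin L θ α β) x) (lpart 1 (lamin L θ α β) x)
      ≤ {x : Plane | (0 < α + β * depth L x.1 ∧ α + β * depth L x.1 < 1) ∧
          1 - θ ≤ x.2}.indicator (fun _ => θ ^ 2 * β ^ 2) x := by
  filter_upwards [lpart_lamin L θ α β, lpart_trace L α β] with x h1 h2
  have h0 : 0 ≤ {x : Plane | (0 < α + β * depth L x.1 ∧ α + β * depth L x.1 < 1) ∧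
          1 - θ ≤ x.2}.indicator (fun _ => θ ^ 2 * β ^ 2) x :=
    indicator_nonneg (fun _ _ => by positivity) _
  rcases lt_or_ge x.2 (θ * trace(α,β,L,x.1) + (1 - θ)) with h | h
  · rw [(h1.1 h).1, (h1.1 h).2, wellDens, sub_self]
    grind
  · rw [(h1.2 h).1, (h1.2 h).2, wellDens]
    have hm : min ((θ - 1 - θ) ^ 2) ((θ - 1 + 1 - θ) ^ 2) ≤ 0 :=
      (min_le_right _ _).trans (by ring_nf; rfl)
    have hx : 1 - θ ≤ x.2 := le_trans (le_add_of_nonneg_left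
      (mul_nonneg hθ.le (le_max_right _ _))) h
    by_cases hc : 0 < α + β * depth L x.1 ∧ α + β * depth L x.1 < 1
    · rw [indicator_of_mem (show x ∈ {x : Plane | (0 < α + β * depth L x.1 ∧
        α + β * depth L x.1 < 1) ∧ 1 - θ ≤ x.2} from ⟨hc, hx⟩), h2.1, if_pos hc]
      have : (θ * if x.1 < L then β else -β) ^ 2 = θ ^ 2 * β ^ 2 := by split_ifs <;> ring
      linarith
    · rw [h2.1, if_neg hc]
      grind

theorem lamin_slice_one : ∀ᵐ s : ℝ, SliceVar (Ioo 0 1)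
    (fun t => lpart 1 (lamin L θ α β) (s, t)) (if α + β * depth L s < 1 then 2 else 0) := by
  filter_upwards [ae_slice_fst (lpart_lamin L θ α β)] with s hs
  split_ifs with h
  · have h1 := (sliceVar_indicator'
      (J := {t | t < θ * trace(α,β,L,s) + (1 - θ)}) 0 1
      (fun z _ z' hz' t _ ht => lt_of_le_of_lt ht hz') (fun z _ hz => ⟨hz.1.le, hz.2.le⟩) 1).add
      (sliceVar_affine (θ - 1) 0)
    refine (h1.congr_ae (ae_restrict_of_ae (hs.mono fun t ht => ?_))).mono subset_rfl (by simp)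
    simp only [indicator_apply, mem_ofPred_eq]
    grind
  · refine ((sliceVar_affine θ 0).congr_ae ((ae_restrict_iff' measurableSet_Ioo).2
      (hs.mono fun t ht ht1 => ?_))).mono subset_rfl (by simp)
    rw [min_eq_right (not_lt.1 h), max_eq_left zero_le_one] at ht
    grind

theorem lamin_slice_zero (hθ : 0 < θ) : ∀ᵐ s : ℝ, SliceVar (Ioo 0 1)
    (fun t => lpart 0 (lamin L θ α β) (s, t))
    (if 0 < α + β * depth L s ∧ α + β * depth L s < 1 then 2 * (θ * |β|) else 0) := by
  filter_upwards [ae_slice_fst (lpart_lamin L θ α β), ae_slice_fst (lpart_trace L α β)]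
    with s hs ht
  set c := if 0 < α + β * depth L s ∧ α + β * depth L s < 1 then
    (if s < L then β else -β) else 0 with hc
  have h1 := sliceVar_indicator' (I := Ioo 0 1)
    (J := {t | θ * trace(α,β,L,s) + (1 - θ) ≤ t}) 0 1
    (fun z hz z' _ t ht _ => le_trans hz ht) (fun z _ hz => ⟨hz.1.le, hz.2.le⟩) (θ * c)
  refine (h1.congr_ae (ae_restrict_of_ae ?_)).mono subset_rfl ?_
  · filter_upwards [hs, ht] with t h2 h3
    by_cases hc : t < θ * trace(α,β,L,s) + (1 - θ)
    · rw [(h2.1 hc).1, indicator_of_notMem (show t ∉ {t |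
        θ * trace(α,β,L,s) + (1 - θ) ≤ t} from not_le.2 hc)]
    · rw [(h2.2 (not_lt.1 hc)).1, indicator_of_mem (show t ∈ {t |
        θ * trace(α,β,L,s) + (1 - θ) ≤ t} from not_lt.1 hc), h3.1]
  grind

theorem lamin_slice_fst (hθ : 0 < θ) : ∀ᵐ t : ℝ, SliceVar (Ioo 0 (2 * L))
    (fun s => lpart 0 (lamin L θ α β) (s, t)) (4 * (θ * |β|)) := by
  filter_upwards [ae_slice_snd (lpart_lamin L θ α β), ae_slice_snd (lpart_trace L α β)]
    with t ht h2
  have hconv : ∀ (g : ℝ → ℝ) (z z' w : ℝ), (∃ e, g = fun s => α + β * (e + s)) ∨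
      (∃ e, g = fun s => α + β * (e - s)) → z ≤ w → w ≤ z' →
      min (g z) (g z') ≤ g w ∧ g w ≤ max (g z) (g z') := by
    rintro g z z' w (⟨e, rfl⟩ | ⟨e, rfl⟩) h1 h2 <;> rcases le_total 0 β with hb | hb <;>
      have k1 := mul_le_mul_of_nonneg_left h1 (abs_nonneg β) <;>
      have k2 := mul_le_mul_of_nonneg_left h2 (abs_nonneg β) <;>
      simp only [abs_of_nonneg, abs_of_nonpos, hb] at k1 k2 <;>
      grind
  have hI : ∀ (P : ℝ → Prop) (g : ℝ → ℝ) (c : ℝ), (∀ z z' w, P z → P z' → z ≤ w → w ≤ z' → P w) →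
      ((∃ e, g = fun s => α + β * (e + s)) ∨ (∃ e, g = fun s => α + β * (e - s))) →
      SliceVar (Ioo 0 (2 * L)) ({s | P s ∧ (0 < g s ∧ g s < 1) ∧ θ * g s + (1 - θ) ≤ t}.indicator
        fun _ => c) (2 * |c|) := by
    intro P g c hP hg
    refine sliceVar_indicator' 0 (2 * L) (fun z hz z' hz' w hw hw' => ?_)
      (fun z _ hz => ⟨hz.1.le, hz.2.le⟩) c
    obtain ⟨k1, k2⟩ := hconv g z z' w hg hw hw'
    refine ⟨hP z z' w hz.1 hz'.1 hw hw', ⟨(lt_min hz.2.1.1 hz'.2.1.1).trans_le k1,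
      k2.trans_lt (max_lt hz.2.1.2 hz'.2.1.2)⟩, ?_⟩
    have h3 : g w ≤ (t - (1 - θ)) / θ := k2.trans (max_le
      ((le_div_iff₀ hθ).2 (by linarith [hz.2.2])) ((le_div_iff₀ hθ).2 (by linarith [hz'.2.2])))
    rw [le_div_iff₀ hθ] at h3
    linarith
  refine (((hI (fun s => s < L) (fun s => α + β * (0 + s)) (θ * β)
    (fun z z' w _ h _ h' => h'.trans_lt h) (Or.inl ⟨0, rfl⟩)).add
    (hI (fun s => L ≤ s) (fun s => α + β * (2 * L - s)) (θ * -β)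
    (fun z z' w h _ h' _ => le_trans h h') (Or.inr ⟨2 * L, rfl⟩))).congr_ae
    (ae_restrict_of_ae ?_)).mono subset_rfl
    (le_of_eq (by grind))
  filter_upwards [ht, h2] with s h3 h4
  have hm : depth L s = if s < L then 0 + s else 2 * L - s := by
    unfold depth
    grind
  simp only [indicator_apply, mem_ofPred_eq]
  grind

end Lamin

section Lamin

/-- The laminate is in a well up to the slope `θ * β` of its trace, in a layer of height at most `θ`. -/
theorem lamin_dens_lintegral_le (hθ : 0 < θ) :
    ∫⁻ x in nucleus L, ofReal
      (wellDens θ (lpart 0 (lamin L θ α β) x) (lpart 1 (lamin L θ α β) x))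
      ≤ ofReal (2 * (θ ^ 3 * |β|)) := by
  have hnm : MeasurableSet (nucleus L) := measurableSet_Ioo.prod measurableSet_Ioo
  obtain rfl | hβ := eq_or_ne β 0
  · refine le_of_eq_of_le (lintegral_eq_zero_of_ae_eq_zero (ae_restrict_of_ae ?_)) zero_le
    filter_upwards [lamin_dens (L := L) hθ] with x hx
    refine ENNReal.ofReal_of_nonpos (hx.trans ?_)
    simp
  have hβ' : 0 < |β| := abs_pos.2 hβ
  set S := {s : ℝ | 0 < α + β * depth L s ∧ α + β * depth L s < 1} with hS
  have hS' : ∃ k, S ⊆ {s : ℝ | 0 < k - depth L s ∧ k - depth L s ≤ 1 / |β|} := by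
    rcases lt_or_gt_of_ne hβ with hb | hb
    · refine ⟨-α / β, fun s hs => ?_⟩
      have e : -α / β - depth L s = (α + β * depth L s) / |β| := by
        grind
      show _ ∧ _
      rw [e]
      exact ⟨div_pos hs.1 hβ', div_le_div_of_nonneg_right hs.2.le hβ'.le⟩
    · refine ⟨(1 - α) / β, fun s hs => ?_⟩
      have e : (1 - α) / β - depth L s = (1 - (α + β * depth L s)) / |β| := by
        grind
      show _ ∧ _
      rw [e]
      exact ⟨div_pos (by linarith [hs.2]) hβ',
        div_le_div_of_nonneg_right (by linarith [hs.1]) hβ'.le⟩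
  obtain ⟨k, hk⟩ := hS'
  have hSv := (measure_mono hk).trans (volume_depth_layer_le L k (by positivity))
  have hSm : MeasurableSet S := by
    have hc := continuous_depth L
    have h : Measurable fun s => α + β * depth L s := by fun_prop
    exact (measurableSet_lt measurable_const h).inter (measurableSet_lt h measurable_const)
  have hTm : MeasurableSet (S ×ˢ Icc (1 - θ) 1) := hSm.prod measurableSet_Icc
  have hpt : ∀ᵐ x ∂(volume.restrict (nucleus L)), ofReal
      (wellDens θ (lpart 0 (lamin L θ α β) x) (lpart 1 (lamin L θ α β) x))
      ≤ (S ×ˢ Icc (1 - θ) 1).indicator (fun _ => ofReal (θ ^ 2 * β ^ 2)) x := by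
    refine (ae_restrict_iff' hnm).2 ?_
    filter_upwards [lamin_dens (L := L) hθ] with x hx hxn
    refine (ofReal_le_ofReal hx).trans ?_
    by_cases h : x ∈ {x : Plane | (0 < α + β * depth L x.1 ∧ α + β * depth L x.1 < 1) ∧
          1 - θ ≤ x.2}
    · rw [indicator_of_mem h, indicator_of_mem (show x ∈ S ×ˢ Icc (1 - θ) 1 from
        ⟨h.1, h.2, hxn.2.2.le⟩)]
    · rw [indicator_of_notMem h]; simp
  refine (lintegral_mono_ae hpt).trans
    ((lintegral_mono' Measure.restrict_le_self le_rfl).trans ?_)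
  rw [lintegral_indicator_const hTm, Measure.volume_eq_prod, Measure.prod_prod, Real.volume_Icc]
  refine (mul_le_mul_right (mul_le_mul_left hSv _) _).trans ?_
  rw [← ofReal_mul (by positivity), ← ofReal_mul (by positivity)]
  grind

theorem decay_nonneg (hθ : 0 < θ) (x : Plane) : 0 ≤ decay L θ k a M p x :=
  mul_nonneg hθ.le (le_max_right _ _)

theorem decay_le (hθ : 0 < θ) (hM : 0 < M) (hp : 0 ≤ p) (x : Plane) :
    decay L θ k a M p x
      ≤ θ * max (1 - max (k - depth L x.1) 0 * (a + max (x.2 - 1) 0)⁻¹) 0 := by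
  have : 0 ≤ (max (x.2 - 1) 0 + p * max (depth L x.1) 0) / M := by positivity
  exact mul_le_mul_of_nonneg_left (max_le_max_right 0 (by linarith)) hθ.le

theorem volume_depth_ge (L b : ℝ) :
    volume {s : ℝ | b ≤ depth L s} ≤ ofReal (2 * L - 2 * b) := by
  refine (measure_mono (t := Icc b (2 * L - b)) fun s hs => ?_).trans ?_
  · have := le_min_iff.1 (show b ≤ min s (2 * L - s) from hs)
    constructor <;> linarith
  · rw [Real.volume_Icc]; grind

theorem decay_support_rise (hL : 1 / 2 ≤ L) (hp : (p = 0 ∧ M = L) ∨ (p = 1 ∧ 1 ≤ M)) :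
    ∀ y ∈ Ioo 0 M, volume {s : ℝ | 0 - depth L s ≤ 1 + y ∧ p * depth L s ≤ M}
      ≤ ofReal (16 * M) := by
  intro y hy
  rcases hp with ⟨rfl, rfl⟩ | ⟨rfl, hM⟩
  · refine ((measure_mono fun s hs => ?_).trans (volume_depth_ge M (-(1 + y)))).trans
      (ofReal_le_ofReal (by linarith [hy.2]))
    grind
  · have hsub : {s : ℝ | 0 - depth L s ≤ 1 + y ∧ 1 * depth L s ≤ M}
        ⊆ {s : ℝ | 0 < (M + 1) - depth L s ∧ (M + 1) - depth L s ≤ M + 2 + y} := by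
      grind
    exact ((measure_mono hsub).trans (volume_depth_layer_le L _ (by linarith [hy.1]))).trans
      (ofReal_le_ofReal (by linarith [hy.2]))

theorem decay_support_shoulder (hl0 : 0 ≤ l) :
    ∀ y ∈ Ioo 0 L, volume {s : ℝ | 2 * l - depth L s ≤ l + y ∧ 0 * depth L s ≤ L}
      ≤ ofReal (16 * L) := by
  intro y hy
  refine ((measure_mono fun s hs => ?_).trans (volume_depth_ge L (l - y))).trans ?_
  · grind
  · exact ofReal_le_ofReal (by linarith [hy.1, hy.2])

/-! ### The affine deformation near the ends of the nucleus -/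

/-- The affine deformation near the ends of the nucleus. Its trace on the upper side of the nucleus
is extended by `decay`, and it decays linearly next to the lateral sides. -/
def rise (L θ M p : ℝ) (x : Plane) : ℝ :=
  min (min (θ * max x.2 0) (decay L θ 0 1 M p x + (1 - θ) * max (1 - x.2) 0))
    (θ * max (1 + max (x.2 - 1) 0 - outDist L x.1) 0)

@[fun_prop] theorem locallyLipschitz_rise (L θ M p : ℝ) : LocLip (rise L θ M p) := by
  have := locallyLipschitz_decay (L := L) (θ := θ) (k := 0) (M := M) (p := p) one_pos
  unfold rise; fun_prop

theorem rise_below (hθ : 0 < θ) (hθ2 : θ ≤ 1 / 2) (hx : x.2 < 0) :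
    rise L θ M p x = 0 := by
  have h1 := decay_nonneg (L := L) (k := 0) (a := 1) (M := M) (p := p) hθ x
  have h2 : 0 ≤ (1 - θ) * max (1 - x.2) 0 := mul_nonneg (by linarith) (le_max_right _ _)
  rw [rise, max_eq_right hx.le, mul_zero, min_eq_left (add_nonneg h1 h2),
    min_eq_left (mul_nonneg hθ.le (le_max_right _ _))]

theorem rise_above (hθ : 0 < θ) (hM : 0 < M) (hp : 0 ≤ p) (hx : 1 < x.2) :
    rise L θ M p x = decay L θ 0 1 M p x := by
  have h1 := decay_le (L := L) (k := 0) (a := 1) hθ hM hp x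
  have hy : 0 < max (x.2 - 1) 0 := lt_max_of_lt_left (by linarith)
  have ho : max (0 - depth L x.1) 0 = outDist L x.1 := by rw [zero_sub]; rfl
  have hs := outDist_nonneg L x.1
  rw [ho] at h1
  set y := max (x.2 - 1) 0
  set s := outDist L x.1
  have h2 : max (1 - s * (1 + y)⁻¹) 0 ≤ 1 := max_le (by
    have : 0 ≤ s * (1 + y)⁻¹ := by positivity
    linarith) zero_le_one
  have h3 : max (1 - s * (1 + y)⁻¹) 0 ≤ max (1 + y - s) 0 := by
    rcases le_or_gt s (1 + y) with h | h
    · refine max_le_max_right 0 ?_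
      have e : 1 - s * (1 + y)⁻¹ = (1 + y - s) * (1 + y)⁻¹ := by field_simp
      nlinarith
    · have : 1 ≤ s * (1 + y)⁻¹ := by rw [← div_eq_mul_inv, one_le_div (by positivity)]; exact h.le
      grind
  rw [rise, max_eq_left (by linarith : 0 ≤ x.2), max_eq_right (by linarith : 1 - x.2 ≤ 0),
    mul_zero, add_zero, min_eq_right (h1.trans (by gcongr; linarith)),
    min_eq_left (h1.trans (by gcongr))]

theorem rise_inside (hθ : 0 < θ) (hM : 0 < M) (hp : 0 ≤ p) (h0 : 0 < x.2)
    (h1 : x.2 < 1) (hm : 0 < depth L x.1) : rise L θ M p x = lamin L θ 1 (-(p / M)) x := by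
  have hq : 0 ≤ p / M * depth L x.1 := by positivity
  have e : 1 - max (0 - depth L x.1) 0 * (1 + (0 : ℝ))⁻¹ - (0 + p * depth L x.1) / M
      = 1 + -(p / M) * depth L x.1 := by
    grind
  rw [rise, decay, lamin, max_eq_left h0.le, max_eq_left (by linarith : 0 ≤ 1 - x.2),
    max_eq_right (by linarith : x.2 - 1 ≤ 0), outDist_eq_zero hm.le, max_eq_left hm.le, e,
    min_eq_left (by linarith : 1 + -(p / M) * depth L x.1 ≤ 1)]
  refine min_eq_left ((min_le_left _ _).trans ?_)
  norm_num
  nlinarith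

theorem rise_side (hθ : 0 < θ) (hθ2 : θ ≤ 1 / 2) (h0 : 0 < x.2)
    (h1 : x.2 < 1) (hm : depth L x.1 < 0) :
    rise L θ M p x = min (θ * x.2) (θ * max (1 - outDist L x.1) 0) := by
  have ho : max (0 - depth L x.1) 0 = outDist L x.1 := by rw [zero_sub]; rfl
  have h2 : 0 ≤ (1 - θ) * (1 - x.2) := mul_nonneg (by linarith) (by linarith)
  rw [rise, decay, max_eq_left h0.le, max_eq_left (by linarith : 0 ≤ 1 - x.2),
    max_eq_right (by linarith : x.2 - 1 ≤ 0), max_eq_right hm.le, ho]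
  grind

theorem rise_side_grad (hθ : 0 < θ) (hθ2 : θ ≤ 1 / 2) :
    ∀ᵐ x : Plane, 0 < x.2 → x.2 < 1 → depth L x.1 < 0 →
      lpart 0 (rise L θ M p) x ^ 2 + lpart 1 (rise L θ M p) x ^ 2
        ≤ {x : Plane | 0 < depth L x.1 + 1}.indicator (fun _ => θ ^ 2) x := by
  have hlo := locallyLipschitz_outDist L
  have l1 : LocLip fun x : Plane => θ * x.2 := by fun_prop
  have d1 := lpart_affine' (f := fun x : Plane => θ * x.2) 0 0 θ fun x => by ring
  have l2 : LocLip fun x : Plane => 1 - outDist L x.1 := by fun_prop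
  have l3 : LocLip fun x : Plane => θ * max (1 - outDist L x.1) 0 := by fun_prop
  have hU : IsOpen {x : Plane | x.2 ∈ Ioo 0 1 ∧ depth L x.1 < 0} :=
    (isOpen_Ioo.preimage continuous_snd).inter (isOpen_depth_lt L 0)
  have hU' : IsOpen {x : Plane | x.2 ∈ Ioo 0 1 ∧ depth L x.1 < -1} :=
    (isOpen_Ioo.preimage continuous_snd).inter (isOpen_depth_lt L (-1))
  have key : ∀ i, ∀ᵐ x : Plane, x.2 ∈ Ioo 0 1 ∧ depth L x.1 < 0 →
      (θ * x.2 ≤ θ * max (1 - outDist L x.1) 0 →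
        lpart i (rise L θ M p) x = lpart i (fun x : Plane => θ * x.2) x) ∧
      (θ * max (1 - outDist L x.1) 0 ≤ θ * x.2 →
        lpart i (rise L θ M p) x = -(θ * lpart i (fun x : Plane => outDist L x.1) x) ∨
        lpart i (rise L θ M p) x = 0) := by
    intro i
    filter_upwards [lpart_min l1 l3 i, lpart_pos l2 i, lpart_sub (.const 1) hlo i]
      with x h1 h2 h3 hx
    rw [lpart_const, zero_sub] at h3
    rw [lpart_congr (eventually_of_mem (hU.mem_nhds hx) fun y hy =>
      rise_side hθ hθ2 hy.1.1 hy.1.2 hy.2) i]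
    refine ⟨h1.1, fun h => ?_⟩
    rw [h1.2 h, lpart_const_mul]
    grind
  filter_upwards [key 0, key 1, lpart_outDist L, ae_depth_fst_ne L (-1)]
    with x k0 k1 ho hne h0 h1 hm
  rcases lt_or_gt_of_ne hne with h | h
  · have hz : ∀ y ∈ {x : Plane | x.2 ∈ Ioo 0 1 ∧ depth L x.1 < -1}, rise L θ M p y = 0 :=
      fun y hy => by
        have : depth L y.1 < -1 := hy.2
        have ho : 1 ≤ outDist L y.1 := le_max_of_le_left (by linarith)
        rw [rise_side hθ hθ2 hy.1.1 hy.1.2 (by linarith), max_eq_right (by linarith), mul_zero,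
          min_eq_right (mul_nonneg hθ.le hy.1.1.le)]
    rw [lpart_eq_zero_of_forall hU' hz ⟨⟨h0, h1⟩, h⟩, lpart_eq_zero_of_forall hU' hz ⟨⟨h0, h1⟩, h⟩]
    simpa using indicator_nonneg (fun _ _ => sq_nonneg θ) x
  · rw [indicator_of_mem (show x ∈ {x : Plane | 0 < depth L x.1 + 1} from
      neg_lt_iff_pos_add.1 h)]
    have k0 := k0 ⟨⟨h0, h1⟩, hm⟩
    have k1 := k1 ⟨⟨h0, h1⟩, hm⟩
    rcases le_total (θ * x.2) (θ * max (1 - outDist L x.1) 0) with h' | h'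
    · rw [k0.1 h', k1.1 h', (d1 x).1, (d1 x).2]; simp
    · have e1 : lpart 1 (rise L θ M p) x = 0 := by
        grind
      rw [e1]
      rcases k0.2 h' with e | e <;> rw [e]
      · have : lpart 0 (fun x : Plane => outDist L x.1) x ^ 2 ≤ 1 :=
          (sq_le_one_iff_abs_le_one _).2 ho.1
        nlinarith [sq_nonneg θ]
      · simpa using sq_nonneg θ

/-! ### The deformation away from the ends of the nucleus -/

/-- The correction that turns the laminate into the affine deformation at distance at least `2l`
from the ends of the nucleus. -/
def shoulder (L θ l : ℝ) (x : Plane) : ℝ :=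
  min (θ * max x.2 0) (decay L θ (2 * l) l L 0 x + (1 - θ) * max (1 - x.2) 0)
    - min (θ * max x.2 0) ((1 - θ) * max (1 - x.2) 0)

theorem locallyLipschitz_shoulder (hl : 0 < l) : LocLip (shoulder L θ l) := by
  have := locallyLipschitz_decay (L := L) (θ := θ) (k := 2 * l) (M := L) (p := 0) hl
  unfold shoulder; fun_prop

theorem shoulder_below (hθ : 0 < θ) (hθ2 : θ ≤ 1 / 2) (hx : x.2 < 0) :
    shoulder L θ l x = 0 := by
  have h1 := decay_nonneg (L := L) (k := 2 * l) (a := l) (M := L) (p := 0) hθ x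
  have h2 : 0 ≤ (1 - θ) * max (1 - x.2) 0 := mul_nonneg (by linarith) (le_max_right _ _)
  rw [shoulder, max_eq_right hx.le, mul_zero, min_eq_left (by linarith), min_eq_left h2, sub_self]

theorem shoulder_above (hθ : 0 < θ) (hl : 0 < l) (hL : 0 < L) (hx : 1 < x.2) :
    shoulder L θ l x = decay L θ (2 * l) l L 0 x := by
  have h1 := decay_le (L := L) (k := 2 * l) (a := l) hθ hL le_rfl x
  have h2 : max (1 - max (2 * l - depth L x.1) 0 * (l + max (x.2 - 1) 0)⁻¹) 0 ≤ 1 :=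
    max_le (by
      have : 0 ≤ max (2 * l - depth L x.1) 0 * (l + max (x.2 - 1) 0)⁻¹ := by positivity
      linarith) zero_le_one
  rw [shoulder, max_eq_left (by linarith : 0 ≤ x.2), max_eq_right (by linarith : 1 - x.2 ≤ 0),
    mul_zero, add_zero, min_eq_right (h1.trans (by gcongr; linarith)),
    min_eq_right (by positivity), sub_zero]

theorem decay_side (hl : 0 < l) (hx : x.2 ≤ 1) (hm : depth L x.1 ≤ l) :
    decay L θ (2 * l) l L 0 x = 0 := by
  rw [decay, max_eq_right (by linarith : x.2 - 1 ≤ 0), max_eq_left (by linarith : 0 ≤ 2 * l - _)]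
  have : 1 ≤ (2 * l - depth L x.1) * (l + 0)⁻¹ := by
    rw [add_zero, ← div_eq_mul_inv, one_le_div hl]; linarith
  grind

theorem shoulder_side (hl : 0 < l) (hx : x.2 ≤ 1) (hm : depth L x.1 ≤ l) :
    shoulder L θ l x = 0 := by
  rw [shoulder, decay_side hl hx hm, zero_add, sub_self]

theorem decay_inside (hl : 0 < l) (hx : x.2 ≤ 1) :
    decay L θ (2 * l) l L 0 x = θ * max (min (-1 + 1 / l * depth L x.1) 1) 0 := by
  rw [decay, max_eq_right (by linarith : x.2 - 1 ≤ 0), zero_mul, add_zero, add_zero, zero_div,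
    sub_zero]
  congr 2
  rcases le_total (2 * l) (depth L x.1) with h | h
  · have : 2 ≤ 1 / l * depth L x.1 := by rw [one_div_mul_eq_div, le_div_iff₀ hl]; exact h
    grind
  · have : 1 / l * depth L x.1 ≤ 2 := by rw [one_div_mul_eq_div, div_le_iff₀ hl]; exact h
    rw [max_eq_left (by linarith), min_eq_left (by linarith)]; field_simp; ring

theorem shoulder_inside (hl : 0 < l) (h0 : 0 < x.2) (h1 : x.2 < 1) :
    shoulder L θ l x = lamin L θ (-1) (1 / l) x - lamin L θ 0 0 x := by
  rw [shoulder, decay_inside hl h1.le, lamin, lamin, max_eq_left h0.le,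
    max_eq_left (by linarith : 0 ≤ 1 - x.2)]
  norm_num

end Lamin

theorem mem_nucleus :
    x ∈ nucleus L ↔ 0 < depth L x.1 ∧ 0 < x.2 ∧ x.2 < 1 :=
  and_congr depth_pos.symm Iff.rfl

theorem lpart_congr_nucleus (h : ∀ x ∈ nucleus L, f x = g x) (hx : x ∈ nucleus L)
    (i : Fin 2) : lpart i f x = lpart i g x :=
  lpart_congr (eventually_of_mem ((nucleus_isOpen L).mem_nhds hx) h) i

theorem SliceVar.congr_Ioo {g g' : ℝ → ℝ} (h : SliceVar (Ioo a b) g n)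
    (hg : ∀ t ∈ Ioo a b, g' t = g t) : SliceVar (Ioo a b) g' n :=
  h.congr_ae (ae_restrict_of_forall_mem measurableSet_Ioo hg)

theorem lintegral_ofReal_const_le (hab : a ≤ b) (hc : c * (b - a) ≤ C) :
    ∫⁻ _s in Ioo a b, ofReal c ≤ ofReal C := by
  rw [setLIntegral_const, Real.volume_Ioo, ← ENNReal.ofReal_mul' (by linarith)]
  exact ofReal_le_ofReal hc

section Rise

theorem rise_exterior (hθ : 0 < θ) (hθ2 : θ ≤ 1 / 2) (hL : 1 / 2 ≤ L)
    (hp : (p = 0 ∧ M = L) ∨ (p = 1 ∧ 1 ≤ M)) :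
    ∫⁻ x in (nucleus L)ᶜ, ofReal (lpart 0 (rise L θ M p) x ^ 2
      + lpart 1 (rise L θ M p) x ^ 2) ≤ ofReal (8 * θ ^ 2 * (log (1 + M) + 9)) := by
  have hM : 0 < M := by grind
  have hp0 : 0 ≤ p := by grind
  have hp1 : p ≤ 1 := by grind
  simpa only [div_one] using exterior_le hθ one_pos hM hp0 hp1 (decay_support_rise hL hp)
    (fun x hx => rise_below hθ hθ2 hx) (fun x hx => rise_above hθ hM hp0 hx)
    (rise_side_grad hθ hθ2)

theorem rise_eq_lamin (hθ : 0 < θ) (hM : 0 < M) (hp : 0 ≤ p) :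
    ∀ x ∈ nucleus L, rise L θ M p x = lamin L θ 1 (-(p / M)) x := fun x hx => by
  have h := mem_nucleus.1 hx
  exact rise_inside hθ hM hp h.2.1 h.2.2 h.1

theorem rise_dens (hθ : 0 < θ) (hM : 0 < M) (hp : 0 ≤ p) :
    ∫⁻ x in nucleus L, ofReal (wellDens θ (lpart 0 (rise L θ M p) x)
      (lpart 1 (rise L θ M p) x)) ≤ ofReal (2 * (θ ^ 3 * (p / M))) := by
  have h := lamin_dens_lintegral_le (L := L) (α := 1) (β := -(p / M)) hθ
  rw [abs_neg, abs_of_nonneg (by positivity)] at h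
  refine le_of_eq_of_le (setLIntegral_congr_fun (nucleus_isOpen L).measurableSet fun x hx => ?_) h
  simp only [lpart_congr_nucleus (rise_eq_lamin hθ hM hp) hx]

theorem rise_slices (hθ : 0 < θ) (hθ2 : θ ≤ 1 / 2) (hp : p = 0 ∨ p = 1) (hM : 0 < M)
    (hM1 : p = 1 → 1 ≤ M) :
    SliceBounds L (rise L θ M p) (fun _ => 2 * p) (fun _ => p) fun _ => 2 * p := by
  have hp0 : 0 ≤ p := by grind
  have hβ : θ * |(-(p / M))| ≤ p / 2 := by
    rw [abs_neg, abs_of_nonneg (by positivity)]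
    rcases hp with rfl | rfl
    · simp
    · have : 1 / M ≤ 1 := (div_le_one hM).2 (hM1 rfl)
      nlinarith
  refine ⟨(ae_restrict_iff' measurableSet_Ioo).2 ?_, (ae_restrict_iff' measurableSet_Ioo).2 ?_,
    (ae_restrict_iff' measurableSet_Ioo).2 ?_⟩
  · filter_upwards [lamin_slice_one (L := L) (θ := θ) (β := -(p / M))] with s hs hsL
    refine (hs.congr_Ioo fun t ht => lpart_congr_nucleus (rise_eq_lamin hθ hM hp0)
      (show (s, t) ∈ nucleus L from ⟨hsL, ht⟩) 1).mono subset_rfl ?_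
    rcases hp with rfl | rfl
    · simp
    · split_ifs <;> norm_num
  · filter_upwards [lamin_slice_zero (L := L) (β := -(p / M)) hθ] with s hs hsL
    refine (hs.congr_Ioo fun t ht => lpart_congr_nucleus (rise_eq_lamin hθ hM hp0)
      (show (s, t) ∈ nucleus L from ⟨hsL, ht⟩) 0).mono subset_rfl ?_
    split_ifs <;> linarith
  · filter_upwards [lamin_slice_fst (L := L) (β := -(p / M)) hθ] with t ht ht1
    exact (ht.congr_Ioo fun s hs => lpart_congr_nucleus (rise_eq_lamin hθ hM hp0)
      (show (s, t) ∈ nucleus L from ⟨hs, ht1⟩) 0).mono subset_rfl (by linarith)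

/-- The competitor that is affine in the nucleus (`p = 0`), and the one that interpolates between
the affine deformation at the ends of the nucleus and the laminate at distance `M` (`p = 1`). -/
theorem hasCompetitor_rise (hμ : 0 ≤ μ) (hε : 0 ≤ ε) (hθ : 0 < θ) (hθ2 : θ ≤ 1 / 2)
    (hL : 1 / 2 ≤ L) (hp : (p = 0 ∧ M = L) ∨ (p = 1 ∧ 1 ≤ M)) :
    HasCompetitor μ ε θ L (μ * (8 * θ ^ 2 * (log (1 + M) + 9)) + 2 * (θ ^ 3 * (p / M))
      + p * (12 * (ε * L))) := by
  have hM : 0 < M := by grind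
  have hp0 : 0 ≤ p := by grind
  have hlog : 0 ≤ log (1 + M) := log_nonneg (by linarith)
  refine (hasCompetitor_of_bounds (V2 := 4 * L * p) (V12 := 2 * L * p) (V1 := 2 * p)
    (locallyLipschitz_rise L θ M p) hμ hε (by positivity) (by positivity)
    (by positivity) (by positivity) (by positivity) (rise_exterior hθ hθ2 hL hp)
    (rise_dens hθ hM hp0) (rise_slices hθ hθ2 (hp.imp And.left And.left) hM fun h => by
      grind) (lintegral_ofReal_const_le (by linarith) (by linarith))
    (lintegral_ofReal_const_le (by linarith) (by linarith))
    (lintegral_ofReal_const_le zero_le_one (by linarith))).mono ?_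
  have : p ≤ 2 * (p * L) := by nlinarith
  nlinarith

end Rise

/-- A function that coincides with the laminate without branching in the nucleus at distance at
least `l` from its ends, with bounds for its energy outside and at smaller distance. -/
structure NearField (L θ l X D : ℝ) (V : Plane → ℝ) : Prop where
  lip : LocLip V
  exterior : ∫⁻ x in (nucleus L)ᶜ, ofReal (lpart 0 V x ^ 2 + lpart 1 V x ^ 2)
    ≤ ofReal X
  eq_lamin : ∀ x ∈ nucleus L, l ≤ depth L x.1 → V x = lamin L θ 0 0 x
  dens : ∫⁻ x in nucleus L, ofReal (wellDens θ (lpart 0 V x) (lpart 1 V x))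
    ≤ ofReal D
  slices : SliceBounds L V (fun s => 6 + 8 * rate(l,L,s))
    (fun s => 6 + 8 * rate(l,L,s)) fun _ => 10

/-- The corner: the affine deformation at the ends, with a trace that falls to zero over the length
`M`. -/
theorem nearField_rise (hθ : 0 < θ) (hθ2 : θ ≤ 1 / 2) (hL : 1 / 2 ≤ L) (hM : 1 ≤ M)
    (hMl : M ≤ l) : NearField L θ l (8 * θ ^ 2 * (log (1 + M) + 9)) (2 * (θ ^ 3 * (1 / M)))
      (rise L θ M 1) := by
  have hM0 : 0 < M := by linarith
  obtain ⟨h1, h2, h3⟩ := rise_slices (L := L) hθ hθ2 (Or.inr rfl) hM0 fun _ => hM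
  have hs : ∀ s ∈ Ioo 0 (2 * L), 0 ≤ rate(l,L,s) := fun s hs =>
    Real.rpow_nonneg (div_nonneg (by linarith) (depth_pos.2 hs).le) _
  refine ⟨locallyLipschitz_rise L θ M 1, rise_exterior hθ hθ2 hL (Or.inr ⟨rfl, hM⟩),
    fun x hx hl => ?_, rise_dens hθ hM0 zero_le_one, ?_, ?_,
    h3.mono fun t ht => ht.mono subset_rfl (by norm_num)⟩
  · have h : 1 ≤ 1 / M * depth L x.1 := by
      rw [one_div_mul_eq_div, one_le_div hM0]; exact hMl.trans hl
    rw [rise_eq_lamin hθ hM0 zero_le_one x hx, lamin, lamin,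
      max_eq_right ((min_le_left _ _).trans (by linarith)), zero_mul, add_zero,
      min_eq_left zero_le_one, max_self]
  · filter_upwards [h1, ae_restrict_mem measurableSet_Ioo] with s h hsL
    exact h.mono subset_rfl (by linarith [hs s hsL])
  · filter_upwards [h2, ae_restrict_mem measurableSet_Ioo] with s h hsL
    exact h.mono subset_rfl (by linarith [hs s hsL])

/-- A single period, of height one, of a laminate or of a truncated branching. -/
theorem nearField_cell (hθ : 0 < θ) (hθ2 : θ ≤ 1 / 2)
    (hL : 1 / 2 ≤ L) (hθr : θ ≤ r) (hr1 : r ≤ 1) (hl : 0 < l) (hlL : l ≤ L) (hη : 0 ≤ η)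
    (hκ : (r = 1 ∧ κ = 0) ∨ (2 * r ≤ 1 ∧ κ = 1)) (hF : StripFn L (θ * 1 / r) r l η F) :
    NearField L θ l (κ * (20 * θ ^ 2 * log (1 + 1 / r))) (10 * η * (θ ^ 2 * r / l))
      (cell L θ 1 r F) := by
  have hr : 0 < r := hθ.trans_le hθr
  have hθr' : θ * 1 ≤ r := by rwa [mul_one]
  have hV := locallyLipschitz_cell (θ := θ) (h := 1) hr hF
  have hΩ := (nucleus_isOpen L).measurableSet
  have hEm : MeasurableSet ((Ioo 0 (2 * L))ᶜ ×ˢ (univ : Set ℝ)) :=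
    measurableSet_Ioo.compl.prod MeasurableSet.univ
  refine ⟨hV, ?_, fun x hx hm => ?_, ?_, ?_, ?_,
    ae_restrict_of_ae (cell_slice_fst hθ hr hr1 hF)⟩
  · have h := cell_exterior (by linarith) hθ hr hκ hF
    rw [mul_one] at h
    refine le_trans ?_ h
    rw [← lintegral_indicator hΩ.compl, ← lintegral_indicator hEm]
    refine lintegral_mono_ae ?_
    filter_upwards [ae_snd_ne 0, ae_snd_ne 1] with x h0 h1
    by_cases hx : x ∈ (nucleus L)ᶜ
    · by_cases hE : x ∈ (Ioo 0 (2 * L))ᶜ ×ˢ (univ : Set ℝ)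
      · rw [indicator_of_mem hx, indicator_of_mem hE]
      · have hs : x.1 ∈ Ioo 0 (2 * L) := by
          grind
        have ho : x.2 < 0 ∨ 1 < x.2 := by
          by_contra! hc
          exact hx ⟨hs, lt_of_le_of_ne hc.1 h0.symm, lt_of_le_of_ne hc.2 h1⟩
        rw [indicator_of_mem hx, lpart_cell_eq_zero hθ hr hr1 hF ho,
          lpart_cell_eq_zero hθ hr hr1 hF ho]
        simp
    · rw [indicator_of_notMem hx]; exact zero_le
  · have h := mem_nucleus.1 hx
    have hp : θ * (1 - r) * (1 - x.2) * (r + 0)⁻¹ = θ / r * ((1 - r) * (1 - x.2)) := by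
      rw [add_zero]; field_simp
    have hq : θ ≤ θ / r := by rw [le_div_iff₀ hr]; nlinarith
    have hq1 : θ / r ≤ 1 := (div_le_one hr).2 hθr
    have e1 : θ / r * r = θ := by field_simp
    rw [cell, wedge, outDist_eq_zero h.1.le, mul_zero, sub_zero, hp,
      hF.eq_tooth (x.1, x.2 - (1 - r)) hm, tooth, lamin, zero_mul, add_zero,
      min_eq_left zero_le_one, max_self, mul_zero, zero_add, mul_one]
    simp only
    set q := θ / r
    have hx2 := sub_pos.2 h.2.2
    have n1 : 0 ≤ q * ((1 - r) * (1 - x.2)) :=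
      mul_nonneg (hθ.le.trans hq) (mul_nonneg (by linarith) hx2.le)
    have n2 : 0 ≤ θ * x.2 := mul_nonneg hθ.le h.2.1.le
    rw [max_eq_left (le_min n2 n1)]
    rcases le_total x.2 (1 - r) with hc | hc
    · have a1 : θ * x.2 ≤ q * ((1 - r) * (1 - x.2)) := by
        nlinarith [mul_nonneg (hθ.le.trans hq) (sub_nonneg.2 hc)]
      have a2 : θ * x.2 ≤ (1 - θ) * (1 - x.2) := by nlinarith
      rw [min_eq_left a1, min_eq_left a2, max_eq_right ((min_le_left _ _).trans
        (mul_nonpos_of_nonneg_of_nonpos (hθ.le.trans hq) (by linarith))), add_zero]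
    · have a1 : q * ((1 - r) * (1 - x.2)) ≤ θ * x.2 := by
        nlinarith [mul_nonneg (hθ.le.trans hq) (sub_nonneg.2 hc)]
      rw [min_eq_right a1, max_eq_left (le_min (mul_nonneg (hθ.le.trans hq) (by linarith))
        (mul_nonneg (by linarith) (by linarith))), ← min_add_add_left]
      grind
  · refine le_trans (lintegral_mono_ae ((ae_restrict_iff' hΩ).2 ?_))
      ((lintegral_stripDens_le (h := 1) (lam := θ * 1 / r) hr hl hlL hη).trans
        (ofReal_le_ofReal (le_of_eq (by field_simp))))
    filter_upwards [cell_dens hθ hθr' hr hr1 hF] with x hx hxΩ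
    exact ofReal_le_ofReal (hx (depth_pos.2 hxΩ.1) hxΩ.2.1 hxΩ.2.2)
  · exact slice_snd_restrict (cell_slice_one hθ hθ2 hθr' hr hr1 hF hl)
  · filter_upwards [slice_snd_restrict (cell_slice_zero hθ hθr' hr hr1 hF hl),
      ae_restrict_mem measurableSet_Ioo] with s h hsL
    have : 0 ≤ rate(l,L,s) :=
      Real.rpow_nonneg (div_nonneg hl.le (depth_pos.2 hsL).le) _
    exact h.mono subset_rfl (by linarith)

section Shoulder

variable {V : Plane → ℝ}

theorem exterior_shoulder (hθ : 0 < θ) (hL : 0 < L) (hl : 0 < l) (hb : ∀ x : Plane,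
    x.2 < 0 → v x = 0)
    (ht : ∀ x : Plane, 1 < x.2 → v x = decay L θ (2 * l) l L 0 x)
    (hs : ∀ x : Plane, x.2 ≤ 1 → depth L x.1 ≤ l → v x = 0) :
    ∫⁻ x in (nucleus L)ᶜ, ofReal (lpart 0 v x ^ 2 + lpart 1 v x ^ 2)
      ≤ ofReal (8 * θ ^ 2 * (log (1 + L / l) + 9)) := by
  refine exterior_le hθ hl hL le_rfl zero_le_one (decay_support_shoulder hl.le) hb ht
    (.of_forall fun x _ h1 hm => ?_)
  have hU : IsOpen {x : Plane | x.2 < 1 ∧ depth L x.1 < l} :=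
    (isOpen_lt continuous_snd continuous_const).inter (isOpen_depth_lt L l)
  have hz : ∀ i, lpart i v x = 0 := lpart_eq_zero_of_forall hU
    (fun y hy => hs y hy.1.le hy.2.le) ⟨h1, hm.trans hl⟩
  rw [hz, hz]
  simpa using indicator_nonneg (fun _ _ => sq_nonneg θ) x

/-- The number of teeth is integrable up to the ends, since `3 / 4 < 1`. -/
theorem lintegral_near_le (hl : 0 < l) (hlL : 2 * l ≤ L) :
    ∫⁻ s in Ioo 0 (2 * L), ofReal (if depth L s < 2 * l then
      6 + 8 * rate(l,L,s) else 0) ≤ ofReal (152 * l) := by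
  have hL : 0 < L := by linarith
  have e : ∀ s, ofReal (if s < 2 * l then 6 + 8 * (l / s) ^ (3 / 4 : ℝ) else 0)
      = (Iio (2 * l)).indicator (fun s => ofReal (6 + 8 * (l / s) ^ (3 / 4 : ℝ))) s := by
    intro s
    rw [indicator_apply]
    simp only [mem_Iio]
    split_ifs <;> simp
  have hm : Measurable fun s : ℝ => ofReal (6 + 8 * (l / s) ^ (3 / 4 : ℝ)) := by fun_prop
  rw [lintegral_depth hL (f := fun s => ofReal (if s < 2 * l then
      6 + 8 * (l / s) ^ (3 / 4 : ℝ) else 0))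
          (by simp only [e]; exact hm.indicator measurableSet_Iio)]
  simp only [e]
  rw [setLIntegral_indicator measurableSet_Iio]
  have h2 : Iio (2 * l) ∩ Ioo 0 L = Ioo 0 (2 * l) := by
    grind
  rw [h2, ← lintegral_depth (by linarith : 0 < 2 * l) hm]
  exact (lintegral_add_rpow_le hl (by linarith) (by norm_num) (by norm_num)).trans
    (ofReal_le_ofReal (by linarith))

theorem add_shoulder_near (hl : 0 < l) : ∀ x ∈ nucleus L ∩ {x | depth L x.1 < l}, ∀ i,
    lpart i (fun x => V x + shoulder L θ l x) x = lpart i V x := fun x hx i =>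
  lpart_congr (eventually_of_mem (((nucleus_isOpen L).inter (isOpen_depth_lt L l)).mem_nhds hx)
    fun y hy => by rw [shoulder_side hl hy.1.2.2.le (le_of_lt hy.2), add_zero]) i

theorem add_shoulder_far (hl : 0 < l) (hV : NearField L θ l X D V) :
    ∀ x ∈ nucleus L ∩ {x | l < depth L x.1}, ∀ i,
    lpart i (fun x => V x + shoulder L θ l x) x = lpart i (lamin L θ (-1) (1 / l)) x :=
        fun x hx i =>
  lpart_congr (eventually_of_mem (((nucleus_isOpen L).inter (isOpen_lt_depth L l)).mem_nhds hx)
    fun y hy => by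
      rw [shoulder_inside hl hy.1.2.1 hy.1.2.2, hV.eq_lamin y hy.1 (le_of_lt hy.2)]; ring) i

theorem lpart_zero_lamin_zero (L θ : ℝ) : ∀ᵐ x : Plane, lpart 0 (lamin L θ 0 0) x = 0 := by
  filter_upwards [lpart_lamin L θ 0 0, lpart_trace L 0 0] with x h1 h2
  grind

/-- A laminate near the ends of the nucleus can be continued by the affine deformation at distance
`2l`, at the price of the exterior energy of `decay` and of the energy of the transition. -/
theorem hasCompetitor_shoulder (hμ : 0 ≤ μ) (hε : 0 ≤ ε) (hθ : 0 < θ) (hθ2 : θ ≤ 1 / 2)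
    (hl : 1 ≤ l) (hlL : 2 * l ≤ L) (hX : 0 ≤ X) (hD : 0 ≤ D) (hV : NearField L θ l X D V) :
    HasCompetitor μ ε θ L (μ * (2 * X + 16 * θ ^ 2 * (log (1 + L / l) + 9))
      + (D + 2 * (θ ^ 3 * (1 / l))) + 470 * (ε * l)) := by
  have hl0 : 0 < l := by linarith
  have hL0 : 0 < L := by linarith
  have hlog : 0 ≤ log (1 + L / l) := log_nonneg (by linarith [div_pos hL0 hl0])
  have hW := locallyLipschitz_shoulder (L := L) (θ := θ) hl0
  have hΩ := (nucleus_isOpen L).measurableSet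
  have h1l : |1 / l| = 1 / l := abs_of_pos (by positivity)
  have h1l1 : 1 / l ≤ 1 := (div_le_one hl0).2 hl
  have m0 := measurable_lpart hV.lip 0
  have m1 := measurable_lpart hV.lip 1
  set v : Plane → ℝ := fun x => V x + shoulder L θ l x with hv
  have hpow : ∀ s ∈ Ioo 0 (2 * L), 0 ≤ rate(l,L,s) := fun s hs =>
    Real.rpow_nonneg (div_nonneg hl0.le (depth_pos.2 hs).le) _
  have hext : ∫⁻ x in (nucleus L)ᶜ, ofReal (lpart 0 v x ^ 2 + lpart 1 v x ^ 2)
      ≤ ofReal (2 * X + 16 * θ ^ 2 * (log (1 + L / l) + 9)) := by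
    have hp : ∀ᵐ x ∂(volume.restrict (nucleus L)ᶜ),
        ofReal (lpart 0 v x ^ 2 + lpart 1 v x ^ 2)
        ≤ ofReal 2 * (ofReal (lpart 0 V x ^ 2 + lpart 1 V x ^ 2)
          + ofReal (lpart 0 (shoulder L θ l) x ^ 2 + lpart 1 (shoulder L θ l) x ^ 2)) := by
      refine ae_restrict_of_ae ?_
      filter_upwards [lpart_add hV.lip hW 0, lpart_add hV.lip hW 1] with x e0 e1
      rw [← ofReal_add (by positivity) (by positivity),
        ← ofReal_mul (by norm_num), e0, e1]
      refine ofReal_le_ofReal ?_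
      nlinarith [sq_nonneg (lpart 0 V x - lpart 0 (shoulder L θ l) x),
        sq_nonneg (lpart 1 V x - lpart 1 (shoulder L θ l) x)]
    refine (lintegral_mono_ae hp).trans ?_
    rw [lintegral_const_mul' _ _ ofReal_ne_top, lintegral_add_left (by fun_prop)]
    refine (mul_le_mul_right (add_le_add hV.exterior (exterior_shoulder hθ hL0 hl0
      (fun x hx => shoulder_below hθ hθ2 hx) (fun x hx => shoulder_above hθ hl0 hL0 hx)
      (fun x hx hm => shoulder_side hl0 hx hm))) _).trans ?_
    rw [← ofReal_add hX (by positivity), ← ofReal_mul (by norm_num)]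
    grind
  have hdens : ∫⁻ x in nucleus L, ofReal (wellDens θ (lpart 0 v x) (lpart 1 v x))
      ≤ ofReal (D + 2 * (θ ^ 3 * (1 / l))) := by
    have hp : ∀ᵐ x ∂(volume.restrict (nucleus L)),
        ofReal (wellDens θ (lpart 0 v x) (lpart 1 v x))
        ≤ ofReal (wellDens θ (lpart 0 V x) (lpart 1 V x))
          + ofReal (wellDens θ (lpart 0 (lamin L θ (-1) (1 / l)) x)
            (lpart 1 (lamin L θ (-1) (1 / l)) x)) := by
      refine (ae_restrict_iff' hΩ).2 ?_
      filter_upwards [ae_depth_fst_ne L l] with x hne hx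
      rcases lt_or_gt_of_ne hne with h | h
      · rw [add_shoulder_near hl0 x ⟨hx, h⟩, add_shoulder_near hl0 x ⟨hx, h⟩]
        exact le_add_right le_rfl
      · rw [add_shoulder_far hl0 hV x ⟨hx, h⟩, add_shoulder_far hl0 hV x ⟨hx, h⟩]
        exact le_add_left le_rfl
    refine (lintegral_mono_ae hp).trans ?_
    have hwm : Measurable fun x => ofReal (wellDens θ (lpart 0 V x) (lpart 1 V x)) := by
      unfold wellDens; fun_prop
    rw [lintegral_add_left hwm, ofReal_add hD (by positivity)]
    have := lamin_dens_lintegral_le (L := L) (α := -1) (β := 1 / l) hθ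
    rw [h1l] at this
    exact add_le_add hV.dens this
  have hsl : ∀ i, (∀ᵐ s ∂(volume.restrict (Ioo 0 (2 * L))), SliceVar (Ioo 0 1)
      (fun t => lpart i V (s, t)) (6 + 8 * rate(l,L,s))) →
      (∀ᵐ s : ℝ, SliceVar (Ioo 0 1) (fun t => lpart i (lamin L θ (-1) (1 / l)) (s, t))
        (if depth L s < 2 * l then 2 else 0)) →
      ∀ᵐ s ∂(volume.restrict (Ioo 0 (2 * L))), SliceVar (Ioo 0 1) (fun t => lpart i v (s, t))
        (if depth L s < 2 * l then 6 + 8 * rate(l,L,s) else 0) := by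
    intro i h1 h2
    filter_upwards [h1, ae_restrict_of_ae h2, ae_restrict_of_ae (ae_depth_ne L l),
      ae_restrict_mem measurableSet_Ioo] with s k1 k2 hne hs
    rcases lt_or_gt_of_ne hne with h | h
    · rw [if_pos (by linarith)]
      exact k1.congr_Ioo fun t ht => add_shoulder_near hl0 (s, t) ⟨⟨hs, ht⟩, h⟩ i
    · refine (k2.congr_Ioo fun t ht => add_shoulder_far hl0 hV (s, t) ⟨⟨hs, ht⟩, h⟩ i).mono
        subset_rfl ?_
      grind
  have hiff : ∀ s, -1 + 1 / l * depth L s < 1 ↔ depth L s < 2 * l := fun s => by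
    rw [one_div_mul_eq_div, neg_add_lt_iff_lt_add, div_lt_iff₀ hl0]
    grind
  have h22 := hsl 1 hV.slices.snd_snd ((lamin_slice_one (L := L) (θ := θ) (α := -1)
    (β := 1 / l)).mono fun s hs => by simpa only [hiff] using hs)
  have h12 := hsl 0 hV.slices.fst_snd ((lamin_slice_zero (L := L) (α := -1)
    (β := 1 / l) hθ).mono fun s hs => hs.mono subset_rfl (by
      simp only [hiff, h1l]
      split_ifs with h1 h2 h2
      · nlinarith
      · exact absurd h1.2 h2
      · norm_num
      · rfl))
  have h11 : ∀ᵐ t ∂(volume.restrict (Ioo 0 1)),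
      SliceVar (Ioo 0 (2 * L)) (fun s => lpart 0 v (s, t)) 12 := by
    filter_upwards [hV.slices.fst_fst, ae_restrict_of_ae (lamin_slice_fst (L := L) (α := -1)
      (β := 1 / l) hθ), ae_restrict_of_ae (ae_slice_snd (lpart_add hV.lip hW 0)),
      ae_restrict_of_ae (ae_slice_snd (lpart_sub (locallyLipschitz_lamin (α := -1) (β := 1 / l))
        (locallyLipschitz_lamin (α := 0) (β := 0)) 0)), ae_restrict_of_ae (ae_slice_snd
        (lpart_zero_lamin_zero L θ)), ae_restrict_mem measurableSet_Ioo]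
      with t k1 k2 k3 k4 k5 ht
    refine ((k1.add k2).congr_ae ((ae_restrict_iff' measurableSet_Ioo).2 ?_)).mono subset_rfl ?_
    · filter_upwards [k3, k4, k5] with s e1 e2 e3 hs
      have hsh : ∀ x ∈ nucleus L, shoulder L θ l x
          = lamin L θ (-1) (1 / l) x - lamin L θ 0 0 x := fun x hx =>
        shoulder_inside hl0 hx.2.1 hx.2.2
      rw [e1, lpart_congr_nucleus hsh (show (s, t) ∈ nucleus L from ⟨hs, ht⟩), e2, e3, sub_zero]
    · rw [h1l]; nlinarith
  refine (hasCompetitor_of_bounds (hV.lip.add hW) hμ hε (by positivity)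
    (by positivity) (by positivity) (by positivity) (by norm_num) hext hdens ⟨h22, h12, h11⟩
    (lintegral_near_le hl0 hlL) (lintegral_near_le hl0 hlL)
    (lintegral_ofReal_const_le (C := 12) zero_le_one (by norm_num))).mono ?_
  nlinarith

end Shoulder

section Linear

theorem trace_slice (hθ : 0 < θ) (L α β t : ℝ) : SliceVar (Ioo 0 (2 * L))
    (fun s => θ * lpart 0 (fun x => trace(α,β,L,x.1)) (s, t))
    (4 * (θ * |β|)) := by
  have hn : volume (Ioo 2 3 : Set ℝ) ≠ 0 := by rw [Real.volume_Ioo]; norm_num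
  obtain ⟨t', ht', h1, h2⟩ : ∃ t' ∈ Ioo (2 : ℝ) 3, SliceVar (Ioo 0 (2 * L))
      (fun s => lpart 0 (lamin L θ α β) (s, t')) (4 * (θ * |β|)) ∧ ∀ᵐ s : ℝ,
      lpart 0 (lamin L θ α β) (s, t') = θ * lpart 0 (fun x : Plane =>
        trace(α,β,L,x.1)) (s, t') := by
    have h := (lamin_slice_fst (L := L) (α := α) (β := β) hθ).and
      (ae_slice_snd (lpart_lamin L θ α β))
    obtain ⟨t', ht, h1, h2⟩ := ((frequently_ae_mem_iff.2 hn).and_eventually h).exists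
    refine ⟨t', ht, h1, h2.mono fun s hs => (hs.2 ?_).1⟩
    have : trace(α,β,L,s) ≤ 1 := max_le (min_le_right _ _) zero_le_one
    nlinarith [ht.1]
  refine h1.congr_ae (ae_restrict_of_ae (h2.mono fun s hs => ?_))
  beta_reduce
  rw [hs]
  simp [lpart, lineDeriv, dir]

/-- The linear interpolation in the vertical direction. -/
theorem hasCompetitor_linear (hμ : 0 ≤ μ) (hε : 0 ≤ ε) (hθ : 0 < θ) (hθ2 : θ ≤ 1 / 2)
    (hl : 1 / 4 ≤ l) (hlL : l ≤ L) :
    HasCompetitor μ ε θ L (μ * (8 * θ ^ 2 * (log (1 + L / l) + 9)) + 100 * (θ ^ 2 * l)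
      + 100 * (ε * θ)) := by
  have hl0 : 0 < l := by linarith
  have hL0 : 0 < L := by linarith
  have hlog : 0 ≤ log (1 + L / l) := log_nonneg (by linarith [div_pos hL0 hl0])
  have h1l : |1 / l| = 1 / l := abs_of_pos (by positivity)
  set τ : Plane → ℝ := fun x => max (min (-1 + 1 / l * depth L x.1) 1) 0 with hτ
  set v : Plane → ℝ := fun x => min (max x.2 0) 1 * decay L θ (2 * l) l L 0 x with hv
  have ld := locallyLipschitz_decay (L := L) (θ := θ) (k := 2 * l) (M := L) (p := 0) hl0
  have hlip : LocLip v := by fun_prop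
  have hin : ∀ x ∈ nucleus L, v x = x.2 * (θ * τ x) := fun x hx => by
    simp only [hv]
    rw [max_eq_left hx.2.1.le, min_eq_left hx.2.2.le, decay_inside hl0 hx.2.2.le]
  have d2 := lpart_affine' (f := fun x : Plane => x.2) 0 0 1 fun x => by ring
  have lτ : LocLip fun x => θ * τ x := by fun_prop
  have hg : ∀ᵐ x : Plane, x ∈ nucleus L → lpart 0 v x = x.2 * (θ * lpart 0 τ x) ∧
      lpart 1 v x = θ * τ x := by
    filter_upwards [lpart_mul locallyLipschitz_snd lτ 0, lpart_mul locallyLipschitz_snd lτ 1,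
        lpart_trace L (-1) (1 / l)]
      with x h0 h1 h2 hx
    rw [lpart_const_mul] at h0 h1
    rw [lpart_congr_nucleus hin hx, lpart_congr_nucleus hin hx, h0, h1, h2.2, (d2 x).1, (d2 x).2]
    constructor <;> ring
  have hsmall : ∀ᵐ x : Plane, |lpart 0 τ x| ≤ if depth L x.1 < 2 * l then 1 / l else 0 := by
    filter_upwards [lpart_trace L (-1) (1 / l)] with x hx
    rw [hx.1]
    have hiff : -1 + 1 / l * depth L x.1 < 1 ↔ depth L x.1 < 2 * l := by
      rw [one_div_mul_eq_div, neg_add_lt_iff_lt_add, div_lt_iff₀ hl0]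
      grind
    by_cases hc : depth L x.1 < 2 * l
    · rw [if_pos hc]
      split_ifs
      · exact h1l.le
      · rw [abs_neg]; exact h1l.le
      · rw [abs_zero]; positivity
    grind
  set S := {s : ℝ | 0 < 2 * l - depth L s ∧ 2 * l - depth L s ≤ 2 * l} with hS
  have hSv : volume S ≤ ofReal (4 * l) :=
    (volume_depth_layer_le L (2 * l) (by positivity)).trans (le_of_eq (by congr 1; ring))
  have hSm : MeasurableSet S := by
    have h : Measurable fun s => 2 * l - depth L s := by
      have := continuous_depth L
      fun_prop
    exact (measurableSet_lt measurable_const h).inter (measurableSet_le h measurable_const)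
  have hΩ := (nucleus_isOpen L).measurableSet
  have hτ1 : ∀ x : Plane, 2 * l ≤ depth L x.1 → τ x = 1 := fun x h => by
    have : 2 ≤ 1 / l * depth L x.1 := by rwa [one_div_mul_eq_div, le_div_iff₀ hl0]
    grind
  have hdens : ∫⁻ x in nucleus L, ofReal (wellDens θ (lpart 0 v x) (lpart 1 v x))
      ≤ ofReal (17 * θ ^ 2 * (4 * l)) := by
    have hp : ∀ᵐ x ∂(volume.restrict (nucleus L)),
        ofReal (wellDens θ (lpart 0 v x) (lpart 1 v x))
        ≤ (S ×ˢ Ioo 0 1).indicator (fun _ => ofReal (17 * θ ^ 2)) x := by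
      refine (ae_restrict_iff' hΩ).2 ?_
      filter_upwards [hg, hsmall] with x h1 h2 hx
      rw [(h1 hx).1, (h1 hx).2]
      rcases lt_or_ge (depth L x.1) (2 * l) with h | h
      · rw [indicator_of_mem (show x ∈ S ×ˢ Ioo 0 1 from
          ⟨⟨by linarith, by linarith [(mem_nucleus.1 hx).1]⟩, hx.2⟩)]
        refine ofReal_le_ofReal ?_
        rw [if_pos h] at h2
        have h4 : |x.2 * lpart 0 τ x| ≤ 4 := by
          have : 1 / l ≤ 4 := by rw [div_le_iff₀ hl0]; linarith
          rw [abs_mul, abs_of_pos hx.2.1]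
          nlinarith [hx.2.2, hx.2.1, abs_nonneg (lpart 0 τ x)]
        have h5 : (x.2 * lpart 0 τ x) ^ 2 ≤ 16 := by
          rw [← sq_abs]; nlinarith [abs_nonneg (x.2 * lpart 0 τ x)]
        have h6 : (τ x - 1) ^ 2 ≤ 1 := by
          have a : 0 ≤ τ x := le_max_right _ _
          have b : τ x ≤ 1 := max_le (min_le_right _ _) zero_le_one
          nlinarith
        have h7 := mul_le_mul_of_nonneg_left (add_le_add h5 h6) (sq_nonneg θ)
        refine (add_le_add_right (min_le_left _ _) _).trans ?_
        linarith
      · rw [if_neg (not_lt.2 h)] at h2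
        rw [abs_nonpos_iff.1 h2, hτ1 x h, wellDens, mul_one, sub_self]
        refine (ENNReal.ofReal_of_nonpos ?_).le.trans zero_le
        grind
    refine (lintegral_mono_ae hp).trans ((lintegral_mono' Measure.restrict_le_self le_rfl).trans ?_)
    rw [lintegral_indicator_const (hSm.prod measurableSet_Ioo), Measure.volume_eq_prod,
      Measure.prod_prod, Real.volume_Ioo, sub_zero, ENNReal.ofReal_one, mul_one]
    exact (mul_le_mul_right hSv _).trans (ofReal_mul (by positivity)).symm.le
  have h22 : ∀ᵐ s ∂(volume.restrict (Ioo 0 (2 * L))),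
      SliceVar (Ioo 0 1) (fun t => lpart 1 v (s, t)) 0 := by
    filter_upwards [ae_restrict_of_ae (ae_slice_fst hg), ae_restrict_mem measurableSet_Ioo]
      with s h hs
    refine ((sliceVar_affine (θ * τ (s, 0)) 0).congr_ae ((ae_restrict_iff' measurableSet_Ioo).2
      (h.mono fun t h ht => ?_))).mono subset_rfl (by simp)
    beta_reduce
    rw [(h ⟨hs, ht⟩).2, zero_mul, add_zero]
  have hτ0 : ∀ s t : ℝ, lpart 0 τ (s, t) = lpart 0 τ (s, 0) := fun s t => by
    simp [hτ, lpart, lineDeriv, dir]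
  have h12 : ∀ᵐ s ∂(volume.restrict (Ioo 0 (2 * L))),
      SliceVar (Ioo 0 1) (fun t => lpart 0 v (s, t))
        (θ * (if depth L s < 2 * l then 1 / l else 0)) := by
    filter_upwards [ae_restrict_of_ae (ae_slice_fst hg), ae_restrict_of_ae (ae_slice_fst hsmall),
      ae_restrict_mem measurableSet_Ioo] with s h h' hs
    refine ((sliceVar_affine 0 (θ * lpart 0 τ (s, 0))).congr_ae ((ae_restrict_iff'
      measurableSet_Ioo).2 (h.mono fun t h ht => ?_))).mono subset_rfl ?_
    · beta_reduce
      rw [(h ⟨hs, ht⟩).1, hτ0]; ring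
    · obtain ⟨t, ht⟩ := h'.exists
      rw [hτ0] at ht
      rw [abs_mul, abs_of_pos hθ]
      exact mul_le_mul_of_nonneg_left ht hθ.le
  have i12 : ∫⁻ s in Ioo 0 (2 * L), ofReal
      (θ * (if depth L s < 2 * l then 1 / l else 0)) ≤ ofReal (4 * θ) := by
    have hp : ∀ s ∈ Ioo 0 (2 * L), ofReal (θ * (if depth L s < 2 * l then 1 / l else 0))
        ≤ S.indicator (fun _ => ofReal (θ * (1 / l))) s := fun s hs => by
      split_ifs with h
      · rw [indicator_of_mem (show s ∈ S from
          ⟨by linarith, by linarith [depth_pos.2 hs]⟩)]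
      · simp
    refine (setLIntegral_mono' measurableSet_Ioo hp).trans
      ((lintegral_mono' Measure.restrict_le_self le_rfl).trans ?_)
    rw [lintegral_indicator_const hSm]
    refine (mul_le_mul_right hSv _).trans ?_
    rw [← ofReal_mul (by positivity)]
    grind
  have h11 : ∀ᵐ t ∂(volume.restrict (Ioo 0 1)),
      SliceVar (Ioo 0 (2 * L)) (fun s => lpart 0 v (s, t)) (16 * θ) := by
    filter_upwards [ae_restrict_of_ae (ae_slice_snd hg), ae_restrict_mem measurableSet_Ioo]
      with t h ht
    refine (((trace_slice hθ L (-1) (1 / l) t).const_mul t).congr_ae ((ae_restrict_iff'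
      measurableSet_Ioo).2 (h.mono fun s h hs => (h ⟨hs, ht⟩).1))).mono subset_rfl ?_
    rw [h1l, abs_of_pos ht.1]
    have : 1 / l ≤ 4 := by rw [div_le_iff₀ hl0]; linarith
    have h2 : 4 * (θ * (1 / l)) ≤ 16 * θ := by nlinarith
    nlinarith [ht.2, ht.1]
  refine (hasCompetitor_of_bounds hlip hμ hε (by positivity) (by positivity) le_rfl
    (by positivity) (by positivity) (exterior_shoulder hθ hL0 hl0 (fun x hx => ?_) (fun x hx => ?_)
    fun x hx hm => ?_) hdens ⟨h22, h12, h11⟩ (by simp) i12 (lintegral_ofReal_const_le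
    (C := 16 * θ) zero_le_one (by linarith))).mono ?_
  · grind
  · grind
  · simp only [hv]
    rw [decay_side hl0 hx hm, mul_zero]
  · have a : 0 ≤ θ ^ 2 * l := by positivity
    have b : 0 ≤ ε * θ := by positivity
    linarith

end Linear

/-! ### The scaling regimes -/

/-- The largest period `h = 1 / N` below `1 / 2` and the value `Q / A` at which the surface energy
`Q / h` equals `A`. -/
theorem exists_period {Q A : ℝ} (hQ : 0 < Q) (hA : 0 < A) : ∃ (N : ℕ) (h : ℝ), 0 < h ∧
    N * h = 1 ∧ h ≤ 1 / 2 ∧ h ≤ Q / A ∧ Q / h ≤ 4 * Q + 2 * A := by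
  set m := min (1 / 2) (Q / A)
  have hm : 0 < m := lt_min (by norm_num) (by positivity)
  have hm1 : 1 ≤ 1 / m := by rw [one_le_div hm]; exact (min_le_left _ _).trans (by norm_num)
  have hN : 0 < ⌈1 / m⌉₊ := Nat.ceil_pos.2 (by positivity)
  have hN' : (0 : ℝ) < ⌈1 / m⌉₊ := by exact_mod_cast hN
  have hle := Nat.le_ceil (1 / m)
  have hlt := Nat.ceil_lt_add_one (show 0 ≤ 1 / m by positivity)
  have h1 : 1 / (⌈1 / m⌉₊ : ℝ) ≤ m := by rwa [div_le_comm₀ hN' hm]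
  have h2 : 1 / m ≤ 2 + A / Q := by
    rcases min_choice (1 / 2) (Q / A) with h | h <;> simp only [m, h]
    · have : 0 < A / Q := by positivity
      norm_num; linarith
    · rw [one_div_div]; linarith
  refine ⟨⌈1 / m⌉₊, 1 / ⌈1 / m⌉₊, by positivity, by field_simp, h1.trans (min_le_left _ _),
    h1.trans (min_le_right _ _), ?_⟩
  rw [div_div_eq_mul_div, div_one]
  have e : Q * (2 * (2 + A / Q)) = 4 * Q + 2 * A := by field_simp; ring
  rw [← e]
  exact mul_le_mul_of_nonneg_left (by linarith) hQ.le

theorem one_le_log_add {x : ℝ} (hx : 0 ≤ x) : 1 ≤ log (3 + x) := by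
  rw [Real.le_log_iff_exp_le (by linarith)]
  linarith [Real.exp_one_lt_d9]

theorem log_le_two_mul {x y : ℝ} (hx : 0 < x) (h : x ≤ y ^ 2) :
    log x ≤ 2 * log y := by
  have := log_le_log hx h
  rwa [Real.log_pow, Nat.cast_ofNat] at this

/-- The choice between a laminate with a steep part of minimal width, a branched laminate with
austenitic boundary layer and a fully branched laminate, according to the size of `μ * l`. -/
theorem exists_strip (hθ : 0 < θ) (hθ2 : θ ≤ 1 / 2) (hh : 0 < h) (hhl : h ≤ l)
    (hμ : 0 < μ) (hΛ : 0 ≤ Λ) (h1 : μ * l ≤ 2 * (θ * h) → log (1 + 1 / θ) ≤ 2 * Λ)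
    (h2 : 2 * (θ * h) < μ * l → log (1 + h / (μ * l)) ≤ 2 * Λ) :
    ∃ (r η κ : ℝ) (F : Plane → ℝ), θ * h ≤ r ∧ r ≤ h ∧ 0 ≤ η ∧
      ((r = h ∧ κ = 0) ∨ (2 * r ≤ h ∧ κ = 1)) ∧ StripFn L (θ * h / r) r l η F ∧
      0 ≤ κ * log (1 + h / r) ∧ κ * log (1 + h / r) ≤ 2 * Λ ∧ η * (r / l) ≤ 2 * μ := by
  have hl : 0 < l := hh.trans_le hhl
  have hθh : 2 * (θ * h) ≤ h := by nlinarith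
  have hp : ∀ r, 0 < r → 0 ≤ log (1 + h / r) := fun r hr =>
    log_nonneg (by linarith [div_pos hh hr])
  -- steep part of the minimal width: an exact laminate
  rcases le_or_gt (μ * l) (2 * (θ * h)) with hc | hc
  · have e : θ * h / (θ * h) = 1 := div_self (by positivity)
    have e' : h / (θ * h) = 1 / θ := by field_simp
    refine ⟨θ * h, 0, 1, fun _ => 0, le_rfl, by nlinarith, le_rfl, Or.inr ⟨hθh, rfl⟩,
      by rw [e]; exact stripFn_zero, ?_, ?_, ?_⟩
    · rw [one_mul]; exact hp _ (by positivity)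
    · rw [one_mul, e']; exact h1 hc
    · rw [zero_mul]; positivity
  -- boundary layer of width `μ * l`, or of the full period if this is too wide
  rcases lt_or_ge (2 * (μ * l)) h with hc' | hc'
  · have hr : 0 < μ * l := by positivity
    obtain ⟨F, hF⟩ := exists_stripFn (r := μ * l) (l := l) L
      (show 0 < θ * h / (μ * l) by positivity) (by rw [div_le_iff₀ hr]; linarith) hr (by linarith)
    refine ⟨μ * l, 1, 1, F, by nlinarith, by linarith, zero_le_one, Or.inr ⟨hc'.le, rfl⟩, hF, ?_,
      ?_, ?_⟩
    · rw [one_mul]; exact hp _ hr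
    · rw [one_mul]; exact h2 hc
    · rw [one_mul, mul_div_cancel_right₀ _ hl.ne']; linarith
  · obtain ⟨F, hF⟩ := exists_stripFn (r := h) (l := l) L
      (show 0 < θ * h / h by positivity) (by rw [div_le_iff₀ hh]; linarith) hh hhl
    refine ⟨h, 1, 0, F, by linarith, le_rfl, zero_le_one, Or.inl ⟨rfl, rfl⟩, hF, by simp,
      by simpa using hΛ, ?_⟩
    rw [one_mul, div_le_iff₀ hl]; linarith

section Regimes

theorem competitor_constant (hμ : 0 < μ) (hε : 0 < ε) (hL : 1 / 2 ≤ L) :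
    HasCompetitor μ ε θ L (10000 * constantRegime θ L) := by
  refine (hasCompetitor_zero hμ.le hε.le (by linarith)).mono ?_
  have : 0 ≤ θ ^ 2 * L := mul_nonneg (sq_nonneg θ) (by linarith)
  rw [constantRegime]; linarith

/-- The affine deformation in the whole nucleus. -/
theorem competitor_affine (hμ : 0 < μ) (hε : 0 < ε) (hθ : 0 < θ) (hθ2 : θ ≤ 1 / 2)
    (hL : 1 / 2 ≤ L) : HasCompetitor μ ε θ L (10000 * affineRegime μ θ L) := by
  refine (hasCompetitor_rise hμ.le hε.le hθ hθ2 hL (Or.inl ⟨rfl, rfl⟩)).mono ?_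
  have h1 := one_le_log_add (show 0 ≤ L by linarith)
  have h2 : log (1 + L) ≤ log (3 + L) := log_le_log (by linarith) (by linarith)
  have h3 : μ * θ ^ 2 * (8 * (log (1 + L) + 9)) ≤ μ * θ ^ 2 * (10000 * log (3 + L)) :=
    mul_le_mul_of_nonneg_left (by linarith) (by positivity)
  rw [affineRegime, zero_div, mul_zero, mul_zero, zero_mul, add_zero, add_zero]
  linarith

/-- The linear interpolation with a trace that rises at a distance of order `μ` from the ends, at
which elastic and exterior energy balance. For
small `μ` the affine deformation and for large `μ` the zero function are better. -/
theorem competitor_linear (hμ : 0 < μ) (hε : 0 < ε) (hθ : 0 < θ) (hθ2 : θ ≤ 1 / 2)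
    (hL : 1 / 2 ≤ L) : HasCompetitor μ ε θ L (10000 * linearInterpolationRegime μ ε θ L) := by
  have hL0 : 0 < L := by linarith
  have hlog := one_le_log_add (show 0 ≤ L / μ by positivity)
  rw [linearInterpolationRegime]
  have hεθ : 0 < ε * θ := by positivity
  have ha : 0 < μ * θ ^ 2 := by positivity
  have ha' := le_mul_of_one_le_right ha.le hlog
  rcases le_or_gt μ 1 with h | h
  · refine (competitor_affine hμ hε hθ hθ2 hL).mono ?_
    have h1 : L ≤ L / μ := by rw [le_div_iff₀ hμ]; nlinarith
    have h2 : affineRegime μ θ L ≤ μ * θ ^ 2 * log (3 + L / μ) := by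
      unfold affineRegime; gcongr
    linarith
  rcases le_or_gt μ (4 * L) with h' | h'
  · refine (hasCompetitor_linear (l := μ / 4) hμ.le hε.le hθ hθ2 (by linarith)
      (by linarith)).mono ?_
    have e : L / (μ / 4) = 4 * (L / μ) := by field_simp
    have hq : 0 < L / μ := by positivity
    have h1 : log (1 + L / (μ / 4)) ≤ 2 * log (3 + L / μ) := by
      rw [e]; exact log_le_two_mul (by linarith) (by nlinarith)
    have h2 := mul_le_mul_of_nonneg_left h1 ha.le
    linarith
  · refine (hasCompetitor_zero hμ.le hε.le (by linarith)).mono ?_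
    have : θ ^ 2 * L ≤ θ ^ 2 * μ := by gcongr; linarith
    linarith

/-- Branching in the whole nucleus, without exterior energy. The period is
`(ε L² / θ²) ^ (1 / 3)` up to a factor. -/
theorem competitor_branching (hμ : 0 < μ) (hε : 0 < ε) (hθ : 0 < θ) (hθ2 : θ ≤ 1 / 2)
    (hL : 1 / 2 ≤ L) : HasCompetitor μ ε θ L (10000 * branchingRegime ε θ L) := by
  have hL0 : 0 < L := by linarith
  rw [branchingRegime]
  set A := ε ^ (2 / 3 : ℝ) * θ ^ (2 / 3 : ℝ) * L ^ (1 / 3 : ℝ) with hA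
  have hA0 : 0 < A := by positivity
  have hA3 : A ^ 3 = ε ^ 2 * θ ^ 2 * L := by
    rw [hA, mul_pow, mul_pow, ← Real.rpow_natCast, ← Real.rpow_natCast, ← Real.rpow_natCast,
      ← Real.rpow_mul hε.le, ← Real.rpow_mul hθ.le, ← Real.rpow_mul hL0.le]
    norm_num
  obtain ⟨N, h, hh, hN, hh1, hhA, hQ⟩ := exists_period (mul_pos hε hL0) hA0
  have e : θ * h / h = θ := by field_simp
  obtain ⟨F, hF⟩ := exists_stripFn (r := h) (l := L) L hθ hθ2 hh (by linarith)
  refine (hasCompetitor_periodic (r := h) (l := L) (η := 1) (κ := 0) hμ.le hε.le hθ hθ2 hL hh hN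
    (by nlinarith) le_rfl hL0 le_rfl zero_le_one (Or.inl ⟨rfl, rfl⟩) (by rwa [e])).mono ?_
  have h1 : θ ^ 2 * h * h / L ≤ A := by
    have : θ ^ 2 * (ε * L / A) * (ε * L / A) / L = A := by
      grind
    calc θ ^ 2 * h * h / L ≤ θ ^ 2 * (ε * L / A) * (ε * L / A) / L := by gcongr
      _ = A := this
  have : 0 < ε * L := by positivity
  linarith

theorem sq_regime (hμ : 0 < μ) (hε : 0 < ε) (hL : 0 < L) (hΛ : 0 < Λ) :
    (μ ^ (1 / 2 : ℝ) * ε ^ (1 / 2 : ℝ) * θ * L ^ (1 / 2 : ℝ) * Λ ^ (1 / 2 : ℝ)) ^ 2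
      = μ * θ ^ 2 * Λ * (ε * L) := by
  simp only [← Real.sqrt_eq_rpow]
  grind

/-- Laminates with `N` periods: the period balances the energy `μ * θ ^ 2 * Λ * h` of the boundary
layer and the surface energy `ε * L / h`. -/
theorem competitor_of_log (hμ : 0 < μ) (hε : 0 < ε) (hθ : 0 < θ) (hθ2 : θ ≤ 1 / 2)
    (hL : 1 / 2 ≤ L) (hΛ : 1 ≤ Λ)
    (H : ∀ h, 0 < h → h ≤ 1 / 2 → μ * θ ^ 2 * Λ * h ^ 2 ≤ ε * L →
      ∃ (r η κ : ℝ) (F : Plane → ℝ), θ * h ≤ r ∧ r ≤ h ∧ 0 ≤ η ∧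
      ((r = h ∧ κ = 0) ∨ (2 * r ≤ h ∧ κ = 1)) ∧ StripFn L (θ * h / r) r L η F ∧
      0 ≤ κ * log (1 + h / r) ∧ κ * log (1 + h / r) ≤ 2 * Λ ∧ η * (r / L) ≤ 2 * μ) :
    HasCompetitor μ ε θ L (2000 * (μ ^ (1 / 2 : ℝ) * ε ^ (1 / 2 : ℝ) * θ * L ^ (1 / 2 : ℝ)
      * Λ ^ (1 / 2 : ℝ) + ε * L)) := by
  have hL0 : 0 < L := by linarith
  have hΛ0 : 0 < Λ := by linarith
  have hA2 := sq_regime (θ := θ) hμ hε hL0 hΛ0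
  have hA0 : 0 < μ ^ (1 / 2 : ℝ) * ε ^ (1 / 2 : ℝ) * θ * L ^ (1 / 2 : ℝ) * Λ ^ (1 / 2 : ℝ) := by
    positivity
  set A := μ ^ (1 / 2 : ℝ) * ε ^ (1 / 2 : ℝ) * θ * L ^ (1 / 2 : ℝ) * Λ ^ (1 / 2 : ℝ)
  obtain ⟨N, h, hh, hN, hh1, hhA, hQ⟩ := exists_period (mul_pos hε hL0) hA0
  have hP : μ * θ ^ 2 * Λ * h ≤ A := by
    have : μ * θ ^ 2 * Λ * (ε * L / A) = A := by
      grind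
    calc μ * θ ^ 2 * Λ * h ≤ μ * θ ^ 2 * Λ * (ε * L / A) := by gcongr
      _ = A := this
  have hP2 : μ * θ ^ 2 * Λ * h ^ 2 ≤ ε * L := by
    rw [le_div_iff₀ hA0] at hhA
    nlinarith
  obtain ⟨r, η, κ, F, hr1, hr2, hη, hκ, hF, hl0, hl1, hl2⟩ := H h hh hh1 hP2
  refine (hasCompetitor_periodic hμ.le hε.le hθ hθ2 hL hh hN hr1 hr2 hL0 le_rfl hη hκ hF).mono ?_
  have h1 : μ * θ ^ 2 * h * (κ * log (1 + h / r)) ≤ μ * θ ^ 2 * h * (2 * Λ) := by gcongr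
  have h2 : θ ^ 2 * h * (η * (r / L)) ≤ θ ^ 2 * h * (2 * μ) := by gcongr
  have h3 : μ * θ ^ 2 * h ≤ μ * θ ^ 2 * Λ * h := by
    have := mul_le_mul_of_nonneg_left hΛ (show 0 ≤ μ * θ ^ 2 * h by positivity)
    linarith
  have e1 : 20 * κ * (μ * θ ^ 2 * h * log (1 + h / r))
      = 20 * (μ * θ ^ 2 * h * (κ * log (1 + h / r))) := by ring
  have e2 : 10 * η * (θ ^ 2 * h * r / L) = 10 * (θ ^ 2 * h * (η * (r / L))) := by ring
  rw [e1, e2]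
  have : 0 < ε * L := by positivity
  linarith

/-- An exact laminate; `h / r = 1 / θ` is the ratio of the scales of the exterior energy. -/
theorem competitor_laminate (hμ : 0 < μ) (hε : 0 < ε) (hθ : 0 < θ) (hθ2 : θ ≤ 1 / 2)
    (hL : 1 / 2 ≤ L) : HasCompetitor μ ε θ L (2000 * laminateRegime μ ε θ L) := by
  have hθi : 0 < 1 / θ ^ 2 := by positivity
  have hΛ := one_le_log_add hθi.le
  have hθ1 : 1 / θ ≤ 1 / θ ^ 2 := by
    rw [div_le_div_iff_of_pos_left one_pos hθ (by positivity)]; nlinarith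
  have hlog : log (1 + 1 / θ) ≤ log (3 + 1 / θ ^ 2) :=
    log_le_log (by positivity) (by linarith)
  refine competitor_of_log hμ hε hθ hθ2 hL hΛ fun h hh _ _ => ?_
  have e : θ * h / (θ * h) = 1 := div_self (by positivity)
  have e' : h / (θ * h) = 1 / θ := by field_simp
  refine ⟨θ * h, 0, 1, fun _ => 0, le_rfl, by nlinarith, le_rfl, Or.inr ⟨by nlinarith, rfl⟩,
    by rw [e]; exact stripFn_zero, ?_, ?_, ?_⟩
  · rw [one_mul, e']; exact log_nonneg (by linarith [show 0 < 1 / θ by positivity])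
  · rw [one_mul, e']; linarith
  · rw [zero_mul]; positivity

/-- A boundary layer of width `μ * L` balances the exterior energy with that of the branching. -/
theorem competitor_twoScale (hμ : 0 < μ) (hε : 0 < ε) (hθ : 0 < θ) (hθ2 : θ ≤ 1 / 2)
    (hL : 1 / 2 ≤ L) : HasCompetitor μ ε θ L (2000 * twoScaleBranchingRegime μ ε θ L) := by
  have hL0 : 0 < L := by linarith
  have hX : 0 < ε / (μ ^ 3 * θ ^ 2 * L) := by positivity
  have hΛ := one_le_log_add hX.le
  refine competitor_of_log hμ hε hθ hθ2 hL hΛ fun h hh hh1 hP => ?_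
  set X := ε / (μ ^ 3 * θ ^ 2 * L)
  have hXm : X * (μ ^ 3 * θ ^ 2 * L) = ε := div_mul_cancel₀ _ (by positivity)
  -- the choice of the period bounds its ratio to the width `μ * L` of the boundary layer
  have hq : (h / (μ * L)) ^ 2 ≤ X := by
    have h1 : μ * θ ^ 2 * h ^ 2 ≤ ε * L := by
      have := mul_le_mul_of_nonneg_left hΛ (show 0 ≤ μ * θ ^ 2 * h ^ 2 by positivity)
      linarith
    rw [div_pow, div_le_iff₀ (by positivity)]
    have : μ * θ ^ 2 * h ^ 2 ≤ μ * θ ^ 2 * (X * (μ * L) ^ 2) := by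
      rw [← hXm] at h1; linarith
    exact le_of_mul_le_mul_left this (by positivity)
  have hq0 : 0 < h / (μ * L) := by positivity
  refine exists_strip hθ hθ2 hh (by linarith) hμ (by linarith) (fun hc => ?_) fun _ => ?_
  · refine log_le_two_mul (by positivity) ?_
    have h1 : 1 / θ ≤ 2 * (h / (μ * L)) := by
      rw [div_le_iff₀ hθ, mul_div_assoc', div_mul_eq_mul_div, le_div_iff₀ (by positivity)]
      linarith
    nlinarith [sq_nonneg (h / (μ * L) - 1)]
  · exact log_le_two_mul (by positivity) (by nlinarith [sq_nonneg (h / (μ * L) - 1)])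

end Regimes

section Regimes

/-- The trace of the affine deformation falls to zero over the length `max 1 (θ / μ)` and rises again
at the distance `a / ε` from the ends, at which the surface energy equals `a = μ * θ ^ 2`. -/
theorem competitor_corner (hμ : 0 < μ) (hε : 0 < ε) (hθ : 0 < θ) (hθ2 : θ ≤ 1 / 2)
    (hL : 1 / 2 ≤ L) : HasCompetitor μ ε θ L (10000 * cornerLaminateRegime μ ε θ L) := by
  have hL0 : 0 < L := by linarith
  rw [cornerLaminateRegime]
  set a := μ * θ ^ 2 with ha_def
  have ha : 0 < a := by positivity
  set δ := max 1 (θ / μ) with hδ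
  have hz : 0 < θ / μ := by positivity
  have hδ1 : 1 ≤ δ := le_max_left _ _
  have hδ0 : 0 < δ := by linarith
  have hδ2 : δ ≤ 1 + θ / μ := max_le (by linarith) (by linarith)
  have hb : 0 < ε * L / a := by positivity
  have g1 := one_le_log_add hb.le
  have g2 := one_le_log_add hz.le
  have p1 := mul_le_mul_of_nonneg_left g1 ha.le
  have p2 := mul_le_mul_of_nonneg_left g2 ha.le
  have hlogδ : a * log (1 + δ) ≤ a * log (3 + θ / μ) :=
    mul_le_mul_of_nonneg_left (log_le_log (by positivity) (by linarith)) ha.le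
  have hθδ : θ ^ 3 * (1 / δ) ≤ a := by
    have : θ / μ ≤ δ := le_max_right _ _
    rw [div_le_iff₀ hμ] at this
    rw [mul_one_div, div_le_iff₀ hδ0]
    nlinarith [mul_le_mul_of_nonneg_left this (sq_nonneg θ)]
  -- if this distance is too short, the affine deformation is as good
  rcases lt_or_ge (a / ε) δ with hl | hl
  · refine (competitor_affine hμ hε hθ hθ2 hL).mono ?_
    have h1 : L ≤ ε * L / a * δ := by
      rw [div_lt_iff₀ hε] at hl
      rw [div_mul_eq_mul_div, le_div_iff₀ ha]
      nlinarith
    have h2 : log (3 + L) ≤ log (3 + ε * L / a) + log (3 + θ / μ) := by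
      rw [← Real.log_mul (by positivity) (by positivity)]
      refine log_le_log (by positivity) ?_
      nlinarith
    have h3 := mul_le_mul_of_nonneg_left h2 ha.le
    unfold affineRegime
    linarith
  have hεl : ε * (a / ε) = a := by field_simp
  rcases le_or_gt (2 * (a / ε)) L with hlL | hlL
  · have e : L / (a / ε) = ε * L / a := by field_simp
    have hlog0 : 0 ≤ log (1 + δ) := log_nonneg (by linarith)
    refine (hasCompetitor_shoulder hμ.le hε.le hθ hθ2 (hδ1.trans hl) hlL (by positivity)
      (by positivity) (nearField_rise hθ hθ2 hL hδ1 hl)).mono ?_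
    have h1 : a * log (1 + L / (a / ε)) ≤ a * log (3 + ε * L / a) := by
      rw [e]; gcongr; norm_num
    have h2 : θ ^ 3 * (1 / (a / ε)) ≤ θ ^ 3 * (1 / δ) := by gcongr
    grind
  · refine (hasCompetitor_rise hμ.le hε.le hθ hθ2 hL (Or.inr ⟨rfl, hδ1⟩)).mono ?_
    have h1 : ε * L < 2 * a := by
      have := mul_lt_mul_of_pos_left hlL hε
      linarith
    grind

/-- The energy of the two-scale branching is controlled by that of the single truncated branching
if the laminate fills the nucleus. -/
theorem twoScale_le (hμ : 0 < μ) (hε : 0 < ε) (hθ : 0 < θ) (hL : 0 < L)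
    (h : ε * L ≤ 2 * (μ * θ ^ 2)) : twoScaleBranchingRegime μ ε θ L
      ≤ 5 * (μ * θ ^ 2 * log (3 + ε / (μ ^ 2 * θ ^ 2))) := by
  rw [twoScaleBranchingRegime]
  set a := μ * θ ^ 2 with ha_def
  have ha : 0 < a := by positivity
  set Y := ε / (μ ^ 2 * θ ^ 2) with hY
  have hY0 : 0 < Y := by positivity
  set τ := ε * L / a with hτ
  have hτ0 : 0 < τ := by positivity
  have hτ2 : τ ≤ 2 := by rwa [hτ, div_le_iff₀ ha]
  have eX : ε / (μ ^ 3 * θ ^ 2 * L) = Y ^ 2 / τ := by grind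
  have eτ : ε * L = a * τ := by rw [hτ]; field_simp
  have g := one_le_log_add hY0.le
  rw [eX]
  set Λ := log (3 + Y ^ 2 / τ) with hΛ
  have hΛ0 : 0 < Λ := lt_of_lt_of_le one_pos (one_le_log_add (by positivity))
  have hsq := sq_regime (θ := θ) hμ hε hL hΛ0
  set A := μ ^ (1 / 2 : ℝ) * ε ^ (1 / 2 : ℝ) * θ * L ^ (1 / 2 : ℝ) * Λ ^ (1 / 2 : ℝ)
  set G := log (3 + Y)
  have h1 : τ * Λ ≤ 4 * G + 1 := by
    have e1 : Λ ≤ log ((3 + Y ^ 2) * (1 + 1 / τ)) :=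
      log_le_log (by positivity) (by
        have : Y ^ 2 / τ = Y ^ 2 * (1 / τ) := by ring
        have h3 : 0 < 1 / τ := by positivity
        nlinarith)
    rw [Real.log_mul (by positivity) (by positivity)] at e1
    have e2 : log (3 + Y ^ 2) ≤ 2 * G := log_le_two_mul (by positivity) (by nlinarith)
    have e3 : log (1 + 1 / τ) ≤ 1 / τ := by
      have := Real.log_le_sub_one_of_pos (show 0 < 1 + 1 / τ by positivity)
      linarith
    calc τ * Λ ≤ τ * (2 * G + 1 / τ) := by gcongr; linarith
      _ = 2 * (τ * G) + 1 := by field_simp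
      _ ≤ 4 * G + 1 := by nlinarith
  have h2 : A ^ 2 ≤ (3 * (a * G)) ^ 2 := by
    rw [hsq, ← ha_def, eτ]
    have : a * Λ * (a * τ) = a ^ 2 * (τ * Λ) := by ring
    rw [this, mul_pow, mul_pow]
    nlinarith [sq_nonneg a, mul_le_mul_of_nonneg_left h1 (sq_nonneg a)]
  have h3 := abs_le_of_sq_le_sq h2 (by positivity)
  have h4 : a ≤ a * G := le_mul_of_one_le_right ha.le g
  grind

/-- A single branched period up to the distance `l` from the ends, the larger of the two distances at
which the surface energy `ε * l` equals `a = μ * θ ^ 2` and the elastic energy `θ ^ 3 / l` of the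
transition to the affine deformation. If the two end regions meet,
    the two-scale branching or a single exact laminate is used. -/
theorem competitor_truncated (hμ : 0 < μ) (hε : 0 < ε) (hθ : 0 < θ) (hθ2 : θ ≤ 1 / 2)
    (hL : 1 / 2 ≤ L) :
    HasCompetitor μ ε θ L (10000 * singleTruncatedBranchingRegime μ ε θ L) := by
  have hL0 : 0 < L := by linarith
  rw [singleTruncatedBranchingRegime]
  set a := μ * θ ^ 2 with ha_def
  have ha : 0 < a := by positivity
  set s := ε ^ (1 / 2 : ℝ) * θ ^ (3 / 2 : ℝ) with hs
  have hs0 : 0 < s := by positivity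
  have hs2 : s ^ 2 = ε * θ ^ 3 := by
    rw [hs, mul_pow, ← Real.rpow_natCast, ← Real.rpow_natCast, ← Real.rpow_mul hε.le,
      ← Real.rpow_mul hθ.le]
    norm_num
  set Y := ε / (μ ^ 2 * θ ^ 2) with hY
  have hY0 : 0 < Y := by positivity
  have hb : 0 < ε * L / a := by positivity
  have g1 := one_le_log_add hb.le
  have g2 := one_le_log_add hY0.le
  have p1 := mul_le_mul_of_nonneg_left g1 ha.le
  have p2 := mul_le_mul_of_nonneg_left g2 ha.le
  set l := max (a / ε) (s / ε) with hl
  have hl0 : 0 < l := lt_max_of_lt_left (by positivity)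
  have ea : ε * (a / ε) = a := by field_simp
  have es : ε * (s / ε) = s := by field_simp
  have hal : a ≤ ε * l := by
    rw [← ea]; exact mul_le_mul_of_nonneg_left (le_max_left _ _) hε.le
  have hsl : s ≤ ε * l := by
    rw [← es]; exact mul_le_mul_of_nonneg_left (le_max_right _ _) hε.le
  have hεl : ε * l ≤ a + s := by
    grind
  -- for `l < 1` the affine deformation is as good
  rcases lt_or_ge l 1 with h1 | h1
  · refine (competitor_affine hμ hε hθ hθ2 hL).mono ?_
    have h2 : L ≤ ε * L / a := by
      rw [le_div_iff₀ ha, mul_comm]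
      gcongr
      exact hal.trans (mul_le_of_le_one_right hε.le h1.le)
    have h3 : affineRegime μ θ L ≤ a * log (3 + ε * L / a) := by unfold affineRegime; gcongr
    linarith
  -- the width of the boundary layer is at least `1 / Y`
  have hY1 : 1 / Y ≤ μ * l := by
    rw [hY, one_div_div, div_le_iff₀ hε]
    have := mul_le_mul_of_nonneg_left hal hμ.le
    rw [ha_def] at this; linarith
  have hY2 : 1 ≤ μ * l * Y := by rwa [div_le_iff₀ hY0] at hY1
  rcases le_or_gt (2 * l) L with hlL | hlL
  · obtain ⟨r, η, κ, F, hr1, hr2, hη, hκ, hF, q0, q1, q2⟩ := exists_strip (L := L) (h := 1)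
      (Λ := log (3 + Y)) hθ hθ2 one_pos h1 hμ (by linarith)
      (fun hc => log_le_two_mul (by positivity) (by
        rw [mul_one] at hc
        have : 1 / θ ≤ 2 * Y := by
          rw [div_le_iff₀ hθ]
          linarith [mul_le_mul_of_nonneg_right hc hY0.le]
        nlinarith))
      (fun hc => log_le_two_mul (by positivity) (by
        have : 1 / (μ * l) ≤ Y := by rw [div_le_iff₀ (by positivity)]; linarith
        nlinarith))
    rw [mul_one] at hr1
    have hr0 : 0 < r := hθ.trans_le hr1
    refine (hasCompetitor_shoulder hμ.le hε.le hθ hθ2 h1 hlL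
      (by have := mul_nonneg (show 0 ≤ 20 * θ ^ 2 by positivity) q0; linarith) (by positivity)
      (nearField_cell hθ hθ2 hL hr1 hr2 hl0 (by linarith) hη hκ hF)).mono ?_
    have k1 : a * (κ * log (1 + 1 / r)) ≤ a * (2 * log (3 + Y)) := by gcongr
    have k2 : a * log (1 + L / l) ≤ a * log (3 + ε * L / a) := by
      have : L / l ≤ ε * L / a := by
        rw [div_le_div_iff₀ hl0 ha]; linarith [mul_le_mul_of_nonneg_left hal hL0.le]
      gcongr
      norm_num
    have k3 : θ ^ 2 * (η * (r / l)) ≤ θ ^ 2 * (2 * μ) := by gcongr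
    have k4 : θ ^ 3 * (1 / l) ≤ s := by
      rw [mul_one_div, div_le_iff₀ hl0]
      have : ε * θ ^ 3 ≤ ε * (s * l) := by
        rw [← hs2]; linarith [mul_le_mul_of_nonneg_left hsl hs0.le]
      exact le_of_mul_le_mul_left this hε
    grind
  -- the end regions meet
  rcases le_or_gt s a with hsa | hsa
  · refine (competitor_twoScale hμ hε hθ hθ2 hL).mono ?_
    have hla : l = a / ε := max_eq_left (by gcongr)
    have h2 : ε * L ≤ 2 * a := by
      have := mul_lt_mul_of_pos_left hlL hε
      rw [hla] at this; linarith
    linarith [twoScale_le hμ hε hθ hL0 h2]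
  · have hla : l = s / ε := max_eq_right (by gcongr)
    have h2 : ε * L ≤ 2 * s := by
      have := mul_lt_mul_of_pos_left hlL hε
      rw [hla] at this; linarith
    have e : θ * 1 / θ = 1 := by field_simp
    refine (hasCompetitor_periodic (h := 1) (r := θ) (l := L) (N := 1) (η := 0) (κ := 1)
      (F := fun _ => 0) hμ.le hε.le hθ hθ2 hL one_pos (by norm_num) (by linarith) (by linarith)
      hL0 le_rfl le_rfl (Or.inr ⟨by linarith, rfl⟩) (by rw [e]; exact stripFn_zero)).mono ?_
    have h3 : 1 / θ ≤ Y := by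
      have h4 : a ^ 2 ≤ s ^ 2 := by gcongr
      rw [hs2, ha_def] at h4
      rw [hY, div_le_div_iff₀ hθ (by positivity)]
      have : θ ^ 3 * (1 * (μ ^ 2 * θ ^ 2)) ≤ θ ^ 3 * (ε * θ) := by nlinarith
      exact le_of_mul_le_mul_left this (by positivity)
    have h4 : a * log (1 + 1 / θ) ≤ a * log (3 + Y) := by gcongr; norm_num
    grind

end Regimes

/-- The constant is the same for all regimes, so the minimum of the regimes is attained by one of
them. -/
theorem hasCompetitor_scaling (hμ : 0 < μ) (hε : 0 < ε) (hθ : 0 < θ) (hθ2 : θ ≤ 1 / 2)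
    (hL : 1 / 2 ≤ L) : HasCompetitor μ ε θ L (10000 * branchedScaling μ ε θ L) ∧
      HasCompetitor μ ε θ L (10000 * scaling μ ε θ L) := by
  have hmin : ∀ {a b : ℝ}, HasCompetitor μ ε θ L (10000 * a) →
      HasCompetitor μ ε θ L (10000 * b) →
      HasCompetitor μ ε θ L (10000 * min a b) := fun {a b} ha hb => by
    rcases min_choice a b with h | h <;> rwa [h]
  have hlog : ∀ {x : ℝ}, 0 < x → 0 ≤ μ ^ (1 / 2 : ℝ) * ε ^ (1 / 2 : ℝ) * θ * L ^ (1 / 2 : ℝ)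
      * log (3 + x) ^ (1 / 2 : ℝ) + ε * L := fun {x} hx => by
    have := one_le_log_add hx.le
    positivity
  have hB : HasCompetitor μ ε θ L (10000 * branchedScaling μ ε θ L) :=
    hmin (competitor_branching hμ hε hθ hθ2 hL) <|
    hmin ((competitor_laminate hμ hε hθ hθ2 hL).mono
      (mul_le_mul_of_nonneg_right (by norm_num) (hlog (by positivity)))) <|
    (competitor_twoScale hμ hε hθ hθ2 hL).mono
      (mul_le_mul_of_nonneg_right (by norm_num) (hlog (by positivity)))
  exact ⟨hB,
    hmin (competitor_constant hμ hε hL) <|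
    hmin (competitor_affine hμ hε hθ hθ2 hL) <|
    hmin (competitor_linear hμ hε hθ hθ2 hL) <|
    hmin (competitor_truncated hμ hε hθ hθ2 hL) <|
    hmin (competitor_corner hμ hε hθ hθ2 hL) hB⟩

end Nucleus

end

theorem mainTheorem5 :
    ∃ c : ℝ, 0 < c ∧ ∀ μ ε θ L : ℝ, 0 < μ → 0 < ε → 0 < θ → θ ≤ 1 / 2 → 1 / 2 ≤ L →
      (∃ u : Nucleus.Field, Nucleus.FieldMemW12loc u ∧
        (∀ w : Nucleus.Field, Nucleus.FieldMemW12loc w →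
          Nucleus.energyJ μ ε θ L u ≤ Nucleus.energyJ μ ε θ L w) ∧
        Nucleus.energyJ μ ε θ L u ≤ ENNReal.ofReal (c * Nucleus.scaling μ ε θ L)) ∧
      (∃ v : Nucleus.Plane → ℝ, Nucleus.ScalarAdmissible L v ∧
        (∀ w : Nucleus.Plane → ℝ, Nucleus.ScalarAdmissible L w →
          Nucleus.energyE μ ε θ L v ≤ Nucleus.energyE μ ε θ L w) ∧
        Nucleus.energyE μ ε θ L v ≤ ENNReal.ofReal (c * Nucleus.branchedScaling μ ε θ L) ∧
        Nucleus.energyE μ ε θ L v ≤ ENNReal.ofReal (c * Nucleus.scaling μ ε θ L) ∧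
        Nucleus.energyJ μ ε θ L (Nucleus.scalarField v)
          ≤ ENNReal.ofReal (c * Nucleus.scaling μ ε θ L)) := by
  refine ⟨10000, by norm_num, fun μ ε θ L hμ hε hθ hθ2 hL => ?_⟩
  have key : ∀ b, Nucleus.HasCompetitor μ ε θ L b → ∃ v, Nucleus.ScalarAdmissible L v ∧
      Nucleus.energyE μ ε θ L v ≤ ENNReal.ofReal b := fun b ⟨v, hv, hb⟩ =>
    ⟨v, Nucleus.scalarAdmissible_of_energyE_ne_top hε (Nucleus.memW12loc_of_locallyLipschitz hv)
      (ne_top_of_le_ne_top ENNReal.ofReal_ne_top hb), hb⟩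
  obtain ⟨hB, hI⟩ := Nucleus.hasCompetitor_scaling hμ hε hθ hθ2 hL
  obtain ⟨b, hb, hbE⟩ := key _ hB
  obtain ⟨s, hs, hsE⟩ := key _ hI
  have hst := ne_top_of_le_ne_top ENNReal.ofReal_ne_top hsE
  obtain ⟨u, hu, hmu⟩ := Nucleus.exists_minimizer_energyJ hμ hε hθ hθ2
    (Nucleus.fieldMemW12loc_scalarField hs.1)
    (ne_top_of_le_ne_top hst (Nucleus.energyJ_le_energyI μ ε θ L _))
  obtain ⟨v, hv, hmv⟩ := Nucleus.exists_minimizer_energyE hμ hε hθ hθ2 hs hst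
  have hvI := (hmv s hs).trans hsE
  have hvJ := (Nucleus.energyJ_le_energyI μ ε θ L (Nucleus.scalarField v)).trans hvI
  exact ⟨⟨u, hu, hmu, (hmu _ (Nucleus.fieldMemW12loc_scalarField hv.1)).trans hvJ⟩,
    v, hv, hmv, (hmv b hb).trans hbE, hvI, hvJ⟩
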